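/- Let $G=(V,E)$ be a finite simple graph with $n$ vertices and $w:E\to\{0,1\}$. For $S\subseteq V$ let $\delta(S)$ be the set of edges with exactly one endpoint in $S$ and $w(\delta(S))=\sum_{e\in\delta(S)}w(e)$. The $\{0,1\}$-Connected Maximum Cut problem asks for a nonempty $S\subseteq V$ with $G[S]$ connected that maximizes $w(\delta(S))$. A $1$-edge is an edge of weight $1$, $\eta$ is the number of $1$-edges, $W_G(v)$ is the number of $1$-edges at $v$. A leaf of a tree is a vertex of degree at most $1$ in it. A subtree $T$ of $G$ (not necessarily spanning) with leaf set $L$ is $\alpha$-thick if $\sum_{v\in L}W_G(v)\ge\alpha\eta$. A thin path is a path $v_0v_1v_2v_3$ on four distinct vertices in which $v_1,v_2,v_3$ have degree two in the graph; shortening it means deleting $v_2$ and adding the edge $v_1v_3$. If $k$ of its three edges are $1$-edges, then after shortening $v_0v_1$ has weight $1$ iff $k\ge2$ and $v_1v_3$ has weight $1$ iff $k\ge1$. Consider the following algorithm, with a constant $c$. It treats every connected component separately and returns the best of the sets found. A component without $1$-edges yields a single vertex. In any other component: 1. While there is a vertex $v$ without incident $1$-edges, delete $v$ and join any two non-adjacent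 neighbours of $v$ by an edge of weight $0$. (A solution $S'$ of the new graph is carried back as $S'$ if it induces a connected subgraph of the old graph, and as $S'\cup\{v\}$ otherwise.) 2. While there is a thin path $v_0v_1v_2v_3$, shorten it. (A solution $S'$ of the new graph is carried back as a best set, with respect to cut weight in the old graph, in the following list. If $v_0,v_3\in S'$: $S'\cup\{v_2\}$ when $v_1\in S'$, and $S',S'\cup\{v_1\},S'\cup\{v_2\}$ when $v_1\notin S'$. If exactly one of $v_0,v_3$ is in $S'$: $S'\setminus\{v_1\}$ together with one of the three initial parts, possibly empty, of the sequence $v_1,v_2$ (when $v_0\in S'$) or $v_2,v_1$ (when $v_3\in S'$). If $v_0,v_3\notin S'$: $\{v_1\},\{v_2\},\{v_1,v_2\}$ when $v_1\in S'$, and $S'$ when $v_1\notin S'$.) 3. Let $G_1$ be the resulting graph, with $n_1$ vertices and $\eta_1$ $1$-edges. If $\eta_1\le c\,n_1\lceil\log_2n_1\rceil$, choose a spanning tree $T$ of $G_1$ with at least $n_1/14$ leaves. Otherwise, for $i=1,2,\dots$ until $G_i$ is empty, choose a spanning tree $T_i$ of $G_i$ at least a fraction $1/14$ of whose vertices are leaves,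 let $L_i$ be its leaf set, delete $L_i$ from $G_i$, and shorten thin paths until none is left; this gives $G_{i+1}$. View $T_i$ as a subtree of $G_1$ by replacing the edges that arose from shortening by the corresponding paths, and let $T$ be a $T_i$ with $\sum_{v\in L_i}W_{G_1}(v)$ maximum. 4. Split the leaf set $L$ of $T$ into $L_1,L_2$ such that at least half of the $1$-edges of $G_1[L]$ run between $L_1$ and $L_2$; take the better of $V(T)\setminus L_1$ and $V(T)\setminus L_2$ and carry it back to $G$. There are constants $c\in\mathbb{N}$, $c\geq 1$, and $\kappa>0$ such that the following hold. (a) For every $G$ with $n\ge2$ vertices and every $w$, whatever choices are made, every output $S$ of the algorithm is nonempty, $G[S]$ is connected, and $w(\delta(S))\ge\frac{\kappa}{\log n}\,w(\delta(S'))$ for every nonempty $S'\subseteq V$ with $G[S']$ connected. (b) The algorithm can be carried out in deterministic polynomial time: there are one random access machine program (with addition, truncated subtraction and indirect addressing as unit-cost operations) and one polynomial $p$ such that for every $G$ with $n\ge1$ vertices and every $w$, given as an adjacency matrix, the program halts after at most $p(n)$ steps with an output of the algorithm. (c) On a graph with $n_1$ vertices in which every vertex has an incident $1$-edge and which has no thin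 path, the tree $T$ from which steps 3 and 4 obtain their solution can be taken to be $\frac{\kappa}{\log n_1}$-thick. (d) For $\alpha>0$ and a graph with $\eta>0$, step 4 (with that graph in the place of $G_1$) turns every $\alpha$-thick tree into a nonempty set $S$ that induces a connected subgraph and satisfies $w(\delta(S))\ge\frac{\alpha}{4}\eta$. -/

import Mathlib

/-! ## Graphs, weights, cuts -/

/-- Finite simple graphs whose vertex set is a subset of the ambient type `V`: a set of vertices
together with a symmetric irreflexive adjacency relation on it. -/
abbrev VGraph (V : Type*) := (⊤ : SimpleGraph V).Subgraph

section Weights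

variable {V : Type*} [Finite V]

/-- Total weight of a set of edges. -/
noncomputable def totalWeight (w : Sym2 V → Fin 2) (F : Set (Sym2 V)) : ℕ :=
  ∑ e ∈ F.toFinite.toFinset, (w e : ℕ)

/-- `δ(S)`: the edges (of the edge set `E`) with exactly one endpoint in `S`. -/
def cut (E : Set (Sym2 V)) (S : Set V) : Set (Sym2 V) :=
  {e | e ∈ E ∧ ∃ u ∈ S, ∃ v, v ∉ S ∧ e = s(u, v)}

/-- `δ(A, B)`: the edges with one endpoint in `A` and the other in `B`. -/
def cutBetween (E : Set (Sym2 V)) (A B : Set V) : Set (Sym2 V) :=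
  {e | e ∈ E ∧ ∃ u ∈ A, ∃ v ∈ B, e = s(u, v)}

/-- The edges with both endpoints in `A`. -/
def edgesInside (E : Set (Sym2 V)) (A : Set V) : Set (Sym2 V) :=
  {e | e ∈ E ∧ ∀ v ∈ e, v ∈ A}

/-- `w(δ(S))`. -/
noncomputable def cutWeight (E : Set (Sym2 V)) (w : Sym2 V → Fin 2) (S : Set V) : ℕ :=
  totalWeight w (cut E S)

/-- `W(v)`: total weight of the edges incident with `v`. -/
noncomputable def vertexWeight (E : Set (Sym2 V)) (w : Sym2 V → Fin 2) (v : V) : ℕ :=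
  totalWeight w {e | e ∈ E ∧ v ∈ e}

end Weights

/-- An instance of the `{0,1}`-weighted connected maximum cut problem. Only the weights of the
edges of `graph` matter. -/
structure CMCInstance (V : Type*) where
  graph : VGraph V
  weight : Sym2 V → Fin 2

section Operations

variable {V : Type*}

/-- Degree of a vertex. -/
noncomputable def VGraph.deg (G : VGraph V) (v : V) : ℕ := (G.neighborSet v).ncard

/-- Leaves: vertices of degree one; the only vertex of a one-vertex tree also counts. -/
def VGraph.leaves (T : VGraph V) : Set V := {v | v ∈ T.verts ∧ VGraph.deg T v ≤ 1}

/-- `T` is a spanning tree of `G` in which at least a fraction `1/14` of the vertices are leaves. -/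
def VGraph.IsLeafyTree (G T : VGraph V) : Prop :=
  T ≤ G ∧ T.verts = G.verts ∧ T.coe.IsTree ∧ G.verts.ncard ≤ 14 * (VGraph.leaves T).ncard

/-- `v₁, v₂, v₃` are consecutive vertices of degree two, and `v₀` is the neighbour of `v₁`
other than `v₂`. The condition `v₀ ≠ v₃` says that the path does not close up to a triangle. -/
structure VGraph.IsThinPath (G : VGraph V) (v₀ v₁ v₂ v₃ : V) : Prop where
  adj₀₁ : G.Adj v₀ v₁
  adj₁₂ : G.Adj v₁ v₂
  adj₂₃ : G.Adj v₂ v₃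
  deg₁ : VGraph.deg G v₁ = 2
  deg₂ : VGraph.deg G v₂ = 2
  deg₃ : VGraph.deg G v₃ = 2
  ne₀₂ : v₀ ≠ v₂
  ne₀₃ : v₀ ≠ v₃
  ne₁₃ : v₁ ≠ v₃

/-- There is no path of degree-two vertices left that can be shortened. -/
def VGraph.NoThinPath (G : VGraph V) : Prop :=
  ∀ v₀ v₁ v₂ v₃, ¬ VGraph.IsThinPath G v₀ v₁ v₂ v₃

/-- Shortening of the path `v₀ v₁ v₂ v₃` to `v₀ v₁ v₃`: delete `v₂`, join `v₁` and `v₃`.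
(The vertex that replaces `v₁` and `v₂` is again called `v₁`.) -/
def VGraph.contract (G : VGraph V) (v₁ v₂ v₃ : V) : VGraph V where
  verts := G.verts \ {v₂}
  Adj a b := (a ∈ G.verts \ {v₂} ∧ b ∈ G.verts \ {v₂}) ∧ a ≠ b ∧
    (G.Adj a b ∨ s(a, b) = s(v₁, v₃))
  adj_sub h := h.2.1
  edge_vert h := h.1.1
  symm := ⟨fun _ _ h => ⟨h.1.symm, h.2.1.symm,
    h.2.2.imp (fun h' => h'.symm) (fun h' => Sym2.eq_swap.trans h')⟩⟩

open Classical in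
/-- Undoing `contract` on a subtree `T`: if `T` uses the edge `v₁v₃`, then this edge is replaced
by the path `v₁ v₂ v₃`; otherwise `T` is unchanged. -/
noncomputable def VGraph.expand (v₁ v₂ v₃ : V) (T : VGraph V) : VGraph V :=
  if T.Adj v₁ v₃ then
    { verts := T.verts ∪ {v₁, v₂, v₃}
      Adj := fun a b => a ≠ b ∧
        ((T.Adj a b ∧ s(a, b) ≠ s(v₁, v₃)) ∨ s(a, b) = s(v₁, v₂) ∨ s(a, b) = s(v₂, v₃))
      adj_sub := fun h => h.1
      edge_vert := by
        rintro a b ⟨-, ⟨h, -⟩ | h | h⟩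
        · exact Or.inl h.fst_mem
        · rcases Sym2.eq_iff.1 h with ⟨rfl, -⟩ | ⟨rfl, -⟩ <;> simp
        · rcases Sym2.eq_iff.1 h with ⟨rfl, -⟩ | ⟨rfl, -⟩ <;> simp
      symm := ⟨by
        rintro a b ⟨hab, h⟩
        rw [Sym2.eq_swap] at h
        exact ⟨hab.symm, h.imp_left (fun h' => ⟨h'.1.symm, h'.2⟩)⟩⟩ }
  else T

/-- Deletion of a vertex `v`, joining all pairs of neighbours of `v`. -/
def VGraph.dropVertex (G : VGraph V) (v : V) : VGraph V where
  verts := G.verts \ {v}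
  Adj a b := (a ∈ G.verts \ {v} ∧ b ∈ G.verts \ {v}) ∧ a ≠ b ∧
    (G.Adj a b ∨ (G.Adj v a ∧ G.Adj v b))
  adj_sub h := h.2.1
  edge_vert h := h.1.1
  symm := ⟨fun _ _ h => ⟨h.1.symm, h.2.1.symm, h.2.2.imp (fun h' => h'.symm) And.symm⟩⟩

/-- `ShrinksTo G H f`: the graph `H` arises from `G` by shortening thin paths until none is left,
and `f` turns a subtree of `H` into the corresponding subtree of `G`. -/
inductive ShrinksTo : VGraph V → VGraph V → (VGraph V → VGraph V) → Prop
  | done (G : VGraph V) : VGraph.NoThinPath G → ShrinksTo G G id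
  | step (G H : VGraph V) (f : VGraph V → VGraph V) (v₀ v₁ v₂ v₃ : V) :
      VGraph.IsThinPath G v₀ v₁ v₂ v₃ → ShrinksTo (VGraph.contract G v₁ v₂ v₃) H f →
      ShrinksTo G H (VGraph.expand v₁ v₂ v₃ ∘ f)

/-- `Peel G ts`: the main loop, started with the graph `G`, produces the trees `ts`, viewed as
subtrees of `G`. In every round a leafy spanning tree is chosen, its leaves are deleted, and thin
paths of the remaining graph are shortened; the loop ends when the graph is empty. -/
inductive Peel : VGraph V → List (VGraph V) → Prop
  | nil (G : VGraph V) : G.verts = ∅ → Peel G []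
  | cons (G T H : VGraph V) (f : VGraph V → VGraph V) (ts : List (VGraph V)) :
      G.verts.Nonempty → VGraph.IsLeafyTree G T →
      ShrinksTo (G.deleteVerts (VGraph.leaves T)) H f → Peel H ts →
      Peel G (T :: ts.map f)

open Classical in
/-- Deletion of a vertex all of whose edges have weight zero; the new edges have weight zero. -/
noncomputable def CMCInstance.dropVertex (I : CMCInstance V) (v : V) : CMCInstance V where
  graph := VGraph.dropVertex I.graph v
  weight e := if e ∈ I.graph.edgeSet then I.weight e else 0

open Classical in
/-- Shortening of the path `v₀ v₁ v₂ v₃` with weights: if it has `k` edges of weight one, then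
`v₀v₁` gets weight one iff `k ≥ 2`, and `v₁v₃` gets weight one iff `k ≥ 1`. -/
noncomputable def CMCInstance.contract (I : CMCInstance V) (v₀ v₁ v₂ v₃ : V) : CMCInstance V where
  graph := VGraph.contract I.graph v₁ v₂ v₃
  weight e :=
    let k : ℕ := (I.weight s(v₀, v₁) : ℕ) + (I.weight s(v₁, v₂) : ℕ) + (I.weight s(v₂, v₃) : ℕ)
    if e = s(v₀, v₁) then (if 2 ≤ k then 1 else 0)
    else if e = s(v₁, v₃) then (if 1 ≤ k then 1 else 0)
    else I.weight e

open Classical in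
/-- The candidate solutions of `I` that correspond to a solution `S'` of
`I.contract v₀ v₁ v₂ v₃`. -/
noncomputable def expandCandidates (v₀ v₁ v₂ v₃ : V) (S' : Set V) : Set (Set V) :=
  if v₀ ∈ S' ∧ v₃ ∈ S' then
    if v₁ ∈ S' then {S' ∪ {v₂}} else {S', S' ∪ {v₁}, S' ∪ {v₂}}
  else if v₀ ∈ S' then
    {S' \ {v₁}, S' \ {v₁} ∪ {v₁}, S' \ {v₁} ∪ {v₁, v₂}}
  else if v₃ ∈ S' then
    {S' \ {v₁}, S' \ {v₁} ∪ {v₂}, S' \ {v₁} ∪ {v₁, v₂}}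
  else
    if v₁ ∈ S' then {{v₁}, {v₂}, {v₁, v₂}} else {S'}

end Operations

/-! ## The algorithm

The algorithm leaves some choices open (which spanning tree, which path to shorten first, ...).
The relations below hold between an input and every output that some sequence of choices gives. -/

section Algorithm

variable {V : Type*} [Finite V]

namespace CMCInstance

/-- The number `η` of edges of weight one. -/
noncomputable def numOnes (I : CMCInstance V) : ℕ := totalWeight I.weight I.graph.edgeSet

/-- `w(δ(S))` in the instance `I`. -/
noncomputable def cutW (I : CMCInstance V) (S : Set V) : ℕ := cutWeight I.graph.edgeSet I.weight S

/-- Sum of `W(v)` over the leaves `v` of `T`. -/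
noncomputable def leafWeight (I : CMCInstance V) (T : VGraph V) : ℕ :=
  ∑ v ∈ (VGraph.leaves T).toFinite.toFinset, vertexWeight I.graph.edgeSet I.weight v

/-- `T` is an `α`-thick tree of `I`: a subtree, not necessarily spanning, the leaves `v` of which
have `∑ W(v) ≥ α η`. -/
def IsThickTree (I : CMCInstance V) (α : ℝ) (T : VGraph V) : Prop :=
  T ≤ I.graph ∧ T.coe.IsTree ∧ α * (I.numOnes : ℝ) ≤ (I.leafWeight T : ℝ)

/-- Conversion of a subtree `T` with leaf set `L` into a solution: split `L` into `L₁` and `L₂` so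
that at least half of the edges of weight one inside `L` run between `L₁` and `L₂`, and take the
better of `T \ L₁` and `T \ L₂`. -/
def FromTree (I : CMCInstance V) (T : VGraph V) (S : Set V) : Prop :=
  ∃ L₁ L₂ : Set V, Disjoint L₁ L₂ ∧ L₁ ∪ L₂ = VGraph.leaves T ∧
    totalWeight I.weight (edgesInside I.graph.edgeSet (VGraph.leaves T)) ≤
      2 * totalWeight I.weight (cutBetween I.graph.edgeSet L₁ L₂) ∧
    (S = T.verts \ L₁ ∨ S = T.verts \ L₂) ∧
    I.cutW (T.verts \ L₁) ≤ I.cutW S ∧ I.cutW (T.verts \ L₂) ≤ I.cutW S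

/-- The algorithm on a reduced connected instance with `n` vertices. If there are at most
`c n ⌈log₂ n⌉` edges of weight one, a leafy spanning tree is converted into a solution; otherwise
the best tree that the loop finds is. -/
def CoreOutput (c : ℕ) (I : CMCInstance V) (S : Set V) : Prop :=
  (I.numOnes ≤ c * I.graph.verts.ncard * Nat.clog 2 I.graph.verts.ncard ∧
    ∃ T, VGraph.IsLeafyTree I.graph T ∧ I.FromTree T S) ∨
  (c * I.graph.verts.ncard * Nat.clog 2 I.graph.verts.ncard < I.numOnes ∧
    ∃ ts, Peel I.graph ts ∧ ∃ T ∈ ts, (∀ T' ∈ ts, I.leafWeight T' ≤ I.leafWeight T) ∧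
      I.FromTree T S)

/-- Every vertex has an incident edge of weight one. -/
def EveryVertexHasOne (I : CMCInstance V) : Prop :=
  ∀ v ∈ I.graph.verts, ∃ u, I.graph.Adj v u ∧ I.weight s(v, u) = 1

open Classical in
/-- The algorithm with its two preliminary reductions, on a connected instance: first vertices
without incident edges of weight one are removed, then thin paths are shortened, then `CoreOutput`
is applied; each reduction comes with the way a solution is carried back. -/
inductive Output (c : ℕ) : CMCInstance V → Set V → Prop
  | drop (I : CMCInstance V) (v : V) (S' : Set V) :
      v ∈ I.graph.verts → (∀ u, I.graph.Adj v u → I.weight s(v, u) = 0) →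
      Output c (I.dropVertex v) S' →
      Output c I (if (I.graph.induce S').Connected then S' else S' ∪ {v})
  | shorten (I : CMCInstance V) (v₀ v₁ v₂ v₃ : V) (S' S : Set V) :
      I.EveryVertexHasOne → VGraph.IsThinPath I.graph v₀ v₁ v₂ v₃ →
      Output c (I.contract v₀ v₁ v₂ v₃) S' →
      S ∈ expandCandidates v₀ v₁ v₂ v₃ S' →
      (∀ X ∈ expandCandidates v₀ v₁ v₂ v₃ S', I.cutW X ≤ I.cutW S) →
      Output c I S
  | core (I : CMCInstance V) (S : Set V) :
      I.EveryVertexHasOne → VGraph.NoThinPath I.graph → I.CoreOutput c S → Output c I S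

/-- The instance induced by a connected component of a weighted graph. -/
def ofComponent {G : SimpleGraph V} (w : Sym2 V → Fin 2) (C : G.ConnectedComponent) :
    CMCInstance V where
  graph :=
    { verts := C.supp
      Adj := fun a b => (a ∈ C.supp ∧ b ∈ C.supp) ∧ G.Adj a b
      adj_sub := fun h => h.2.ne
      edge_vert := fun h => h.1.1
      symm := ⟨fun _ _ h => ⟨h.1.symm, h.2.symm⟩⟩ }
  weight := w

/-- The algorithm on one connected component; if it has no edge of weight one, any single vertex
is returned. -/
def ComponentOutput (c : ℕ) (I : CMCInstance V) (S : Set V) : Prop :=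
  (I.numOnes = 0 ∧ ∃ v ∈ I.graph.verts, S = {v}) ∨ (0 < I.numOnes ∧ I.Output c S)

end CMCInstance

/-- `S` is a possible output of the algorithm (with threshold constant `c`) on `G` and `w`:
a best one among the solutions that it finds for the connected components. -/
def AlgorithmOutput (c : ℕ) (G : SimpleGraph V) (w : Sym2 V → Fin 2) (S : Set V) : Prop :=
  ∃ sol : G.ConnectedComponent → Set V,
    (∀ C, CMCInstance.ComponentOutput c (CMCInstance.ofComponent w C) (sol C)) ∧
    ∃ C, S = sol C ∧ ∀ C', cutWeight G.edgeSet w (sol C') ≤ cutWeight G.edgeSet w (sol C)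

end Algorithm

/-! ## Random access machine programs with a step count

Memory cells hold natural numbers and have three indices, so that the memory can be used as
arrays. Expressions allow literals, indirect addressing, addition and truncated subtraction;
there is no multiplication, hence numbers have only linearly many bits in the number of steps. -/

namespace RAM

/-- Memory contents. -/
abbrev Mem := ℕ → ℕ → ℕ → ℕ

inductive Expr
  | lit (k : ℕ)
  | load (i j k : Expr)
  | add (a b : Expr)
  | sub (a b : Expr)

def Expr.eval (m : Mem) : Expr → ℕ
  | .lit k => k
  | .load i j k => m (i.eval m) (j.eval m) (k.eval m)
  | .add a b => a.eval m + b.eval m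
  | .sub a b => a.eval m - b.eval m

/-- Programs. A test `e` counts as true iff its value is not zero. -/
inductive Program
  | nop
  | store (i j k e : Expr)
  | seq (p q : Program)
  | cond (e : Expr) (p q : Program)
  | loop (e : Expr) (p : Program)

/-- Writing `x` into the cell `(i, j, k)`. -/
def Mem.write (m : Mem) (i j k x : ℕ) : Mem :=
  fun i' j' k' => if i' = i ∧ j' = j ∧ k' = k then x else m i' j' k'

/-- `Exec p m t m'`: the program `p`, started with memory `m`, halts after exactly `t` steps with
memory `m'`. Every store, `nop` and test is one step. (The expressions in a program have fixed
size, so this is up to a constant factor the number of elementary operations.) -/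
inductive Exec : Program → Mem → ℕ → Mem → Prop
  | nop (m : Mem) : Exec .nop m 1 m
  | store (i j k e : Expr) (m : Mem) :
      Exec (.store i j k e) m 1 (m.write (i.eval m) (j.eval m) (k.eval m) (e.eval m))
  | seq {p q : Program} {m m' m'' : Mem} {s t : ℕ} :
      Exec p m s m' → Exec q m' t m'' → Exec (.seq p q) m (s + t) m''
  | condTrue {e : Expr} {p q : Program} {m m' : Mem} {t : ℕ} :
      e.eval m ≠ 0 → Exec p m t m' → Exec (.cond e p q) m (t + 1) m'
  | condFalse {e : Expr} {p q : Program} {m m' : Mem} {t : ℕ} :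
      e.eval m = 0 → Exec q m t m' → Exec (.cond e p q) m (t + 1) m'
  | loopTrue {e : Expr} {p : Program} {m m' m'' : Mem} {s t : ℕ} :
      e.eval m ≠ 0 → Exec p m s m' → Exec (.loop e p) m' t m'' →
      Exec (.loop e p) m (s + t + 1) m''
  | loopFalse {e : Expr} {p : Program} {m : Mem} :
      e.eval m = 0 → Exec (.loop e p) m 1 m

open Classical in
/-- The input: cell `(0, 0, 0)` holds `n`; cell `(1, u, v)` holds `0` if `uv` is not an edge, and
one plus its weight if it is an edge; all other cells hold `0`. -/
noncomputable def encode {n : ℕ} (G : SimpleGraph (Fin n)) (w : Sym2 (Fin n) → Fin 2) : Mem :=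
  fun i j k =>
    if i = 0 ∧ j = 0 ∧ k = 0 then n
    else if i = 1 then
      if h : j < n ∧ k < n then
        if G.Adj ⟨j, h.1⟩ ⟨k, h.2⟩ then 1 + (w s(⟨j, h.1⟩, ⟨k, h.2⟩) : ℕ) else 0
      else 0
    else 0

/-- The output: the vertices `v` for which cell `(2, v, 0)` is not zero. -/
def decode (n : ℕ) (m : Mem) : Set (Fin n) := {v | m 2 v 0 ≠ 0}

end RAM

set_option linter.unusedSimpArgs false
set_option linter.unusedSectionVars false

section

open Classical Relation

/-! The statement has two halves: an approximation bound that holds for every run of the algorithm,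
and one concrete polynomial-time run.

Thick trees give good cuts. No cut contains more than η 1-edges, so on a reduced instance it is
enough to cut a fraction of order 1/log n of all 1-edges. Let T be a tree with leaf set L = L₁ ∪ L₂.
Deleting leaves does not disconnect a tree, and the sets T \ L₁ and T \ L₂ together cut every 1-edge
from L to a non-leaf (inside or outside T) at least once and every 1-edge between L₁ and L₂ twice.
Since half of the 1-edges inside L run between L₁ and L₂, the better of the two sets cuts at least a
quarter of the leaf weight (`cut_diff_ge`, `leafWeight_le_of_fromTree`).

Thick trees are found (`thick_of_coreOutput`). If η ≤ 4n⌈log₂ n⌉, then n/14 leaves with one 1-edge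
each are enough. If η is larger, the 1-edges of G₁ are charged to the rounds of the loop: each of
them disappears either because one of its ends is a leaf of some Tᵢ, or because the middle vertex of
a thin path is deleted. A middle vertex has degree two, so the second kind amounts to at most 2n ≤
η/2 edges (`Peel.arcs_le`). Every round removes a fourteenth of the vertices, so there are O(log n)
rounds (`Peel.length_bound`), and the best tree carries leaf weight of order η/log n. Undoing a
shortening changes no leaf set (`expand_leaves`), so all leaf weights can be compared in G₁.

The reductions lose nothing. Deleting a vertex without 1-edges changes no cut weight, and making its
neighbours a clique preserves connectivity in both directions. For a thin path with k 1-edges, a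
connected set with v₀ and v₃ on the same side cuts at most min(k, 2) of them, and one that separates
v₀ from v₃ cuts at most min(k, 1). The weights after shortening are exactly [k ≥ 2] and [k ≥ 1], so
the optimum does not decrease (`optLe_of_contract`), and among the listed candidates one is at least
as good as the given solution (`cutW_le_of_expandCandidates`).

Leafy spanning trees exist and are found by local search: edge exchanges that drop an edge or gain a
leaf are made as long as possible. At a local optimum T of a graph H, a vertex of degree two in T
that has two further vertices of degree two on either side has degree two in H as well
(`LocalOpt.deg_two`). Seven consecutive vertices of degree two would therefore contain a thin path
of H, and counting arcs yields n/14 leaves (`LocalOpt.leafy`). The leaf set is split by the usual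
local search for maximum cuts (`splitSet_spec`).

The program is not written out by hand. Closure rules show that numbers, predicates, sets, graphs
and instances built from computable ones by arithmetic, quantifiers over vertices, cardinalities,
reachability and a canonical choice of a vertex are computable in polynomial time (`Comp`, `CompP`,
`SetC`, `GraphC`, `InstC`), and that state changes compose and can be iterated polynomially often
(`CompS`). Every open choice is resolved by taking a last vertex with a given property, and every
while-loop is replaced by an iteration of fixed length whose step is the identity once the goal is
reached (`iterate_reaches`). -/

namespace ConnCut

/-! ### Connectivity of a relation on a set -/

section Conn

variable {V : Type*}

/-- The relation `R`, restricted to the nonempty set `S`, connects any two points of `S`. -/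
def ConnOn (R : V → V → Prop) (S : Set V) : Prop :=
  S.Nonempty ∧ ∀ u ∈ S, ∀ v ∈ S, ReflTransGen (fun a b => a ∈ S ∧ b ∈ S ∧ R a b) u v

/-- Induced graphs and subgraphs live on different subtypes. Moving connectivity to a relation on
the ambient type makes it possible to compare them while vertex sets and edges change. -/
theorem connected_iff_connOn (S : Set V) (K : SimpleGraph S) (R : V → V → Prop)
    (h : ∀ a b : S, K.Adj a b ↔ R a b) : K.Connected ↔ ConnOn R S := by
  rw [SimpleGraph.connected_iff, ConnOn, Set.nonempty_coe_sort, and_comm]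
  refine and_congr_right fun _ => ⟨fun hK u hu v hv => ?_, fun hK u v => ?_⟩
  · have := (SimpleGraph.reachable_iff_reflTransGen _ _).1 (hK ⟨u, hu⟩ ⟨v, hv⟩)
    exact this.lift (fun x : S => (x : V)) fun a b hab => ⟨a.2, b.2, (h a b).1 hab⟩
  · rw [SimpleGraph.reachable_iff_reflTransGen]
    obtain ⟨v, hv⟩ := v
    have := hK u u.2 v hv
    induction this with
    | refl => exact .refl
    | tail _ hbc ih => exact (ih hbc.1).tail ((h _ _).2 hbc.2.2)

theorem subgraph_connected_iff {G : SimpleGraph V} (H : G.Subgraph) :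
    H.Connected ↔ ConnOn H.Adj H.verts := by
  rw [SimpleGraph.Subgraph.connected_iff', connected_iff_connOn H.verts H.coe H.Adj]
  intro a b; rfl

theorem coe_connected_iff {G : SimpleGraph V} (H : G.Subgraph) :
    H.coe.Connected ↔ ConnOn H.Adj H.verts := by
  rw [connected_iff_connOn H.verts H.coe H.Adj]
  intro a b; rfl

theorem connOn_congr {R R' : V → V → Prop} {S : Set V}
    (h : ∀ a ∈ S, ∀ b ∈ S, (R a b ↔ R' a b)) : ConnOn R S ↔ ConnOn R' S := by
  have : (fun a b => a ∈ S ∧ b ∈ S ∧ R a b) = (fun a b => a ∈ S ∧ b ∈ S ∧ R' a b) := by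
    ext a b; constructor <;> rintro ⟨ha, hb, hr⟩
    · exact ⟨ha, hb, (h a ha b hb).1 hr⟩
    · exact ⟨ha, hb, (h a ha b hb).2 hr⟩
  rw [ConnOn, ConnOn, this]

theorem induce_connected_iff {G : SimpleGraph V} (H : G.Subgraph) (S : Set V) :
    (H.induce S).Connected ↔ ConnOn H.Adj S := by
  rw [subgraph_connected_iff]
  refine connOn_congr fun a ha b hb => ?_
  change (a ∈ S ∧ b ∈ S ∧ H.Adj a b) ↔ _
  tauto

theorem graph_induce_connected_iff (G : SimpleGraph V) (S : Set V) :
    (G.induce S).Connected ↔ ConnOn G.Adj S := by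
  rw [connected_iff_connOn S _ G.Adj]
  intro a b; rfl

theorem connOn_singleton (R : V → V → Prop) (v : V) : ConnOn R {v} := by
  refine ⟨⟨v, rfl⟩, ?_⟩
  rintro u rfl w rfl
  exact .refl

theorem rtg_symm {r : V → V → Prop} (hr : ∀ a b, r a b → r b a) {a b : V}
    (h : ReflTransGen r a b) : ReflTransGen r b a := by
  induction h with
  | refl => exact .refl
  | tail _ hbc ih => exact ih.head (hr _ _ hbc)

/-- If every edge of `R` inside `S` is simulated by `R'` inside `S'` via `f`, and every point of
`S'` is joined to a point of the image of `S`, then connectivity is inherited. -/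
theorem ConnOn.transfer {R R' : V → V → Prop} {S S' : Set V} (h : ConnOn R S) (f : V → V)
    (hsymm : ∀ a b, R' a b → R' b a) (hf : ∀ a ∈ S, f a ∈ S')
    (hR : ∀ a ∈ S, ∀ b ∈ S, R a b →
      ReflTransGen (fun a b => a ∈ S' ∧ b ∈ S' ∧ R' a b) (f a) (f b))
    (hS : ∀ a ∈ S', ∃ b ∈ S, ReflTransGen (fun a b => a ∈ S' ∧ b ∈ S' ∧ R' a b) a (f b)) :
    ConnOn R' S' := by
  refine ⟨h.1.elim fun a ha => ⟨f a, hf a ha⟩, fun u hu v hv => ?_⟩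
  obtain ⟨u', hu', hu2⟩ := hS u hu
  obtain ⟨v', hv', hv2⟩ := hS v hv
  have key : ∀ z, ReflTransGen (fun a b => a ∈ S ∧ b ∈ S ∧ R a b) u' z →
      ReflTransGen (fun a b => a ∈ S' ∧ b ∈ S' ∧ R' a b) (f u') (f z) := by
    intro z hz
    induction hz with
    | refl => exact .refl
    | tail _ hbc ih => exact ih.trans (hR _ hbc.1 _ hbc.2.1 hbc.2.2)
  exact hu2.trans ((key _ (h.2 u' hu' v' hv')).trans
    (rtg_symm (fun a b hab => ⟨hab.2.1, hab.1, hsymm _ _ hab.2.2⟩) hv2))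

theorem ConnOn.mono {R R' : V → V → Prop} {S : Set V} (h : ConnOn R S)
    (hR : ∀ a b, R a b → R' a b) : ConnOn R' S :=
  ⟨h.1, fun u hu v hv => ReflTransGen.mono
    (fun _ _ hab => ⟨hab.1, hab.2.1, hR _ _ hab.2.2⟩) _ _ (h.2 u hu v hv)⟩

end Conn

/-! ### Degree sums and trees -/

section Trees

variable {V : Type*} [Fintype V]

theorem deg_eq_card (H : VGraph V) (v : V) :
    VGraph.deg H v = (Finset.univ.filter fun u => H.Adj v u).card := by
  rw [VGraph.deg, ← Set.ncard_coe_finset]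
  congr 1; ext u; simp

theorem deg_eq_zero_of_notMem (H : VGraph V) {v : V} (hv : v ∉ H.verts) : VGraph.deg H v = 0 := by
  rw [deg_eq_card, Finset.card_eq_zero, Finset.filter_eq_empty_iff]
  exact fun u _ h => hv h.fst_mem

theorem sum_deg_eq (H : VGraph V) : ∑ v, VGraph.deg H v = 2 * Nat.card H.coe.edgeSet := by
  have h1 : ∑ v, VGraph.deg H v = ∑ v : H.verts, VGraph.deg H v := by
    rw [← Fintype.sum_subtype_add_sum_subtype (· ∈ H.verts) (fun v => VGraph.deg H v)]
    rw [Finset.sum_eq_zero (s := (Finset.univ : Finset {x // x ∉ H.verts}))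
      fun v _ => deg_eq_zero_of_notMem H v.2, add_zero]
  have h2 : ∀ v : H.verts, VGraph.deg H v = H.coe.degree v := by
    intro v
    rw [SimpleGraph.Subgraph.coe_degree, ← SimpleGraph.Subgraph.finset_card_neighborSet_eq_degree,
      VGraph.deg, Set.ncard_eq_toFinset_card']
  have h3 := H.coe.sum_degrees_eq_twice_card_edges
  rw [SimpleGraph.edgeFinset_card, ← Nat.card_eq_fintype_card] at h3
  rw [h1, ← h3]
  refine Finset.sum_congr rfl fun v _ => ?_
  rw [h2 v]
  congr
  exact Subsingleton.elim _ _

/-- Acyclicity is replaced by the edge count, in the form of a degree sum. In this form the tree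
property is easily followed through the subdivision of an edge. -/
theorem isTree_iff (T : VGraph V) :
    T.coe.IsTree ↔ ConnOn T.Adj T.verts ∧ ∑ v, VGraph.deg T v + 2 = 2 * T.verts.ncard := by
  rw [SimpleGraph.isTree_iff_connected_and_card, coe_connected_iff, sum_deg_eq,
    Nat.card_coe_set_eq T.verts]
  refine and_congr_right fun _ => ?_
  omega

end Trees

/-! ### Weights as sums over ordered pairs -/

section Weights

variable {V : Type*} [Fintype V]

/-- The number of pairs in `A × B` that are related by `R`. -/
noncomputable def arcs (R : V → V → Prop) (A B : Set V) : ℕ :=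
  ∑ u, ∑ v, if u ∈ A ∧ v ∈ B ∧ R u v then 1 else 0

/-- `Q` is an orientation of the edges of `F`: by `h2` each edge is counted in one direction only.
-/
theorem totalWeight_eq_sum (w : Sym2 V → Fin 2) (F : Set (Sym2 V)) (Q : V → V → Prop)
    (h1 : ∀ e, e ∈ F ↔ ∃ u v, Q u v ∧ e = s(u, v)) (h2 : ∀ u v, Q u v → ¬ Q v u) :
    totalWeight w F = ∑ u, ∑ v, if Q u v ∧ w s(u, v) = 1 then 1 else 0 := by
  have hF : F.toFinite.toFinset =
      (Finset.univ.filter fun p : V × V => Q p.1 p.2).image fun p => s(p.1, p.2) := by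
    ext e
    simp only [Set.Finite.mem_toFinset, h1, Finset.mem_image, Finset.mem_filter, Finset.mem_univ,
      true_and, Prod.exists, eq_comm]
  rw [totalWeight, hF, Finset.sum_image, Finset.sum_filter, Fintype.sum_prod_type]
  · refine Finset.sum_congr rfl fun u _ => Finset.sum_congr rfl fun v _ => ?_
    rcases Fin.exists_fin_two.1 ⟨w s(u, v), rfl⟩ with h | h <;> simp [h]
  · rintro ⟨u, v⟩ hp ⟨u', v'⟩ hp' he
    simp only [Finset.coe_filter, Finset.mem_univ, true_and, Set.mem_ofPred_eq] at hp hp'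
    rcases Sym2.eq_iff.1 he with ⟨rfl, rfl⟩ | ⟨rfl, rfl⟩
    · rfl
    · exact absurd hp' (h2 _ _ hp)

/-- Edge sets without a natural orientation are oriented by an arbitrary numbering of the vertices;
adding the reversed arcs gives the factor two. -/
theorem two_mul_totalWeight (w : Sym2 V → Fin 2) (F : Set (Sym2 V)) (hF : ∀ u, s(u, u) ∉ F) :
    2 * totalWeight w F = ∑ u, ∑ v, if s(u, v) ∈ F ∧ w s(u, v) = 1 then 1 else 0 := by
  set r := Fintype.equivFin V
  rw [totalWeight_eq_sum w F (fun u v => s(u, v) ∈ F ∧ r u < r v), two_mul]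
  · conv_lhs => arg 2; rw [Finset.sum_comm]
    rw [← Finset.sum_add_distrib]
    refine Finset.sum_congr rfl fun u _ => ?_
    rw [← Finset.sum_add_distrib]
    refine Finset.sum_congr rfl fun v _ => ?_
    rw [Sym2.eq_swap (a := v)]
    rcases lt_trichotomy (r u) (r v) with h | h | h
    · simp [h, h.not_gt]
    · have := r.injective h
      subst this
      simp [hF]
    · simp [h, h.not_gt]
  · intro e
    induction e with | _ u v => ?_
    constructor
    · intro h
      rcases lt_trichotomy (r u) (r v) with h' | h' | h'
      · exact ⟨u, v, ⟨h, h'⟩, rfl⟩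
      · rw [r.injective h'] at h; exact absurd h (hF _)
      · exact ⟨v, u, ⟨by rwa [Sym2.eq_swap], h'⟩, Sym2.eq_swap⟩
    · rintro ⟨a, b, ⟨h, -⟩, he⟩
      rwa [he]
  · rintro u v ⟨-, h⟩ ⟨-, h'⟩
    exact absurd h h'.not_gt

theorem arcs_comm {R : V → V → Prop} (hR : ∀ a b, R a b → R b a) (A B : Set V) :
    arcs R A B = arcs R B A := by
  rw [arcs, arcs, Finset.sum_comm]
  refine Finset.sum_congr rfl fun u _ => Finset.sum_congr rfl fun v _ => ?_
  have : R u v ↔ R v u := ⟨hR _ _, hR _ _⟩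
  simp only [this]
  congr 1
  exact propext (by tauto)

theorem arcs_mono {R R' : V → V → Prop} {A B A' B' : Set V}
    (h : ∀ u v, u ∈ A → v ∈ B → R u v → u ∈ A' ∧ v ∈ B' ∧ R' u v) :
    arcs R A B ≤ arcs R' A' B' := by
  refine Finset.sum_le_sum fun u _ => Finset.sum_le_sum fun v _ => ?_
  by_cases h1 : u ∈ A ∧ v ∈ B ∧ R u v
  · simp [h1, h u v h1.1 h1.2.1 h1.2.2]
  · simp [h1]

theorem arcs_congr {R R' : V → V → Prop} {A B A' B' : Set V}
    (h : ∀ u v, (u ∈ A ∧ v ∈ B ∧ R u v) ↔ (u ∈ A' ∧ v ∈ B' ∧ R' u v)) :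
    arcs R A B = arcs R' A' B' := by
  simp only [arcs, h]

theorem arcs_union_left {R : V → V → Prop} {A A' B : Set V} (h : Disjoint A A') :
    arcs R (A ∪ A') B = arcs R A B + arcs R A' B := by
  simp only [arcs, ← Finset.sum_add_distrib]
  refine Finset.sum_congr rfl fun u _ => Finset.sum_congr rfl fun v _ => ?_
  by_cases h1 : u ∈ A
  · have := Set.disjoint_left.1 h h1
    simp [h1, this]
  · simp [h1]

theorem arcs_union_right {R : V → V → Prop} {A B B' : Set V} (h : Disjoint B B') :
    arcs R A (B ∪ B') = arcs R A B + arcs R A B' := by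
  simp only [arcs, ← Finset.sum_add_distrib]
  refine Finset.sum_congr rfl fun u _ => Finset.sum_congr rfl fun v _ => ?_
  by_cases h1 : v ∈ B
  · have := Set.disjoint_left.1 h h1
    simp [h1, this]
  · simp [h1]

theorem cutWeight_eq (E : Set (Sym2 V)) (w : Sym2 V → Fin 2) (S : Set V) :
    cutWeight E w S = arcs (fun u v => s(u, v) ∈ E ∧ w s(u, v) = 1) S Sᶜ := by
  rw [cutWeight, totalWeight_eq_sum w _ (fun u v => u ∈ S ∧ v ∉ S ∧ s(u, v) ∈ E), arcs]
  · refine Finset.sum_congr rfl fun u _ => Finset.sum_congr rfl fun v _ => ?_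
    congr 1
    exact propext (by simp only [Set.mem_compl_iff]; tauto)
  · intro e
    constructor
    · rintro ⟨he, u, hu, v, hv, rfl⟩
      exact ⟨u, v, ⟨hu, hv, he⟩, rfl⟩
    · rintro ⟨u, v, ⟨hu, hv, he⟩, rfl⟩
      exact ⟨he, u, hu, v, hv, rfl⟩
  · rintro u v ⟨hu, hv, -⟩ ⟨hu', hv', -⟩
    exact hv hu'

end Weights

/-! ### Cut weights, leaf weights and the number of 1-edges as arc counts -/

section Instances

variable {V : Type*} {I : CMCInstance V}

/-- `uv` is an edge of weight one. -/
def One (I : CMCInstance V) (u v : V) : Prop := I.graph.Adj u v ∧ I.weight s(u, v) = 1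

theorem One.symm {u v : V} (h : One I u v) : One I v u :=
  ⟨h.1.symm, by rw [Sym2.eq_swap]; exact h.2⟩

theorem One.ne {u v : V} (h : One I u v) : u ≠ v := h.1.ne

theorem loop_notMem_edgeSet (H : VGraph V) (u : V) : s(u, u) ∉ H.edgeSet :=
  fun h => (SimpleGraph.Subgraph.mem_edgeSet.1 h).ne rfl

variable [Fintype V]

theorem cutW_eq (S : Set V) : I.cutW S = arcs (One I) S Sᶜ := cutWeight_eq _ _ _

theorem two_mul_numOnes : 2 * I.numOnes = arcs (One I) Set.univ Set.univ := by
  rw [CMCInstance.numOnes, two_mul_totalWeight _ _ (loop_notMem_edgeSet _), arcs]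
  simp [One]

theorem vertexWeight_eq (v : V) :
    vertexWeight I.graph.edgeSet I.weight v = arcs (One I) {v} Set.univ := by
  rw [vertexWeight, totalWeight_eq_sum _ _ (fun a b => a = v ∧ I.graph.Adj a b), arcs]
  · simp [One, and_assoc]
  · intro e
    constructor
    · rintro ⟨he, hv⟩
      obtain ⟨u, rfl⟩ := Sym2.mem_iff_exists.1 hv
      exact ⟨v, u, ⟨rfl, he⟩, rfl⟩
    · rintro ⟨a, b, ⟨rfl, he⟩, rfl⟩
      exact ⟨he, by simp⟩
  · rintro a b ⟨rfl, h⟩ ⟨rfl, -⟩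
    exact h.ne rfl

theorem sum_arcs_singleton (R : V → V → Prop) (A B : Set V) (s : Finset V)
    (hs : ∀ v, v ∈ s ↔ v ∈ A) : ∑ v ∈ s, arcs R {v} B = arcs R A B := by
  have : ∀ v, arcs R {v} B = ∑ u, if u ∈ B ∧ R v u then 1 else 0 := by
    intro v
    rw [arcs, Finset.sum_eq_single_of_mem v (Finset.mem_univ v)]
    · simp only [Set.mem_singleton_iff, true_and]
    · intro b _ hb
      simp only [Set.mem_singleton_iff, hb, false_and, if_false, Finset.sum_const_zero]
  rw [Finset.sum_congr rfl fun v _ => this v, arcs, ← Finset.sum_subset (Finset.subset_univ s)]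
  · refine Finset.sum_congr rfl fun u hu => ?_
    simp only [(hs u).1 hu, true_and]
  · intro u _ hu
    simp only [(hs u).not.1 hu, false_and, if_false, Finset.sum_const_zero]

theorem leafWeight_eq (T : VGraph V) :
    I.leafWeight T = arcs (One I) (VGraph.leaves T) Set.univ := by
  rw [CMCInstance.leafWeight, ← sum_arcs_singleton _ _ _ (VGraph.leaves T).toFinite.toFinset
    (by simp)]
  exact Finset.sum_congr rfl fun v _ => vertexWeight_eq v

theorem two_mul_inside (L : Set V) :
    2 * totalWeight I.weight (edgesInside I.graph.edgeSet L) = arcs (One I) L L := by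
  rw [two_mul_totalWeight _ _ (fun u h => loop_notMem_edgeSet _ u h.1), arcs]
  refine Finset.sum_congr rfl fun u _ => Finset.sum_congr rfl fun v _ => ?_
  congr 1
  refine propext ?_
  simp only [edgesInside, One, Set.mem_ofPred_eq, SimpleGraph.Subgraph.mem_edgeSet, Sym2.mem_iff,
    forall_eq_or_imp, forall_eq]
  tauto

theorem between_eq {A B : Set V} (h : Disjoint A B) :
    totalWeight I.weight (cutBetween I.graph.edgeSet A B) = arcs (One I) A B := by
  rw [totalWeight_eq_sum _ _ (fun u v => u ∈ A ∧ v ∈ B ∧ I.graph.Adj u v), arcs]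
  · refine Finset.sum_congr rfl fun u _ => Finset.sum_congr rfl fun v _ => ?_
    congr 1
    exact propext (by simp only [One, and_assoc])
  · intro e
    constructor
    · rintro ⟨he, u, hu, v, hv, rfl⟩
      exact ⟨u, v, ⟨hu, hv, he⟩, rfl⟩
    · rintro ⟨u, v, ⟨hu, hv, he⟩, rfl⟩
      exact ⟨he, u, hu, v, hv, rfl⟩
  · rintro u v ⟨hu, hv, -⟩ ⟨hu', hv', -⟩
    exact Set.disjoint_left.1 h hu hv'

theorem arcs_one_comm (I : CMCInstance V) (A B : Set V) : arcs (One I) A B = arcs (One I) B A :=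
  arcs_comm (fun _ _ h => h.symm) A B

theorem cutW_le_numOnes (S : Set V) : I.cutW S ≤ I.numOnes := by
  have h1 : arcs (One I) S Sᶜ + arcs (One I) Sᶜ S ≤ arcs (One I) Set.univ Set.univ := by
    rw [← Set.union_compl_self S, arcs_union_left disjoint_compl_right]
    exact add_le_add (arcs_mono (by simp +contextual)) (arcs_mono (by simp +contextual))
  rw [arcs_one_comm I Sᶜ S, ← two_mul_numOnes, ← cutW_eq] at h1
  omega

end Instances

/-! ### From a tree to a connected cut -/

section FromTree

variable {V : Type*} [Fintype V] {I : CMCInstance V}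

theorem deg_le_one_iff (H : VGraph V) (v : V) :
    VGraph.deg H v ≤ 1 ↔ ∀ a b, H.Adj v a → H.Adj v b → a = b := by
  rw [VGraph.deg, Set.ncard_le_one (Set.toFinite _)]
  exact ⟨fun h a b ha hb => h a ha b hb, fun h a ha b hb => h a b ha hb⟩

/-- Deleting leaves of a connected graph leaves it connected, unless nothing remains. -/
theorem connOn_diff_leaves {T : VGraph V} (hT : ConnOn T.Adj T.verts) {L : Set V}
    (hL : L ⊆ VGraph.leaves T) (hne : (T.verts \ L).Nonempty) : ConnOn T.Adj (T.verts \ L) := by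
  refine ⟨hne, fun u hu v hv => ?_⟩
  -- A walk in `T` is followed by a walk that avoids `L`: when it enters a vertex of `L`, the second
  -- walk waits at the neighbour `y`. A leaf has no other neighbour, so the walk must return to `y`.
  have key : ∀ z, ReflTransGen (fun a b => a ∈ T.verts ∧ b ∈ T.verts ∧ T.Adj a b) u z →
      ∃ y ∈ T.verts \ L, ReflTransGen
        (fun a b => a ∈ T.verts \ L ∧ b ∈ T.verts \ L ∧ T.Adj a b) u y ∧
        (z = y ∨ z ∈ L ∧ T.Adj z y) := by
    intro z hz
    induction hz with
    | refl => exact ⟨u, hu, .refl, .inl rfl⟩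
    | @tail b c _ hbc ih =>
      obtain ⟨y, hy, huy, rfl | ⟨hb, hby⟩⟩ := ih
      · by_cases hc : c ∈ L
        · exact ⟨b, hy, huy, .inr ⟨hc, hbc.2.2.symm⟩⟩
        · exact ⟨c, ⟨hbc.2.1, hc⟩, huy.tail ⟨hy, ⟨hbc.2.1, hc⟩, hbc.2.2⟩, .inl rfl⟩
      · exact ⟨y, hy, huy, .inl ((deg_le_one_iff T b).1 (hL hb).2 _ _ hbc.2.2 hby)⟩
  obtain ⟨y, hy, huy, rfl | ⟨hvL, -⟩⟩ := key v (hT.2 u hu.1 v hv.1)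
  · exact huy
  · exact absurd hvL hv.2

/-- In `X \ L₁` the leaves `L₂` are kept and see `L₁` and the outside of `X`, whereas the removed
leaves `L₁` see the inner vertices. The missing terms appear in the same bound with `L₁` and `L₂`
exchanged. -/
theorem cut_diff_ge {X L₁ L₂ L : Set V} (hd : Disjoint L₁ L₂) (hL : L₁ ∪ L₂ = L) (hX : L ⊆ X) :
    arcs (One I) L₁ L₂ + arcs (One I) L₁ (X \ L) + arcs (One I) L₂ Xᶜ ≤ I.cutW (X \ L₁) := by
  subst hL
  have h12 := Set.disjoint_left.1 hd
  rw [cutW_eq, arcs_one_comm I L₁ L₂,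
    arcs_one_comm I L₁ (X \ (L₁ ∪ L₂))]
  have h1 : arcs (One I) (L₂ ∪ X \ (L₁ ∪ L₂)) (L₁ ∪ Xᶜ) ≤ arcs (One I) (X \ L₁) (X \ L₁)ᶜ := by
    refine arcs_mono fun u v hu hv h => ⟨?_, ?_, h⟩
    · rcases hu with hu | hu
      · exact ⟨hX (.inr hu), fun h => h12 h hu⟩
      · exact ⟨hu.1, fun h => hu.2 (.inl h)⟩
    · rcases hv with hv | hv
      · exact fun h => h.2 hv
      · exact fun h => hv h.1
  have h2 : Disjoint L₂ (X \ (L₁ ∪ L₂)) :=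
    Set.disjoint_left.2 fun x hx hx' => hx'.2 (.inr hx)
  have h3 : Disjoint L₁ Xᶜ := Set.disjoint_left.2 fun x hx hx' => hx' (hX (.inl hx))
  rw [arcs_union_left h2, arcs_union_right h3, arcs_union_right h3] at h1
  omega

/-- Let e be the number of 1-edges between `L₁` and `L₂`, and r the number of those from leaves to
non-leaves. The two cuts have total weight at least 2e + r, hence the better one has half of that.
Arcs inside the leaf set number at most 4e by the choice of the split, so the leaf weight is at most
4e + r. -/
theorem leafWeight_le_of_fromTree {T : VGraph V} {S : Set V} (h : I.FromTree T S) :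
    I.leafWeight T ≤ 4 * I.cutW S := by
  obtain ⟨L₁, L₂, hd, hL, hhalf, -, hc1, hc2⟩ := h
  have hX : VGraph.leaves T ⊆ T.verts := fun v hv => hv.1
  have h1 := cut_diff_ge (I := I) hd hL hX
  have h2 := cut_diff_ge (I := I) hd.symm (by rwa [Set.union_comm]) hX
  have hb := between_eq (I := I) hd
  have hin := two_mul_inside (I := I) (VGraph.leaves T)
  have hcomm := arcs_one_comm I L₁ L₂
  have hsplit : ∀ A : Set V, arcs (One I) A (VGraph.leaves T)ᶜ =
      arcs (One I) A (T.verts \ VGraph.leaves T) + arcs (One I) A T.vertsᶜ := by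
    intro A
    rw [← arcs_union_right]
    · congr 1
      ext x
      have := @hX x
      simp only [Set.mem_compl_iff, Set.mem_union, Set.mem_sdiff]
      tauto
    · exact Set.disjoint_left.2 fun x hx hx' => hx' hx.1
  have hlw : I.leafWeight T = arcs (One I) (VGraph.leaves T) (VGraph.leaves T) +
      (arcs (One I) L₁ (VGraph.leaves T)ᶜ + arcs (One I) L₂ (VGraph.leaves T)ᶜ) := by
    rw [leafWeight_eq, ← arcs_union_left hd, hL, ← arcs_union_right disjoint_compl_right,
      Set.union_compl_self]
  rw [hsplit, hsplit] at hlw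
  omega

/-- In a tree with at most two vertices all vertices are leaves, and `S` could be empty; the
positive cut weight excludes this. -/
theorem fromTree_connected {T : VGraph V} {S : Set V} (hT : T.coe.IsTree) (h : I.FromTree T S)
    (hpos : 0 < I.cutW S) : S ⊆ T.verts ∧ ConnOn T.Adj S := by
  have hS : S.Nonempty := by
    by_contra hS
    rw [Set.not_nonempty_iff_eq_empty] at hS
    subst hS
    rw [cutW_eq] at hpos
    simp [arcs] at hpos
  have hconn := ((isTree_iff T).1 hT).1
  obtain ⟨L₁, L₂, -, hL, -, hS' | hS', -, -⟩ := h <;> subst hS'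
  · exact ⟨Set.sdiff_subset, connOn_diff_leaves hconn (hL ▸ Set.subset_union_left) hS⟩
  · exact ⟨Set.sdiff_subset, connOn_diff_leaves hconn (hL ▸ Set.subset_union_right) hS⟩

theorem fromTree_of_thick {α : ℝ} {T : VGraph V} {S : Set V} (hα : 0 < α) (hpos : 0 < I.numOnes)
    (hT : I.IsThickTree α T) (h : I.FromTree T S) :
    S ⊆ I.graph.verts ∧ (I.graph.induce S).Connected ∧
      α / 4 * (I.numOnes : ℝ) ≤ (I.cutW S : ℝ) := by
  have h1 : (I.leafWeight T : ℝ) ≤ 4 * I.cutW S := mod_cast leafWeight_le_of_fromTree h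
  have h2 := hT.2.2
  have h3 : (0 : ℝ) < I.numOnes := mod_cast hpos
  have h4 : α / 4 * (I.numOnes : ℝ) ≤ (I.cutW S : ℝ) := by linarith
  have h5 : (0 : ℝ) < I.cutW S := lt_of_lt_of_le (by positivity) h4
  obtain ⟨h6, h7⟩ := fromTree_connected hT.2.1 h (by exact_mod_cast h5)
  exact ⟨h6.trans hT.1.1, (induce_connected_iff _ _).2 (h7.mono fun a b hab => hT.1.2 hab), h4⟩

end FromTree

/-! ### Elementary changes of connected sets -/

section ConnSteps

variable {V : Type*} {R : V → V → Prop} {S : Set V}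

theorem ConnOn.union_singleton (hR : ∀ a b, R a b → R b a) (h : ConnOn R S) {x y : V}
    (hy : y ∈ S) (hxy : R x y) : ConnOn R (S ∪ {x}) := by
  refine h.transfer id hR (fun a ha => .inl ha) (fun a ha b hb hab => .single ⟨.inl ha, .inl hb, hab⟩)
    fun a ha => ?_
  rcases ha with ha | rfl
  · exact ⟨a, ha, .refl⟩
  · exact ⟨y, hy, .single ⟨.inr rfl, .inl hy, hxy⟩⟩

theorem ConnOn.exists_adj (h : ConnOn R S) {x y : V} (hx : x ∈ S) (hy : y ∈ S) (hxy : x ≠ y) :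
    ∃ z ∈ S, R x z := by
  rcases (h.2 x hx y hy).cases_head with h' | ⟨z, hz, -⟩
  · exact absurd h' hxy
  · exact ⟨z, hz.2.1, hz.2.2⟩

/-- Walks through `x` enter and leave it via `y`, so `x` may be mapped to `y`. -/
theorem ConnOn.diff_singleton (hR : ∀ a b, R a b → R b a) (h : ConnOn R S)
    {x y : V} (hy : y ∈ S) (hyx : y ≠ x) (hx : ∀ z ∈ S, R x z → z = y) : ConnOn R (S \ {x}) := by
  refine h.transfer (fun a => if a = x then y else a) hR (fun a ha => ?_)
    (fun a ha b hb hab => ?_) fun a ha => ⟨a, ha.1, ?_⟩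
  · by_cases hax : a = x
    · simp [hax, hy, hyx]
    · simp [hax, ha]
  · by_cases hax : a = x
    · subst hax
      have := hx b hb hab
      subst this
      simp [hyx, ReflTransGen.refl]
    · by_cases hbx : b = x
      · subst hbx
        have := hx a ha (hR _ _ hab)
        subst this
        simp [hyx, ReflTransGen.refl]
      · simp only [hax, hbx, if_false]
        exact .single ⟨⟨ha, hax⟩, ⟨hb, hbx⟩, hab⟩
  · simp only [show a ≠ x from ha.2, if_false]
    exact .refl

theorem ConnOn.subset_of_closed (h : ConnOn R S) {C : Set V} {x : V} (hx : x ∈ S) (hxC : x ∈ C)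
    (hC : ∀ a ∈ C, ∀ b ∈ S, R a b → b ∈ C) : S ⊆ C := by
  intro y hy
  have := h.2 x hx y hy
  induction this with
  | refl => exact hxC
  | tail _ hbc ih => exact hC _ (ih hbc.1) _ hbc.2.1 hbc.2.2

end ConnSteps

/-! ### Deleting a vertex without edges of weight one -/

section Drop

variable {V : Type*} {I : CMCInstance V} {v : V}

/-- Every connected set of vertices cuts at most `k` edges of weight one. -/
def OptLe [Finite V] (I : CMCInstance V) (k : ℕ) : Prop :=
  ∀ X ⊆ I.graph.verts, ConnOn I.graph.Adj X → I.cutW X ≤ k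

theorem graph_symm (H : VGraph V) : ∀ a b, H.Adj a b → H.Adj b a := fun _ _ h => h.symm

theorem dropVertex_adj {H : VGraph V} {a b : V} :
    (VGraph.dropVertex H v).Adj a b ↔ a ≠ v ∧ b ≠ v ∧ a ≠ b ∧
      (H.Adj a b ∨ (H.Adj v a ∧ H.Adj v b)) := by
  change ((a ∈ H.verts \ {v} ∧ b ∈ H.verts \ {v}) ∧ a ≠ b ∧ _) ↔ _
  constructor
  · rintro ⟨⟨ha, hb⟩, hab, h⟩
    exact ⟨ha.2, hb.2, hab, h⟩
  · rintro ⟨ha, hb, hab, h⟩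
    refine ⟨⟨⟨?_, ha⟩, ⟨?_, hb⟩⟩, hab, h⟩
    · exact h.elim (fun h => h.fst_mem) (fun h => h.1.snd_mem)
    · exact h.elim (fun h => h.snd_mem) (fun h => h.2.snd_mem)

/-- The edges lost at `v` and the edges added between its neighbours all have weight zero. -/
theorem one_dropVertex (hv : ∀ u, I.graph.Adj v u → I.weight s(v, u) = 0) (a b : V) :
    One (I.dropVertex v) a b ↔ One I a b := by
  have hw : (I.dropVertex v).weight s(a, b) =
      if s(a, b) ∈ I.graph.edgeSet then I.weight s(a, b) else 0 := rfl
  have hne : ∀ u, ¬ One I v u := fun u h => by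
    have := hv u h.1
    rw [h.2] at this
    exact absurd this (by decide)
  rw [One, hw]
  constructor
  · rintro ⟨-, h⟩
    split_ifs at h with he
    · exact ⟨he, h⟩
    · exact absurd h (by decide)
  · intro h
    refine ⟨dropVertex_adj.2 ⟨?_, ?_, h.ne, .inl h.1⟩, ?_⟩
    · rintro rfl; exact hne _ h
    · rintro rfl; exact hne _ h.symm
    · rw [if_pos (SimpleGraph.Subgraph.mem_edgeSet.2 h.1)]
      exact h.2

/-- If `v` had no neighbour in `S'`, all edges inside `S'` would be old and `S'` would already be
connected. With such a neighbour, `v` can be attached, and every new edge is replaced by a path of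
length two through `v`. -/
theorem connOn_of_dropVertex {S' : Set V} (h : ConnOn (I.dropVertex v).graph.Adj S')
    (hn : ¬ ConnOn I.graph.Adj S') : ConnOn I.graph.Adj (S' ∪ {v}) := by
  have : ∃ a ∈ S', I.graph.Adj v a := by
    by_contra hcon
    push Not at hcon
    exact hn (h.imp_right fun h' u hu w hw => ReflTransGen.mono (fun a b hab => ⟨hab.1, hab.2.1,
      (dropVertex_adj.1 hab.2.2).2.2.2.resolve_right fun h'' => hcon a hab.1 h''.1⟩) _ _
      (h' u hu w hw))
  obtain ⟨x, hx, hvx⟩ := this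
  refine h.transfer id (graph_symm _) (fun a ha => .inl ha) (fun a ha b hb hab => ?_)
    fun a ha => ?_
  · rcases (dropVertex_adj.1 hab).2.2.2 with h' | ⟨h1, h2⟩
    · exact .single ⟨.inl ha, .inl hb, h'⟩
    · exact .head ⟨.inl ha, .inr rfl, h1.symm⟩ (.single ⟨.inr rfl, .inl hb, h2⟩)
  · rcases ha with ha | rfl
    · exact ⟨a, ha, .refl⟩
    · exact ⟨x, hx, .single ⟨.inr rfl, .inl hx, hvx⟩⟩

/-- The neighbours of `v` have become a clique, so a walk through `v` can be rerouted through any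
fixed neighbour `x` of `v` in `S`. -/
theorem connOn_dropVertex {S : Set V} (h : ConnOn I.graph.Adj S) (hne : (S \ {v}).Nonempty) :
    ConnOn (I.dropVertex v).graph.Adj (S \ {v}) := by
  by_cases hv : v ∈ S
  · obtain ⟨y, hy⟩ := hne
    obtain ⟨x, hx, hvx⟩ := h.exists_adj hv hy.1 (Ne.symm hy.2)
    have hxv : x ≠ v := hvx.ne.symm
    have hadj : ∀ a b : V, I.graph.Adj v a → I.graph.Adj v b → a ∈ S → b ∈ S →
        ReflTransGen (fun a b => a ∈ S \ {v} ∧ b ∈ S \ {v} ∧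
          (I.dropVertex v).graph.Adj a b) a b := by
      intro a b ha hb haS hbS
      by_cases hab : a = b
      · subst hab; exact .refl
      · exact .single ⟨⟨haS, ha.ne.symm⟩, ⟨hbS, hb.ne.symm⟩,
          dropVertex_adj.2 ⟨ha.ne.symm, hb.ne.symm, hab, .inr ⟨ha, hb⟩⟩⟩
    refine h.transfer (fun a => if a = v then x else a) (graph_symm _) (fun a ha => ?_)
      (fun a ha b hb hab => ?_) fun a ha => ⟨a, ha.1, ?_⟩
    · by_cases hax : a = v
      · simp [hax, hx, hxv]
      · simp [hax, ha]
    · by_cases hax : a = v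
      · subst hax
        simp only [if_true, hab.ne.symm, if_false]
        exact hadj _ _ hvx hab hx hb
      · by_cases hbx : b = v
        · subst hbx
          simp only [if_true, hax, if_false]
          exact hadj _ _ hab.symm hvx ha hx
        · simp only [hax, hbx, if_false]
          exact .single ⟨⟨ha, hax⟩, ⟨hb, hbx⟩, dropVertex_adj.2 ⟨hax, hbx, hab.ne, .inl hab⟩⟩
    · simp only [show a ≠ v from ha.2, if_false]
      exact .refl
  · rw [Set.sdiff_singleton_eq_self hv]
    refine h.imp_right fun h' u hu w hw => ReflTransGen.mono (fun a b hab => ⟨hab.1, hab.2.1,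
      dropVertex_adj.2 ⟨?_, ?_, hab.2.2.ne, .inl hab.2.2⟩⟩) _ _ (h' u hu w hw)
    · rintro rfl; exact hv hab.1
    · rintro rfl; exact hv hab.2.1

variable [Fintype V]

theorem cutW_dropVertex (hv : ∀ u, I.graph.Adj v u → I.weight s(v, u) = 0) {S S' : Set V}
    (hS : ∀ x, x ≠ v → (x ∈ S ↔ x ∈ S')) : (I.dropVertex v).cutW S' = I.cutW S := by
  rw [cutW_eq, cutW_eq]
  refine arcs_congr fun a b => ?_
  rw [one_dropVertex hv]
  by_cases h : One I a b
  · have h' := (one_dropVertex hv a b).2 h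
    obtain ⟨ha, hb, -⟩ := dropVertex_adj.1 h'.1
    rw [Set.mem_compl_iff, Set.mem_compl_iff, hS a ha, hS b hb]
  · simp [h]

theorem optLe_of_dropVertex (hv : ∀ u, I.graph.Adj v u → I.weight s(v, u) = 0) {k : ℕ}
    (h : OptLe (I.dropVertex v) k) : OptLe I k := by
  intro X hX hc
  by_cases hne : (X \ {v}).Nonempty
  · rw [← cutW_dropVertex hv (S' := X \ {v})]
    · exact h _ (fun x hx => ⟨hX hx.1, hx.2⟩) (connOn_dropVertex hc hne)
    · intro x hx; simp [hx]
  -- Here `X` is contained in `{v}`, so it cuts no more than the empty set.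
  · rw [← cutW_dropVertex hv (S' := ∅), cutW_eq]
    · simp [arcs]
    · intro x hx
      simp only [Set.mem_empty_iff_false, iff_false]
      exact fun hxX => hne ⟨x, hxX, hx⟩

end Drop

/-! ### Shortening a thin path -/

section ContractGraph

variable {V : Type*} {H : VGraph V} {v₀ v₁ v₂ v₃ : V}

theorem contract_adj {a b : V} : (VGraph.contract H v₁ v₂ v₃).Adj a b ↔
    (a ∈ H.verts \ {v₂} ∧ b ∈ H.verts \ {v₂}) ∧ a ≠ b ∧ (H.Adj a b ∨ s(a, b) = s(v₁, v₃)) :=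
  Iff.rfl

theorem adj_iff_of_deg_two [Finite V] {x y z : V} (hd : VGraph.deg H x = 2) (hy : H.Adj x y) (hz : H.Adj x z)
    (hyz : y ≠ z) (b : V) : H.Adj x b ↔ b = y ∨ b = z := by
  have h : ({y, z} : Set V) = H.neighborSet x := by
    refine Set.eq_of_subset_of_ncard_le ?_ ?_ (Set.toFinite _)
    · rintro w (rfl | rfl)
      · exact hy
      · exact hz
    · rw [Set.ncard_pair hyz]
      exact hd.le
  have h2 : b ∈ H.neighborSet x ↔ b ∈ ({y, z} : Set V) := by rw [h]
  exact h2

namespace IsThinPath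

theorem adj_v₁ [Finite V] (h : VGraph.IsThinPath H v₀ v₁ v₂ v₃)
    (b : V) : H.Adj v₁ b ↔ b = v₀ ∨ b = v₂ :=
  adj_iff_of_deg_two h.deg₁ h.adj₀₁.symm h.adj₁₂ h.ne₀₂ b

theorem adj_v₂ [Finite V] (h : VGraph.IsThinPath H v₀ v₁ v₂ v₃)
    (b : V) : H.Adj v₂ b ↔ b = v₁ ∨ b = v₃ :=
  adj_iff_of_deg_two h.deg₂ h.adj₁₂.symm h.adj₂₃ h.ne₁₃ b

theorem contract_iff (h : VGraph.IsThinPath H v₀ v₁ v₂ v₃)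
    {a b : V} : (VGraph.contract H v₁ v₂ v₃).Adj a b ↔
    (a ≠ v₂ ∧ b ≠ v₂ ∧ H.Adj a b) ∨ s(a, b) = s(v₁, v₃) := by
  rw [contract_adj]
  constructor
  · rintro ⟨⟨ha, hb⟩, hab, h' | h'⟩
    · exact .inl ⟨ha.2, hb.2, h'⟩
    · exact .inr h'
  · rintro (⟨ha, hb, hab⟩ | h')
    · exact ⟨⟨⟨hab.fst_mem, ha⟩, ⟨hab.snd_mem, hb⟩⟩, hab.ne, .inl hab⟩
    · have h1 : v₁ ∈ H.verts \ {v₂} := ⟨h.adj₁₂.fst_mem, h.adj₁₂.ne⟩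
      have h3 : v₃ ∈ H.verts \ {v₂} := ⟨h.adj₂₃.snd_mem, h.adj₂₃.ne.symm⟩
      have h13 := h.ne₁₃
      rcases Sym2.eq_iff.1 h' with ⟨rfl, rfl⟩ | ⟨rfl, rfl⟩
      · exact ⟨⟨h1, h3⟩, h13, .inr rfl⟩
      · exact ⟨⟨h3, h1⟩, h13.symm, .inr Sym2.eq_swap⟩

theorem contract_v₁ [Finite V] (h : VGraph.IsThinPath H v₀ v₁ v₂ v₃)
    (b : V) : (VGraph.contract H v₁ v₂ v₃).Adj v₁ b ↔ b = v₀ ∨ b = v₃ := by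
  rw [contract_iff h, adj_v₁ h, Sym2.eq_iff]
  have h12 := h.adj₁₂.ne
  have h13 := h.ne₁₃
  have h02 := h.ne₀₂
  constructor
  · rintro (⟨-, h1, h2⟩ | h2)
    · tauto
    · tauto
  · rintro (rfl | rfl)
    · tauto
    · tauto

/-- The only new edge is `v₁v₃`, and the only edges lost are at `v₂`; neither lies inside `S`. -/
theorem connOn_contract_iff (h : VGraph.IsThinPath H v₀ v₁ v₂ v₃)
    {S : Set V} (h2 : v₂ ∉ S) (h13 : ¬ (v₁ ∈ S ∧ v₃ ∈ S)) :
    ConnOn H.Adj S ↔ ConnOn (VGraph.contract H v₁ v₂ v₃).Adj S := by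
  refine connOn_congr fun a ha b hb => ?_
  rw [contract_iff h]
  constructor
  · intro hab
    refine .inl ⟨?_, ?_, hab⟩
    · rintro rfl; exact h2 ha
    · rintro rfl; exact h2 hb
  · rintro (h' | h')
    · exact h'.2.2
    · exfalso
      rcases Sym2.eq_iff.1 h' with ⟨rfl, rfl⟩ | ⟨rfl, rfl⟩ <;> tauto

/-- If `S` contains `v₁` and `v₂`, then `v₂` can be removed when the path is shortened. -/
theorem connOn_contract_diff [Finite V] (h : VGraph.IsThinPath H v₀ v₁ v₂ v₃)
    {S : Set V} (hS : ConnOn H.Adj S) (h1 : v₁ ∈ S) :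
    ConnOn (VGraph.contract H v₁ v₂ v₃).Adj (S \ {v₂}) := by
  have h12 := h.adj₁₂.ne
  have h32 := h.adj₂₃.ne.symm
  have key : ∀ b ∈ S, H.Adj v₂ b → ReflTransGen (fun a b => a ∈ S \ {v₂} ∧ b ∈ S \ {v₂} ∧
      (VGraph.contract H v₁ v₂ v₃).Adj a b) v₁ b := by
    intro b hb hab
    rcases (adj_v₂ h b).1 hab with rfl | rfl
    · exact .refl
    · exact .single ⟨⟨h1, h12⟩, ⟨hb, h32⟩, (contract_iff h).2 (.inr rfl)⟩
  refine hS.transfer (fun a => if a = v₂ then v₁ else a) (graph_symm _) (fun a ha => ?_)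
    (fun a ha b hb hab => ?_) fun a ha => ⟨a, ha.1, ?_⟩
  · by_cases hax : a = v₂
    · simp [hax, h1, h12]
    · simp [hax, ha]
  · by_cases hax : a = v₂
    · subst hax
      simp only [if_true, hab.ne.symm, if_false]
      exact key b hb hab
    · by_cases hbx : b = v₂
      · subst hbx
        simp only [if_true, hax, if_false]
        exact rtg_symm (fun a b hab => ⟨hab.2.1, hab.1, hab.2.2.symm⟩) (key a ha hab.symm)
      · simp only [hax, hbx, if_false]
        exact .single ⟨⟨ha, hax⟩, ⟨hb, hbx⟩, (contract_iff h).2 (.inl ⟨hax, hbx, hab⟩)⟩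
  · simp only [show a ≠ v₂ from ha.2, if_false]
    exact .refl

theorem connOn_union_of_contract (h : VGraph.IsThinPath H v₀ v₁ v₂ v₃)
    {S : Set V} (hS : ConnOn (VGraph.contract H v₁ v₂ v₃).Adj S)
    (h1 : v₁ ∈ S) : ConnOn H.Adj (S ∪ {v₂}) := by
  have key : v₃ ∈ S → ReflTransGen (fun a b => a ∈ S ∪ {v₂} ∧ b ∈ S ∪ {v₂} ∧ H.Adj a b) v₁ v₃ :=
    fun h3 => .head ⟨.inl h1, .inr rfl, h.adj₁₂⟩ (.single ⟨.inr rfl, .inl h3, h.adj₂₃⟩)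
  refine hS.transfer id (graph_symm _) (fun a ha => .inl ha) (fun a ha b hb hab => ?_)
    fun a ha => ?_
  · rcases (contract_iff h).1 hab with h' | h'
    · exact .single ⟨.inl ha, .inl hb, h'.2.2⟩
    · rcases Sym2.eq_iff.1 h' with ⟨rfl, rfl⟩ | ⟨rfl, rfl⟩
      · exact key hb
      · exact rtg_symm (fun a b hab => ⟨hab.2.1, hab.1, hab.2.2.symm⟩) (key ha)
  · rcases ha with ha | rfl
    · exact ⟨a, ha, .refl⟩
    · exact ⟨v₁, h1, .single ⟨.inr rfl, .inl h1, h.adj₁₂.symm⟩⟩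

theorem connOn_contract_verts [Finite V] (h : VGraph.IsThinPath H v₀ v₁ v₂ v₃)
    (hH : ConnOn H.Adj H.verts) :
    ConnOn (VGraph.contract H v₁ v₂ v₃).Adj (VGraph.contract H v₁ v₂ v₃).verts :=
  connOn_contract_diff h hH h.adj₁₂.fst_mem

end IsThinPath

end ContractGraph

/-! ### The contribution of a thin path to a cut, before and after shortening -/

section ContractCut

variable {V : Type*} [Fintype V]

/-- The indicator of a proposition. -/
noncomputable def ind (p : Prop) : ℕ := if p then 1 else 0

theorem ind_of {p : Prop} (h : p) : ind p = 1 := if_pos h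

theorem ind_of_not {p : Prop} (h : ¬ p) : ind p = 0 := if_neg h

/-- Used to split off the path edges one at a time, so that a cut weight becomes the contribution of
the remaining graph plus explicit indicators. The condition `p` says that the edge has weight one.
-/
theorem arcs_add_edge {R R₀ : V → V → Prop} {u v : V} (p : Prop) (huv : u ≠ v)
    (hR : ∀ a b, R a b ↔ R₀ a b ∨ (p ∧ s(a, b) = s(u, v))) (h1 : ¬ R₀ u v) (h2 : ¬ R₀ v u)
    (S : Set V) :
    arcs R S Sᶜ = arcs R₀ S Sᶜ + ind (p ∧ ¬ (u ∈ S ↔ v ∈ S)) := by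
  have hsum : ∀ x y : V, (∑ a, ∑ b, if a = x ∧ b = y then 1 else 0) = 1 := by
    intro x y
    rw [Finset.sum_eq_single_of_mem x (Finset.mem_univ x), Finset.sum_eq_single_of_mem y
      (Finset.mem_univ y)]
    · simp
    · intro b _ hb; simp [hb]
    · intro b _ hb; simp [hb]
  have hsplit : arcs R S Sᶜ = arcs R₀ S Sᶜ +
      ∑ a, ∑ b, if a ∈ S ∧ b ∉ S ∧ p ∧ s(a, b) = s(u, v) then 1 else 0 := by
    simp only [arcs, ← Finset.sum_add_distrib]
    refine Finset.sum_congr rfl fun a _ => Finset.sum_congr rfl fun b _ => ?_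
    by_cases hc : p ∧ s(a, b) = s(u, v)
    · have h0 : ¬ R₀ a b := by
        rcases Sym2.eq_iff.1 hc.2 with ⟨rfl, rfl⟩ | ⟨rfl, rfl⟩ <;> assumption
      simp [hR, h0]
    · have hc' : ¬ (a ∈ S ∧ b ∉ S ∧ p ∧ s(a, b) = s(u, v)) := fun h => hc h.2.2
      simp only [hR, or_iff_left hc, Set.mem_compl_iff, if_neg hc', add_zero]
  rw [hsplit, add_right_inj]
  by_cases hp : p
  · by_cases hu : u ∈ S <;> by_cases hv : v ∈ S
    · rw [ind_of_not (by tauto)]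
      refine Finset.sum_eq_zero fun a _ => Finset.sum_eq_zero fun b _ => if_neg ?_
      rintro ⟨ha, hb, -, h⟩
      rcases Sym2.eq_iff.1 h with ⟨rfl, rfl⟩ | ⟨rfl, rfl⟩ <;> tauto
    · rw [ind_of (by tauto)]
      refine Eq.trans ?_ (hsum u v)
      refine Finset.sum_congr rfl fun a _ => Finset.sum_congr rfl fun b _ => by
        congr 1
        refine propext ⟨?_, ?_⟩
        · rintro ⟨ha, hb, -, h⟩
          rcases Sym2.eq_iff.1 h with ⟨rfl, rfl⟩ | ⟨rfl, rfl⟩ <;> tauto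
        · rintro ⟨rfl, rfl⟩; tauto
    · rw [ind_of (by tauto)]
      refine Eq.trans ?_ (hsum v u)
      refine Finset.sum_congr rfl fun a _ => Finset.sum_congr rfl fun b _ => by
        congr 1
        refine propext ⟨?_, ?_⟩
        · rintro ⟨ha, hb, -, h⟩
          rcases Sym2.eq_iff.1 h with ⟨rfl, rfl⟩ | ⟨rfl, rfl⟩ <;> tauto
        · rintro ⟨rfl, rfl⟩; exact ⟨hv, hu, hp, Sym2.eq_swap⟩
    · rw [ind_of_not (by tauto)]
      refine Finset.sum_eq_zero fun a _ => Finset.sum_eq_zero fun b _ => if_neg ?_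
      rintro ⟨ha, hb, -, h⟩
      rcases Sym2.eq_iff.1 h with ⟨rfl, rfl⟩ | ⟨rfl, rfl⟩ <;> tauto
  · simp [hp, ind]

/-- Edges of weight one that avoid `v₁` and `v₂`. -/
def OneOff (I : CMCInstance V) (v₁ v₂ a b : V) : Prop :=
  One I a b ∧ a ≠ v₁ ∧ a ≠ v₂ ∧ b ≠ v₁ ∧ b ≠ v₂

theorem arcs_oneOff_congr {I : CMCInstance V} {v₁ v₂ : V} {S S' : Set V}
    (h : ∀ x, x ≠ v₁ → x ≠ v₂ → (x ∈ S ↔ x ∈ S')) :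
    arcs (OneOff I v₁ v₂) S Sᶜ = arcs (OneOff I v₁ v₂) S' S'ᶜ := by
  refine arcs_congr fun a b => ?_
  simp only [OneOff, Set.mem_compl_iff]
  constructor
  · rintro ⟨ha, hb, h', h1, h2, h3, h4⟩
    exact ⟨(h a h1 h2).1 ha, (h b h3 h4).not.1 hb, h', h1, h2, h3, h4⟩
  · rintro ⟨ha, hb, h', h1, h2, h3, h4⟩
    exact ⟨(h a h1 h2).2 ha, (h b h3 h4).not.2 hb, h', h1, h2, h3, h4⟩

variable {I : CMCInstance V} {v₀ v₁ v₂ v₃ : V}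

theorem cutW_of_thinPath (h : VGraph.IsThinPath I.graph v₀ v₁ v₂ v₃) (S : Set V) :
    I.cutW S = arcs (OneOff I v₁ v₂) S Sᶜ +
      ind (I.weight s(v₀, v₁) = 1 ∧ ¬ (v₀ ∈ S ↔ v₁ ∈ S)) +
      ind (I.weight s(v₁, v₂) = 1 ∧ ¬ (v₁ ∈ S ↔ v₂ ∈ S)) +
      ind (I.weight s(v₂, v₃) = 1 ∧ ¬ (v₂ ∈ S ↔ v₃ ∈ S)) := by
  have h01 := h.adj₀₁.ne
  have h12 := h.adj₁₂.ne
  have h23 := h.adj₂₃.ne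
  have h02 := h.ne₀₂
  have h03 := h.ne₀₃
  have h13 := h.ne₁₃
  rw [cutW_eq,
    ← arcs_add_edge (R := fun a b => OneOff I v₁ v₂ a b ∨
        (I.weight s(v₀, v₁) = 1 ∧ s(a, b) = s(v₀, v₁))) (R₀ := OneOff I v₁ v₂) _ h01
      (fun a b => Iff.rfl),
    ← arcs_add_edge (R := fun a b => (OneOff I v₁ v₂ a b ∨
        (I.weight s(v₀, v₁) = 1 ∧ s(a, b) = s(v₀, v₁))) ∨
          (I.weight s(v₁, v₂) = 1 ∧ s(a, b) = s(v₁, v₂))) _ h12 (fun a b => Iff.rfl),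
    ← arcs_add_edge (R := One I) _ h23]
  · intro a b
    constructor
    · intro hab
      by_cases ha1 : a = v₁
      · subst ha1
        rcases (IsThinPath.adj_v₁ h b).1 hab.1 with rfl | rfl
        · exact .inl (.inl (.inr ⟨by rw [Sym2.eq_swap]; exact hab.2, Sym2.eq_swap⟩))
        · exact .inl (.inr ⟨hab.2, rfl⟩)
      by_cases hb1 : b = v₁
      · subst hb1
        rcases (IsThinPath.adj_v₁ h a).1 hab.1.symm with rfl | rfl
        · exact .inl (.inl (.inr ⟨hab.2, rfl⟩))
        · exact .inl (.inr ⟨by rw [Sym2.eq_swap]; exact hab.2, Sym2.eq_swap⟩)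
      by_cases ha2 : a = v₂
      · subst ha2
        rcases (IsThinPath.adj_v₂ h b).1 hab.1 with rfl | rfl
        · exact absurd rfl hb1
        · exact .inr ⟨hab.2, rfl⟩
      by_cases hb2 : b = v₂
      · subst hb2
        rcases (IsThinPath.adj_v₂ h a).1 hab.1.symm with rfl | rfl
        · exact absurd rfl ha1
        · exact .inr ⟨by rw [Sym2.eq_swap]; exact hab.2, Sym2.eq_swap⟩
      exact .inl (.inl (.inl ⟨hab, ha1, ha2, hb1, hb2⟩))
    · have key : ∀ x y, I.graph.Adj x y → I.weight s(x, y) = 1 → s(a, b) = s(x, y) →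
          One I a b := by
        intro x y hxy hw he
        rcases Sym2.eq_iff.1 he with ⟨rfl, rfl⟩ | ⟨rfl, rfl⟩
        · exact ⟨hxy, hw⟩
        · exact One.symm ⟨hxy, hw⟩
      rintro (((hab | ⟨hw, he⟩) | ⟨hw, he⟩) | ⟨hw, he⟩)
      · exact hab.1
      · exact key _ _ h.adj₀₁ hw he
      · exact key _ _ h.adj₁₂ hw he
      · exact key _ _ h.adj₂₃ hw he
  all_goals simp only [OneOff, Sym2.eq_iff]; tauto

/-- The majority and the disjunction of `p, q, r` express k ≥ 2 and k ≥ 1. With the three weights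
replaced by abstract propositions, the comparison with the old cut becomes propositional. -/
theorem cutW_contract (h : VGraph.IsThinPath I.graph v₀ v₁ v₂ v₃) {p q r : Prop}
    (hp : I.weight s(v₀, v₁) = 1 ↔ p) (hq : I.weight s(v₁, v₂) = 1 ↔ q)
    (hr : I.weight s(v₂, v₃) = 1 ↔ r) (S : Set V) :
    (I.contract v₀ v₁ v₂ v₃).cutW S = arcs (OneOff I v₁ v₂) S Sᶜ +
      ind ((p ∧ q ∨ p ∧ r ∨ q ∧ r) ∧ ¬ (v₀ ∈ S ↔ v₁ ∈ S)) +
      ind ((p ∨ q ∨ r) ∧ ¬ (v₁ ∈ S ↔ v₃ ∈ S)) := by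
  have h01 := h.adj₀₁.ne
  have h12 := h.adj₁₂.ne
  have h23 := h.adj₂₃.ne
  have h02 := h.ne₀₂
  have h03 := h.ne₀₃
  have h13 := h.ne₁₃
  have hval : ∀ x : Fin 2, (x = 1 ∧ (x : ℕ) = 1) ∨ (x ≠ 1 ∧ (x : ℕ) = 0) := by decide
  have hw : ∀ e, (I.contract v₀ v₁ v₂ v₃).weight e = if e = s(v₀, v₁) then
      (if p ∧ q ∨ p ∧ r ∨ q ∧ r then 1 else 0) else if e = s(v₁, v₃) then
      (if p ∨ q ∨ r then 1 else 0) else I.weight e := by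
    intro e
    have h2 : 2 ≤ (I.weight s(v₀, v₁) : ℕ) + (I.weight s(v₁, v₂) : ℕ) + (I.weight s(v₂, v₃) : ℕ) ↔
        p ∧ q ∨ p ∧ r ∨ q ∧ r := by
      rw [← hp, ← hq, ← hr]
      rcases hval (I.weight s(v₀, v₁)) with ⟨h1, h1'⟩ | ⟨h1, h1'⟩ <;>
      rcases hval (I.weight s(v₁, v₂)) with ⟨h2, h2'⟩ | ⟨h2, h2'⟩ <;>
      rcases hval (I.weight s(v₂, v₃)) with ⟨h3, h3'⟩ | ⟨h3, h3'⟩ <;>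
      rw [h1', h2', h3'] <;> simp [h1, h2, h3]
    have h1 : 1 ≤ (I.weight s(v₀, v₁) : ℕ) + (I.weight s(v₁, v₂) : ℕ) + (I.weight s(v₂, v₃) : ℕ) ↔
        p ∨ q ∨ r := by
      rw [← hp, ← hq, ← hr]
      rcases hval (I.weight s(v₀, v₁)) with ⟨h1, h1'⟩ | ⟨h1, h1'⟩ <;>
      rcases hval (I.weight s(v₁, v₂)) with ⟨h2, h2'⟩ | ⟨h2, h2'⟩ <;>
      rcases hval (I.weight s(v₂, v₃)) with ⟨h3, h3'⟩ | ⟨h3, h3'⟩ <;>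
      rw [h1', h2', h3'] <;> simp [h1, h2, h3]
    simp only [CMCInstance.contract, h1, h2]
  have hne : s(v₁, v₃) ≠ s(v₀, v₁) := by rw [Ne, Sym2.eq_iff]; tauto
  rw [cutW_eq,
    ← arcs_add_edge (R := fun a b => OneOff I v₁ v₂ a b ∨
        ((p ∧ q ∨ p ∧ r ∨ q ∧ r) ∧ s(a, b) = s(v₀, v₁))) (R₀ := OneOff I v₁ v₂) _ h01
      (fun a b => Iff.rfl),
    ← arcs_add_edge (R := One (I.contract v₀ v₁ v₂ v₃)) _ h13]
  · intro a b
    rw [One, hw]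
    change (VGraph.contract I.graph v₁ v₂ v₃).Adj a b ∧ _ ↔ _
    by_cases e1 : s(a, b) = s(v₀, v₁)
    · have hadj : (VGraph.contract I.graph v₁ v₂ v₃).Adj a b := by
        rcases Sym2.eq_iff.1 e1 with ⟨rfl, rfl⟩ | ⟨rfl, rfl⟩
        · exact ((IsThinPath.contract_v₁ h a).2 (.inl rfl)).symm
        · exact (IsThinPath.contract_v₁ h b).2 (.inl rfl)
      have hoff : ¬ OneOff I v₁ v₂ a b := by
        rcases Sym2.eq_iff.1 e1 with ⟨rfl, rfl⟩ | ⟨rfl, rfl⟩ <;> simp [OneOff]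
      simp only [e1, hne.symm, hadj, hoff, if_true, true_and, false_or, and_false, or_false,
        and_true]
      split_ifs with hc <;> simp [hc]
    by_cases e3 : s(a, b) = s(v₁, v₃)
    · have hadj : (VGraph.contract I.graph v₁ v₂ v₃).Adj a b :=
        (IsThinPath.contract_iff h).2 (.inr e3)
      have hoff : ¬ OneOff I v₁ v₂ a b := by
        rcases Sym2.eq_iff.1 e3 with ⟨rfl, rfl⟩ | ⟨rfl, rfl⟩ <;> simp [OneOff]
      simp only [e3, hne, hadj, hoff, if_true, if_false, true_and, false_or, and_false,
        and_true]
      split_ifs with hc <;> simp [hc]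
    simp only [e1, e3, if_false, and_false, or_false]
    rw [IsThinPath.contract_iff h]
    constructor
    · rintro ⟨⟨ha, hb, hab⟩ | he, hw⟩
      · refine ⟨⟨hab, hw⟩, ?_, ha, ?_, hb⟩
        · rintro rfl
          rcases (IsThinPath.adj_v₁ h b).1 hab with rfl | rfl
          · exact e1 Sym2.eq_swap
          · exact hb rfl
        · rintro rfl
          rcases (IsThinPath.adj_v₁ h a).1 hab.symm with rfl | rfl
          · exact e1 rfl
          · exact ha rfl
      · exact absurd he e3
    · rintro ⟨hab, ha1, ha2, hb1, hb2⟩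
      exact ⟨.inl ⟨ha2, hb2, hab.1⟩, hab.2⟩
  all_goals simp only [OneOff, Sym2.eq_iff]; tauto

end ContractCut

/-! ### The optimum under shortening -/

section ContractSolutions

variable {V : Type*} [Fintype V] {I : CMCInstance V} {v₀ v₁ v₂ v₃ : V}

/-- Parity: with both ends on the same side, an even number of the three edges is cut, hence at most
two. So at most min(k, 2) = [k ≥ 2] + [k ≥ 1] 1-edges are cut. -/
theorem ind_path_le_of_iff {p q r a₀ a₁ a₂ a₃ : Prop} (h : a₀ ↔ a₃) :
    ind (p ∧ ¬ (a₀ ↔ a₁)) + ind (q ∧ ¬ (a₁ ↔ a₂)) + ind (r ∧ ¬ (a₂ ↔ a₃)) ≤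
      ind (p ∧ q ∨ p ∧ r ∨ q ∧ r) + ind (p ∨ q ∨ r) := by
  rw [← h]
  clear h
  by_cases p <;> by_cases q <;> by_cases r <;> by_cases a₀ <;> by_cases a₁ <;> by_cases a₂ <;>
    simp [*, ind]

/-- With the ends on different sides, one or three edges are cut, and three would need both outer
edges to be cut, against `h'`. A single cut edge counts at most [k ≥ 1]. -/
theorem ind_path_le {p q r a₀ a₁ a₂ a₃ : Prop} (h : ¬ (a₀ ↔ a₃))
    (h' : (a₀ ↔ a₁) ∨ (a₂ ↔ a₃)) :
    ind (p ∧ ¬ (a₀ ↔ a₁)) + ind (q ∧ ¬ (a₁ ↔ a₂)) + ind (r ∧ ¬ (a₂ ↔ a₃)) ≤ ind (p ∨ q ∨ r) := by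
  have h3 : a₃ ↔ ¬ a₀ := by tauto
  rw [h3] at h' ⊢
  by_cases p <;> by_cases q <;> by_cases r <;> by_cases a₀ <;> by_cases a₁ <;> by_cases a₂ <;>
    simp_all [ind]

/-- Shortening a thin path does not decrease the optimum. -/
theorem optLe_of_contract (h : VGraph.IsThinPath I.graph v₀ v₁ v₂ v₃) {k : ℕ}
    (hk : OptLe (I.contract v₀ v₁ v₂ v₃) k) : OptLe I k := by
  intro S hS hc
  have h01 := h.adj₀₁.ne
  have h12 := h.adj₁₂.ne
  have h23 := h.adj₂₃.ne
  have h02 := h.ne₀₂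
  have h03 := h.ne₀₃
  have h13 := h.ne₁₃
  suffices hX : ∃ X ⊆ (I.contract v₀ v₁ v₂ v₃).graph.verts,
      ConnOn (I.contract v₀ v₁ v₂ v₃).graph.Adj X ∧ I.cutW S ≤ (I.contract v₀ v₁ v₂ v₃).cutW X by
    obtain ⟨X, h1, h2, h3⟩ := hX
    exact h3.trans (hk X h1 h2)
  have hv1 : v₁ ∈ (I.contract v₀ v₁ v₂ v₃).graph.verts := ⟨h.adj₁₂.fst_mem, h12⟩
  have hG : (I.contract v₀ v₁ v₂ v₃).graph = VGraph.contract I.graph v₁ v₂ v₃ := rfl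
  have hsub : ∀ X : Set V, (∀ x ∈ X, x ≠ v₁ → x ∈ S) → v₂ ∉ X →
      X ⊆ (I.contract v₀ v₁ v₂ v₃).graph.verts := by
    intro X hX hX2 x hx
    by_cases hx1 : x = v₁
    · exact hx1 ▸ hv1
    · exact ⟨hS (hX x hx hx1), fun hx2 => hX2 ((Set.mem_singleton_iff.1 hx2) ▸ hx)⟩
  rw [cutW_of_thinPath h]
  rw [hG] at hsub ⊢
  set p := I.weight s(v₀, v₁) = 1
  set q := I.weight s(v₁, v₂) = 1
  set r := I.weight s(v₂, v₃) = 1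
  have hcut := cutW_contract h (p := p) (q := q) (r := r) Iff.rfl Iff.rfl Iff.rfl
  -- the set with `v₁` and `v₂` removed
  have hrem : ∀ X : Set V, v₀ ∈ S ∨ v₃ ∈ S → (v₃ ∈ S → v₁ ∈ S → v₂ ∉ S → v₀ ∈ S) →
      (v₀ ∈ S → v₂ ∈ S → v₁ ∉ S → v₃ ∈ S) → ¬ (v₀ ∈ S ∧ v₁ ∈ S ∧ v₂ ∈ S) →
      X = (S \ {v₁}) \ {v₂} → ConnOn (VGraph.contract I.graph v₁ v₂ v₃).Adj X := by
    rintro X h03S hA hB hC rfl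
    rw [← IsThinPath.connOn_contract_iff h (by simp) (by simp)]
    have step1 : ConnOn I.graph.Adj (S \ {v₁}) := by
      by_cases h1 : v₁ ∈ S
      · by_cases h2 : v₂ ∈ S
        · refine hc.diff_singleton (graph_symm _) h2 h12.symm fun z hz hz' => ?_
          rcases (IsThinPath.adj_v₁ h z).1 hz' with rfl | rfl
          · exact absurd ⟨hz, h1, h2⟩ hC
          · rfl
        · have h0 : v₀ ∈ S := h03S.elim id fun h3 => hA h3 h1 h2
          refine hc.diff_singleton (graph_symm _) h0 h01 fun z hz hz' => ?_
          rcases (IsThinPath.adj_v₁ h z).1 hz' with rfl | rfl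
          · rfl
          · exact absurd hz h2
      · rwa [Set.sdiff_singleton_eq_self h1]
    by_cases h2 : v₂ ∈ S
    · have h3 : v₃ ∈ S := h03S.elim (fun h0 => hB h0 h2 fun h1 => hC ⟨h0, h1, h2⟩) id
      refine step1.diff_singleton (graph_symm _) ⟨h3, h13.symm⟩ h23.symm fun z hz hz' => ?_
      rcases (IsThinPath.adj_v₂ h z).1 hz' with rfl | rfl
      · exact absurd rfl hz.2
      · rfl
    · rwa [Set.sdiff_singleton_eq_self fun h' => h2 h'.1]
  -- Equal ends: with `v₁` on the other side both edges of the shortened path are cut, which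
  -- realizes [k ≥ 2] + [k ≥ 1].
  have hfin1 : ∀ X : Set V, (∀ x, x ≠ v₁ → x ≠ v₂ → (x ∈ X ↔ x ∈ S)) → (v₀ ∈ S ↔ v₃ ∈ S) →
      ¬ (v₁ ∈ X ↔ v₃ ∈ S) → arcs (OneOff I v₁ v₂) S Sᶜ + ind (p ∧ ¬ (v₀ ∈ S ↔ v₁ ∈ S)) +
        ind (q ∧ ¬ (v₁ ∈ S ↔ v₂ ∈ S)) + ind (r ∧ ¬ (v₂ ∈ S ↔ v₃ ∈ S)) ≤
          (I.contract v₀ v₁ v₂ v₃).cutW X := by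
    intro X hX h1 h2
    have h3 := ind_path_le_of_iff (p := p) (q := q) (r := r) (a₁ := v₁ ∈ S) (a₂ := v₂ ∈ S) h1
    rw [hcut, arcs_oneOff_congr hX, hX v₀ h01 h02, hX v₃ h13.symm h23.symm,
      and_iff_left (show ¬ (v₀ ∈ S ↔ v₁ ∈ X) by tauto), and_iff_left h2]
    omega
  -- Different ends: it suffices to cut the heavier edge `v₁v₃`, so `v₁` goes to the side of `v₀`.
  have hfin2 : ∀ X : Set V, (∀ x, x ≠ v₁ → x ≠ v₂ → (x ∈ X ↔ x ∈ S)) → ¬ (v₀ ∈ S ↔ v₃ ∈ S) →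
      ((v₀ ∈ S ↔ v₁ ∈ S) ∨ (v₂ ∈ S ↔ v₃ ∈ S)) → ¬ (v₁ ∈ X ↔ v₃ ∈ S) →
      arcs (OneOff I v₁ v₂) S Sᶜ + ind (p ∧ ¬ (v₀ ∈ S ↔ v₁ ∈ S)) +
        ind (q ∧ ¬ (v₁ ∈ S ↔ v₂ ∈ S)) + ind (r ∧ ¬ (v₂ ∈ S ↔ v₃ ∈ S)) ≤
          (I.contract v₀ v₁ v₂ v₃).cutW X := by
    intro X hX h1 h1' h2
    have h3 := ind_path_le (p := p) (q := q) (r := r) (a₁ := v₁ ∈ S) (a₂ := v₂ ∈ S) h1 h1'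
    rw [hcut, arcs_oneOff_congr hX, hX v₃ h13.symm h23.symm, and_iff_left h2]
    omega
  have hsub2 : (S \ {v₁}) \ {v₂} ⊆ (VGraph.contract I.graph v₁ v₂ v₃).verts :=
    hsub _ (fun x hx _ => hx.1.1) (by simp)
  by_cases m0 : v₀ ∈ S <;> by_cases m3 : v₃ ∈ S
  -- If the whole path lies in `S`, none of its edges is cut and `v₂` is just removed. Otherwise
  -- both inner vertices can be left out without disconnecting the rest.
  · by_cases m12 : v₁ ∈ S ∧ v₂ ∈ S
    · refine ⟨S \ {v₂}, hsub _ (fun x hx _ => hx.1) (by simp),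
        IsThinPath.connOn_contract_diff h hc m12.1, ?_⟩
      simp [m0, m3, m12.1, m12.2, ind, hcut, h12, h02, h23.symm,
        arcs_oneOff_congr (I := I) (v₁ := v₁) (v₂ := v₂) (S := S \ {v₂}) (S' := S)
          (fun x h1 h2 => by simp [h2])]
    · refine ⟨_, hsub2, hrem _ (.inl m0) (fun _ _ _ => m0) (fun _ _ _ => m3) (by tauto) rfl, ?_⟩
      exact hfin1 _ (fun x h1 h2 => by simp [h1, h2]) (by tauto) (by simp [m3])
  · -- `v₀ ∈ S`, `v₃ ∉ S`
    have m21 : v₂ ∈ S → v₁ ∈ S := by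
      intro m2
      obtain ⟨z, hz, hz'⟩ := hc.exists_adj m2 m0 h02.symm
      rcases (IsThinPath.adj_v₂ h z).1 hz' with rfl | rfl
      · exact hz
      · exact absurd hz m3
    have hcX : ConnOn I.graph.Adj ((S ∪ {v₁}) \ {v₂}) := by
      by_cases m1 : v₁ ∈ S
      · rw [Set.union_eq_self_of_subset_right (by simpa using m1)]
        refine hc.diff_singleton (graph_symm _) m1 h12 fun z hz hz' => ?_
        rcases (IsThinPath.adj_v₂ h z).1 hz' with rfl | rfl
        · rfl
        · exact absurd hz m3
      · rw [Set.sdiff_singleton_eq_self]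
        · exact hc.union_singleton (graph_symm _) m0 h.adj₀₁.symm
        · simp only [Set.mem_union, Set.mem_singleton_iff, h12.symm, or_false]
          tauto
    refine ⟨(S ∪ {v₁}) \ {v₂}, hsub _ (fun x hx hx1 => ?_) (by simp),
      (IsThinPath.connOn_contract_iff h (by simp) (by simp [m3, h13.symm])).1 hcX, ?_⟩
    · exact hx.1.resolve_right hx1
    · exact hfin2 _ (fun x h1 h2 => by simp [h1, h2]) (by tauto) (by tauto) (by simp [m3, h12])
  · -- `v₃ ∈ S`, `v₀ ∉ S`
    have m12 : v₁ ∈ S → v₂ ∈ S := by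
      intro m1
      obtain ⟨z, hz, hz'⟩ := hc.exists_adj m1 m3 h13
      rcases (IsThinPath.adj_v₁ h z).1 hz' with rfl | rfl
      · exact absurd hz m0
      · exact hz
    refine ⟨_, hsub2, hrem _ (.inr m3) (by tauto) (by tauto) (by tauto) rfl, ?_⟩
    exact hfin2 _ (fun x h1 h2 => by simp [h1, h2]) (by tauto) (by tauto) (by simp [m3])
  · by_cases m12 : v₁ ∈ S ∨ v₂ ∈ S
    -- With both ends outside, a connected set that meets the interior of the path cannot leave it;
    -- the single vertex `v₁` then does at least as well.
    · have hsub12 : S ⊆ {v₁, v₂} := by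
        obtain ⟨x, hx, hx'⟩ : ∃ x ∈ S, x ∈ ({v₁, v₂} : Set V) := by
          rcases m12 with h' | h'
          · exact ⟨v₁, h', by simp⟩
          · exact ⟨v₂, h', by simp⟩
        refine hc.subset_of_closed hx hx' ?_
        rintro a (rfl | rfl) b hb hab
        · rcases (IsThinPath.adj_v₁ h b).1 hab with rfl | rfl
          · exact absurd hb m0
          · simp
        · rcases (IsThinPath.adj_v₂ h b).1 hab with rfl | rfl
          · simp
          · exact absurd hb m3
      refine ⟨{v₁}, Set.singleton_subset_iff.2 hv1, connOn_singleton _ _, ?_⟩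
      refine hfin1 _ (fun x h1 h2 => ?_) (by tauto) (by simp [m3])
      simp only [Set.mem_singleton_iff, h1, false_iff]
      intro hx
      rcases hsub12 hx with h' | h'
      · exact h1 h'
      · exact h2 h'
    · refine ⟨S, hsub _ (fun x hx _ => hx) (by tauto),
        (IsThinPath.connOn_contract_iff h (by tauto) (by tauto)).1 hc, ?_⟩
      have m1 : v₁ ∉ S := fun h' => m12 (.inl h')
      have m2 : v₂ ∉ S := fun h' => m12 (.inr h')
      simp [hcut, m0, m1, m2, m3, ind]

end ContractSolutions

/-! ### Carrying solutions back over a shortening -/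

section CarryBack

variable {V : Type*} [Fintype V] {I : CMCInstance V} {v₀ v₁ v₂ v₃ : V}

theorem connOn_expandCandidates (h : VGraph.IsThinPath I.graph v₀ v₁ v₂ v₃) {S' X : Set V}
    (hS : S' ⊆ (VGraph.contract I.graph v₁ v₂ v₃).verts)
    (hc : ConnOn (VGraph.contract I.graph v₁ v₂ v₃).Adj S')
    (hX : X ∈ expandCandidates v₀ v₁ v₂ v₃ S') :
    X ⊆ I.graph.verts ∧ ConnOn I.graph.Adj X := by
  have h01 := h.adj₀₁.ne
  have h12 := h.adj₁₂.ne
  have h23 := h.adj₂₃.ne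
  have h02 := h.ne₀₂
  have h03 := h.ne₀₃
  have h13 := h.ne₁₃
  have hv1 : v₁ ∈ I.graph.verts := h.adj₁₂.fst_mem
  have hv2 : v₂ ∈ I.graph.verts := h.adj₁₂.snd_mem
  have m2 : v₂ ∉ S' := fun h' => (hS h').2 rfl
  have hS0 : S' ⊆ I.graph.verts := fun x hx => (hS hx).1
  have hS1 : S' \ {v₁} ⊆ I.graph.verts := fun x hx => (hS hx.1).1
  have u1 : ({v₁} : Set V) ⊆ I.graph.verts := Set.singleton_subset_iff.2 hv1
  have u2 : ({v₂} : Set V) ⊆ I.graph.verts := Set.singleton_subset_iff.2 hv2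
  have hpair : ConnOn I.graph.Adj {v₁, v₂} := by
    have := (connOn_singleton I.graph.Adj v₁).union_singleton (graph_symm _) (x := v₂) rfl
      h.adj₁₂.symm
    rw [Set.union_comm, Set.union_singleton] at this
    exact this
  have hun : ∀ Y : Set V, Y ∪ {v₁, v₂} = Y ∪ {v₁} ∪ {v₂} := fun Y => by
    rw [Set.union_assoc]; rfl
  have u12 : ({v₁, v₂} : Set V) ⊆ I.graph.verts := by
    rintro x (rfl | rfl)
    · exact hv1
    · exact hv2
  have hun' : ∀ Y : Set V, Y ∪ {v₁, v₂} = Y ∪ {v₂} ∪ {v₁} := fun Y => by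
    rw [Set.union_assoc, Set.pair_comm]; rfl
  unfold expandCandidates at hX
  split_ifs at hX with h1 h2 h3 h4 h5
  · rw [Set.mem_singleton_iff] at hX
    subst hX
    exact ⟨Set.union_subset hS0 u2, IsThinPath.connOn_union_of_contract h hc h2⟩
  · have hc' : ConnOn I.graph.Adj S' :=
      (IsThinPath.connOn_contract_iff h m2 fun h' => h2 h'.1).2 hc
    rcases hX with rfl | rfl | rfl
    · exact ⟨hS0, hc'⟩
    · exact ⟨Set.union_subset hS0 u1, hc'.union_singleton (graph_symm _) h1.1 h.adj₀₁.symm⟩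
    · exact ⟨Set.union_subset hS0 u2, hc'.union_singleton (graph_symm _) h1.2 h.adj₂₃⟩
  · have m3 : v₃ ∉ S' := fun h' => h1 ⟨h3, h'⟩
    have hc' : ConnOn I.graph.Adj (S' \ {v₁}) := by
      refine (IsThinPath.connOn_contract_iff h (fun h' => m2 h'.1) fun h' => h'.1.2 rfl).2 ?_
      refine hc.diff_singleton (graph_symm _) h3 h01 fun z hz hz' => ?_
      rcases (IsThinPath.contract_v₁ h z).1 hz' with rfl | rfl
      · rfl
      · exact absurd hz m3
    have hc1 : ConnOn I.graph.Adj (S' \ {v₁} ∪ {v₁}) :=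
      hc'.union_singleton (graph_symm _) ⟨h3, h01⟩ h.adj₀₁.symm
    rcases hX with rfl | rfl | rfl
    · exact ⟨hS1, hc'⟩
    · exact ⟨Set.union_subset hS1 u1, hc1⟩
    · refine ⟨Set.union_subset hS1 u12, ?_⟩
      rw [hun]
      exact hc1.union_singleton (graph_symm _) (.inr rfl) h.adj₁₂.symm
  · have hc' : ConnOn I.graph.Adj (S' \ {v₁}) := by
      refine (IsThinPath.connOn_contract_iff h (fun h' => m2 h'.1) fun h' => h'.1.2 rfl).2 ?_
      refine hc.diff_singleton (graph_symm _) h4 h13.symm fun z hz hz' => ?_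
      rcases (IsThinPath.contract_v₁ h z).1 hz' with rfl | rfl
      · exact absurd hz h3
      · rfl
    have hc1 : ConnOn I.graph.Adj (S' \ {v₁} ∪ {v₂}) :=
      hc'.union_singleton (graph_symm _) ⟨h4, h13.symm⟩ h.adj₂₃
    rcases hX with rfl | rfl | rfl
    · exact ⟨hS1, hc'⟩
    · exact ⟨Set.union_subset hS1 u2, hc1⟩
    · refine ⟨Set.union_subset hS1 u12, ?_⟩
      rw [hun']
      exact hc1.union_singleton (graph_symm _) (.inr rfl) h.adj₁₂
  · rcases hX with rfl | rfl | rfl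
    · exact ⟨u1, connOn_singleton _ _⟩
    · exact ⟨u2, connOn_singleton _ _⟩
    · exact ⟨u12, hpair⟩
  · rw [Set.mem_singleton_iff] at hX
    subst hX
    exact ⟨hS0, (IsThinPath.connOn_contract_iff h m2 fun h' => h5 h'.1).2 hc⟩

/-- For equal ends the three candidates cut the three pairs of path edges; the best pair contains
min(k, 2) 1-edges. -/
theorem ind_add_ind_le_of_pairs {p q r : Prop} {m : ℕ} (h1 : ind p + ind q ≤ m)
    (h2 : ind p + ind r ≤ m) (h3 : ind q + ind r ≤ m) :
    ind (p ∧ q ∨ p ∧ r ∨ q ∧ r) + ind (p ∨ q ∨ r) ≤ m := by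
  by_cases p <;> by_cases q <;> by_cases r <;> simp_all [ind]

/-- For different ends each of the three candidates cuts exactly one path edge, and the three edges
all occur. -/
theorem ind_or_le {p q r : Prop} {m : ℕ} (h1 : ind p ≤ m) (h2 : ind q ≤ m) (h3 : ind r ≤ m) :
    ind (p ∨ q ∨ r) ≤ m := by
  by_cases p <;> by_cases q <;> by_cases r <;> simp_all [ind]

theorem ind_maj_le (p q r : Prop) : ind (p ∧ q ∨ p ∧ r ∨ q ∧ r) ≤ ind (p ∨ q ∨ r) := by
  by_cases p <;> by_cases q <;> by_cases r <;> simp_all [ind]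

/-- The cut edges outside the path are the same for all candidates. What remains is to compare the
candidates with [k ≥ 2] + [k ≥ 1], with at most [k ≥ 1], or with zero, according to the position of
`v₀`, `v₁` and `v₃`. -/
theorem cutW_le_of_expandCandidates (h : VGraph.IsThinPath I.graph v₀ v₁ v₂ v₃) {S' S : Set V}
    (hS : S' ⊆ (VGraph.contract I.graph v₁ v₂ v₃).verts)
    (hc : ConnOn (VGraph.contract I.graph v₁ v₂ v₃).Adj S')
    (hbest : ∀ X ∈ expandCandidates v₀ v₁ v₂ v₃ S', I.cutW X ≤ I.cutW S) :
    (I.contract v₀ v₁ v₂ v₃).cutW S' ≤ I.cutW S := by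
  have h01 := h.adj₀₁.ne
  have h12 := h.adj₁₂.ne
  have h23 := h.adj₂₃.ne
  have h02 := h.ne₀₂
  have h03 := h.ne₀₃
  have h13 := h.ne₁₃
  have m2 : v₂ ∉ S' := fun h' => (hS h').2 rfl
  obtain ⟨p, hp⟩ : ∃ p : Prop, I.weight s(v₀, v₁) = 1 ↔ p := ⟨_, Iff.rfl⟩
  obtain ⟨q, hq⟩ : ∃ q : Prop, I.weight s(v₁, v₂) = 1 ↔ q := ⟨_, Iff.rfl⟩
  obtain ⟨r, hr⟩ : ∃ r : Prop, I.weight s(v₂, v₃) = 1 ↔ r := ⟨_, Iff.rfl⟩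
  have hcut := cutW_contract h hp hq hr S'
  have hI : ∀ X, X ∈ expandCandidates v₀ v₁ v₂ v₃ S' →
      (∀ x, x ≠ v₁ → x ≠ v₂ → (x ∈ X ↔ x ∈ S')) → arcs (OneOff I v₁ v₂) S' S'ᶜ +
        (ind (p ∧ ¬ (v₀ ∈ S' ↔ v₁ ∈ X)) + ind (q ∧ ¬ (v₁ ∈ X ↔ v₂ ∈ X)) +
        ind (r ∧ ¬ (v₂ ∈ X ↔ v₃ ∈ S'))) ≤ I.cutW S := by
    intro X hX hX'
    have := hbest X hX
    rw [cutW_of_thinPath h, arcs_oneOff_congr hX', hp, hq, hr, hX' v₀ h01 h02,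
      hX' v₃ h13.symm h23.symm] at this
    omega
  unfold expandCandidates at hI
  split_ifs at hI with h1 h2 h3 h4 h5
  · have := hI _ rfl (fun x h1 h2 => by simp [h2])
    simp only [h1.1, h1.2, h2, iff_self, not_true, and_false] at hcut
    rw [hcut, ind_of_not not_false]
    omega
  · have e1 := hI S' (by simp) (fun x h1 h2 => by simp)
    have e2 := hI (S' ∪ {v₁}) (by simp) (fun x h1 h2 => by simp [h1])
    have e3 := hI (S' ∪ {v₂}) (by simp) (fun x h1 h2 => by simp [h2])
    simp only [h1.1, h1.2, h2, m2, Set.mem_union, Set.mem_singleton_iff, h12, h12.symm, iff_true,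
      iff_false, not_true, not_false_iff, and_true, and_false, or_false, or_true, true_iff,
      ind_of_not not_false] at e1 e2 e3 hcut
    rw [hcut, add_assoc]
    have := ind_add_ind_le_of_pairs (p := p) (q := q) (r := r)
      (m := I.cutW S - arcs (OneOff I v₁ v₂) S' S'ᶜ) (by omega) (by omega) (by omega)
    omega
  · have m3 : v₃ ∉ S' := fun h' => h1 ⟨h3, h'⟩
    have e1 := hI (S' \ {v₁}) (by simp) (fun x h1 h2 => by simp [h1])
    have e2 := hI (S' \ {v₁} ∪ {v₁}) (by simp) (fun x h1 h2 => by simp [h1])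
    have e3 := hI (S' \ {v₁} ∪ {v₁, v₂}) (by simp) (fun x h1 h2 => by simp [h1, h2])
    simp only [h3, m3, m2, Set.mem_union, Set.mem_sdiff, Set.mem_insert_iff,
      Set.mem_singleton_iff, h12, h12.symm, iff_true, true_or,
      iff_false, not_true, not_false_iff, and_true, and_false, or_false, or_true, true_iff,
      ind_of_not not_false] at e1 e2 e3 hcut
    have := ind_or_le (p := p) (q := q) (r := r)
      (m := I.cutW S - arcs (OneOff I v₁ v₂) S' S'ᶜ) (by omega) (by omega) (by omega)
    have := ind_maj_le p q r
    rw [hcut]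
    by_cases m1 : v₁ ∈ S'
    · simp only [m1, not_true, not_false_iff, and_false, and_true, ind_of_not not_false]
      omega
    · simp only [m1, not_false_iff, not_true, and_false, and_true, ind_of_not not_false]
      omega
  · have e1 := hI (S' \ {v₁}) (by simp) (fun x h1 h2 => by simp [h1])
    have e2 := hI (S' \ {v₁} ∪ {v₂}) (by simp) (fun x h1 h2 => by simp [h1, h2])
    have e3 := hI (S' \ {v₁} ∪ {v₁, v₂}) (by simp) (fun x h1 h2 => by simp [h1, h2])
    simp only [h3, h4, m2, Set.mem_union, Set.mem_sdiff, Set.mem_insert_iff,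
      Set.mem_singleton_iff, h12, h12.symm, iff_true, true_or,
      iff_false, not_true, not_false_iff, and_true, and_false, or_false, or_true, true_iff,
      false_iff, not_not, ind_of_not not_false] at e1 e2 e3 hcut
    have := ind_or_le (p := p) (q := q) (r := r)
      (m := I.cutW S - arcs (OneOff I v₁ v₂) S' S'ᶜ) (by omega) (by omega) (by omega)
    have := ind_maj_le p q r
    rw [hcut]
    by_cases m1 : v₁ ∈ S'
    · simp only [m1, not_true, not_false_iff, and_false, and_true, ind_of_not not_false]
      omega
    · simp only [m1, not_false_iff, not_true, and_false, and_true, ind_of_not not_false]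
      omega
  -- Both neighbours of `v₁` lie outside, so the connected set `S'` is just `{v₁}`. This is why the
  -- candidates need not mention the rest of `S'`.
  · have hsub : S' ⊆ {v₁} := by
      refine hc.subset_of_closed h5 rfl ?_
      rintro a rfl b hb hab
      rcases (IsThinPath.contract_v₁ h b).1 hab with rfl | rfl
      · exact absurd hb h3
      · exact absurd hb h4
    have hoff : ∀ x, x ≠ v₁ → x ∉ S' := fun x hx hx' => hx (hsub hx')
    have e1 := hI {v₁} (by simp) (fun x h1 h2 => by simp [h1, hoff])
    have e2 := hI {v₂} (by simp) (fun x h1 h2 => by simp [h1, h2, hoff])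
    have e3 := hI {v₁, v₂} (by simp) (fun x h1 h2 => by simp [h1, h2, hoff])
    simp only [h3, h4, h5, Set.mem_insert_iff, Set.mem_singleton_iff, h12, h12.symm, iff_true,
      true_or, iff_false, not_true, not_false_iff, and_true, and_false, or_false, or_true, true_iff,
      false_iff, not_not, ind_of_not not_false] at e1 e2 e3 hcut
    rw [hcut, add_assoc]
    have := ind_add_ind_le_of_pairs (p := p) (q := q) (r := r)
      (m := I.cutW S - arcs (OneOff I v₁ v₂) S' S'ᶜ) (by omega) (by omega) (by omega)
    omega
  · have := hI _ rfl (fun x h1 h2 => Iff.rfl)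
    simp only [h3, h4, h5, iff_self, not_true, and_false] at hcut
    rw [hcut, ind_of_not not_false]
    omega

end CarryBack

/-! ### Undoing the shortening of paths on subtrees -/

section Expand

variable {V : Type*} [Fintype V] {G T : VGraph V} {v₀ v₁ v₂ v₃ : V}

theorem expand_of_not_adj (h : ¬ T.Adj v₁ v₃) : VGraph.expand v₁ v₂ v₃ T = T := if_neg h

theorem expand_adj (h : T.Adj v₁ v₃) (a b : V) : (VGraph.expand v₁ v₂ v₃ T).Adj a b ↔ a ≠ b ∧
    ((T.Adj a b ∧ s(a, b) ≠ s(v₁, v₃)) ∨ s(a, b) = s(v₁, v₂) ∨ s(a, b) = s(v₂, v₃)) := by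
  rw [VGraph.expand, if_pos h]

theorem expand_verts (h : T.Adj v₁ v₃) : (VGraph.expand v₁ v₂ v₃ T).verts = T.verts ∪ {v₂} := by
  rw [VGraph.expand, if_pos h]
  ext x
  have h1 := h.fst_mem
  have h3 := h.snd_mem
  simp only [Set.mem_union, Set.mem_insert_iff, Set.mem_singleton_iff]
  constructor
  · rintro (hx | rfl | rfl | rfl) <;> tauto
  · tauto

theorem expand_le (hP : VGraph.IsThinPath G v₀ v₁ v₂ v₃) (hT : T ≤ VGraph.contract G v₁ v₂ v₃) :
    VGraph.expand v₁ v₂ v₃ T ≤ G := by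
  have key : ∀ a b, T.Adj a b → s(a, b) ≠ s(v₁, v₃) → G.Adj a b := by
    intro a b hab hne
    exact ((IsThinPath.contract_iff hP).1 (hT.2 hab)).elim (fun h => h.2.2) fun h => absurd h hne
  by_cases h : T.Adj v₁ v₃
  · refine ⟨?_, fun a b hab => ?_⟩
    · rw [expand_verts h]
      refine Set.union_subset (fun x hx => (hT.1 hx).1) ?_
      exact Set.singleton_subset_iff.2 hP.adj₁₂.snd_mem
    · obtain ⟨-, ⟨h1, h2⟩ | h1 | h1⟩ := (expand_adj h a b).1 hab
      · exact key a b h1 h2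
      · rcases Sym2.eq_iff.1 h1 with ⟨rfl, rfl⟩ | ⟨rfl, rfl⟩
        · exact hP.adj₁₂
        · exact hP.adj₁₂.symm
      · rcases Sym2.eq_iff.1 h1 with ⟨rfl, rfl⟩ | ⟨rfl, rfl⟩
        · exact hP.adj₂₃
        · exact hP.adj₂₃.symm
  · rw [expand_of_not_adj h]
    refine ⟨fun x hx => (hT.1 hx).1, fun a b hab => key a b hab fun he => h ?_⟩
    rcases Sym2.eq_iff.1 he with ⟨rfl, rfl⟩ | ⟨rfl, rfl⟩
    · exact hab
    · exact hab.symm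

/-- Subdividing the edge `v₁v₃` replaces one neighbour by `v₂` at each of its two ends and changes
nothing elsewhere, so the neighbourhoods correspond bijectively. -/
theorem expand_deg (h : T.Adj v₁ v₃) (h2 : v₂ ∉ T.verts) {x : V} (hx : x ≠ v₂) :
    VGraph.deg (VGraph.expand v₁ v₂ v₃ T) x = VGraph.deg T x := by
  have h12 : v₁ ≠ v₂ := fun h' => h2 (h' ▸ h.fst_mem)
  have h32 : v₃ ≠ v₂ := fun h' => h2 (h' ▸ h.snd_mem)
  have himg : (VGraph.expand v₁ v₂ v₃ T).neighborSet x =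
      (fun b => if s(x, b) = s(v₁, v₃) then v₂ else b) '' T.neighborSet x := by
    ext b
    simp only [SimpleGraph.Subgraph.mem_neighborSet, expand_adj h, Set.mem_image]
    constructor
    · rintro ⟨hne, ⟨hb, hb'⟩ | hb | hb⟩
      · exact ⟨b, hb, if_neg hb'⟩
      · rcases Sym2.eq_iff.1 hb with ⟨rfl, rfl⟩ | ⟨rfl, rfl⟩
        · exact ⟨v₃, h, if_pos rfl⟩
        · exact absurd rfl hx
      · rcases Sym2.eq_iff.1 hb with ⟨rfl, rfl⟩ | ⟨rfl, rfl⟩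
        · exact absurd rfl hx
        · exact ⟨v₁, h.symm, if_pos Sym2.eq_swap⟩
    · rintro ⟨c, hc, hcb⟩
      by_cases hs : s(x, c) = s(v₁, v₃)
      · rw [if_pos hs] at hcb
        subst hcb
        rcases Sym2.eq_iff.1 hs with ⟨rfl, rfl⟩ | ⟨rfl, rfl⟩
        · exact ⟨hx, .inr (.inl rfl)⟩
        · exact ⟨hx, .inr (.inr Sym2.eq_swap)⟩
      · rw [if_neg hs] at hcb
        subst hcb
        exact ⟨hc.ne, .inl ⟨hc, hs⟩⟩
  rw [VGraph.deg, VGraph.deg, himg, Set.InjOn.ncard_image]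
  intro a ha b hb hab
  have ha2 : a ≠ v₂ := fun h' => h2 (h' ▸ SimpleGraph.Subgraph.Adj.snd_mem ha)
  have hb2 : b ≠ v₂ := fun h' => h2 (h' ▸ SimpleGraph.Subgraph.Adj.snd_mem hb)
  by_cases h1 : s(x, a) = s(v₁, v₃) <;> by_cases h3 : s(x, b) = s(v₁, v₃)
  · exact Sym2.congr_right.1 (h1.trans h3.symm)
  · simp only [h1, h3, if_true, if_false] at hab
    exact absurd hab.symm hb2
  · simp only [h1, h3, if_true, if_false] at hab
    exact absurd hab ha2
  · simpa only [h1, h3, if_false] using hab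

theorem expand_deg_v₂ (h : T.Adj v₁ v₃) (h2 : v₂ ∉ T.verts) :
    VGraph.deg (VGraph.expand v₁ v₂ v₃ T) v₂ = 2 := by
  have h12 : v₁ ≠ v₂ := fun h' => h2 (h' ▸ h.fst_mem)
  have h32 : v₃ ≠ v₂ := fun h' => h2 (h' ▸ h.snd_mem)
  rw [VGraph.deg, ← Set.ncard_pair h.ne]
  congr 1
  ext b
  simp only [SimpleGraph.Subgraph.mem_neighborSet, expand_adj h, Set.mem_insert_iff,
    Set.mem_singleton_iff, Sym2.eq_iff]
  constructor
  · rintro ⟨-, ⟨hb, -⟩ | hb | hb⟩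
    · exact absurd hb.fst_mem h2
    · tauto
    · tauto
  · rintro (rfl | rfl)
    · exact ⟨h12.symm, by tauto⟩
    · exact ⟨h32.symm, by tauto⟩

/-- The subdividing vertex has degree two, and all other degrees are kept. Hence the leaf weight of
a tree found in a late round can be measured in the initial graph. -/
theorem expand_leaves (h2 : v₂ ∉ T.verts) :
    VGraph.leaves (VGraph.expand v₁ v₂ v₃ T) = VGraph.leaves T := by
  by_cases h : T.Adj v₁ v₃
  · ext x
    by_cases hx : x = v₂
    · subst hx
      simp only [VGraph.leaves, Set.mem_ofPred_eq, expand_deg_v₂ h h2, h2, false_and, iff_false]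
      rintro ⟨-, h⟩
      omega
    · simp only [VGraph.leaves, Set.mem_ofPred_eq, expand_deg h h2 hx, expand_verts h,
        Set.mem_union, Set.mem_singleton_iff, hx, or_false]
  · rw [expand_of_not_adj h]

theorem expand_isTree (h2 : v₂ ∉ T.verts) (hT : T.coe.IsTree) :
    (VGraph.expand v₁ v₂ v₃ T).coe.IsTree := by
  by_cases h : T.Adj v₁ v₃
  · rw [isTree_iff] at hT ⊢
    have h12 : v₁ ≠ v₂ := fun h' => h2 (h' ▸ h.fst_mem)
    have h32 : v₃ ≠ v₂ := fun h' => h2 (h' ▸ h.snd_mem)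
    refine ⟨?_, ?_⟩
    · rw [expand_verts h]
      have m1 : v₁ ∈ T.verts ∪ {v₂} := .inl h.fst_mem
      have m3 : v₃ ∈ T.verts ∪ {v₂} := .inl h.snd_mem
      have m2 : v₂ ∈ T.verts ∪ {v₂} := .inr rfl
      have e12 : (VGraph.expand v₁ v₂ v₃ T).Adj v₁ v₂ :=
        (expand_adj h _ _).2 ⟨h12, .inr (.inl rfl)⟩
      have e23 : (VGraph.expand v₁ v₂ v₃ T).Adj v₂ v₃ :=
        (expand_adj h _ _).2 ⟨h32.symm, .inr (.inr rfl)⟩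
      refine hT.1.transfer id (graph_symm _) (fun a ha => .inl ha) (fun a ha b hb hab => ?_)
        fun a ha => ?_
      · by_cases hs : s(a, b) = s(v₁, v₃)
        · rcases Sym2.eq_iff.1 hs with ⟨rfl, rfl⟩ | ⟨rfl, rfl⟩
          · exact .head ⟨m1, m2, e12⟩ (.single ⟨m2, m3, e23⟩)
          · exact .head ⟨m3, m2, e23.symm⟩ (.single ⟨m2, m1, e12.symm⟩)
        · exact .single ⟨.inl ha, .inl hb, (expand_adj h _ _).2 ⟨hab.ne, .inl ⟨hab, hs⟩⟩⟩
      · rcases ha with ha | rfl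
        · exact ⟨a, ha, .refl⟩
        · exact ⟨v₁, h.fst_mem, .single ⟨m2, m1, e12.symm⟩⟩
    · have hsum : ∑ v, VGraph.deg (VGraph.expand v₁ v₂ v₃ T) v = ∑ v, VGraph.deg T v + 2 := by
        rw [← Finset.add_sum_erase _ _ (Finset.mem_univ v₂),
          ← Finset.add_sum_erase _ (VGraph.deg T) (Finset.mem_univ v₂), expand_deg_v₂ h h2,
          deg_eq_zero_of_notMem T h2, Finset.sum_congr rfl fun x hx =>
            expand_deg h h2 (Finset.ne_of_mem_erase hx)]
        omega
      have hn : (VGraph.expand v₁ v₂ v₃ T).verts.ncard = T.verts.ncard + 1 := by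
        rw [expand_verts h, Set.union_singleton, Set.ncard_insert_of_notMem h2]
      rw [hsum, hn]
      omega
  · rwa [expand_of_not_adj h]

theorem notMem_of_le_contract (hT : T ≤ VGraph.contract G v₁ v₂ v₃) : v₂ ∉ T.verts :=
  fun h => (hT.1 h).2 rfl

end Expand

/-! ### The trees found by the main loop -/

section Peel

variable {V : Type*} [Fintype V] {G H T : VGraph V} {f : VGraph V → VGraph V}

theorem ShrinksTo.le (h : ShrinksTo G H f) (hT : T ≤ H) : f T ≤ G := by
  induction h with
  | done => exact hT
  | step G H f v₀ v₁ v₂ v₃ hP _ ih => exact expand_le hP (ih hT)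

theorem ShrinksTo.leaves (h : ShrinksTo G H f) (hT : T ≤ H) :
    VGraph.leaves (f T) = VGraph.leaves T := by
  induction h with
  | done => rfl
  | step G H f v₀ v₁ v₂ v₃ hP h ih =>
    exact (expand_leaves (notMem_of_le_contract (ShrinksTo.le h hT))).trans (ih hT)

theorem ShrinksTo.isTree (h : ShrinksTo G H f) (hT : T ≤ H) (hT' : T.coe.IsTree) :
    (f T).coe.IsTree := by
  induction h with
  | done => exact hT'
  | step G H f v₀ v₁ v₂ v₃ hP h ih =>
    exact expand_isTree (notMem_of_le_contract (ShrinksTo.le h hT)) (ih hT)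

theorem ShrinksTo.verts_subset (h : ShrinksTo G H f) : H.verts ⊆ G.verts := by
  induction h with
  | done => exact subset_rfl
  | step G H f v₀ v₁ v₂ v₃ hP h ih => exact ih.trans Set.sdiff_subset

theorem Peel.isTree {ts : List (VGraph V)} (h : Peel G ts) :
    ∀ T ∈ ts, T ≤ G ∧ T.coe.IsTree := by
  induction h with
  | nil => simp
  | cons G T H f ts hne hT hH _ ih =>
    intro T' hT'
    rcases List.mem_cons.1 hT' with rfl | hT'
    · exact ⟨hT.1, hT.2.2.1⟩
    · obtain ⟨T'', hT'', rfl⟩ := List.mem_map.1 hT'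
      obtain ⟨h1, h2⟩ := ih T'' hT''
      exact ⟨(ShrinksTo.le hH h1).trans SimpleGraph.Subgraph.deleteVerts_le,
        ShrinksTo.isTree hH h1 h2⟩

/-- Every round deletes at least a fourteenth of the vertices, and the graph of the last round still
has a vertex; hence the exponent is the number of rounds minus one. The powers are kept on both
sides to stay in ℕ. -/
theorem Peel.length_bound {ts : List (VGraph V)} (h : Peel G ts) (hne : ts ≠ []) :
    14 ^ (ts.length - 1) ≤ G.verts.ncard * 13 ^ (ts.length - 1) := by
  induction h with
  | nil => exact absurd rfl hne
  | cons G T H f ts hG hT hH _ ih =>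
    simp only [List.length_cons, List.length_map, Nat.add_sub_cancel]
    have hpos : 0 < G.verts.ncard := (Set.ncard_pos (Set.toFinite _)).2 hG
    by_cases hts : ts = []
    · subst hts
      simp only [List.length_nil, pow_zero, mul_one]
      exact hpos
    · have h1 := ih hts
      have hl : ts.length = (ts.length - 1) + 1 :=
        (Nat.sub_add_cancel (List.length_pos_iff.2 hts)).symm
      have h2 : H.verts.ncard + (VGraph.leaves T).ncard ≤ G.verts.ncard := by
        have hL : VGraph.leaves T ⊆ G.verts := fun v hv => hT.1.1 hv.1
        have := Set.ncard_le_ncard (ShrinksTo.verts_subset hH) (Set.toFinite _)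
        rw [SimpleGraph.Subgraph.deleteVerts_verts, Set.ncard_sdiff hL] at this
        have := Set.ncard_le_ncard hL (Set.toFinite _)
        omega
      have h3 := hT.2.2.2
      rw [hl, pow_succ, pow_succ]
      have h4 : 14 * H.verts.ncard ≤ 13 * G.verts.ncard := by omega
      calc 14 ^ (ts.length - 1) * 14 ≤ H.verts.ncard * 13 ^ (ts.length - 1) * 14 :=
            Nat.mul_le_mul_right _ h1
        _ = (14 * H.verts.ncard) * 13 ^ (ts.length - 1) := by ring
        _ ≤ (13 * G.verts.ncard) * 13 ^ (ts.length - 1) := Nat.mul_le_mul_right _ h4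
        _ = G.verts.ncard * (13 ^ (ts.length - 1) * 13) := by ring

theorem arcs_deg_le {R : V → V → Prop} {v : V} {A : Set V} (hv : v ∈ A)
    (hR : ∀ a ∈ A, ∀ b ∈ A, R a b → G.Adj a b) : arcs R {v} A ≤ VGraph.deg G v := by
  rw [deg_eq_card, arcs, Finset.sum_eq_single_of_mem v (Finset.mem_univ v)]
  · rw [Finset.card_filter]
    refine Finset.sum_le_sum fun b _ => ?_
    by_cases h : v ∈ ({v} : Set V) ∧ b ∈ A ∧ R v b
    · simp [h.2.1, h.2.2, hR v hv b h.2.1 h.2.2]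
    · rw [if_neg h]; exact Nat.zero_le _
  · intro b _ hb
    simp [hb]

theorem arcs_diff_le {R : V → V → Prop} (hs : ∀ a b, R a b → R b a) {A L : Set V} (hL : L ⊆ A) :
    arcs R A A ≤ 2 * arcs R L A + arcs R (A \ L) (A \ L) := by
  have hd : Disjoint L (A \ L) := Set.disjoint_left.2 fun x hx hx' => hx'.2 hx
  have hA : L ∪ A \ L = A := Set.union_sdiff_cancel hL
  have h1 : arcs R A A = arcs R L A + arcs R (A \ L) A := by
    conv_lhs => arg 2; rw [← hA]
    exact arcs_union_left hd
  have h2 : arcs R (A \ L) A = arcs R (A \ L) L + arcs R (A \ L) (A \ L) := by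
    conv_lhs => arg 3; rw [← hA]
    exact arcs_union_right hd
  have h3 : arcs R (A \ L) L ≤ arcs R L A := by
    rw [arcs_comm hs]
    exact arcs_mono fun u v hu hv h => ⟨hu, hv.1, h⟩
  omega

/-- `R` is always the relation of the initial graph; edges that arise from shortening are not
counted. Each shortening deletes a vertex with at most two `R`-edges, that is at most four arcs, and
it is paid for by the loss of one vertex. -/
theorem ShrinksTo.arcs_le (h : ShrinksTo G H f) {R : V → V → Prop} (hs : ∀ a b, R a b → R b a)
    (hR : ∀ a ∈ G.verts, ∀ b ∈ G.verts, R a b → G.Adj a b) :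
    (∀ a ∈ H.verts, ∀ b ∈ H.verts, R a b → H.Adj a b) ∧
    arcs R G.verts G.verts + 4 * H.verts.ncard ≤ arcs R H.verts H.verts + 4 * G.verts.ncard := by
  induction h with
  | done => exact ⟨hR, le_rfl⟩
  | step G H f v₀ v₁ v₂ v₃ hP h ih =>
    have hv2 : v₂ ∈ G.verts := hP.adj₁₂.snd_mem
    have hverts : (VGraph.contract G v₁ v₂ v₃).verts = G.verts \ {v₂} := rfl
    obtain ⟨h1, h2⟩ := ih (fun a ha b hb hab => (IsThinPath.contract_iff hP).2
      (.inl ⟨ha.2, hb.2, hR a ha.1 b hb.1 hab⟩))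
    refine ⟨h1, ?_⟩
    have h3 := arcs_diff_le hs (A := G.verts) (L := {v₂}) (by simpa using hv2)
    have h4 := arcs_deg_le hv2 hR
    rw [hP.deg₂] at h4
    have h5 := Set.ncard_sdiff_singleton_add_one hv2 (Set.toFinite _)
    rw [hverts] at h2
    omega

/-- Arcs that disappear with the leaves of a round are charged to the leaf weight of its tree, all
others to vertices deleted by shortening. The vertex terms telescope over the rounds, so the error
is at most four arcs per vertex in total. -/
theorem Peel.arcs_le {ts : List (VGraph V)} (h : Peel G ts) {R : V → V → Prop}
    (hs : ∀ a b, R a b → R b a) (hR : ∀ a ∈ G.verts, ∀ b ∈ G.verts, R a b → G.Adj a b) :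
    arcs R G.verts G.verts ≤
      2 * (ts.map fun T => arcs R (VGraph.leaves T) Set.univ).sum + 4 * G.verts.ncard := by
  induction h with
  | nil G hG => simp [arcs, hG]
  | cons G T H f ts hG hT hH hts ih =>
    have hL : VGraph.leaves T ⊆ G.verts := fun v hv => hT.1.1 hv.1
    have hverts : (G.deleteVerts (VGraph.leaves T)).verts = G.verts \ VGraph.leaves T := rfl
    obtain ⟨h1, h2⟩ := ShrinksTo.arcs_le hH hs (fun a ha b hb hab => by
      rw [SimpleGraph.Subgraph.deleteVerts_adj]
      exact ⟨ha.1, ha.2, hb.1, hb.2, hR a ha.1 b hb.1 hab⟩)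
    have h3 := ih h1
    have h4 := arcs_diff_le hs hL
    have h5 : arcs R (VGraph.leaves T) G.verts ≤ arcs R (VGraph.leaves T) Set.univ :=
      arcs_mono fun u v hu _ h => ⟨hu, trivial, h⟩
    have h6 : (ts.map fun T => arcs R (VGraph.leaves (f T)) Set.univ) =
        ts.map fun T => arcs R (VGraph.leaves T) Set.univ := by
      refine List.map_congr_left fun T' hT' => ?_
      rw [ShrinksTo.leaves hH (Peel.isTree hts T' hT').1]
    have h7 : (G.verts \ VGraph.leaves T).ncard ≤ G.verts.ncard :=
      Set.ncard_le_ncard Set.sdiff_subset (Set.toFinite _)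
    rw [hverts] at h2
    simp only [List.map_cons, List.map_map, List.sum_cons, Function.comp_def, h6]
    omega

end Peel

/-! ### The tree chosen on a reduced instance is thick -/

section Thick

variable {V : Type*} [Fintype V] {I : CMCInstance V}

theorem arcs_pos {R : V → V → Prop} {A B : Set V} {u v : V} (hu : u ∈ A) (hv : v ∈ B)
    (h : R u v) : 0 < arcs R A B := by
  rw [Nat.pos_iff_ne_zero]
  intro h0
  rw [arcs, Finset.sum_eq_zero_iff] at h0
  have h1 := Finset.sum_eq_zero_iff.1 (h0 u (Finset.mem_univ u)) v (Finset.mem_univ v)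
  rw [if_pos ⟨hu, hv, h⟩] at h1
  exact one_ne_zero h1

theorem leaves_ncard_le_leafWeight (h1 : I.EveryVertexHasOne) {T : VGraph V} (hT : T ≤ I.graph) :
    (VGraph.leaves T).ncard ≤ I.leafWeight T := by
  rw [CMCInstance.leafWeight, Set.ncard_eq_toFinset_card _ (VGraph.leaves T).toFinite,
    Finset.card_eq_sum_ones]
  refine Finset.sum_le_sum fun v hv => ?_
  have hv' : v ∈ VGraph.leaves T := by simpa using hv
  obtain ⟨u, hu, hw⟩ := h1 v (hT.1 hv'.1)
  rw [vertexWeight_eq]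
  exact arcs_pos rfl trivial ⟨hu, hw⟩

theorem two_le_ncard_of_hasOne (h1 : I.EveryVertexHasOne) (hne : I.graph.verts.Nonempty) :
    2 ≤ I.graph.verts.ncard := by
  obtain ⟨v, hv⟩ := hne
  obtain ⟨u, hu, -⟩ := h1 v hv
  have := (Set.one_lt_ncard (Set.toFinite I.graph.verts)).2 ⟨v, hv, u, hu.snd_mem, hu.ne⟩
  omega

theorem half_le_log_two : (1 / 2 : ℝ) ≤ Real.log 2 := by
  have := Real.log_two_gt_d9
  linarith

theorem half_le_log {n : ℕ} (hn : 2 ≤ n) : (1 / 2 : ℝ) ≤ Real.log n :=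
  half_le_log_two.trans (Real.log_le_log (by norm_num) (by exact_mod_cast hn))

/-- From 2^(⌈log₂ n⌉ - 1) < n and log 2 ≥ 1/2 one gets ⌈log₂ n⌉ ≤ 2 log n + 1, and 1 ≤ 2 log n. -/
theorem clog_le {n : ℕ} (hn : 2 ≤ n) : (Nat.clog 2 n : ℝ) ≤ 4 * Real.log n := by
  have h1 := half_le_log_two
  have h2 := half_le_log hn
  have h3 : 2 ^ (Nat.clog 2 n - 1) < n := Nat.pow_pred_clog_lt_self (by norm_num) (by omega)
  have h4 : ((Nat.clog 2 n - 1 : ℕ) : ℝ) * Real.log 2 ≤ Real.log n := by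
    rw [← Real.log_pow]
    exact Real.log_le_log (by positivity) (by exact_mod_cast h3.le)
  have h5 : (Nat.clog 2 n : ℝ) ≤ ((Nat.clog 2 n - 1 : ℕ) : ℝ) + 1 := by
    exact_mod_cast (by omega : Nat.clog 2 n ≤ Nat.clog 2 n - 1 + 1)
  have h6 : (0 : ℝ) ≤ ((Nat.clog 2 n - 1 : ℕ) : ℝ) := Nat.cast_nonneg _
  nlinarith

theorem List.sum_le_length_mul {l : List ℕ} {m : ℕ} (h : ∀ x ∈ l, x ≤ m) :
    l.sum ≤ l.length * m := by
  have := List.sum_le_card_nsmul l m h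
  simpa using this

/-- The constant comes from the sparse case: η ≤ 4n⌈log₂ n⌉ ≤ 16 n log n, while the n/14 leaves
carry weight at least n/14, and 14 · 16 = 224. In the dense case there are at most 16 log n rounds
and the leaf weights add up to at least η/2, so the best tree has at least η/(32 log n). -/
theorem thick_of_coreOutput {S : Set V} (h1 : I.EveryVertexHasOne) (h : I.CoreOutput 4 S) :
    ∃ T, 2 ≤ I.graph.verts.ncard ∧ I.IsThickTree (1 / 224 / Real.log I.graph.verts.ncard) T ∧
      I.FromTree T S := by
  have hverts : ∀ T : VGraph V, T ≤ I.graph → T.coe.IsTree → 2 ≤ I.graph.verts.ncard := by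
    intro T hT hT'
    exact two_le_ncard_of_hasOne h1 (((isTree_iff T).1 hT').1.1.mono hT.1)
  set n := I.graph.verts.ncard with hn
  rcases h with ⟨hle, T, hT, hS⟩ | ⟨hlt, ts, hts, T, hT, hmax, hS⟩
  · have h2 := hverts T hT.1 hT.2.2.1
    refine ⟨T, h2, ⟨hT.1, hT.2.2.1, ?_⟩, hS⟩
    have hlog := half_le_log h2
    have hlw := leaves_ncard_le_leafWeight h1 hT.1
    have hleaf := hT.2.2.2
    rw [← hn] at hleaf
    have e1 : (n : ℝ) ≤ 14 * I.leafWeight T := by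
      exact_mod_cast hleaf.trans (Nat.mul_le_mul_left _ hlw)
    have e2 : (I.numOnes : ℝ) ≤ 4 * n * Nat.clog 2 n := by exact_mod_cast hle
    have e3 := clog_le h2
    have e4 : (0 : ℝ) ≤ n := Nat.cast_nonneg _
    have e5 : (I.numOnes : ℝ) ≤ 4 * n * (4 * Real.log n) :=
      e2.trans (mul_le_mul_of_nonneg_left e3 (by positivity))
    rw [div_mul_eq_mul_div, div_le_iff₀ (by linarith)]
    nlinarith
  · have hT' := Peel.isTree hts T hT
    have h2 := hverts T hT'.1 hT'.2
    refine ⟨T, h2, ⟨hT'.1, hT'.2, ?_⟩, hS⟩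
    have hlog := half_le_log h2
    have hne : ts ≠ [] := List.ne_nil_of_mem hT
    -- the number of rounds
    have hlen : (ts.length : ℝ) ≤ 16 * Real.log n := by
      have e1 := Peel.length_bound hts hne
      rw [← hn] at e1
      have e2 : ((14 : ℝ) / 13) ^ (ts.length - 1) ≤ n := by
        rw [div_pow, div_le_iff₀ (by positivity)]
        exact_mod_cast e1
      have e3 := Real.log_le_log (by positivity) e2
      rw [Real.log_pow] at e3
      -- By log x ≥ 1 - 1/x. This bounds the number of rounds by 14 log n + 1, and 1 ≤ 2 log n.
      have e4 : (1 / 14 : ℝ) ≤ Real.log (14 / 13) := by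
        have := Real.one_sub_inv_le_log_of_pos (show (0 : ℝ) < 14 / 13 by norm_num)
        norm_num at this ⊢
        linarith
      have e5 : (ts.length : ℝ) ≤ ((ts.length - 1 : ℕ) : ℝ) + 1 := by
        exact_mod_cast (by omega : ts.length ≤ ts.length - 1 + 1)
      have e6 : (0 : ℝ) ≤ ((ts.length - 1 : ℕ) : ℝ) := Nat.cast_nonneg _
      nlinarith
    -- the edges counted at the leaves
    have hsum := Peel.arcs_le hts (R := One I) (fun a b h => h.symm) (fun a _ b _ h => h.1)
    have hall : arcs (One I) I.graph.verts I.graph.verts = 2 * I.numOnes := by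
      rw [two_mul_numOnes]
      exact arcs_congr fun u v => ⟨fun h => ⟨trivial, trivial, h.2.2⟩,
        fun h => ⟨h.2.2.1.fst_mem, h.2.2.1.snd_mem, h.2.2⟩⟩
    rw [hall, ← hn] at hsum
    have hmap : (ts.map fun T => arcs (One I) (VGraph.leaves T) Set.univ) =
        ts.map fun T => I.leafWeight T := List.map_congr_left fun T _ => (leafWeight_eq T).symm
    rw [hmap] at hsum
    have hle := List.sum_le_length_mul (l := ts.map fun T => I.leafWeight T)
      (m := I.leafWeight T) (by simpa using hmax)
    rw [List.length_map] at hle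
    have hclog : 1 ≤ Nat.clog 2 n := Nat.clog_pos (by norm_num) h2
    -- Here the threshold constant 4 is used: the at most 4n arcs lost by shortening are at most η
    -- of the 2η arcs in total.
    have e1 : 4 * n ≤ I.numOnes := by
      refine le_trans ?_ hlt.le
      exact Nat.le_mul_of_pos_right _ hclog
    have e2 : I.numOnes ≤ 2 * (ts.length * I.leafWeight T) := by omega
    have e3 : (I.numOnes : ℝ) ≤ 2 * (ts.length * I.leafWeight T) := by exact_mod_cast e2
    have e4 : (0 : ℝ) ≤ I.leafWeight T := Nat.cast_nonneg _
    have e5 : (I.numOnes : ℝ) ≤ 2 * (16 * Real.log n * I.leafWeight T) :=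
      e3.trans (by gcongr)
    rw [div_mul_eq_mul_div, div_le_iff₀ (by linarith)]
    nlinarith

end Thick

/-! ### The approximation guarantee -/

section Approximation

variable {V : Type*} [Fintype V]

theorem verts_ncard_dropVertex_le (I : CMCInstance V) (v : V) :
    (I.dropVertex v).graph.verts.ncard ≤ I.graph.verts.ncard :=
  Set.ncard_le_ncard Set.sdiff_subset (Set.toFinite _)

theorem verts_ncard_contract_le (I : CMCInstance V) (v₀ v₁ v₂ v₃ : V) :
    (I.contract v₀ v₁ v₂ v₃).graph.verts.ncard ≤ I.graph.verts.ncard :=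
  Set.ncard_le_ncard Set.sdiff_subset (Set.toFinite _)

/-- The induction carries an upper bound `k` for the optimum instead of the optimum itself. It
passes unchanged through both reductions, and at the core it is the number of 1-edges. Fixing `n`
from the start keeps the logarithm the same although the instances shrink. -/
theorem output_guarantee {I : CMCInstance V} {S : Set V} (h : CMCInstance.Output 4 I S) {n : ℕ}
    (hn : I.graph.verts.ncard ≤ n) :
    S ⊆ I.graph.verts ∧ ConnOn I.graph.Adj S ∧
      ∃ k : ℕ, OptLe I k ∧ 1 / 896 / Real.log n * (k : ℝ) ≤ (I.cutW S : ℝ) := by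
  induction h with
  | drop I v S' hv hw _ ih =>
    obtain ⟨h1, h2, k, h3, h4⟩ := ih ((verts_ncard_dropVertex_le I v).trans hn)
    have hcut : ∀ X : Set V, (∀ x, x ≠ v → (x ∈ X ↔ x ∈ S')) → I.cutW X =
        (I.dropVertex v).cutW S' := fun X hX => (cutW_dropVertex hw hX).symm
    split_ifs with hc
    · rw [induce_connected_iff] at hc
      exact ⟨h1.trans Set.sdiff_subset, hc, k, optLe_of_dropVertex hw h3,
        by rwa [hcut _ fun x _ => Iff.rfl]⟩
    · rw [induce_connected_iff] at hc
      refine ⟨Set.union_subset (h1.trans Set.sdiff_subset) (Set.singleton_subset_iff.2 hv),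
        connOn_of_dropVertex h2 hc, k, optLe_of_dropVertex hw h3, ?_⟩
      rwa [hcut _ fun x hx => by simp [hx]]
  | shorten I v₀ v₁ v₂ v₃ S' S _ hP _ hS hbest ih =>
    obtain ⟨h1, h2, k, h3, h4⟩ := ih ((verts_ncard_contract_le I v₀ v₁ v₂ v₃).trans hn)
    obtain ⟨h5, h6⟩ := connOn_expandCandidates hP h1 h2 hS
    refine ⟨h5, h6, k, optLe_of_contract hP h3, h4.trans ?_⟩
    exact_mod_cast cutW_le_of_expandCandidates hP h1 h2 hbest
  | core I S h1 _ hcore =>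
    obtain ⟨T, h2, hT, hS⟩ := thick_of_coreOutput h1 hcore
    have hlog := half_le_log h2
    have hpos : 0 < I.numOnes := by
      have hne : I.graph.verts.Nonempty :=
        (Set.ncard_pos (Set.toFinite _)).1 (by omega)
      obtain ⟨v, hv⟩ := hne
      obtain ⟨u, hu, hw⟩ := h1 v hv
      have := cutW_le_numOnes (I := I) {v}
      refine lt_of_lt_of_le ?_ this
      rw [cutW_eq]
      exact arcs_pos rfl hu.ne.symm ⟨hu, hw⟩
    obtain ⟨h3, h4, h5⟩ := fromTree_of_thick (by positivity) hpos hT hS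
    refine ⟨h3, (induce_connected_iff _ _).1 h4, I.numOnes, fun X _ _ => cutW_le_numOnes X, ?_⟩
    refine le_trans ?_ h5
    refine mul_le_mul_of_nonneg_right ?_ (Nat.cast_nonneg _)
    have hlog' : Real.log I.graph.verts.ncard ≤ Real.log n :=
      Real.log_le_log (by exact_mod_cast (by omega : 0 < I.graph.verts.ncard))
        (by exact_mod_cast hn)
    -- The factor is 1/224 for the thickness times 1/4 for the conversion into a cut.
    rw [div_div, div_div, div_div]
    refine one_div_le_one_div_of_le (by positivity) ?_
    linarith

end Approximation

/-! ### From connected components to the whole graph -/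

section Components

variable {V : Type*} [Fintype V] {G : SimpleGraph V} {w : Sym2 V → Fin 2}

theorem ofComponent_adj (C : G.ConnectedComponent) (a b : V) :
    (CMCInstance.ofComponent w C).graph.Adj a b ↔ (a ∈ C.supp ∧ b ∈ C.supp) ∧ G.Adj a b := Iff.rfl

theorem ofComponent_connOn_iff (C : G.ConnectedComponent) {S : Set V} (hS : S ⊆ C.supp) :
    ConnOn (CMCInstance.ofComponent w C).graph.Adj S ↔ ConnOn G.Adj S :=
  connOn_congr fun a ha b hb => by rw [ofComponent_adj]; simp [hS ha, hS hb]

theorem ofComponent_cutW (C : G.ConnectedComponent) {S : Set V} (hS : S ⊆ C.supp) :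
    (CMCInstance.ofComponent w C).cutW S = cutWeight G.edgeSet w S := by
  rw [cutW_eq, cutWeight_eq]
  refine arcs_congr fun u v => and_congr_right fun hu => and_congr_right fun hv => ?_
  rw [One, ofComponent_adj, SimpleGraph.mem_edgeSet]
  constructor
  · rintro ⟨⟨-, h⟩, h'⟩
    exact ⟨h, h'⟩
  · rintro ⟨h, h'⟩
    exact ⟨⟨⟨hS hu, (C.mem_supp_congr_adj h).1 (hS hu)⟩, h⟩, h'⟩

theorem subset_supp_of_connOn {S : Set V} (h : ConnOn G.Adj S) {x : V} (hx : x ∈ S) :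
    S ⊆ (G.connectedComponentMk x).supp := by
  refine h.subset_of_closed hx rfl fun a ha b _ hab => ?_
  exact ((G.connectedComponentMk x).mem_supp_congr_adj hab).1 ha

theorem componentOutput_guarantee {n : ℕ} (hn : Fintype.card V ≤ n) {C : G.ConnectedComponent}
    {S : Set V} (h : CMCInstance.ComponentOutput 4 (CMCInstance.ofComponent w C) S) :
    S ⊆ C.supp ∧ ConnOn G.Adj S ∧ ∃ k : ℕ, OptLe (CMCInstance.ofComponent w C) k ∧
      1 / 896 / Real.log n * (k : ℝ) ≤ (cutWeight G.edgeSet w S : ℝ) := by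
  rcases h with ⟨h0, v, hv, rfl⟩ | ⟨-, h⟩
  · refine ⟨Set.singleton_subset_iff.2 hv, connOn_singleton _ _, 0, fun X _ _ => ?_, by simp⟩
    exact (cutW_le_numOnes X).trans h0.le
  · obtain ⟨h1, h2, k, h3, h4⟩ := output_guarantee h (n := n)
      ((Set.ncard_le_card _).trans (by rwa [Nat.card_eq_fintype_card]))
    exact ⟨h1, (ofComponent_connOn_iff C h1).1 h2, k, h3, by rwa [← ofComponent_cutW C h1]⟩

/-- A connected competitor `S'` lies in one component, so it is bounded by the solution found there,
and the output is at least as good as that. -/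
theorem algorithm_guarantee {n : ℕ} (hn : Fintype.card V ≤ n) {S : Set V}
    (h : AlgorithmOutput 4 G w S) : (G.induce S).Connected ∧
      ∀ S' : Set V, (G.induce S').Connected →
        1 / 896 / Real.log n * (cutWeight G.edgeSet w S' : ℝ) ≤ (cutWeight G.edgeSet w S : ℝ) := by
  obtain ⟨sol, hsol, C, rfl, hbest⟩ := h
  refine ⟨(graph_induce_connected_iff _ _).2 (componentOutput_guarantee hn (hsol C)).2.1,
    fun S' hS' => ?_⟩
  rw [graph_induce_connected_iff] at hS'
  obtain ⟨x, hx⟩ := hS'.1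
  have hsub := subset_supp_of_connOn hS' hx
  obtain ⟨-, -, k, h3, h4⟩ := componentOutput_guarantee hn (hsol (G.connectedComponentMk x))
  have h5 := h3 S' hsub ((ofComponent_connOn_iff _ hsub).2 hS')
  rw [ofComponent_cutW _ hsub] at h5
  have hlog : 0 ≤ Real.log n := Real.log_natCast_nonneg n
  calc 1 / 896 / Real.log n * (cutWeight G.edgeSet w S' : ℝ)
      ≤ 1 / 896 / Real.log n * (k : ℝ) := by
        refine mul_le_mul_of_nonneg_left (by exact_mod_cast h5) (by positivity)
    _ ≤ _ := h4
    _ ≤ _ := by exact_mod_cast hbest _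

end Components

/-! ### Locally optimal spanning trees have many leaves -/

section LocalSearch

variable {V : Type*} [Fintype V] {H T : VGraph V}

/-- Add the edge `uv` to `T` and remove the edge `xy`. -/
def exch (T : VGraph V) (u v x y : V) : VGraph V where
  verts := T.verts
  Adj a b := (a ∈ T.verts ∧ b ∈ T.verts) ∧ a ≠ b ∧ s(a, b) ≠ s(x, y) ∧
    (T.Adj a b ∨ s(a, b) = s(u, v))
  adj_sub h := h.2.1
  edge_vert h := h.1.1
  symm := ⟨fun a b h => by
    rw [Sym2.eq_swap (a := b) (b := a)]
    exact ⟨h.1.symm, h.2.1.symm, h.2.2.1, h.2.2.2.imp_left fun h' => h'.symm⟩⟩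

/-- The exchange keeps the graph connected, and it removes an edge or increases the number of
leaves. -/
def Improves (H T : VGraph V) (u v x y : V) : Prop :=
  H.Adj u v ∧ T.Adj x y ∧ ConnOn (exch T u v x y).Adj T.verts ∧
    (T.Adj u v ∨ (VGraph.leaves T).ncard < (VGraph.leaves (exch T u v x y)).ncard)

/-- `T` is only assumed to be a connected spanning subgraph. That it is a tree follows, because
removing a superfluous edge counts as an improvement. -/
structure LocalOpt (H T : VGraph V) : Prop where
  le : T ≤ H
  verts_eq : T.verts = H.verts
  conn : ConnOn T.Adj T.verts
  opt : ∀ u v x y, ¬ Improves H T u v x y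

theorem exch_adj_of {u v x y a b : V} (h : T.Adj a b) (hne : s(a, b) ≠ s(x, y)) :
    (exch T u v x y).Adj a b :=
  ⟨⟨h.fst_mem, h.snd_mem⟩, h.ne, hne, .inl h⟩

theorem exch_adj_new {u v x y : V} (hu : u ∈ T.verts) (hv : v ∈ T.verts) (huv : u ≠ v)
    (hne : s(u, v) ≠ s(x, y)) : (exch T u v x y).Adj u v :=
  ⟨⟨hu, hv⟩, huv, hne, .inr rfl⟩

theorem connOn_exch {u v x y : V} (hT : ConnOn T.Adj T.verts)
    (h : ReflTransGen (fun a b => a ∈ T.verts ∧ b ∈ T.verts ∧ (exch T u v x y).Adj a b) x y) :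
    ConnOn (exch T u v x y).Adj T.verts := by
  refine hT.transfer id (graph_symm _) (fun a ha => ha) (fun a ha b hb hab => ?_)
    fun a ha => ⟨a, ha, .refl⟩
  by_cases hs : s(a, b) = s(x, y)
  · rcases Sym2.eq_iff.1 hs with ⟨rfl, rfl⟩ | ⟨rfl, rfl⟩
    · exact h
    · exact rtg_symm (fun a b hab => ⟨hab.2.1, hab.1, hab.2.2.symm⟩) h
  · exact .single ⟨ha, hb, exch_adj_of hab hs⟩

/-- An edge `xy` of `T` outside a spanning tree `K` of `T` could be dropped: exchanging `xy` for
itself removes it, and `K` keeps the rest connected. -/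
theorem LocalOpt.isTree (h : LocalOpt H T) : T.coe.IsTree := by
  have hc : T.coe.Connected := (coe_connected_iff T).2 h.conn
  obtain ⟨K, hK, hKt⟩ := hc.exists_isTree_le
  suffices hKT : K = T.coe by rwa [← hKT]
  refine le_antisymm hK fun x y hxy => ?_
  by_contra hne
  have hxy' : T.Adj x y := hxy
  refine h.opt x y x y ⟨h.le.2 hxy', hxy', ?_, .inl hxy'⟩
  have hKc := (connected_iff_connOn T.verts K (fun a b => ∃ (ha : a ∈ T.verts) (hb : b ∈ T.verts),
    K.Adj ⟨a, ha⟩ ⟨b, hb⟩) (fun a b => ⟨fun h => ⟨a.2, b.2, h⟩, fun ⟨_, _, h⟩ => h⟩)).1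
    hKt.1
  refine hKc.mono ?_
  rintro a b ⟨ha, hb, hab⟩
  have hab' : T.Adj a b := hK hab
  refine exch_adj_of hab' fun hs => hne ?_
  rcases Sym2.eq_iff.1 hs with ⟨h1, h2⟩ | ⟨h1, h2⟩
  · subst h1 h2; exact hab
  · subst h1 h2; exact hab.symm

/-- `z` is the vertex of a walk just before it first meets `p`. -/
theorem exists_reach_avoiding {R : V → V → Prop} {v p : V} (hvp : v ≠ p)
    (h : ReflTransGen R v p) :
    ∃ z, R z p ∧ ReflTransGen (fun a b => R a b ∧ a ≠ p ∧ b ≠ p) v z := by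
  induction h using ReflTransGen.head_induction_on with
  | refl => exact absurd rfl hvp
  | @head a c hac _ ih =>
    by_cases hc : c = p
    · subst hc
      exact ⟨a, hac, .refl⟩
    · obtain ⟨z, hz, hcz⟩ := ih hc
      exact ⟨z, hz, hcz.head ⟨hac, hvp, hc⟩⟩

theorem eq_of_deg_two {x c a b : V} (hd : VGraph.deg T x = 2) (hc : T.Adj x c) (ha : T.Adj x a)
    (hb : T.Adj x b) (hac : a ≠ c) (hbc : b ≠ c) : a = b := by
  rcases (adj_iff_of_deg_two hd hc ha hac.symm b).1 hb with h | h
  · exact absurd h hbc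
  · exact h.symm

theorem mem_leaves_exch {u v x y z : V} (hz : z ∈ VGraph.leaves T) (hu : z ≠ u) (hv : z ≠ v) :
    z ∈ VGraph.leaves (exch T u v x y) := by
  refine ⟨hz.1, (deg_le_one_iff _ _).2 fun a b ha hb => ?_⟩
  have key : ∀ c, (exch T u v x y).Adj z c → T.Adj z c := by
    intro c hc
    refine hc.2.2.2.resolve_right fun h => ?_
    rcases Sym2.eq_iff.1 h with ⟨h1, -⟩ | ⟨h1, -⟩
    · exact hu h1
    · exact hv h1
  exact (deg_le_one_iff _ _).1 hz.2 a b (key a ha) (key b hb)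

/-- A vertex `p` that is followed in `T` by two vertices `c` and `d` of degree two has no further
neighbour on their side. -/
theorem LocalOpt.side (h : LocalOpt H T) {p c d v : V} (hp : VGraph.deg T p = 2)
    (hpc : T.Adj p c) (hc : VGraph.deg T c = 2) (hcd : T.Adj c d) (hdp : d ≠ p)
    (hd : VGraph.deg T d = 2) (hpv : H.Adj p v) (hvc : v ≠ c)
    (hreach : ReflTransGen (fun a b => (a ∈ T.verts ∧ b ∈ T.verts ∧ T.Adj a b) ∧ a ≠ p ∧ b ≠ p)
      v c) : False := by
  have hvT : v ∈ T.verts := h.verts_eq ▸ hpv.snd_mem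
  have hpT : p ∈ T.verts := hpc.fst_mem
  have hcdeg : ∀ b, T.Adj c b → b = p ∨ b = d :=
    fun b hb => (adj_iff_of_deg_two hc hpc.symm hcd hdp.symm b).1 hb
  by_cases hv : VGraph.deg T v ≤ 1
  -- If `v` is a leaf, exchange `cd` for `pv`. Both `c` and `d` become leaves and at most the leaf
  -- `v` is lost. The route from `c` over `p` and `v` to `d` replaces the removed edge.
  · obtain ⟨z, hz, hvz⟩ := exists_reach_avoiding hvc hreach
    have hzd : z = d := (hcdeg z hz.1.2.2.symm).resolve_left hz.2.1
    subst hzd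
    have hvz' : v ≠ z := fun h' => by subst h'; omega
    have hleaf : VGraph.leaves T \ {v} ∪ {c, z} ⊆ VGraph.leaves (exch T p v c z) := by
      rintro x (hx | rfl | rfl)
      · exact mem_leaves_exch hx.1 (fun h' => by have := hx.1.2; subst h'; omega) hx.2
      · refine ⟨hpc.snd_mem, (deg_le_one_iff _ _).2 ?_⟩
        have key : ∀ b, (exch T p v x z).Adj x b → b = p := by
          rintro b ⟨-, -, h1, h2 | h2⟩
          · exact (hcdeg b h2).resolve_right fun h' => h1 (by rw [h'])
          · rcases Sym2.eq_iff.1 h2 with ⟨h3, -⟩ | ⟨h3, -⟩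
            · exact absurd h3 hpc.ne.symm
            · exact absurd h3 hvc.symm
        intro a b ha hb
        rw [key a ha, key b hb]
      · refine ⟨hcd.snd_mem, (deg_le_one_iff _ _).2 ?_⟩
        have key : ∀ b, (exch T p v c x).Adj x b → T.Adj x b ∧ b ≠ c := by
          rintro b ⟨-, -, h1, h2 | h2⟩
          · exact ⟨h2, fun h' => h1 (by rw [h', Sym2.eq_swap])⟩
          · rcases Sym2.eq_iff.1 h2 with ⟨h3, -⟩ | ⟨h3, -⟩
            · exact absurd h3 hdp
            · exact absurd h3 hvz'.symm
        intro a b ha hb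
        exact eq_of_deg_two hd hcd.symm (key a ha).1 (key b hb).1 (key a ha).2 (key b hb).2
    refine h.opt p v c z ⟨hpv, hcd, connOn_exch h.conn ?_, .inr ?_⟩
    · refine .head ⟨hpc.snd_mem, hpT, exch_adj_of hpc.symm ?_⟩
        (.head ⟨hpT, hvT, exch_adj_new hpT hvT hpv.ne ?_⟩ (ReflTransGen.mono ?_ _ _ hvz))
      · rw [Ne, Sym2.eq_iff]
        rintro (⟨-, h1⟩ | ⟨h1, -⟩)
        · exact hdp h1.symm
        · exact hcd.ne h1
      · rw [Ne, Sym2.eq_iff]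
        rintro (⟨h1, -⟩ | ⟨h1, -⟩)
        · exact hpc.ne h1
        · exact hdp h1.symm
      · rintro a b ⟨⟨⟨ha, hb, hab⟩, -⟩, hac, hbc⟩
        refine ⟨ha, hb, exch_adj_of hab ?_⟩
        rw [Ne, Sym2.eq_iff]
        rintro (⟨h1, -⟩ | ⟨-, h1⟩)
        · exact hac h1
        · exact hbc h1
    · have hvl : v ∈ VGraph.leaves T := ⟨hvT, hv⟩
      have hdisj : Disjoint (VGraph.leaves T \ {v}) {c, z} := by
        rw [Set.disjoint_left]
        rintro x hx (rfl | rfl)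
        · have := hx.1.2; omega
        · have := hx.1.2; omega
      have h1 := Set.ncard_le_ncard hleaf (Set.toFinite _)
      rw [Set.ncard_union_eq hdisj (Set.toFinite _) (Set.toFinite _), Set.ncard_pair hcd.ne] at h1
      have h2 := Set.ncard_sdiff_singleton_add_one hvl (Set.toFinite _)
      omega
  -- If `v` is no leaf, exchange `pc` for `pv`: then `c` becomes a leaf and no leaf is lost, since
  -- neither `p` nor `v` was one.
  · have hleaf : VGraph.leaves T ∪ {c} ⊆ VGraph.leaves (exch T p v p c) := by
      rintro x (hx | rfl)
      · exact mem_leaves_exch hx (fun h' => by have := hx.2; subst h'; omega)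
          (fun h' => by have := hx.2; subst h'; omega)
      · refine ⟨hpc.snd_mem, (deg_le_one_iff _ _).2 ?_⟩
        have key : ∀ b, (exch T p v p x).Adj x b → b = d := by
          rintro b ⟨-, -, h1, h2 | h2⟩
          · exact (hcdeg b h2).resolve_left fun h' => h1 (by rw [h', Sym2.eq_swap])
          · rcases Sym2.eq_iff.1 h2 with ⟨h3, -⟩ | ⟨h3, -⟩
            · exact absurd h3 hpc.ne.symm
            · exact absurd h3 hvc.symm
        intro a b ha hb
        rw [key a ha, key b hb]
    refine h.opt p v p c ⟨hpv, hpc, connOn_exch h.conn ?_, .inr ?_⟩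
    · refine .head ⟨hpT, hvT, exch_adj_new hpT hvT hpv.ne ?_⟩ (ReflTransGen.mono ?_ _ _ hreach)
      · rw [Ne, Sym2.eq_iff]
        rintro (⟨-, h1⟩ | ⟨h1, -⟩)
        · exact hvc h1
        · exact hpc.ne h1
      · rintro a b ⟨⟨ha, hb, hab⟩, hap, hbp⟩
        refine ⟨ha, hb, exch_adj_of hab ?_⟩
        rw [Ne, Sym2.eq_iff]
        rintro (⟨h1, -⟩ | ⟨-, h1⟩)
        · exact hap h1
        · exact hbp h1
    · have h1 := Set.ncard_le_ncard hleaf (Set.toFinite _)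
      have hcl : c ∉ VGraph.leaves T := fun h' => by have := h'.2; omega
      rw [Set.union_singleton, Set.ncard_insert_of_notMem hcl] at h1
      omega

/-- A third neighbour `v` of `p` in `H` would be joined to `b` or to `c` in `T` without passing
through `p`; `LocalOpt.side` excludes both. -/
theorem LocalOpt.deg_two (h : LocalOpt H T) {a b p c d : V} (hp : VGraph.deg T p = 2)
    (hpb : T.Adj p b) (hpc : T.Adj p c) (hbc : b ≠ c)
    (hb : VGraph.deg T b = 2) (hba : T.Adj b a) (hap : a ≠ p) (ha : VGraph.deg T a = 2)
    (hc : VGraph.deg T c = 2) (hcd : T.Adj c d) (hdp : d ≠ p) (hd : VGraph.deg T d = 2) :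
    VGraph.deg H p = 2 := by
  have hN : ∀ v, H.Adj p v → v = b ∨ v = c := by
    intro v hv
    by_contra hne
    push Not at hne
    have hvT : v ∈ T.verts := h.verts_eq ▸ hv.snd_mem
    obtain ⟨z, hz, hvz⟩ := exists_reach_avoiding hv.ne.symm (h.conn.2 v hvT p hpb.fst_mem)
    rcases (adj_iff_of_deg_two hp hpb hpc hbc z).1 hz.2.2.symm with rfl | rfl
    · exact h.side hp hpb hb hba hap ha hv hne.1 hvz
    · exact h.side hp hpc hc hcd hdp hd hv hne.2 hvz
  rw [VGraph.deg, ← Set.ncard_pair hbc]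
  congr 1
  ext v
  constructor
  · exact hN v
  · rintro (rfl | rfl)
    · exact h.le.2 hpb
    · exact h.le.2 hpc

/-- Starting with the arc `uv`, one meets a vertex of degree other than two after `j` further
vertices of degree two. -/
def Deep (T : VGraph V) : ℕ → V → V → Prop
  | 0, u, v => T.Adj u v ∧ VGraph.deg T v ≠ 2
  | j + 1, u, v => T.Adj u v ∧ VGraph.deg T v = 2 ∧ ∃ w, w ≠ u ∧ T.Adj v w ∧ Deep T j v w

/-- The arc `uv` starts a path with `k` vertices of degree two. -/
def Long (T : VGraph V) : ℕ → V → V → Prop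
  | 0, u, v => T.Adj u v
  | k + 1, u, v => T.Adj u v ∧ VGraph.deg T v = 2 ∧ ∃ w, w ≠ u ∧ T.Adj v w ∧ Long T k v w

theorem exists_other_of_deg_two (u : V) {v : V} (hd : VGraph.deg T v = 2) :
    ∃ w, w ≠ u ∧ T.Adj v w := by
  obtain ⟨w, hw, hwu⟩ := Set.exists_ne_of_one_lt_ncard
    (show 1 < (T.neighborSet v).ncard by rw [VGraph.deg] at hd; omega) u
  exact ⟨w, hwu, hw⟩

theorem deep_or_long (k : ℕ) : ∀ u v, T.Adj u v → (∃ j, j ≤ k ∧ Deep T j u v) ∨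
    Long T (k + 1) u v := by
  induction k with
  | zero =>
    intro u v huv
    by_cases hd : VGraph.deg T v = 2
    · obtain ⟨w, hw, hvw⟩ := exists_other_of_deg_two u hd
      exact .inr ⟨huv, hd, w, hw, hvw, hvw⟩
    · exact .inl ⟨0, le_rfl, huv, hd⟩
  | succ k ih =>
    intro u v huv
    by_cases hd : VGraph.deg T v = 2
    · obtain ⟨w, hw, hvw⟩ := exists_other_of_deg_two u hd
      rcases ih v w hvw with ⟨j, hj, hj'⟩ | hl
      · exact .inl ⟨j + 1, by omega, huv, hd, w, hw, hvw, hj'⟩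
      · exact .inr ⟨huv, hd, w, hw, hvw, hl⟩
    · exact .inl ⟨0, by omega, huv, hd⟩

/-- Among seven consecutive vertices of degree two, the third, fourth and fifth have two such
vertices on either side. So they have degree two in `H`, and together with the second they form a
thin path. -/
theorem LocalOpt.not_long (h : LocalOpt H T) (hH : VGraph.NoThinPath H) (u v : V) :
    ¬ Long T 7 u v := by
  rintro ⟨-, d1, p2, n2, a12, -, d2, p3, n3, a23, -, d3, p4, n4, a34, -, d4, p5, n5, a45, -, d5,
    p6, n6, a56, -, d6, p7, n7, a67, -, d7, -⟩
  refine hH p2 p3 p4 p5 ⟨h.le.2 a23, h.le.2 a34, h.le.2 a45, ?_, ?_, ?_, n4.symm, ?_, n5.symm⟩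
  · exact h.deg_two d3 a23.symm a34 n4.symm d2 a12.symm n3.symm d1 d4 a45 n5 d5
  · exact h.deg_two d4 a34.symm a45 n5.symm d3 a23.symm n4.symm d2 d5 a56 n6 d6
  · exact h.deg_two d5 a45.symm a56 n6.symm d4 a34.symm n5.symm d3 d6 a67 n7 d7
  -- If the ends coincided, `T` would contain a triangle, and one of its edges could be removed.
  · rintro rfl
    refine h.opt p2 p3 p2 p3 ⟨h.le.2 a23, a23, connOn_exch h.conn ?_, .inl a23⟩
    refine .head ⟨a45.snd_mem, a45.fst_mem, exch_adj_of a45.symm ?_⟩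
      (.single ⟨a34.snd_mem, a34.fst_mem, exch_adj_of a34.symm ?_⟩)
    · rw [Ne, Sym2.eq_iff]
      rintro (⟨-, h1⟩ | ⟨h1, -⟩)
      · exact a34.ne h1.symm
      · exact a23.ne h1
    · rw [Ne, Sym2.eq_iff]
      rintro (⟨h1, -⟩ | ⟨h1, -⟩)
      · exact a45.ne h1
      · exact a34.ne h1.symm

/-- An arc is mapped to the next arc of its path. This is injective, since a vertex of degree two
that is left along a given edge was entered along the other one. -/
theorem card_deep_le (T : VGraph V) (j : ℕ) :
    (Finset.univ.filter fun e : V × V => Deep T j e.1 e.2).card ≤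
      (Finset.univ.filter fun e : V × V => Deep T 0 e.1 e.2).card := by
  induction j with
  | zero => exact le_rfl
  | succ j ih =>
    refine le_trans ?_ ih
    have : ∀ e : V × V, ∃ w, Deep T (j + 1) e.1 e.2 → w ≠ e.1 ∧ T.Adj e.2 w ∧ Deep T j e.2 w := by
      intro e
      by_cases he : Deep T (j + 1) e.1 e.2
      · obtain ⟨-, -, w, h1⟩ := he
        exact ⟨w, fun _ => h1⟩
      · exact ⟨e.1, fun h => absurd h he⟩
    choose g hg using this
    refine Finset.card_le_card_of_injOn (fun e => (e.2, g e)) ?_ ?_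
    · intro e he
      have he' : Deep T (j + 1) e.1 e.2 := by simpa using he
      simpa using (hg e he').2.2
    · rintro ⟨u, v⟩ he ⟨u', v'⟩ he' heq
      have h1 : Deep T (j + 1) u v := by simpa using he
      have h2 : Deep T (j + 1) u' v' := by simpa using he'
      obtain ⟨h3, h4⟩ := Prod.ext_iff.1 heq
      simp only at h3 h4
      subst h3
      obtain ⟨g1, g2, -⟩ := hg (u, v) h1
      obtain ⟨g3, -, -⟩ := hg (u', v) h2
      rw [← h4] at g3
      have := eq_of_deg_two h1.2.1 g2 h1.1.symm h2.1.symm g1.symm g3.symm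
      rw [this]

theorem sum_deg_filter (T : VGraph V) (P : V → Prop) :
    (Finset.univ.filter fun e : V × V => T.Adj e.1 e.2 ∧ P e.2).card =
      ∑ v, if P v then VGraph.deg T v else 0 := by
  rw [Finset.card_filter, Fintype.sum_prod_type, Finset.sum_comm]
  refine Finset.sum_congr rfl fun v _ => ?_
  by_cases hv : P v
  · simp only [hv, and_true, if_true]
    rw [deg_eq_card, Finset.card_filter]
    refine Finset.sum_congr rfl fun u _ => ?_
    simp only [T.adj_comm u v]
  · simp [hv]

theorem card_filter_mem (A : Set V) : (Finset.univ.filter fun v => v ∈ A).card = A.ncard := by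
  rw [← Set.ncard_coe_finset]
  congr 1; ext; simp

/-- Let D = 2n - 2 be the number of arcs, n₂ the number of vertices of degree two and ℓ the number
of leaves. Every arc meets a vertex of degree other than two after at most six vertices of degree
two, so D ≤ 7(D - 2n₂), that is n₂ ≤ 3D/7. With 3n ≤ D + 2ℓ + n₂ this gives n ≤ 14ℓ. -/
theorem LocalOpt.leafy (h : LocalOpt H T) (hH : VGraph.NoThinPath H) : VGraph.IsLeafyTree H T := by
  refine ⟨h.le, h.verts_eq, h.isTree, ?_⟩
  rw [← h.verts_eq]
  obtain ⟨hconn, hsum⟩ := (isTree_iff T).1 h.isTree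
  set n := T.verts.ncard with hn
  have hnpos : 0 < n := (Set.ncard_pos (Set.toFinite _)).2 hconn.1
  have hl : (VGraph.leaves T).ncard = ∑ v, if v ∈ VGraph.leaves T then 1 else 0 := by
    rw [← card_filter_mem, Finset.card_filter]
  have hn' : n = ∑ v, if v ∈ T.verts then 1 else 0 := by
    rw [hn, ← card_filter_mem, Finset.card_filter]
  by_cases h1 : n = 1
  · rw [h1]
    obtain ⟨v, hv⟩ := hconn.1
    have hdeg : VGraph.deg T v ≤ ∑ v, VGraph.deg T v :=
      Finset.single_le_sum (f := VGraph.deg T) (fun _ _ => Nat.zero_le _) (Finset.mem_univ v)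
    have : 0 < (VGraph.leaves T).ncard :=
      (Set.ncard_pos (Set.toFinite _)).2 ⟨v, hv, by omega⟩
    omega
  have hdeg1 : ∀ v ∈ T.verts, 1 ≤ VGraph.deg T v := by
    intro v hv
    obtain ⟨u, hu, huv⟩ := Set.exists_ne_of_one_lt_ncard (show 1 < T.verts.ncard by omega) v
    obtain ⟨z, hz, hvz⟩ := hconn.exists_adj hv hu huv.symm
    exact (Set.ncard_pos (Set.toFinite _)).2 ⟨z, hvz⟩
  set n2 := ∑ v, if VGraph.deg T v = 2 then 1 else 0 with hn2
  have hall : (Finset.univ.filter fun e : V × V => T.Adj e.1 e.2).card = ∑ v, VGraph.deg T v := by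
    have := sum_deg_filter T fun _ => True
    simpa using this
  have hnot2 : (Finset.univ.filter fun e : V × V => Deep T 0 e.1 e.2).card + 2 * n2 =
      ∑ v, VGraph.deg T v := by
    have := sum_deg_filter T fun v => VGraph.deg T v ≠ 2
    have hdeep : (Finset.univ.filter fun e : V × V => Deep T 0 e.1 e.2).card =
        ∑ v, if VGraph.deg T v ≠ 2 then VGraph.deg T v else 0 := by
      refine Eq.trans ?_ (this.trans (Finset.sum_congr rfl fun v _ => by
        by_cases hv : VGraph.deg T v = 2 <;> simp [hv]))
      refine congrArg Finset.card (Finset.ext fun e => ?_)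
      simp only [Finset.mem_filter, Finset.mem_univ, true_and]
      exact Iff.rfl
    rw [hdeep, hn2, Finset.mul_sum, ← Finset.sum_add_distrib]
    refine Finset.sum_congr rfl fun v _ => ?_
    by_cases hv : VGraph.deg T v = 2 <;> simp [hv]
  have hcover : (Finset.univ.filter fun e : V × V => T.Adj e.1 e.2).card ≤
      7 * (Finset.univ.filter fun e : V × V => Deep T 0 e.1 e.2).card := by
    have hsub : (Finset.univ.filter fun e : V × V => T.Adj e.1 e.2) ⊆
        (Finset.range 7).biUnion fun j => Finset.univ.filter fun e : V × V => Deep T j e.1 e.2 := by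
      intro e he
      have he' : T.Adj e.1 e.2 := by simpa using he
      rcases deep_or_long 6 e.1 e.2 he' with ⟨j, hj, hj'⟩ | hlong
      · simp only [Finset.mem_biUnion, Finset.mem_range, Finset.mem_filter, Finset.mem_univ,
          true_and]
        exact ⟨j, by omega, hj'⟩
      · exact absurd hlong (h.not_long hH _ _)
    refine (Finset.card_le_card hsub).trans ((Finset.card_biUnion_le).trans ?_)
    refine (Finset.sum_le_sum fun j _ => card_deep_le T j).trans ?_
    simp
  -- Vertex by vertex: the degree is at least three, except that a missing unit is supplied by n₂
  -- for degree two and two missing units are supplied by 2ℓ for leaves.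
  have hhand : 3 * n ≤ ∑ v, VGraph.deg T v + 2 * (VGraph.leaves T).ncard + n2 := by
    rw [hl, hn', hn2, Finset.mul_sum, Finset.mul_sum, ← Finset.sum_add_distrib,
      ← Finset.sum_add_distrib]
    refine Finset.sum_le_sum fun v _ => ?_
    by_cases hv : v ∈ T.verts
    · have := hdeg1 v hv
      by_cases hv1 : VGraph.deg T v ≤ 1
      · have hvl : v ∈ VGraph.leaves T := ⟨hv, hv1⟩
        simp only [hv, hvl, if_true]
        omega
      · by_cases hv2 : VGraph.deg T v = 2
        · simp only [hv, hv2, if_true]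
          omega
        · simp only [hv, if_true]
          omega
    · simp [hv]
  omega

end LocalSearch

/-! ### Running random access machine programs -/

open RAM

/-- The program `P`, started with memory `m`, halts within `c` steps, with memory in `Q`. -/
def Runs (P : Program) (m : Mem) (c : ℕ) (Q : Mem → Prop) : Prop :=
  ∃ t m', Exec P m t m' ∧ t ≤ c ∧ Q m'

theorem Runs.mono {P : Program} {m : Mem} {c c' : ℕ} {Q Q' : Mem → Prop} (h : Runs P m c Q)
    (hc : c ≤ c') (hQ : ∀ m', Q m' → Q' m') : Runs P m c' Q' := by
  obtain ⟨t, m', h1, h2, h3⟩ := h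
  exact ⟨t, m', h1, h2.trans hc, hQ _ h3⟩

theorem Runs.seq {P P' : Program} {m : Mem} {c c' : ℕ} {Q Q' : Mem → Prop} (h : Runs P m c Q)
    (h' : ∀ m', Q m' → Runs P' m' c' Q') : Runs (.seq P P') m (c + c') Q' := by
  obtain ⟨t, m', h1, h2, h3⟩ := h
  obtain ⟨t', m'', h1', h2', h3'⟩ := h' m' h3
  exact ⟨_, _, .seq h1 h1', by omega, h3'⟩

theorem Runs.store {i j k e : Expr} {m : Mem} {Q : Mem → Prop}
    (h : Q (m.write (i.eval m) (j.eval m) (k.eval m) (e.eval m))) :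
    Runs (.store i j k e) m 1 Q :=
  ⟨_, _, .store i j k e m, le_rfl, h⟩

theorem Runs.nop {m : Mem} {Q : Mem → Prop} (h : Q m) : Runs .nop m 1 Q :=
  ⟨_, _, .nop m, le_rfl, h⟩

theorem Runs.cond {e : Expr} {P P' : Program} {m : Mem} {c c' : ℕ} {Q : Mem → Prop}
    (h : e.eval m ≠ 0 → Runs P m c Q) (h' : e.eval m = 0 → Runs P' m c' Q) :
    Runs (.cond e P P') m (c + c' + 1) Q := by
  by_cases he : e.eval m = 0
  · obtain ⟨t, m', h1, h2, h3⟩ := h' he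
    exact ⟨_, _, .condFalse he h1, by omega, h3⟩
  · obtain ⟨t, m', h1, h2, h3⟩ := h he
    exact ⟨_, _, .condTrue he h1, by omega, h3⟩

/-- The test expression is used as a countdown: it has the value `N - k` before round `k`, so there
are exactly `N` rounds. -/
theorem Runs.loop {e : Expr} {P : Program} {N c : ℕ} (Q : ℕ → Mem → Prop)
    (he : ∀ k m, k ≤ N → Q k m → e.eval m = N - k)
    (hP : ∀ k m, k < N → Q k m → Runs P m c (Q (k + 1))) {m : Mem} (h0 : Q 0 m) :
    Runs (.loop e P) m (N * (c + 1) + 1) (Q N) := by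
  suffices H : ∀ r k m, k + r = N → Q k m → Runs (.loop e P) m (r * (c + 1) + 1) (Q N) from
    H N 0 m (by omega) h0
  intro r
  induction r with
  | zero =>
    intro k m hk hQ
    obtain rfl : k = N := by omega
    exact ⟨_, _, .loopFalse (by rw [he k m le_rfl hQ]; omega), by omega, hQ⟩
  | succ r ih =>
    intro k m hk hQ
    obtain ⟨t, m', h1, h2, h3⟩ := hP k m (by omega) hQ
    obtain ⟨t', m'', h1', h2', h3'⟩ := ih (k + 1) m' (by omega) h3
    refine ⟨_, _, .loopTrue (by rw [he k m (by omega) hQ]; omega) h1 h1', ?_, h3'⟩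
    rw [Nat.add_mul]
    omega

/-- The register `r`. -/
def reg (r : ℕ) : Expr := .load (.lit 0) (.lit (r + 1)) (.lit 0)

def setReg (r : ℕ) (e : Expr) : Program := .store (.lit 0) (.lit (r + 1)) (.lit 0) e

def sizeE : Expr := .load (.lit 0) (.lit 0) (.lit 0)

@[simp] theorem eval_reg (m : Mem) (r : ℕ) : (reg r).eval m = m 0 (r + 1) 0 := rfl

@[simp] theorem eval_sizeE (m : Mem) : sizeE.eval m = m 0 0 0 := rfl

/-- Everything but the registers `d, d + 1, …` is unchanged. -/
def Frame (d : ℕ) (m m' : Mem) : Prop := ∀ i j k, i ≠ 0 ∨ j ≤ d → m' i j k = m i j k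

theorem Frame.refl (d : ℕ) (m : Mem) : Frame d m m := fun _ _ _ _ => rfl

theorem Frame.trans {d : ℕ} {m m' m'' : Mem} (h : Frame d m m') (h' : Frame d m' m'') :
    Frame d m m'' := fun i j k hh => (h' i j k hh).trans (h i j k hh)

theorem Frame.le {d d' : ℕ} {m m' : Mem} (h : Frame d' m m') (hd : d ≤ d') : Frame d m m' :=
  fun i j k hh => h i j k (hh.imp_right fun h' => h'.trans hd)

theorem Frame.write {d : ℕ} {m m' : Mem} (h : Frame d m m') {r k x : ℕ} (hr : d ≤ r) :
    Frame d m (m'.write 0 (r + 1) k x) := by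
  intro i j k' hh
  rw [← h i j k' hh, Mem.write, if_neg]
  rintro ⟨rfl, rfl, -⟩
  omega

theorem Frame.reg {d r : ℕ} {m m' : Mem} (h : Frame d m m') (hr : r < d) (k : ℕ) :
    m' 0 (r + 1) k = m 0 (r + 1) k := h _ _ _ (.inr hr)

theorem Runs.setReg {r : ℕ} {e : Expr} {m : Mem} {Q : Mem → Prop}
    (h : Q (m.write 0 (r + 1) 0 (e.eval m))) : Runs (setReg r e) m 1 Q := Runs.store h

/-- Execution of `P` for each value `0, …, n - 1` of the register `r`. -/
def forReg (r : ℕ) (P : Program) : Program :=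
  .seq (setReg r (.lit 0)) (.loop (.sub sizeE (reg r)) (.seq P (setReg r (.add (reg r) (.lit 1)))))

theorem Runs.forReg {r n c : ℕ} {P : Program} (Q : ℕ → Mem → Prop) {m : Mem}
    (hn : ∀ k m, Q k m → m 0 0 0 = n) (h0 : Q 0 (m.write 0 (r + 1) 0 0))
    (hP : ∀ k m, k < n → Q k m → m 0 (r + 1) 0 = k →
      Runs P m c fun m' => m' 0 (r + 1) 0 = k ∧ Q (k + 1) (m'.write 0 (r + 1) 0 (k + 1))) :
    Runs (forReg r P) m (n * (c + 2) + 2) (Q n) := by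
  refine (Runs.seq (Q := fun m' => Q 0 m' ∧ m' 0 (r + 1) 0 = 0) (Runs.setReg ⟨h0, by
    simp [Mem.write, Expr.eval]⟩) (c' := n * (c + 1 + 1) + 1) ?_).mono (by ring_nf; omega)
    (fun m' h => h)
  intro m' hm'
  refine (Runs.loop (fun k m => Q k m ∧ m 0 (r + 1) 0 = k) ?_ ?_ hm').mono le_rfl fun _ h => h.1
  · rintro k m - ⟨h1, h2⟩
    simp [Expr.eval, hn k m h1, h2]
  · rintro k m hk ⟨h1, h2⟩
    refine Runs.seq (hP k m hk h1 h2) fun m' h => Runs.setReg ?_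
    simp only [Expr.eval, eval_reg, h.1]
    exact ⟨h.2, by simp [Mem.write]⟩

/-! ### Computable quantities

Contexts consist of a state, that is a sequence of `n × n` arrays of numbers, and of finitely many
vertices. -/

/-- The arrays on which the programs for graphs with `n` vertices work. -/
abbrev St (n : ℕ) := ℕ → Fin n → Fin n → ℕ

/-- The variables are the vertices bound by enclosing sums, quantifiers and choices. Their number
does not depend on `n`, so one program can reserve a register for each of them. -/
class Ctx (Γ : ℕ → Type) where
  st : ∀ {n}, Γ n → St n
  len : ℕ
  var : ∀ {n}, Γ n → ℕ → ℕ
  var_lt : ∀ {n} (γ : Γ n) k, k < len → var γ k < n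

/-- Extension of a context by a vertex. -/
abbrev Ext (Γ : ℕ → Type) (n : ℕ) := Γ n × Fin n

instance : Ctx St where
  st σ := σ
  len := 0
  var _ _ := 0
  var_lt _ _ h := absurd h (Nat.not_lt_zero _)

instance {Γ : ℕ → Type} [Ctx Γ] : Ctx (Ext Γ) where
  st p := Ctx.st p.1
  len := Ctx.len Γ + 1
  var p k := if k = Ctx.len Γ then p.2 else Ctx.var p.1 k
  var_lt p k hk := by
    split_ifs with h
    · exact p.2.2
    · exact Ctx.var_lt p.1 k (by omega)

/-- The place of the array `a` in the memory. -/
def place (a : ℕ) : ℕ := if a = 0 then 1 else if a = 1 then 2 else a + 2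

/-- Index 0 is reserved for the size and the registers and index 3 for a buffer; the arrays 0 and 1
sit where `encode` and `decode` expect input and output. -/
theorem place_ne_zero (a : ℕ) : place a ≠ 0 := by unfold place; split_ifs <;> omega

theorem place_ne_three (a : ℕ) : place a ≠ 3 := by unfold place; split_ifs <;> omega

theorem place_inj {a b : ℕ} : place a = place b ↔ a = b := by
  unfold place; split_ifs <;> omega

variable {Γ Δ : ℕ → Type} [Ctx Γ] [Ctx Δ]

/-- `lay k` is the register that holds the `k`-th variable. Array cells outside the range of `n` are
left unspecified. -/
structure Rep (lay : ℕ → ℕ) {n : ℕ} (γ : Γ n) (m : Mem) : Prop where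
  size : m 0 0 0 = n
  arr : ∀ a (i j : Fin n), m (place a) i j = Ctx.st γ a i j
  var : ∀ k < Ctx.len Γ, m 0 (lay k + 1) 0 = Ctx.var γ k

theorem Rep.frame {lay : ℕ → ℕ} {n d : ℕ} {γ : Γ n} {m m' : Mem} (h : Rep lay γ m)
    (hf : Frame d m m') (hlay : ∀ k < Ctx.len Γ, lay k < d) : Rep lay γ m' where
  size := (hf 0 0 0 (.inr (Nat.zero_le _))).trans h.size
  arr a i j := (hf _ _ _ (.inl (place_ne_zero a))).trans (h.arr a i j)
  var k hk := (hf _ _ _ (.inr (hlay k hk))).trans (h.var k hk)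

/-- `f` can be computed in polynomial time, the result being put into the register `d`, where all
registers below `d` are preserved. -/
def Comp (f : ∀ n, Γ n → ℕ) : Prop :=
  ∀ (lay : ℕ → ℕ) (d : ℕ), (∀ k < Ctx.len Γ, lay k < d) →
    ∃ (P : Program) (q : Polynomial ℕ), ∀ n (γ : Γ n) m, Rep lay γ m →
      Runs P m (q.eval n) fun m' => m' 0 (d + 1) 0 = f n γ ∧ Frame d m m'

theorem Comp.lit (k : ℕ) : Comp (fun n (_ : Γ n) => k) := fun _ d _ =>
  ⟨setReg d (.lit k), 1, fun n γ m _ => (Runs.setReg ⟨by simp [Mem.write, Expr.eval],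
    (Frame.refl d m).write le_rfl⟩).mono (by simp) fun _ h => h⟩

theorem Comp.size : Comp (fun n (_ : Γ n) => n) := fun _ d _ =>
  ⟨setReg d sizeE, 1, fun n γ m h => (Runs.setReg ⟨by simp [Mem.write, Expr.eval, h.size],
    (Frame.refl d m).write le_rfl⟩).mono (by simp) fun _ h => h⟩

theorem Comp.var (k : ℕ) (hk : k < Ctx.len Γ) : Comp (fun n (γ : Γ n) => Ctx.var γ k) :=
  fun lay d _ => ⟨setReg d (reg (lay k)), 1, fun n γ m h => (Runs.setReg
    ⟨by simp [Mem.write, Expr.eval, h.var k hk], (Frame.refl d m).write le_rfl⟩).mono (by simp)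
    fun _ h => h⟩

/-- Two quantities are computed and combined by the expression `e` of the registers that hold
them. -/
theorem Comp.binary {f g : ∀ n, Γ n → ℕ} (hf : Comp f) (hg : Comp g) (e : ℕ → Expr)
    (F : ∀ n, Γ n → ℕ)
    (he : ∀ lay d n (γ : Γ n) m, Rep lay γ m → m 0 (d + 1) 0 = f n γ →
      m 0 (d + 2) 0 = g n γ → (e d).eval m = F n γ) : Comp F := by
  intro lay d hlay
  obtain ⟨P, p, hP⟩ := hf lay d hlay
  obtain ⟨Q, q, hQ⟩ := hg lay (d + 1) fun k hk => (hlay k hk).trans (Nat.lt_succ_self d)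
  refine ⟨.seq P (.seq Q (setReg d (e d))), p + (q + 1), fun n γ m hm => ?_⟩
  rw [Polynomial.eval_add, Polynomial.eval_add, Polynomial.eval_one]
  refine Runs.seq (hP n γ m hm) fun m1 h1 => Runs.seq (hQ n γ m1 (hm.frame h1.2 hlay))
    fun m2 h2 => Runs.setReg ⟨?_, ?_⟩
  · simp only [Mem.write, and_self, if_true]
    have h12 : Frame d m m2 := h1.2.trans (h2.2.le (by omega))
    exact he lay d n γ m2 (hm.frame h12 hlay) ((h2.2.reg (Nat.lt_succ_self d) 0).trans h1.1) h2.1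
  · exact (h1.2.trans (h2.2.le (by omega))).write le_rfl

theorem Comp.add {f g : ∀ n, Γ n → ℕ} (hf : Comp f) (hg : Comp g) :
    Comp (fun n γ => f n γ + g n γ) :=
  hf.binary hg (fun d => .add (reg d) (reg (d + 1))) _ fun lay d n γ m _ h1 h2 => by
    simp [Expr.eval, h1, h2]

theorem Comp.sub {f g : ∀ n, Γ n → ℕ} (hf : Comp f) (hg : Comp g) :
    Comp (fun n γ => f n γ - g n γ) :=
  hf.binary hg (fun d => .sub (reg d) (reg (d + 1))) _ fun lay d n γ m _ h1 h2 => by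
    simp [Expr.eval, h1, h2]

/-- The quantity `i`, with values in the vertices, is computable. -/
def VertC (i : ∀ n, Γ n → Fin n) : Prop := Comp fun n γ => (i n γ : ℕ)

theorem Comp.get (a : ℕ) {i j : ∀ n, Γ n → Fin n} (hi : VertC i) (hj : VertC j) :
    Comp (fun n γ => Ctx.st γ a (i n γ) (j n γ)) :=
  Comp.binary hi hj (fun d => .load (.lit (place a)) (reg d) (reg (d + 1))) _
    fun lay d n γ m h h1 h2 => by simp [Expr.eval, h1, h2, h.arr]

theorem Comp.cond {c f g : ∀ n, Γ n → ℕ} (hc : Comp c) (hf : Comp f) (hg : Comp g) :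
    Comp (fun n γ => if c n γ ≠ 0 then f n γ else g n γ) := by
  intro lay d hlay
  obtain ⟨C, r, hC⟩ := hc lay d hlay
  obtain ⟨P, p, hP⟩ := hf lay d hlay
  obtain ⟨Q, q, hQ⟩ := hg lay d hlay
  refine ⟨.seq C (.cond (reg d) P Q), r + (p + q + 1), fun n γ m hm => ?_⟩
  simp only [Polynomial.eval_add, Polynomial.eval_one]
  refine Runs.seq (hC n γ m hm) fun m1 h1 => Runs.cond (fun h => ?_) fun h => ?_
  · rw [eval_reg, h1.1] at h
    refine (hP n γ m1 (hm.frame h1.2 hlay)).mono le_rfl fun m2 h2 => ⟨?_, h1.2.trans h2.2⟩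
    rw [if_pos h, h2.1]
  · rw [eval_reg, h1.1] at h
    refine (hQ n γ m1 (hm.frame h1.2 hlay)).mono le_rfl fun m2 h2 => ⟨?_, h1.2.trans h2.2⟩
    rw [if_neg (not_not.2 h), h2.1]

/-- Maps of contexts that preserve the state. -/
def CtxHom (h : ∀ n, Γ n → Δ n) : Prop :=
  (∀ n γ, Ctx.st (h n γ) = Ctx.st γ) ∧ ∀ k < Ctx.len Δ, Comp fun n γ => Ctx.var (h n γ) k

/-- Substitution: the variables of the context `h n γ` are computed into registers from `d` on, and
the program for `f` is run with these registers as its layout. -/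
theorem Comp.comp {f : ∀ n, Δ n → ℕ} (hf : Comp f) {h : ∀ n, Γ n → Δ n} (hh : CtxHom h) :
    Comp (fun n γ => f n (h n γ)) := by
  intro lay d hlay
  have key : ∀ K ≤ Ctx.len Δ, ∃ (P : Program) (q : Polynomial ℕ), ∀ n (γ : Γ n) m, Rep lay γ m →
      Runs P m (q.eval n) fun m' => (∀ k < K, m' 0 (d + k + 1) 0 = Ctx.var (h n γ) k) ∧
        Frame d m m' := by
    intro K
    induction K with
    | zero =>
      exact fun _ => ⟨.nop, 1, fun n γ m _ => (Runs.nop ⟨fun k hk => absurd hk (by omega),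
        Frame.refl d m⟩).mono (by simp) fun _ h => h⟩
    | succ K ih =>
      intro hK
      obtain ⟨P, p, hP⟩ := ih (by omega)
      obtain ⟨Q, q, hQ⟩ := hh.2 K (by omega) lay (d + K) fun k hk => (hlay k hk).trans_le (by omega)
      refine ⟨.seq P Q, p + q, fun n γ m hm => ?_⟩
      rw [Polynomial.eval_add]
      refine Runs.seq (hP n γ m hm) fun m1 h1 => (hQ n γ m1 (hm.frame h1.2 hlay)).mono le_rfl
        fun m2 h2 => ⟨fun k hk => ?_, h1.2.trans (h2.2.le (by omega))⟩
      by_cases hkK : k = K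
      · rw [hkK, h2.1]
      · rw [h2.2.reg (by omega), h1.1 k (by omega)]
  obtain ⟨P, p, hP⟩ := key _ le_rfl
  obtain ⟨Q, q, hQ⟩ := hf (fun k => d + k) (d + Ctx.len Δ) fun k hk => by omega
  refine ⟨.seq P (.seq Q (setReg d (reg (d + Ctx.len Δ)))), p + (q + 1), fun n γ m hm => ?_⟩
  simp only [Polynomial.eval_add, Polynomial.eval_one]
  refine Runs.seq (hP n γ m hm) fun m1 h1 => Runs.seq (hQ n (h n γ) m1 ?_) fun m2 h2 =>
    Runs.setReg ⟨?_, ?_⟩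
  · have hm1 := hm.frame h1.2 hlay
    exact ⟨hm1.size, fun a i j => by rw [hh.1]; exact hm1.arr a i j, fun k hk => h1.1 k hk⟩
  · simp [Mem.write, h2.1]
  · exact (h1.2.trans (h2.2.le (by omega))).write le_rfl

theorem CtxHom.id : CtxHom (fun n (γ : Γ n) => γ) := ⟨fun _ _ => rfl, fun k hk => Comp.var k hk⟩

theorem CtxHom.fst : CtxHom (fun n (p : Ext Γ n) => p.1) := by
  refine ⟨fun _ _ => rfl, fun k hk => ?_⟩
  have : Comp (fun n (p : Ext Γ n) => Ctx.var p k) :=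
    Comp.var k (show k < Ctx.len Γ + 1 by omega)
  convert this using 3
  exact (if_neg (by omega)).symm

theorem VertC.snd : VertC (fun n (p : Ext Γ n) => p.2) := by
  have : Comp (fun n (p : Ext Γ n) => Ctx.var p (Ctx.len Γ)) :=
    Comp.var _ (show Ctx.len Γ < Ctx.len Γ + 1 by omega)
  unfold VertC
  convert this using 3
  exact (if_pos rfl).symm

theorem CtxHom.pair {h : ∀ n, Γ n → Δ n} (hh : CtxHom h) {i : ∀ n, Γ n → Fin n} (hi : VertC i) :
    CtxHom (fun n γ => ((h n γ, i n γ) : Ext Δ n)) := by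
  refine ⟨hh.1, fun k hk => ?_⟩
  by_cases hk' : k = Ctx.len Δ
  · unfold VertC at hi
    convert hi using 3
    exact if_pos hk'
  · convert hh.2 k (by have : k < Ctx.len Δ + 1 := hk; omega) using 3
    exact if_neg hk'

theorem CtxHom.comp {Ω : ℕ → Type} [Ctx Ω] {h : ∀ n, Γ n → Δ n} {g : ∀ n, Ω n → Γ n}
    (hh : CtxHom h) (hg : CtxHom g) : CtxHom (fun n ω => h n (g n ω)) :=
  ⟨fun n ω => (hh.1 n _).trans (hg.1 n ω), fun k hk => (hh.2 k hk).comp hg⟩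

theorem Comp.wk {f : ∀ n, Γ n → ℕ} (hf : Comp f) : Comp (fun n (p : Ext Γ n) => f n p.1) :=
  hf.comp CtxHom.fst

theorem VertC.wk {f : ∀ n, Γ n → Fin n} (hf : VertC f) : VertC (fun n (p : Ext Γ n) => f n p.1) :=
  Comp.comp hf CtxHom.fst

/-! ### Sums over the vertices, predicates and quantifiers -/

open RAM

section Folds

variable {Γ Δ : ℕ → Type} [Ctx Γ] [Ctx Δ]

theorem Comp.congr {f g : ∀ n, Γ n → ℕ} (hf : Comp f) (h : ∀ n γ, f n γ = g n γ) : Comp g := by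
  obtain rfl : f = g := funext fun n => funext fun γ => h n γ
  exact hf

/-- The layout in which the new variable is kept in the register `r`. -/
theorem Rep.ext {lay : ℕ → ℕ} {n r : ℕ} {γ : Γ n} {m : Mem} (h : Rep lay γ m) (v : Fin n)
    (hv : m 0 (r + 1) 0 = v) :
    Rep (Γ := Ext Γ) (Function.update lay (Ctx.len Γ) r) (γ, v) m where
  size := h.size
  arr := h.arr
  var k hk := by
    have hk' : k < Ctx.len Γ + 1 := hk
    change _ = if k = Ctx.len Γ then (v : ℕ) else Ctx.var γ k
    by_cases hkl : k = Ctx.len Γ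
    · simp [hkl, hv]
    · rw [Function.update_of_ne hkl, if_neg hkl]
      exact h.var k (by omega)

theorem update_lay_lt {lay : ℕ → ℕ} {d r d' : ℕ} (hlay : ∀ k < Ctx.len Γ, lay k < d) (hd : d ≤ d')
    (hr : r < d') : ∀ k < Ctx.len (Ext Γ), Function.update lay (Ctx.len Γ) r k < d' := by
  intro k hk
  have hk' : k < Ctx.len Γ + 1 := hk
  by_cases hkl : k = Ctx.len Γ
  · simp [hkl, hr]
  · rw [Function.update_of_ne hkl]
    exact (hlay k (by omega)).trans_le hd

/-- The accumulator is in the register `d`, the loop variable in `d + 1`; the body computes its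
value in `d + 2`. -/
theorem Comp.fold {f : ∀ n, Ext Γ n → ℕ} (hf : Comp f) (e : Expr → Expr → Expr) (g : ℕ → ℕ → ℕ)
    (he : ∀ x y m, (e x y).eval m = g (x.eval m) (y.eval m)) (F : ∀ n, Γ n → ℕ → ℕ)
    (h0 : ∀ n γ, F n γ 0 = 0)
    (hs : ∀ n γ k (hk : k < n), F n γ (k + 1) = g (F n γ k) (f n (γ, ⟨k, hk⟩))) :
    Comp (fun n γ => F n γ n) := by
  intro lay d hlay
  obtain ⟨P, p, hP⟩ := hf (Function.update lay (Ctx.len Γ) (d + 1)) (d + 2)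
    (update_lay_lt hlay (by omega) (by omega))
  refine ⟨.seq (setReg d (.lit 0)) (forReg (d + 1) (.seq P (setReg d (e (reg d) (reg (d + 2)))))),
    1 + (Polynomial.X * (p + 1 + 2) + 2), fun n γ m hm => ?_⟩
  simp only [Polynomial.eval_add, Polynomial.eval_one, Polynomial.eval_mul, Polynomial.eval_X,
    Polynomial.eval_ofNat]
  refine Runs.seq (Runs.setReg (Q := fun m' => Frame d m m' ∧ m' 0 (d + 1) 0 = 0)
    ⟨(Frame.refl d m).write le_rfl, by simp [Mem.write, Expr.eval]⟩) fun m1 h1 => ?_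
  refine (Runs.forReg (fun k m' => Frame d m m' ∧ m' 0 (d + 1) 0 = F n γ k) ?_ ?_ ?_).mono le_rfl
    fun m' h => ⟨h.2, h.1⟩
  · rintro k m' ⟨h, -⟩
    rw [h 0 0 0 (.inr (Nat.zero_le _)), hm.size]
  · exact ⟨h1.1.write (by omega), by simp [Mem.write, h1.2, h0]⟩
  · rintro k m' hk ⟨h2, h3⟩ h4
    refine Runs.seq (hP n (γ, ⟨k, hk⟩) m' ((hm.frame h2 hlay).ext _ h4)) fun m2 h5 =>
      Runs.setReg ⟨?_, ?_, ?_⟩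
    · simp [Mem.write, h5.2.reg (show d + 1 < d + 2 by omega), h4]
    · exact ((h2.trans (h5.2.le (by omega))).write le_rfl).write (by omega)
    · rw [he]
      simp [Mem.write, h5.1, h5.2.reg (show d < d + 2 by omega), h3, hs n γ k hk]

theorem Comp.sum {f : ∀ n, Γ n → Fin n → ℕ} (hf : Comp fun n (p : Ext Γ n) => f n p.1 p.2) :
    Comp (fun n γ => ∑ v, f n γ v) := by
  refine (hf.fold .add (· + ·) (fun _ _ _ => rfl)
    (fun n γ k => ∑ i ∈ Finset.range k, if h : i < n then f n γ ⟨i, h⟩ else 0) ?_ ?_).congr ?_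
  · simp
  · intro n γ k hk
    simp [Finset.sum_range_succ, hk]
  · intro n γ
    rw [← Fin.sum_univ_eq_sum_range (fun i => if h : i < n then f n γ ⟨i, h⟩ else 0)]
    simp

/-- The quantity is a computable predicate. -/
def CompP (P : ∀ n, Γ n → Prop) : Prop := ∃ f : ∀ n, Γ n → ℕ, Comp f ∧ ∀ n γ, f n γ ≠ 0 ↔ P n γ

theorem CompP.congr {P Q : ∀ n, Γ n → Prop} (hP : CompP P) (h : ∀ n γ, P n γ ↔ Q n γ) : CompP Q := by
  obtain rfl : P = Q := funext fun n => funext fun γ => propext (h n γ)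
  exact hP

theorem CompP.ite {P : ∀ n, Γ n → Prop} (hP : CompP P) {f g : ∀ n, Γ n → ℕ} (hf : Comp f)
    (hg : Comp g) [∀ n γ, Decidable (P n γ)] :
    Comp (fun n γ => if P n γ then f n γ else g n γ) := by
  obtain ⟨c, hc, hcP⟩ := hP
  refine (hc.cond hf hg).congr fun n γ => ?_
  by_cases h : P n γ
  · rw [if_pos h, if_pos ((hcP n γ).2 h)]
  · rw [if_neg h, if_neg fun h' => h ((hcP n γ).1 h')]

theorem CompP.ind {P : ∀ n, Γ n → Prop} (hP : CompP P) [∀ n γ, Decidable (P n γ)] :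
    Comp (fun n γ => if P n γ then 1 else 0) := hP.ite (.lit 1) (.lit 0)

theorem CompP.comp {P : ∀ n, Δ n → Prop} (hP : CompP P) {h : ∀ n, Γ n → Δ n} (hh : CtxHom h) :
    CompP (fun n γ => P n (h n γ)) := by
  obtain ⟨f, hf, hfP⟩ := hP
  exact ⟨_, hf.comp hh, fun n γ => hfP n _⟩

theorem CompP.wk {P : ∀ n, Γ n → Prop} (hP : CompP P) : CompP (fun n (p : Ext Γ n) => P n p.1) :=
  hP.comp CtxHom.fst

theorem Comp.ne_zero {f : ∀ n, Γ n → ℕ} (hf : Comp f) : CompP (fun n γ => f n γ ≠ 0) :=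
  ⟨f, hf, fun _ _ => Iff.rfl⟩

theorem CompP.not {P : ∀ n, Γ n → Prop} (hP : CompP P) : CompP (fun n γ => ¬ P n γ) :=
  ⟨_, hP.ite (.lit 0) (.lit 1), fun n γ => by simp⟩

theorem CompP.and {P Q : ∀ n, Γ n → Prop} (hP : CompP P) (hQ : CompP Q) :
    CompP (fun n γ => P n γ ∧ Q n γ) :=
  ⟨_, hP.ite hQ.ind (.lit 0), fun n γ => by simp⟩

theorem CompP.or {P Q : ∀ n, Γ n → Prop} (hP : CompP P) (hQ : CompP Q) :
    CompP (fun n γ => P n γ ∨ Q n γ) :=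
  ⟨_, hP.ite (.lit 1) hQ.ind, fun n γ => by by_cases h : P n γ <;> simp [h]⟩

theorem CompP.imp {P Q : ∀ n, Γ n → Prop} (hP : CompP P) (hQ : CompP Q) :
    CompP (fun n γ => P n γ → Q n γ) :=
  (hP.not.or hQ).congr fun _ _ => imp_iff_not_or.symm

theorem CompP.ex {P : ∀ n, Γ n → Fin n → Prop} (hP : CompP fun n (p : Ext Γ n) => P n p.1 p.2) :
    CompP (fun n γ => ∃ v, P n γ v) :=
  ⟨_, Comp.sum (f := fun n γ v => if P n γ v then 1 else 0) hP.ind, fun n γ => by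
    simp [Finset.sum_eq_zero_iff]⟩

theorem CompP.all {P : ∀ n, Γ n → Fin n → Prop} (hP : CompP fun n (p : Ext Γ n) => P n p.1 p.2) :
    CompP (fun n γ => ∀ v, P n γ v) :=
  (CompP.ex (P := fun n γ v => ¬ P n γ v) hP.not).not.congr fun n γ => by simp

theorem Comp.le {f g : ∀ n, Γ n → ℕ} (hf : Comp f) (hg : Comp g) :
    CompP (fun n γ => f n γ ≤ g n γ) :=
  (hf.sub hg).ne_zero.not.congr fun n γ => by rw [not_not, Nat.sub_eq_zero_iff_le]

theorem Comp.lt {f g : ∀ n, Γ n → ℕ} (hf : Comp f) (hg : Comp g) :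
    CompP (fun n γ => f n γ < g n γ) :=
  (hg.le hf).not.congr fun n γ => by simp

theorem Comp.eq {f g : ∀ n, Γ n → ℕ} (hf : Comp f) (hg : Comp g) :
    CompP (fun n γ => f n γ = g n γ) :=
  ((hf.le hg).and (hg.le hf)).congr fun _ _ => le_antisymm_iff.symm

theorem VertC.eq {i j : ∀ n, Γ n → Fin n} (hi : VertC i) (hj : VertC j) :
    CompP (fun n γ => i n γ = j n γ) :=
  (Comp.eq hi hj).congr fun _ _ => Fin.ext_iff.symm

theorem VertC.le {i j : ∀ n, Γ n → Fin n} (hi : VertC i) (hj : VertC j) :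
    CompP (fun n γ => i n γ ≤ j n γ) :=
  (Comp.le hi hj).congr fun _ _ => Iff.rfl

end Folds

/-! ### Reachability -/

section Reach

variable {Γ : ℕ → Type} [Ctx Γ]

/-- The entry of the vector kept along with the register `d`. -/
def entry (d : ℕ) (e : Expr) : Expr := .load (.lit 0) (.lit (d + 1)) (.add e (.lit 1))

def setEntry (d : ℕ) (e x : Expr) : Program := .store (.lit 0) (.lit (d + 1)) (.add e (.lit 1)) x

/-- The set of the vertices with a nonzero entry in the vector kept along with the register `d`. -/
def marked (d n : ℕ) (m : Mem) : Set (Fin n) := {x | m 0 (d + 1) (x + 1) ≠ 0}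

theorem marked_write (d n : ℕ) (m : Mem) (r x : ℕ) :
    marked d n (m.write 0 (r + 1) 0 x) = marked d n m := by
  ext; simp [marked, Mem.write]

theorem marked_frame {d d' n : ℕ} {m m' : Mem} (h : Frame d' m m') (hd : d < d') :
    marked d n m' = marked d n m := by
  ext; simp [marked, h.reg hd]

theorem mem_marked_setEntry {d n : ℕ} {m : Mem} {y x : Fin n} :
    x ∈ marked d n (m.write 0 (d + 1) (y + 1) 1) ↔ x = y ∨ x ∈ marked d n m := by
  by_cases h : x = y <;> simp [marked, Mem.write, h, Fin.val_inj]

/-- One round of the search: all successors of marked vertices are marked. -/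
def roundP (d : ℕ) (P : Program) : Program :=
  forReg (d + 1) (forReg (d + 2) (.seq P (.cond (reg (d + 4))
    (.cond (entry d (reg (d + 1))) (setEntry d (reg (d + 2)) (.lit 1)) .nop) .nop)))

/-- Vertices marked during the round may already be used in the same round. Hence soundness is
expressed by all closed sets `T` that contain the start, and completeness only for the vertices
marked at the start. -/
theorem runs_round {lay : ℕ → ℕ} {d n c : ℕ} {P : Program} {γ : Γ n} {f : Ext (Ext Γ) n → ℕ}
    (hlay : ∀ k < Ctx.len Γ, lay k < d)
    (hP : ∀ (x y : Fin n) m, Rep lay γ m → m 0 (d + 1 + 1) 0 = x → m 0 (d + 2 + 1) 0 = y →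
      Runs P m c fun m' => m' 0 (d + 4 + 1) 0 = f ((γ, x), y) ∧ Frame (d + 4) m m') {m : Mem}
    (hm : Rep lay γ m) :
    Runs (roundP d P) m (n * (n * (c + 5 + 2) + 2 + 2) + 2) fun m' => Frame d m m' ∧
      m' 0 (d + 3 + 1) 0 = m 0 (d + 3 + 1) 0 ∧ marked d n m ⊆ marked d n m' ∧
      (∀ T : Set (Fin n), marked d n m ⊆ T → (∀ x ∈ T, ∀ y, f ((γ, x), y) ≠ 0 → y ∈ T) →
        marked d n m' ⊆ T) ∧
      ∀ x ∈ marked d n m, ∀ y, f ((γ, x), y) ≠ 0 → y ∈ marked d n m' := by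
  set M := marked d n m with hM
  let B : Mem → Prop := fun m' => Frame d m m' ∧ m' 0 (d + 3 + 1) 0 = m 0 (d + 3 + 1) 0 ∧
    M ⊆ marked d n m' ∧ ∀ T : Set (Fin n), M ⊆ T →
      (∀ x ∈ T, ∀ y, f ((γ, x), y) ≠ 0 → y ∈ T) → marked d n m' ⊆ T
  have hBsize : ∀ m', B m' → m' 0 0 0 = n := fun m' h => (hm.frame h.1 hlay).size
  have hBwrite : ∀ m' r x, B m' → r = d + 1 ∨ r = d + 2 → B (m'.write 0 (r + 1) 0 x) := by
    rintro m' r x ⟨h1, h2, h3, h4⟩ hr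
    refine ⟨h1.write (by omega), ?_, by rwa [marked_write], fun T => by rw [marked_write]; exact h4 T⟩
    rw [← h2]
    exact if_neg (by omega)
  refine (Runs.forReg (fun k m' => B m' ∧ ∀ x : Fin n, (x : ℕ) < k → x ∈ M → ∀ y,
    f ((γ, x), y) ≠ 0 → y ∈ marked d n m') (fun k m' h => hBsize m' h.1) ?_ ?_).mono le_rfl ?_
  · exact ⟨hBwrite _ _ _ ⟨.refl _ _, rfl, subset_rfl, fun T h _ => h⟩ (.inl rfl),
      fun x hx => absurd hx (Nat.not_lt_zero _)⟩
  · rintro k m1 hk ⟨hB1, h1⟩ hk1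
    refine (Runs.forReg (fun l m' => (B m' ∧ m' 0 (d + 1 + 1) 0 = k ∧ ∀ x : Fin n, (x : ℕ) < k →
      x ∈ M → ∀ y, f ((γ, x), y) ≠ 0 → y ∈ marked d n m') ∧ ∀ y : Fin n, (y : ℕ) < l →
        (⟨k, hk⟩ : Fin n) ∈ M → f ((γ, ⟨k, hk⟩), y) ≠ 0 → y ∈ marked d n m')
      (fun k m' h => hBsize m' h.1.1) ?_ ?_).mono le_rfl ?_
    · refine ⟨⟨hBwrite _ _ _ hB1 (.inr rfl), ?_, ?_⟩, fun y hy => absurd hy (Nat.not_lt_zero _)⟩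
      · rw [← hk1]; exact if_neg (by omega)
      · rw [marked_write]; exact h1
    · rintro l m2 hl ⟨⟨hB2, hk2, h2⟩, h2'⟩ hl2
      refine (Runs.seq (hP ⟨k, hk⟩ ⟨l, hl⟩ m2 (hm.frame hB2.1 hlay) hk2 hl2) (c' := 5)
        fun m3 h3 => ?_)
      have hreg : ∀ r < d + 4, ∀ k, m3 0 (r + 1) k = m2 0 (r + 1) k := fun r hr k =>
        h3.2.reg hr k
      have hmk : marked d n m3 = marked d n m2 := marked_frame h3.2 (by omega)
      have hB3 : B m3 := ⟨hB2.1.trans (h3.2.le (by omega)), by rw [hreg _ (by omega), hB2.2.1],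
        by rw [hmk]; exact hB2.2.2.1, by rw [hmk]; exact hB2.2.2.2⟩
      have hskip : (f ((γ, ⟨k, hk⟩), ⟨l, hl⟩) ≠ 0 → (⟨k, hk⟩ : Fin n) ∉ marked d n m2) →
          Runs .nop m3 1 fun m' => m' 0 (d + 2 + 1) 0 = l ∧
            (B (m'.write 0 (d + 2 + 1) 0 (l + 1)) ∧ (m'.write 0 (d + 2 + 1) 0 (l + 1)) 0 (d + 1 + 1) 0
              = k ∧ ∀ x : Fin n, (x : ℕ) < k → x ∈ M → ∀ y, f ((γ, x), y) ≠ 0 →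
                y ∈ marked d n (m'.write 0 (d + 2 + 1) 0 (l + 1))) ∧
            ∀ y : Fin n, (y : ℕ) < l + 1 → (⟨k, hk⟩ : Fin n) ∈ M → f ((γ, ⟨k, hk⟩), y) ≠ 0 →
              y ∈ marked d n (m'.write 0 (d + 2 + 1) 0 (l + 1)) := by
        intro hno
        refine Runs.nop ⟨by rw [hreg _ (by omega), hl2], ⟨hBwrite _ _ _ hB3 (.inr rfl), ?_, ?_⟩, ?_⟩
        · rw [← hk2, ← hreg (d + 1) (by omega) 0]; exact if_neg (by omega)
        · rw [marked_write, hmk]; exact h2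
        · rw [marked_write, hmk]
          intro y hy hkM hf
          rcases Nat.lt_succ_iff_lt_or_eq.1 hy with hy | hy
          · exact h2' y hy hkM hf
          · obtain rfl : y = ⟨l, hl⟩ := Fin.ext hy
            exact absurd (hB2.2.2.1 hkM) (hno hf)
      refine (Runs.cond (c := 3) (c' := 1) (fun hc => ?_) fun hc => hskip fun hf => ?_)
      · refine (Runs.cond (c := 1) (c' := 1) (fun hc' => ?_) fun hc' => hskip fun hf => ?_)
        · have hkM : (⟨k, hk⟩ : Fin n) ∈ marked d n m2 := by
            simp only [entry, Expr.eval, eval_reg] at hc'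
            rw [hreg _ (by omega), hreg _ (by omega), hk2] at hc'
            exact hc'
          have hf : f ((γ, ⟨k, hk⟩), ⟨l, hl⟩) ≠ 0 := by rw [← h3.1]; exact hc
          have hl3 : m3 0 (d + 2 + 1) 0 = l := by rw [hreg _ (by omega), hl2]
          have hmem : ∀ y : Fin n, y ∈ marked d n (m3.write 0 (d + 1) (l + 1) 1) ↔
              y = ⟨l, hl⟩ ∨ y ∈ marked d n m2 := fun y => by
            rw [← hmk]; exact mem_marked_setEntry (y := ⟨l, hl⟩)
          have hB4 : B (m3.write 0 (d + 1) (l + 1) 1) := by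
            refine ⟨hB3.1.write le_rfl, ?_, fun y hy => (hmem y).2 (.inr (hB2.2.2.1 hy)), ?_⟩
            · rw [← hB3.2.1]; exact if_neg (by omega)
            · intro T hT hcl y hy
              rcases (hmem y).1 hy with rfl | hy
              · exact hcl _ (hB2.2.2.2 T hT hcl hkM) _ hf
              · exact hB2.2.2.2 T hT hcl hy
          refine Runs.store ?_
          simp only [Expr.eval, eval_reg, hl3]
          refine ⟨?_, ⟨hBwrite _ _ _ hB4 (.inr rfl), ?_, ?_⟩, ?_⟩
          · rw [← hl3]; exact if_neg (by omega)
          · rw [← hk2, ← hreg (d + 1) (by omega) 0]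
            exact (if_neg (by omega)).trans (if_neg (by omega))
          · rw [marked_write]
            intro x hx hxM y hy
            exact (hmem y).2 (.inr (h2 x hx hxM y hy))
          · rw [marked_write]
            intro y hy hkM' hf'
            rcases Nat.lt_succ_iff_lt_or_eq.1 hy with hy | hy
            · exact (hmem y).2 (.inr (h2' y hy hkM' hf'))
            · exact (hmem y).2 (.inl (Fin.ext hy))
        · simp only [entry, Expr.eval, eval_reg] at hc'
          rw [hreg _ (by omega), hreg _ (by omega), hk2] at hc'
          exact fun h => h hc'
      · rw [eval_reg, h3.1] at hc
        exact absurd hc hf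
    · rintro m2 ⟨⟨hB2, hk2, h2⟩, h2'⟩
      refine ⟨hk2, hBwrite _ _ _ hB2 (.inl rfl), fun x hx hxM y hf => ?_⟩
      rw [marked_write]
      rcases Nat.lt_succ_iff_lt_or_eq.1 hx with hx | hx
      · exact h2 x hx hxM y hf
      · obtain rfl : x = ⟨k, hk⟩ := Fin.ext hx
        exact h2' y y.2 hxM hf
  · rintro m' ⟨⟨h1, h2, h3, h4⟩, h5⟩
    exact ⟨h1, h2, h3, h4, fun x hx y hf => h5 x x.2 hx y hf⟩

/-- A search from `u` with `n` rounds. The marks are kept in the cells `(0, d + 1, x + 1)` next to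
the register `d`, which the frame condition leaves free. -/
theorem Comp.reach {f : ∀ n, Ext (Ext Γ) n → ℕ} (hf : Comp f) :
    Comp (fun n (p : Ext (Ext Γ) n) =>
      if ReflTransGen (fun x y => f n ((p.1.1, x), y) ≠ 0) p.1.2 p.2 then 1 else 0) := by
  intro lay d hlay
  have hlen : Ctx.len (Ext (Ext Γ)) = Ctx.len Γ + 1 + 1 := rfl
  have hlay' : ∀ k < Ctx.len Γ, lay k < d := fun k hk => hlay k (by omega)
  obtain ⟨P, p, hP⟩ := hf (Function.update (Function.update lay (Ctx.len Γ) (d + 1))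
    (Ctx.len (Ext Γ)) (d + 2)) (d + 4)
    (update_lay_lt (update_lay_lt hlay' (d' := d + 4) (by omega) (by omega)) le_rfl (by omega))
  have hlu := hlay (Ctx.len Γ) (by omega)
  have hlv := hlay (Ctx.len Γ + 1) (by omega)
  refine ⟨.seq (forReg (d + 1) (setEntry d (reg (d + 1)) (.lit 0)))
    (.seq (setEntry d (reg (lay (Ctx.len Γ))) (.lit 1)) (.seq (forReg (d + 3) (roundP d P))
      (.cond (entry d (reg (lay (Ctx.len Γ + 1)))) (setReg d (.lit 1)) (setReg d (.lit 0))))),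
    (Polynomial.X * (1 + 2) + 2) + (1 + (Polynomial.X * ((Polynomial.X * (Polynomial.X *
      (p + 5 + 2) + 2 + 2) + 2) + 2) + 2 + (1 + 1 + 1))), fun n γ m hm => ?_⟩
  simp only [Polynomial.eval_add, Polynomial.eval_one, Polynomial.eval_mul, Polynomial.eval_X,
    Polynomial.eval_ofNat]
  obtain ⟨⟨γ, u⟩, v⟩ := γ
  have hmu : m 0 (lay (Ctx.len Γ) + 1) 0 = u := by
    rw [hm.var _ (by omega)]
    change (if Ctx.len Γ = Ctx.len Γ + 1 then _ else if Ctx.len Γ = Ctx.len Γ then (u : ℕ) else _) = _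
    simp
  have hmv : m 0 (lay (Ctx.len Γ + 1) + 1) 0 = v := by
    rw [hm.var _ (by omega)]
    change (if Ctx.len Γ + 1 = Ctx.len Γ + 1 then (v : ℕ) else _) = _
    simp
  have hmγ : Rep lay γ m := by
    refine ⟨hm.size, hm.arr, fun k hk => ?_⟩
    rw [hm.var k (by omega)]
    change (if k = Ctx.len Γ + 1 then _ else if k = Ctx.len Γ then (u : ℕ) else _) = _
    rw [if_neg (by omega), if_neg (by omega)]
  set R : Fin n → Fin n → Prop := fun x y => f n ((γ, x), y) ≠ 0 with hR
  refine Runs.seq (Runs.forReg (fun k m' => Frame d m m' ∧ ∀ x < k, m' 0 (d + 1) (x + 1) = 0)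
    (fun k m' h => (hmγ.frame h.1 hlay').size)
    ⟨(Frame.refl _ _).write (by omega), fun x hx => absurd hx (Nat.not_lt_zero _)⟩ ?_) ?_
  · rintro k m1 hk ⟨h1, h2⟩ hk1
    refine Runs.store ?_
    simp only [Expr.eval, eval_reg, hk1]
    refine ⟨?_, (h1.write le_rfl).write (by omega), fun x hx => ?_⟩
    · rw [← hk1]; exact if_neg (by omega)
    · rcases Nat.lt_succ_iff_lt_or_eq.1 hx with hx | rfl
      · have := h2 x hx
        simp [Mem.write, this]
      · simp [Mem.write]
  rintro m1 ⟨hm1, hz⟩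
  refine Runs.seq (Runs.store (Q := fun m' => Frame d m m' ∧ marked d n m' = {u}) ?_) ?_
  · simp only [Expr.eval, eval_reg, hm1.reg hlu, hmu]
    refine ⟨hm1.write le_rfl, ?_⟩
    ext x
    rw [mem_marked_setEntry, Set.mem_singleton_iff, or_iff_left]
    exact fun h => h (hz x x.2)
  rintro m2 ⟨hm2, hmk2⟩
  -- Invariant: the marked set is closed, or every round so far has added a vertex. After `n` rounds
  -- the second alternative would need `n + 1` vertices.
  refine Runs.seq (Runs.forReg (fun k m' => Frame d m m' ∧ u ∈ marked d n m' ∧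
    (∀ x ∈ marked d n m', ReflTransGen R u x) ∧
      ((∀ x ∈ marked d n m', ∀ y, R x y → y ∈ marked d n m') ∨ k + 1 ≤ (marked d n m').ncard))
    (fun k m' h => (hmγ.frame h.1 hlay').size) ?_ ?_) ?_
  · rw [marked_write, hmk2]
    refine ⟨hm2.write (by omega), rfl, ?_, .inr (by simp)⟩
    rintro x rfl
    exact .refl
  · rintro k m3 hk ⟨hm3, hu, hs, hc⟩ hk3
    refine (runs_round (f := f n) (c := p.eval n) hlay' (fun x y m' hm' hx hy => ?_)
      (hmγ.frame hm3 hlay')).mono le_rfl ?_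
    · exact hP n ((γ, x), y) m' ((hm'.ext x hx).ext y hy)
    · rintro m4 ⟨h1, h2, h3, h4, h5⟩
      refine ⟨h2.trans hk3, (hm3.trans h1).write (by omega), ?_⟩
      rw [marked_write]
      have hsound : ∀ x ∈ marked d n m4, ReflTransGen R u x :=
        h4 {x | ReflTransGen R u x} hs fun x hx y hf => hx.tail hf
      refine ⟨h3 hu, hsound, ?_⟩
      by_cases hcl : ∀ x ∈ marked d n m3, ∀ y, R x y → y ∈ marked d n m3
      · have : marked d n m4 ⊆ marked d n m3 := h4 _ subset_rfl hcl
        exact .inl fun x hx y hf => h3 (hcl x (this hx) y hf)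
      · refine .inr ?_
        have hc' := hc.resolve_left hcl
        push Not at hcl
        obtain ⟨x, hx, y, hf, hy⟩ := hcl
        have : (marked d n m3).ncard < (marked d n m4).ncard :=
          Set.ncard_lt_ncard ⟨h3, fun h => hy (h (h5 x hx y hf))⟩ (Set.toFinite _)
        omega
  · rintro m3 ⟨hm3, hu, hs, hc⟩
    have hcl : ∀ x ∈ marked d n m3, ∀ y, R x y → y ∈ marked d n m3 := by
      refine hc.resolve_right fun h => ?_
      have := Set.ncard_le_ncard (Set.subset_univ (marked d n m3)) (Set.toFinite _)
      rw [Set.ncard_univ, Nat.card_eq_fintype_card, Fintype.card_fin] at this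
      omega
    have hmem : ∀ w, ReflTransGen R u w → w ∈ marked d n m3 := by
      intro w h
      induction h with
      | refl => exact hu
      | tail _ h2 ih => exact hcl _ ih _ h2
    have hall : ReflTransGen R u v ↔ v ∈ marked d n m3 := ⟨hmem v, hs v⟩
    have hev : (entry d (reg (lay (Ctx.len Γ + 1)))).eval m3 ≠ 0 ↔ v ∈ marked d n m3 := by
      simp only [entry, Expr.eval, eval_reg, hm3.reg hlv, hmv]
      rfl
    refine Runs.cond (fun h => Runs.setReg ⟨?_, hm3.write le_rfl⟩)
      fun h => Runs.setReg ⟨?_, hm3.write le_rfl⟩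
    · rw [if_pos (hall.2 (hev.1 h))]
      simp [Mem.write, Expr.eval]
    · rw [if_neg fun h' => hev.2 (hall.1 h') h]
      simp [Mem.write, Expr.eval]

theorem CompP.reach {R : ∀ n, Γ n → Fin n → Fin n → Prop}
    (hR : CompP fun n (p : Ext (Ext Γ) n) => R n p.1.1 p.1.2 p.2) :
    CompP (fun n (p : Ext (Ext Γ) n) => ReflTransGen (R n p.1.1) p.1.2 p.2) := by
  obtain ⟨f, hf, hfR⟩ := hR
  refine ⟨_, hf.reach, fun n p => ?_⟩
  simp only [hfR, ne_eq, ite_eq_right_iff, one_ne_zero, imp_false, not_not]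

end Reach

/-! ### Computable transformations of the state -/

open RAM

/-- The transformation `F` of states can be carried out in polynomial time, where all registers
below `d` are preserved. -/
def CompS (F : ∀ n, St n → St n) : Prop :=
  ∀ d, ∃ (P : Program) (q : Polynomial ℕ), ∀ n (σ : St n) m, Rep id σ m →
    Runs P m (q.eval n) fun m' => Rep id (F n σ) m' ∧ ∀ j ≤ d, ∀ k, m' 0 j k = m 0 j k

theorem CompS.skip : CompS fun _ σ => σ := fun _ =>
  ⟨.nop, 1, fun n σ m h => (Runs.nop ⟨h, fun _ _ _ => rfl⟩).mono (by simp) fun _ h => h⟩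

theorem CompS.comp {F G : ∀ n, St n → St n} (hG : CompS G) (hF : CompS F) :
    CompS fun n σ => G n (F n σ) := by
  intro d
  obtain ⟨P, p, hP⟩ := hF d
  obtain ⟨Q, q, hQ⟩ := hG d
  refine ⟨.seq P Q, p + q, fun n σ m hm => ?_⟩
  rw [Polynomial.eval_add]
  exact Runs.seq (hP n σ m hm) fun m1 h1 => (hQ n _ m1 h1.1).mono le_rfl fun m2 h2 =>
    ⟨h2.1, fun j hj k => (h2.2 j hj k).trans (h1.2 j hj k)⟩

theorem CompS.ite {P : ∀ n, St n → Prop} (hP : CompP P) {F G : ∀ n, St n → St n} (hF : CompS F)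
    (hG : CompS G) [∀ n σ, Decidable (P n σ)] :
    CompS fun n σ => if P n σ then F n σ else G n σ := by
  intro d
  obtain ⟨f, hf, hfP⟩ := hP
  obtain ⟨C, r, hC⟩ := hf id d fun k hk => absurd hk (Nat.not_lt_zero _)
  obtain ⟨P, p, hP⟩ := hF d
  obtain ⟨Q, q, hQ⟩ := hG d
  refine ⟨.seq C (.cond (reg d) P Q), r + (p + q + 1), fun n σ m hm => ?_⟩
  simp only [Polynomial.eval_add, Polynomial.eval_one]
  refine Runs.seq (hC n σ m hm) fun m1 h1 => ?_
  have hm1 : Rep id σ m1 := hm.frame h1.2 fun k hk => absurd hk (Nat.not_lt_zero _)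
  refine Runs.cond (fun h => ?_) fun h => ?_
  · rw [eval_reg, h1.1, hfP] at h
    refine (hP n σ m1 hm1).mono le_rfl fun m2 h2 => ⟨by rw [if_pos h]; exact h2.1,
      fun j hj k => (h2.2 j hj k).trans (h1.2 _ _ _ (.inr hj))⟩
  · rw [eval_reg, h1.1, ← not_ne_iff, hfP] at h
    refine (hQ n σ m1 hm1).mono le_rfl fun m2 h2 => ⟨by rw [if_neg h]; exact h2.1,
      fun j hj k => (h2.2 j hj k).trans (h1.2 _ _ _ (.inr hj))⟩

/-- The number of rounds is evaluated once and kept in the register `d`; the body is compiled for `d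
+ 1` and does not touch it. The bound `b` must hold for all states, since the time bound may depend
on `n` only. -/
theorem CompS.iter {F : ∀ n, St n → St n} (hF : CompS F) {f : ∀ n, St n → ℕ} (hf : Comp f)
    (b : Polynomial ℕ) (hb : ∀ n σ, f n σ ≤ b.eval n) :
    CompS fun n σ => (F n)^[f n σ] σ := by
  intro d
  obtain ⟨C, r, hC⟩ := hf id d fun k hk => absurd hk (Nat.not_lt_zero _)
  obtain ⟨P, p, hP⟩ := hF (d + 1)
  refine ⟨.seq C (.loop (reg d) (.seq P (setReg d (.sub (reg d) (.lit 1))))),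
    r + (b * (p + 1 + 1) + 1), fun n σ m hm => ?_⟩
  simp only [Polynomial.eval_add, Polynomial.eval_one, Polynomial.eval_mul]
  refine Runs.seq (hC n σ m hm) fun m1 h1 => ?_
  have hm1 : Rep id σ m1 := hm.frame h1.2 fun k hk => absurd hk (Nat.not_lt_zero _)
  refine (Runs.loop (N := f n σ) (c := p.eval n + 1) (fun k m' => Rep id ((F n)^[k] σ) m' ∧
    m' 0 (d + 1) 0 = f n σ - k ∧ ∀ j ≤ d, ∀ l, m' 0 j l = m 0 j l) ?_ ?_ ?_).mono ?_ ?_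
  · exact fun k m' _ h => h.2.1
  · rintro k m2 hk ⟨h2, h3, h4⟩
    refine Runs.seq (hP n _ m2 h2) fun m3 h5 => Runs.setReg ⟨?_, ?_, ?_⟩
    · rw [Function.iterate_succ_apply']
      exact h5.1.frame ((Frame.refl d m3).write le_rfl) fun k hk => absurd hk (Nat.not_lt_zero _)
    · simp only [Mem.write, and_self, if_true, Expr.eval, eval_reg]
      rw [h5.2 (d + 1) le_rfl, h3]
      omega
    · intro j hj l
      rw [← h4 j hj l, ← h5.2 j (by omega) l]
      exact if_neg (by omega)
  · exact ⟨hm1, by simpa using h1.1, fun j hj l => h1.2 _ _ _ (.inr hj)⟩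
  · gcongr
    exact hb n σ
  · exact fun m' h => ⟨h.1, h.2.2⟩

/-- The buffer `3` is filled with the values of `f`, then it is copied to the array `a`. -/
theorem CompS.set (a : ℕ) {f : ∀ n, St n → Fin n → Fin n → ℕ}
    (hf : Comp fun n (p : Ext (Ext St) n) => f n p.1.1 p.1.2 p.2) :
    CompS fun n σ => Function.update σ a (f n σ) := by
  intro d
  have h00 : ∀ k < Ctx.len St, (id : ℕ → ℕ) k < d := fun k hk => absurd hk (Nat.not_lt_zero _)
  obtain ⟨P, p, hP⟩ := hf (Function.update (Function.update id (Ctx.len St) d)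
    (Ctx.len (Ext St)) (d + 1)) (d + 2)
    (update_lay_lt (update_lay_lt h00 (d' := d + 2) (by omega) (by omega)) le_rfl (by omega))
  -- The values of `f` may depend on the array `a` itself, so nothing is written there until all of
  -- them are known.
  refine ⟨.seq (forReg d (forReg (d + 1) (.seq P
      (.store (.lit 3) (reg d) (reg (d + 1)) (reg (d + 2))))))
    (forReg d (forReg (d + 1) (.store (.lit (place a)) (reg d) (reg (d + 1))
      (.load (.lit 3) (reg d) (reg (d + 1)))))),
    (Polynomial.X * (Polynomial.X * (p + 1 + 2) + 2 + 2) + 2) +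
      (Polynomial.X * (Polynomial.X * (1 + 2) + 2 + 2) + 2), fun n σ m hm => ?_⟩
  simp only [Polynomial.eval_add, Polynomial.eval_one, Polynomial.eval_mul, Polynomial.eval_X,
    Polynomial.eval_ofNat]
  have h3 := fun b => place_ne_three b
  have h0 := fun b => place_ne_zero b
  let B : Mem → Prop := fun m' => ∀ i j k, (i ≠ 0 ∧ i ≠ 3) ∨ (i = 0 ∧ j ≤ d) → m' i j k = m i j k
  have hB : ∀ m', B m' → Rep id σ m' := fun m' h =>
    ⟨(h _ _ _ (.inr ⟨rfl, Nat.zero_le _⟩)).trans hm.size,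
      fun b i j => (h _ _ _ (.inl ⟨h0 b, h3 b⟩)).trans (hm.arr b i j),
      fun k hk => absurd hk (Nat.not_lt_zero _)⟩
  have hBw : ∀ m' r x, B m' → d ≤ r → B (m'.write 0 (r + 1) 0 x) := by
    intro m' r x h hr i j k hh
    rw [← h i j k hh]
    exact if_neg (by omega)
  refine Runs.seq (Runs.forReg (fun k m' => B m' ∧ ∀ i j : Fin n, (i : ℕ) < k → m' 3 i j = f n σ i j)
    (fun k m' h => (hB m' h.1).size)
    ⟨hBw _ _ _ (fun _ _ _ _ => rfl) le_rfl, fun i j hi => absurd hi (Nat.not_lt_zero _)⟩ ?_) ?_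
  · rintro k m1 hk ⟨hB1, h1⟩ hk1
    refine (Runs.forReg (fun l m' => B m' ∧ m' 0 (d + 1) 0 = k ∧
      (∀ i j : Fin n, (i : ℕ) < k → m' 3 i j = f n σ i j) ∧
      ∀ j : Fin n, (j : ℕ) < l → m' 3 k j = f n σ ⟨k, hk⟩ j) (fun k m' h => (hB m' h.1).size)
      ?_ ?_).mono le_rfl ?_
    · refine ⟨hBw _ _ _ hB1 (by omega), ?_, fun i j hi => ?_, fun j hj => absurd hj (Nat.not_lt_zero _)⟩
      · rw [← hk1]; exact if_neg (by omega)
      · rw [← h1 i j hi]; exact if_neg (by omega)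
    · rintro l m2 hl ⟨hB2, hk2, h2, h2'⟩ hl2
      refine Runs.seq (hP n ((σ, ⟨k, hk⟩), ⟨l, hl⟩) m2
        (((hB m2 hB2).ext ⟨k, hk⟩ hk2).ext ⟨l, hl⟩ hl2)) fun m3 h4 => Runs.store ?_
      have e1 : m3 0 (d + 1) 0 = k := (h4.2.reg (by omega) 0).trans hk2
      have e2 : m3 0 (d + 1 + 1) 0 = l := (h4.2.reg (by omega) 0).trans hl2
      have e3 : ∀ j k, m3 3 j k = m2 3 j k := fun j k => h4.2 _ _ _ (.inl (by omega))
      simp only [Expr.eval, eval_reg, e1, e2, h4.1]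
      refine ⟨?_, hBw _ _ _ ?_ (by omega), ?_, fun i j hi => ?_, fun j hj => ?_⟩
      · exact (if_neg (by omega)).trans e2
      · intro i j k hh
        rw [← hB2 i j k hh, ← h4.2 i j k (by omega)]
        exact if_neg (by omega)
      · exact ((if_neg (by omega)).trans (if_neg (by omega))).trans e1
      · rw [← h2 i j hi, ← e3]; exact (if_neg (by omega)).trans (if_neg (by omega))
      · refine (if_neg (by omega)).trans ?_
        by_cases hjl : (j : ℕ) = l
        · obtain rfl : j = ⟨l, hl⟩ := Fin.ext hjl
          exact if_pos ⟨rfl, rfl, rfl⟩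
        · rw [← h2' j (by omega), ← e3]
          exact if_neg (by omega)
    · rintro m2 ⟨hB2, hk2, h2, h2'⟩
      refine ⟨hk2, hBw _ _ _ hB2 le_rfl, fun i j hi => (if_neg (by omega)).trans ?_⟩
      by_cases hik : (i : ℕ) = k
      · obtain rfl : i = ⟨k, hk⟩ := Fin.ext hik
        exact h2' j j.2
      · exact h2 i j (by omega)
  · rintro m1 ⟨hB1, h1⟩
    let D : Mem → Prop := fun m' => ∀ i j k, (i ≠ 0 ∧ i ≠ place a) ∨ (i = 0 ∧ j ≤ d) →
      m' i j k = m1 i j k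
    have hDn : ∀ m', D m' → m' 0 0 0 = n := fun m' h =>
      (h _ _ _ (.inr ⟨rfl, Nat.zero_le _⟩)).trans (hB m1 hB1).size
    have hDw : ∀ m' r x, D m' → d ≤ r → D (m'.write 0 (r + 1) 0 x) := by
      intro m' r x h hr i j k hh
      rw [← h i j k hh]
      exact if_neg (by omega)
    refine (Runs.forReg (fun k m' => D m' ∧ ∀ i j : Fin n, (i : ℕ) < k →
      m' (place a) i j = f n σ i j) (fun k m' h => hDn m' h.1)
      ⟨hDw _ _ _ (fun _ _ _ _ => rfl) le_rfl, fun i j hi => absurd hi (Nat.not_lt_zero _)⟩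
      ?_).mono le_rfl ?_
    · rintro k m2 hk ⟨hD2, h2⟩ hk2
      refine (Runs.forReg (fun l m' => D m' ∧ m' 0 (d + 1) 0 = k ∧
        (∀ i j : Fin n, (i : ℕ) < k → m' (place a) i j = f n σ i j) ∧
        ∀ j : Fin n, (j : ℕ) < l → m' (place a) k j = f n σ ⟨k, hk⟩ j) (fun k m' h => hDn m' h.1)
        ?_ ?_).mono le_rfl ?_
      · refine ⟨hDw _ _ _ hD2 (by omega), ?_, fun i j hi => ?_,
          fun j hj => absurd hj (Nat.not_lt_zero _)⟩
        · rw [← hk2]; exact if_neg (by omega)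
        · rw [← h2 i j hi]; exact if_neg fun h => h0 a h.1
      · rintro l m3 hl ⟨hD3, hk3, h4, h4'⟩ hl3
        refine Runs.store ?_
        have e3 : m3 3 k l = f n σ ⟨k, hk⟩ ⟨l, hl⟩ :=
          (hD3 _ _ _ (.inl ⟨by omega, (h3 a).symm⟩)).trans (h1 ⟨k, hk⟩ ⟨l, hl⟩ hk)
        simp only [Expr.eval, eval_reg, hk3, hl3, e3]
        refine ⟨?_, hDw _ _ _ ?_ (by omega), ?_, fun i j hi => ?_, fun j hj => ?_⟩
        · exact (if_neg fun h => h0 a h.1.symm).trans hl3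
        · intro i j k hh
          rw [← hD3 i j k hh]
          refine if_neg fun h => ?_
          rcases hh with hh | hh
          · exact hh.2 h.1
          · exact h0 a (h.1.symm.trans hh.1)
        · exact ((if_neg (by omega)).trans (if_neg fun h => h0 a h.1.symm)).trans hk3
        · rw [← h4 i j hi]; exact (if_neg fun h => h0 a h.1).trans (if_neg (by omega))
        · refine (if_neg fun h => h0 a h.1).trans ?_
          by_cases hjl : (j : ℕ) = l
          · obtain rfl : j = ⟨l, hl⟩ := Fin.ext hjl
            exact if_pos ⟨rfl, rfl, rfl⟩
          · rw [← h4' j (by omega)]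
            exact if_neg (by omega)
      · rintro m3 ⟨hD3, hk3, h4, h4'⟩
        refine ⟨hk3, hDw _ _ _ hD3 le_rfl, fun i j hi => (if_neg fun h => h0 a h.1).trans ?_⟩
        by_cases hik : (i : ℕ) = k
        · obtain rfl : i = ⟨k, hk⟩ := Fin.ext hik
          exact h4' j j.2
        · exact h4 i j (by omega)
    · rintro m2 ⟨hD2, h2⟩
      refine ⟨⟨hDn m2 hD2, fun b i j => ?_, fun k hk => absurd hk (Nat.not_lt_zero _)⟩,
        fun j hj k => (hD2 _ _ _ (.inr ⟨rfl, hj⟩)).trans (hB1 _ _ _ (.inr ⟨rfl, hj⟩))⟩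
      change _ = Function.update σ a (f n σ) b i j
      by_cases hb : b = a
      · subst hb
        rw [Function.update_self]
        exact h2 i j i.2
      · rw [Function.update_of_ne hb]
        exact (hD2 _ _ _ (.inl ⟨h0 b, fun h => hb (place_inj.1 h)⟩)).trans ((hB m1 hB1).arr b i j)

/-! ### Computable sets, relations, graphs and instances -/

section Objects

variable {Γ Δ : ℕ → Type} [Ctx Γ] [Ctx Δ]

def RelC (R : ∀ n, Γ n → Fin n → Fin n → Prop) : Prop :=
  CompP fun n (p : Ext (Ext Γ) n) => R n p.1.1 p.1.2 p.2

def SetC (S : ∀ n, Γ n → Set (Fin n)) : Prop := CompP fun n (p : Ext Γ n) => p.2 ∈ S n p.1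

structure GraphC (H : ∀ n, Γ n → VGraph (Fin n)) : Prop where
  verts : SetC fun n γ => (H n γ).verts
  adj : RelC fun n γ => (H n γ).Adj

structure InstC (I : ∀ n, Γ n → CMCInstance (Fin n)) : Prop where
  graph : GraphC fun n γ => (I n γ).graph
  weight : RelC fun n γ u v => (I n γ).weight s(u, v) = 1

theorem RelC.app {R : ∀ n, Γ n → Fin n → Fin n → Prop} (hR : RelC R) {i j : ∀ n, Γ n → Fin n}
    (hi : VertC i) (hj : VertC j) : CompP (fun n γ => R n γ (i n γ) (j n γ)) :=
  CompP.comp hR ((CtxHom.id.pair hi).pair hj)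

theorem SetC.app {S : ∀ n, Γ n → Set (Fin n)} (hS : SetC S) {i : ∀ n, Γ n → Fin n}
    (hi : VertC i) : CompP (fun n γ => i n γ ∈ S n γ) :=
  CompP.comp hS (CtxHom.id.pair hi)

theorem RelC.comp {R : ∀ n, Δ n → Fin n → Fin n → Prop} (hR : RelC R) {h : ∀ n, Γ n → Δ n}
    (hh : CtxHom h) : RelC (fun n γ => R n (h n γ)) :=
  CompP.comp hR (((hh.comp (CtxHom.fst.comp CtxHom.fst)).pair VertC.snd.wk).pair VertC.snd)

theorem SetC.comp {S : ∀ n, Δ n → Set (Fin n)} (hS : SetC S) {h : ∀ n, Γ n → Δ n}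
    (hh : CtxHom h) : SetC (fun n γ => S n (h n γ)) :=
  CompP.comp hS ((hh.comp CtxHom.fst).pair VertC.snd)

theorem GraphC.comp {H : ∀ n, Δ n → VGraph (Fin n)} (hH : GraphC H) {h : ∀ n, Γ n → Δ n}
    (hh : CtxHom h) : GraphC (fun n γ => H n (h n γ)) := ⟨hH.verts.comp hh, hH.adj.comp hh⟩

theorem InstC.comp {I : ∀ n, Δ n → CMCInstance (Fin n)} (hI : InstC I) {h : ∀ n, Γ n → Δ n}
    (hh : CtxHom h) : InstC (fun n γ => I n (h n γ)) := ⟨hI.graph.comp hh, hI.weight.comp hh⟩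

theorem RelC.wk {R : ∀ n, Γ n → Fin n → Fin n → Prop} (hR : RelC R) :
    RelC (fun n (p : Ext Γ n) => R n p.1) := hR.comp CtxHom.fst

theorem SetC.wk {S : ∀ n, Γ n → Set (Fin n)} (hS : SetC S) :
    SetC (fun n (p : Ext Γ n) => S n p.1) := hS.comp CtxHom.fst

theorem GraphC.wk {H : ∀ n, Γ n → VGraph (Fin n)} (hH : GraphC H) :
    GraphC (fun n (p : Ext Γ n) => H n p.1) := hH.comp CtxHom.fst

theorem InstC.wk {I : ∀ n, Γ n → CMCInstance (Fin n)} (hI : InstC I) :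
    InstC (fun n (p : Ext Γ n) => I n p.1) := hI.comp CtxHom.fst

theorem sym2_eq {a b c d : ∀ n, Γ n → Fin n} (ha : VertC a) (hb : VertC b) (hc : VertC c)
    (hd : VertC d) : CompP (fun n γ => s(a n γ, b n γ) = s(c n γ, d n γ)) :=
  (((ha.eq hc).and (hb.eq hd)).or ((ha.eq hd).and (hb.eq hc))).congr fun _ _ => Sym2.eq_iff.symm

theorem SetC.ncard {S : ∀ n, Γ n → Set (Fin n)} (hS : SetC S) : Comp fun n γ => (S n γ).ncard :=
  (Comp.sum (f := fun n γ v => if v ∈ S n γ then 1 else 0) (CompP.ind hS)).congr fun n γ => by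
    rw [← card_filter_mem, Finset.card_filter]

theorem GraphC.deg {H : ∀ n, Γ n → VGraph (Fin n)} (hH : GraphC H) {i : ∀ n, Γ n → Fin n}
    (hi : VertC i) : Comp fun n γ => VGraph.deg (H n γ) (i n γ) :=
  SetC.ncard (S := fun n γ => (H n γ).neighborSet (i n γ)) (hH.wk.adj.app hi.wk VertC.snd)

theorem GraphC.leaves {H : ∀ n, Γ n → VGraph (Fin n)} (hH : GraphC H) :
    SetC fun n γ => VGraph.leaves (H n γ) :=
  CompP.and hH.verts ((hH.wk.deg VertC.snd).le (.lit 1))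

theorem RelC.connOn {R : ∀ n, Γ n → Fin n → Fin n → Prop} (hR : RelC R)
    {S : ∀ n, Γ n → Set (Fin n)} (hS : SetC S) : CompP fun n γ => ConnOn (R n γ) (S n γ) := by
  refine CompP.and (CompP.ex (P := fun n γ v => v ∈ S n γ) hS)
    ((CompP.all (P := fun n γ u => ∀ v, u ∈ S n γ → v ∈ S n γ → ReflTransGen (fun a b =>
      a ∈ S n γ ∧ b ∈ S n γ ∧ R n γ a b) u v) (CompP.all ?_)).congr fun n γ =>
      ⟨fun h u hu v hv => h u v hu hv, fun h u v hu hv => h u hu v hv⟩)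
  refine (hS.wk.wk.app VertC.snd.wk).imp ((hS.wk.wk.app VertC.snd).imp ?_)
  exact CompP.reach (R := fun n γ a b => a ∈ S n γ ∧ b ∈ S n γ ∧ R n γ a b) ((hS.wk.wk.app VertC.snd.wk).and ((hS.wk.wk.app VertC.snd).and hR))

theorem RelC.arcs {R : ∀ n, Γ n → Fin n → Fin n → Prop} (hR : RelC R)
    {A B : ∀ n, Γ n → Set (Fin n)} (hA : SetC A) (hB : SetC B) :
    Comp fun n γ => arcs (R n γ) (A n γ) (B n γ) :=
  Comp.sum (f := fun n γ u => ∑ v, if u ∈ A n γ ∧ v ∈ B n γ ∧ R n γ u v then 1 else 0)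
    (Comp.sum (f := fun n (p : Ext Γ n) v =>
      if p.2 ∈ A n p.1 ∧ v ∈ B n p.1 ∧ R n p.1 p.2 v then 1 else 0)
    (CompP.ind ((hA.wk.wk.app VertC.snd.wk).and ((hB.wk.wk.app VertC.snd).and hR))))

theorem SetC.compl {S : ∀ n, Γ n → Set (Fin n)} (hS : SetC S) : SetC fun n γ => (S n γ)ᶜ :=
  CompP.not hS

theorem SetC.diff {S T : ∀ n, Γ n → Set (Fin n)} (hS : SetC S) (hT : SetC T) :
    SetC fun n γ => S n γ \ T n γ := CompP.and hS (CompP.not hT)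

theorem SetC.union {S T : ∀ n, Γ n → Set (Fin n)} (hS : SetC S) (hT : SetC T) :
    SetC fun n γ => S n γ ∪ T n γ := CompP.or hS hT

theorem SetC.singleton {i : ∀ n, Γ n → Fin n} (hi : VertC i) : SetC fun n γ => {i n γ} :=
  VertC.eq VertC.snd hi.wk

theorem SetC.pair {i j : ∀ n, Γ n → Fin n} (hi : VertC i) (hj : VertC j) :
    SetC fun n γ => {i n γ, j n γ} :=
  (VertC.eq VertC.snd hi.wk).or (VertC.eq VertC.snd hj.wk)

theorem SetC.univ : SetC fun n (_ : Γ n) => Set.univ :=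
  ((Comp.lit 1).eq (Comp.lit 1)).congr fun _ _ => by simp

theorem SetC.ite {P : ∀ n, Γ n → Prop} (hP : CompP P) {S T : ∀ n, Γ n → Set (Fin n)} (hS : SetC S)
    (hT : SetC T) [∀ n γ, Decidable (P n γ)] : SetC fun n γ => if P n γ then S n γ else T n γ :=
  ((hP.wk.and hS).or (hP.wk.not.and hT)).congr fun n γ => by
    by_cases h : P n γ.1 <;> simp [h]

theorem GraphC.ite {P : ∀ n, Γ n → Prop} (hP : CompP P) {S T : ∀ n, Γ n → VGraph (Fin n)}
    (hS : GraphC S) (hT : GraphC T) [∀ n γ, Decidable (P n γ)] :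
    GraphC fun n γ => if P n γ then S n γ else T n γ := by
  refine ⟨?_, ?_⟩
  · refine (SetC.ite hP hS.verts hT.verts).congr fun n γ => ?_
    by_cases h : P n γ.1 <;> simp [h]
  · refine ((hP.wk.wk.and hS.adj).or (hP.wk.wk.not.and hT.adj)).congr fun n γ => ?_
    by_cases h : P n γ.1.1 <;> simp [h]

theorem InstC.one {I : ∀ n, Γ n → CMCInstance (Fin n)} (hI : InstC I) :
    RelC fun n γ => One (I n γ) := CompP.and hI.graph.adj hI.weight

theorem InstC.cutW {I : ∀ n, Γ n → CMCInstance (Fin n)} (hI : InstC I) {S : ∀ n, Γ n → Set (Fin n)}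
    (hS : SetC S) : Comp fun n γ => (I n γ).cutW (S n γ) :=
  (hI.one.arcs hS hS.compl).congr fun _ _ => (cutW_eq _).symm

theorem InstC.leafWeight {I : ∀ n, Γ n → CMCInstance (Fin n)} (hI : InstC I)
    {T : ∀ n, Γ n → VGraph (Fin n)} (hT : GraphC T) : Comp fun n γ => (I n γ).leafWeight (T n γ) :=
  (hI.one.arcs hT.leaves SetC.univ).congr fun _ _ => (leafWeight_eq _).symm

theorem GraphC.exch {T : ∀ n, Γ n → VGraph (Fin n)} (hT : GraphC T) {u v x y : ∀ n, Γ n → Fin n}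
    (hu : VertC u) (hv : VertC v) (hx : VertC x) (hy : VertC y) :
    GraphC fun n γ => exch (T n γ) (u n γ) (v n γ) (x n γ) (y n γ) :=
  ⟨hT.verts, ((hT.verts.wk.wk.app VertC.snd.wk).and (hT.verts.wk.wk.app VertC.snd)).and
    ((VertC.eq VertC.snd.wk VertC.snd).not.and
      ((sym2_eq VertC.snd.wk VertC.snd hx.wk.wk hy.wk.wk).not.and
        (CompP.or hT.adj (sym2_eq VertC.snd.wk VertC.snd hu.wk.wk hv.wk.wk))))⟩

theorem GraphC.contract {T : ∀ n, Γ n → VGraph (Fin n)} (hT : GraphC T) {u v x : ∀ n, Γ n → Fin n}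
    (hu : VertC u) (hv : VertC v) (hx : VertC x) :
    GraphC fun n γ => VGraph.contract (T n γ) (u n γ) (v n γ) (x n γ) := by
  have hs : SetC fun n γ => (T n γ).verts \ {v n γ} := hT.verts.diff (.singleton hv)
  exact ⟨hs, ((hs.wk.wk.app VertC.snd.wk).and (hs.wk.wk.app VertC.snd)).and
    ((VertC.eq VertC.snd.wk VertC.snd).not.and
      (CompP.or hT.adj (sym2_eq VertC.snd.wk VertC.snd hu.wk.wk hx.wk.wk)))⟩

theorem GraphC.dropVertex {T : ∀ n, Γ n → VGraph (Fin n)} (hT : GraphC T) {v : ∀ n, Γ n → Fin n}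
    (hv : VertC v) : GraphC fun n γ => VGraph.dropVertex (T n γ) (v n γ) := by
  have hs : SetC fun n γ => (T n γ).verts \ {v n γ} := hT.verts.diff (.singleton hv)
  exact ⟨hs, ((hs.wk.wk.app VertC.snd.wk).and (hs.wk.wk.app VertC.snd)).and
    ((VertC.eq VertC.snd.wk VertC.snd).not.and
      (CompP.or hT.adj ((hT.adj.wk.wk.app hv.wk.wk VertC.snd.wk).and
        (hT.adj.wk.wk.app hv.wk.wk VertC.snd))))⟩

theorem GraphC.deleteVerts {T : ∀ n, Γ n → VGraph (Fin n)} (hT : GraphC T)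
    {S : ∀ n, Γ n → Set (Fin n)} (hS : SetC S) : GraphC fun n γ => (T n γ).deleteVerts (S n γ) :=
  ⟨hT.verts.diff hS, (((hT.verts.diff hS).wk.wk.app VertC.snd.wk).and
    (((hT.verts.diff hS).wk.wk.app VertC.snd).and hT.adj)).congr fun n γ => by
      simp only [SimpleGraph.Subgraph.deleteVerts_adj, Set.mem_sdiff]
      tauto⟩

theorem GraphC.expand {T : ∀ n, Γ n → VGraph (Fin n)} (hT : GraphC T) {u v x : ∀ n, Γ n → Fin n}
    (hu : VertC u) (hv : VertC v) (hx : VertC x) :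
    GraphC fun n γ => VGraph.expand (u n γ) (v n γ) (x n γ) (T n γ) := by
  refine GraphC.ite (hT.adj.app hu hx) ⟨?_, ?_⟩ hT
  · exact hT.verts.union ((VertC.eq VertC.snd hu.wk).or (SetC.pair hv hx))
  · exact (VertC.eq VertC.snd.wk VertC.snd).not.and ((CompP.and hT.adj
      (sym2_eq VertC.snd.wk VertC.snd hu.wk.wk hx.wk.wk).not).or
      ((sym2_eq VertC.snd.wk VertC.snd hu.wk.wk hv.wk.wk).or
        (sym2_eq VertC.snd.wk VertC.snd hv.wk.wk hx.wk.wk)))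

theorem GraphC.isThinPath {T : ∀ n, Γ n → VGraph (Fin n)} (hT : GraphC T)
    {a b c d : ∀ n, Γ n → Fin n} (ha : VertC a) (hb : VertC b) (hc : VertC c) (hd : VertC d) :
    CompP fun n γ => VGraph.IsThinPath (T n γ) (a n γ) (b n γ) (c n γ) (d n γ) :=
  ((hT.adj.app ha hb).and ((hT.adj.app hb hc).and ((hT.adj.app hc hd).and
    (((hT.deg hb).eq (.lit 2)).and (((hT.deg hc).eq (.lit 2)).and (((hT.deg hd).eq (.lit 2)).and
      ((ha.eq hc).not.and ((ha.eq hd).not.and (hb.eq hd).not)))))))).congr fun _ _ =>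
    ⟨fun ⟨h1, h2, h3, h4, h5, h6, h7, h8, h9⟩ => ⟨h1, h2, h3, h4, h5, h6, h7, h8, h9⟩,
      fun ⟨h1, h2, h3, h4, h5, h6, h7, h8, h9⟩ => ⟨h1, h2, h3, h4, h5, h6, h7, h8, h9⟩⟩

theorem GraphC.improves {H T : ∀ n, Γ n → VGraph (Fin n)} (hH : GraphC H) (hT : GraphC T)
    {u v x y : ∀ n, Γ n → Fin n} (hu : VertC u) (hv : VertC v) (hx : VertC x) (hy : VertC y) :
    CompP fun n γ => Improves (H n γ) (T n γ) (u n γ) (v n γ) (x n γ) (y n γ) :=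
  (hH.adj.app hu hv).and ((hT.adj.app hx hy).and (((hT.exch hu hv hx hy).adj.connOn hT.verts).and
    ((hT.adj.app hu hv).or (hT.leaves.ncard.lt (hT.exch hu hv hx hy).leaves.ncard))))

theorem InstC.dropVertex {I : ∀ n, Γ n → CMCInstance (Fin n)} (hI : InstC I)
    {v : ∀ n, Γ n → Fin n} (hv : VertC v) : InstC fun n γ => (I n γ).dropVertex (v n γ) :=
  ⟨hI.graph.dropVertex hv, (CompP.and hI.graph.adj hI.weight).congr fun n γ => by
    by_cases h : (I n γ.1.1).graph.Adj γ.1.2 γ.2 <;> simp [CMCInstance.dropVertex, h]⟩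

theorem fin2_cases (x : Fin 2) : x = 0 ∨ x = 1 := by omega

theorem InstC.weightN {I : ∀ n, Γ n → CMCInstance (Fin n)} (hI : InstC I)
    {u v : ∀ n, Γ n → Fin n} (hu : VertC u) (hv : VertC v) :
    Comp fun n γ => ((I n γ).weight s(u n γ, v n γ) : ℕ) :=
  (CompP.ind (hI.weight.app hu hv)).congr fun n γ => by
    rcases fin2_cases ((I n γ).weight s(u n γ, v n γ)) with h | h <;> simp [h]

theorem InstC.contract {I : ∀ n, Γ n → CMCInstance (Fin n)} (hI : InstC I)
    {a b c d : ∀ n, Γ n → Fin n} (ha : VertC a) (hb : VertC b) (hc : VertC c) (hd : VertC d) :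
    InstC fun n γ => (I n γ).contract (a n γ) (b n γ) (c n γ) (d n γ) := by
  refine ⟨hI.graph.contract hb hc hd, ?_⟩
  have hk := ((hI.weightN ha hb).add (hI.weightN hb hc)).add (hI.weightN hc hd)
  refine ((Comp.eq (CompP.ite (sym2_eq VertC.snd.wk VertC.snd ha.wk.wk hb.wk.wk)
    (((Comp.lit 2).le hk).wk.wk.ind) (CompP.ite (sym2_eq VertC.snd.wk VertC.snd hb.wk.wk hd.wk.wk)
    (((Comp.lit 1).le hk).wk.wk.ind) (hI.wk.wk.weightN VertC.snd.wk VertC.snd))) (.lit 1))).congr ?_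
  intro n γ
  simp only [CMCInstance.contract]
  split_ifs
  all_goals first
    | simp
    | (rcases fin2_cases ((I n γ.1.1).weight s(γ.1.2, γ.2)) with h | h <;> simp [h])

end Objects

/-! ### Objects kept in arrays -/

section Encodings

variable {n : ℕ}

/-- The graphs have no loops, so the diagonal is free to store the vertex set. -/
noncomputable def encG (H : VGraph (Fin n)) : Fin n → Fin n → ℕ :=
  fun i j => if (i = j ∧ i ∈ H.verts) ∨ H.Adj i j then 1 else 0

def decG (A : Fin n → Fin n → ℕ) : VGraph (Fin n) where
  verts := {v | A v v ≠ 0}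
  Adj u v := u ≠ v ∧ (A u u ≠ 0 ∧ A v v ≠ 0) ∧ A u v ≠ 0 ∧ A v u ≠ 0
  adj_sub h := h.1
  edge_vert h := h.2.1.1
  symm := ⟨fun _ _ h => ⟨h.1.symm, h.2.1.symm, h.2.2.symm⟩⟩

@[simp] theorem decG_encG (H : VGraph (Fin n)) : decG (encG H) = H := by
  have hv : (decG (encG H)).verts = H.verts := by
    ext v
    have : ¬ H.Adj v v := fun h => h.ne rfl
    simp [decG, encG, this]
  refine SimpleGraph.Subgraph.ext hv ?_
  ext u v
  simp only [decG, encG]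
  constructor
  · rintro ⟨h1, -, h2, -⟩
    simpa [h1] using h2
  · intro h
    simp [h, h.symm, h.ne, h.fst_mem, h.snd_mem]

noncomputable def encW (w : Sym2 (Fin n) → Fin 2) : Fin n → Fin n → ℕ := fun i j => w s(i, j)

noncomputable def decW (A : Fin n → Fin n → ℕ) : Sym2 (Fin n) → Fin 2 :=
  fun e => if ∃ u v, e = s(u, v) ∧ A u v ≠ 0 then 1 else 0

theorem decW_eq (A : Fin n → Fin n → ℕ) (u v : Fin n) :
    decW A s(u, v) = 1 ↔ A u v ≠ 0 ∨ A v u ≠ 0 := by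
  have : (∃ u' v', s(u, v) = s(u', v') ∧ A u' v' ≠ 0) ↔ A u v ≠ 0 ∨ A v u ≠ 0 := by
    constructor
    · rintro ⟨u', v', h, h'⟩
      rcases Sym2.eq_iff.1 h with ⟨rfl, rfl⟩ | ⟨rfl, rfl⟩
      · exact .inl h'
      · exact .inr h'
    · rintro (h | h)
      · exact ⟨u, v, rfl, h⟩
      · exact ⟨v, u, Sym2.eq_swap, h⟩
  unfold decW
  rw [if_congr this rfl rfl]
  by_cases h : A u v ≠ 0 ∨ A v u ≠ 0 <;> simp [h]

@[simp] theorem decW_encW (w : Sym2 (Fin n) → Fin 2) : decW (encW w) = w := by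
  ext e
  induction e using Sym2.ind with
  | _ u v =>
    have h := decW_eq (encW w) u v
    simp only [encW, Sym2.eq_swap (a := v) (b := u), or_self] at h
    rcases fin2_cases (w s(u, v)) with h1 | h1 <;>
      rcases fin2_cases (decW (encW w) s(u, v)) with h2 | h2
    · rw [h1]; exact congrArg Fin.val h2
    · exact absurd h1 (by have := h.1 h2; intro h3; simp [h3] at this)
    · have := h.2 (by simp [h1])
      rw [this] at h2
      exact absurd h2 (by decide)
    · rw [h1]; exact congrArg Fin.val h2

/-- Graph and weights of an instance in one array. -/
noncomputable def encI (I : CMCInstance (Fin n)) : Fin n → Fin n → ℕ :=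
  fun i j => encG I.graph i j + (encW I.weight i j + encW I.weight i j)

/-- An entry is the graph bit plus twice the weight bit: odd entries belong to the graph, and
entries of at least two have weight one. Weights are stored for non-edges too, so that decoding
recovers the instance exactly. -/
noncomputable def decI (A : Fin n → Fin n → ℕ) : CMCInstance (Fin n) where
  graph := decG fun i j => if A i j = 1 ∨ A i j = 3 then 1 else 0
  weight := decW fun i j => A i j - 1

@[simp] theorem decI_encI (I : CMCInstance (Fin n)) : decI (encI I) = I := by
  have h : ∀ i j, (encG I.graph i j = 0 ∨ encG I.graph i j = 1) ∧
      (encW I.weight i j = 0 ∨ encW I.weight i j = 1) := fun i j => by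
    constructor
    · unfold encG; split_ifs <;> simp
    · unfold encW; omega
  have h1 : (fun i j => if encI I i j = 1 ∨ encI I i j = 3 then 1 else 0) = encG I.graph := by
    ext i j
    unfold encI
    rcases h i j with ⟨h1 | h1, h2 | h2⟩ <;> simp [h1, h2]
  have h2 : decW (fun i j => encI I i j - 1) = decW (encW I.weight) := by
    unfold decW
    have : ∀ u v, encI I u v - 1 ≠ 0 ↔ encW I.weight u v ≠ 0 := fun u v => by
      unfold encI
      rcases h u v with ⟨h1 | h1, h2 | h2⟩ <;> simp [h1, h2]
    simp only [this]
  unfold decI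
  rw [h1, h2, decG_encG, decW_encW]

/-- The rows are constant: `decS` reads the diagonal, whereas the final output is read from column
0. -/
noncomputable def encS (S : Set (Fin n)) : Fin n → Fin n → ℕ := fun i _ => if i ∈ S then 1 else 0

def decS (A : Fin n → Fin n → ℕ) : Set (Fin n) := {v | A v v ≠ 0}

@[simp] theorem decS_encS (S : Set (Fin n)) : decS (encS S) = S := by
  ext; simp [decS, encS]

def encN (k : ℕ) : Fin n → Fin n → ℕ := fun _ _ => k

/-- The entry at (0, 0), written as a sum because `Fin n` need not have an element 0. -/
def decN (A : Fin n → Fin n → ℕ) : ℕ := ∑ v : Fin n, if (v : ℕ) = 0 then A v v else 0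

@[simp] theorem decN_encN [NeZero n] (k : ℕ) : decN (encN k : Fin n → Fin n → ℕ) = k := by
  unfold decN encN
  rw [Finset.sum_eq_single 0]
  · simp
  · intro v _ hv
    exact if_neg fun h => hv (Fin.ext h)
  · simp

end Encodings

/-! ### Reading and writing encoded objects -/

section States

theorem Comp.arr (a : ℕ) : Comp fun n (p : Ext (Ext St) n) => p.1.1 a p.1.2 p.2 :=
  Comp.get a VertC.snd.wk VertC.snd

theorem Comp.arrApp {Γ : ℕ → Type} [Ctx Γ] (a : ℕ) {s : ∀ n, Γ n → St n} (hs : CtxHom s)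
    {i j : ∀ n, Γ n → Fin n} (hi : VertC i) (hj : VertC j) :
    Comp fun n γ => s n γ a (i n γ) (j n γ) :=
  (Comp.arr a).comp ((hs.pair hi).pair hj)

theorem GraphC.dec {Γ : ℕ → Type} [Ctx Γ] {A : ∀ n, Γ n → Fin n → Fin n → ℕ}
    (hA : Comp fun n (p : Ext (Ext Γ) n) => A n p.1.1 p.1.2 p.2) : GraphC fun n γ => decG (A n γ) := by
  have hR : RelC fun n γ u v => A n γ u v ≠ 0 := hA.ne_zero
  have v0 : VertC fun n (p : Ext (Ext Γ) n) => p.2 := VertC.snd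
  have v1 : VertC fun n (p : Ext (Ext Γ) n) => p.1.2 := VertC.snd.wk
  exact ⟨hR.wk.app VertC.snd VertC.snd, (v1.eq v0).not.and (((hR.wk.wk.app v1 v1).and
    (hR.wk.wk.app v0 v0)).and ((hR.wk.wk.app v1 v0).and (hR.wk.wk.app v0 v1)))⟩

theorem GraphC.state (a : ℕ) : GraphC fun n (σ : St n) => decG (σ a) := GraphC.dec (Comp.arr a)

theorem InstC.state (a : ℕ) : InstC fun n (σ : St n) => decI (σ a) := by
  have hA := Comp.arr a
  refine ⟨GraphC.dec (A := fun n (σ : St n) i j => if σ a i j = 1 ∨ σ a i j = 3 then 1 else 0)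
    (CompP.ind ((hA.eq (.lit 1)).or (hA.eq (.lit 3)))), ?_⟩
  have hR : RelC fun n (σ : St n) u v => σ a u v - 1 ≠ 0 :=
    (hA.sub (.lit 1)).ne_zero
  exact (CompP.or hR (hR.wk.wk.app VertC.snd VertC.snd.wk)).congr fun n γ =>
    (decW_eq (fun i j => γ.1.1 a i j - 1) γ.1.2 γ.2).symm

theorem SetC.state (a : ℕ) : SetC fun n (σ : St n) => decS (σ a) :=
  (Comp.arrApp a CtxHom.fst VertC.snd VertC.snd).ne_zero

theorem Comp.state (a : ℕ) : Comp fun n (σ : St n) => decN (σ a) :=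
  Comp.sum (f := fun n (σ : St n) v => if (v : ℕ) = 0 then σ a v v else 0)
    (CompP.ite (Comp.eq VertC.snd (.lit 0)) (Comp.arrApp a CtxHom.fst VertC.snd VertC.snd) (.lit 0))

theorem CompS.setG (a : ℕ) {H : ∀ n, St n → VGraph (Fin n)} (hH : GraphC H) :
    CompS fun n σ => Function.update σ a (encG (H n σ)) :=
  CompS.set a (f := fun n σ => encG (H n σ)) (CompP.ind
    (((VertC.eq VertC.snd.wk VertC.snd).and (hH.verts.wk.wk.app VertC.snd.wk)).or hH.adj))

theorem CompS.setS (a : ℕ) {S : ∀ n, St n → Set (Fin n)} (hS : SetC S) :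
    CompS fun n σ => Function.update σ a (encS (S n σ)) :=
  CompS.set a (f := fun n σ => encS (S n σ)) (CompP.ind (hS.wk.wk.app VertC.snd.wk))

theorem CompS.setN (a : ℕ) {k : ∀ n, St n → ℕ} (hk : Comp k) :
    CompS fun n σ => Function.update σ a (encN (k n σ)) :=
  CompS.set a (f := fun n σ => encN (k n σ)) hk.wk.wk

theorem CompS.setI (a : ℕ) {I : ∀ n, St n → CMCInstance (Fin n)} (hI : InstC I) :
    CompS fun n σ => Function.update σ a (encI (I n σ)) := by
  have hw := hI.wk.wk.weightN VertC.snd.wk VertC.snd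
  exact CompS.set a (f := fun n σ => encI (I n σ)) ((CompP.ind
    (((VertC.eq VertC.snd.wk VertC.snd).and (hI.graph.verts.wk.wk.app VertC.snd.wk)).or
      hI.graph.adj)).add (hw.add hw))

end States

/-! ### Deterministic choices -/

section Pick

variable {n : ℕ} {β : Type}

/-- `v` is the last vertex with the property `P`. -/
def Last (P : Fin n → Prop) (v : Fin n) : Prop := P v ∧ ∀ u, P u → u ≤ v

theorem Last.unique {P : Fin n → Prop} {u v : Fin n} (hu : Last P u) (hv : Last P v) : u = v :=
  le_antisymm (hv.2 u hu.1) (hu.2 v hv.1)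

theorem exists_last {P : Fin n → Prop} (h : ∃ v, P v) : ∃ v, Last P v := by
  obtain ⟨v, hv, hmax⟩ := Set.exists_max_image {v | P v} id (Set.toFinite _) h
  exact ⟨v, hv, hmax⟩

/-- `f v` for the last vertex `v` with the property `P`, and `x` if there is none. -/
noncomputable def pick (P : Fin n → Prop) (f : Fin n → β) (x : β) : β :=
  if h : ∃ v, Last P v then f h.choose else x

theorem pick_eq_of_last {P : Fin n → Prop} {v : Fin n} (h : Last P v) (f : Fin n → β) (x : β) :
    pick P f x = f v := by
  have hex : ∃ v, Last P v := ⟨v, h⟩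
  unfold pick
  rw [dif_pos hex, hex.choose_spec.unique h]

theorem pick_eq_of_not {P : Fin n → Prop} (h : ∀ v, ¬ P v) (f : Fin n → β) (x : β) :
    pick P f x = x := dif_neg fun ⟨v, hv⟩ => h v hv.1

/-- Any property of the chosen object becomes a formula with quantifiers over vertices. This is what
makes choices computable. -/
theorem pick_iff {P : Fin n → Prop} {f : Fin n → β} {x : β} (φ : β → Prop) :
    φ (pick P f x) ↔ (∃ v, Last P v ∧ φ (f v)) ∨ ((¬ ∃ v, P v) ∧ φ x) := by
  by_cases h : ∃ v, P v
  · obtain ⟨v, hv⟩ := exists_last h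
    rw [pick_eq_of_last hv]
    constructor
    · exact fun h' => .inl ⟨v, hv, h'⟩
    · rintro (⟨u, hu, h'⟩ | ⟨h', -⟩)
      · rwa [hv.unique hu]
      · exact absurd h h'
  · rw [pick_eq_of_not (not_exists.1 h)]
    constructor
    · exact fun h' => .inr ⟨h, h'⟩
    · rintro (⟨u, hu, -⟩ | ⟨-, h'⟩)
      · exact absurd ⟨u, hu.1⟩ h
      · exact h'

/-- The lexicographically last quadruple: each coordinate is the last one that can still be
completed. -/
noncomputable def pick4 (P : Fin n → Fin n → Fin n → Fin n → Prop)
    (f : Fin n → Fin n → Fin n → Fin n → β) (x : β) : β :=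
  pick (fun a => ∃ b c d, P a b c d) (fun a => pick (fun b => ∃ c d, P a b c d)
    (fun b => pick (fun c => ∃ d, P a b c d) (fun c => pick (P a b c) (f a b c) x) x) x) x

theorem pick4_eq_of_not {P : Fin n → Fin n → Fin n → Fin n → Prop} (h : ∀ a b c d, ¬ P a b c d)
    (f : Fin n → Fin n → Fin n → Fin n → β) (x : β) : pick4 P f x = x :=
  pick_eq_of_not (fun a ⟨b, c, d, h'⟩ => h a b c d h') _ _

/-- All choices for the same property `P` select the same quadruple. -/
theorem exists_pick4 {P : Fin n → Fin n → Fin n → Fin n → Prop} (h : ∃ a b c d, P a b c d) :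
    ∃ a b c d, P a b c d ∧ ∀ (β : Type) (f : Fin n → Fin n → Fin n → Fin n → β) (x : β),
      pick4 P f x = f a b c d := by
  obtain ⟨a, ha⟩ := exists_last h
  obtain ⟨b, hb⟩ := exists_last ha.1
  obtain ⟨c, hc⟩ := exists_last hb.1
  obtain ⟨d, hd⟩ := exists_last hc.1
  refine ⟨a, b, c, d, hd.1, fun β f x => ?_⟩
  rw [pick4, pick_eq_of_last ha, pick_eq_of_last hb, pick_eq_of_last hc, pick_eq_of_last hd]

end Pick

/-! ### Computability of the deterministic choices -/

section PickC

variable {Γ : ℕ → Type} [Ctx Γ]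

theorem CompP.pick {β : ℕ → Type} {P : ∀ n, Γ n → Fin n → Prop} (φ : ∀ n, Γ n → β n → Prop)
    (hP : CompP fun n (p : Ext Γ n) => P n p.1 p.2) {f : ∀ n, Γ n → Fin n → β n}
    {x : ∀ n, Γ n → β n} (hf : CompP fun n (p : Ext Γ n) => φ n p.1 (f n p.1 p.2))
    (hx : CompP fun n γ => φ n γ (x n γ)) :
    CompP fun n γ => φ n γ (pick (P n γ) (f n γ) (x n γ)) := by
  have hS : SetC fun n γ => {v | P n γ v} := hP
  refine ((CompP.ex (P := fun n γ v => Last (P n γ) v ∧ φ n γ (f n γ v)) (CompP.and (CompP.and hP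
    (CompP.all (P := fun n (p : Ext Γ n) u => P n p.1 u → u ≤ p.2) ?_)) hf)).or
    ((CompP.ex hP).not.and hx)).congr fun n γ => (pick_iff _).symm
  exact (hS.wk.wk.app VertC.snd).imp (VertC.snd.le VertC.snd.wk)

theorem SetC.pick {P : ∀ n, Γ n → Fin n → Prop} (hP : CompP fun n (p : Ext Γ n) => P n p.1 p.2)
    {f : ∀ n, Γ n → Fin n → Set (Fin n)} {x : ∀ n, Γ n → Set (Fin n)}
    (hf : SetC fun n (p : Ext Γ n) => f n p.1 p.2) (hx : SetC x) :
    SetC fun n γ => pick (P n γ) (f n γ) (x n γ) := by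
  have hS : SetC fun n γ => {v | P n γ v} := hP
  refine CompP.pick (Γ := Ext Γ) (P := fun n p => P n p.1) (f := fun n p => f n p.1)
    (x := fun n p => x n p.1) (fun n p S => p.2 ∈ S) (hS.wk.wk.app VertC.snd) ?_ hx
  exact (hf.comp ((CtxHom.fst.comp CtxHom.fst).pair VertC.snd)).app VertC.snd.wk

theorem RelC.pick {β : ℕ → Type} {P : ∀ n, Γ n → Fin n → Prop}
    (φ : ∀ n, β n → Fin n → Fin n → Prop)
    (hP : CompP fun n (p : Ext Γ n) => P n p.1 p.2)
    {f : ∀ n, Γ n → Fin n → β n} {x : ∀ n, Γ n → β n}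
    (hf : RelC fun n (p : Ext Γ n) => φ n (f n p.1 p.2)) (hx : RelC fun n γ => φ n (x n γ)) :
    RelC fun n γ => φ n (pick (P n γ) (f n γ) (x n γ)) := by
  have hS : SetC fun n γ => {v | P n γ v} := hP
  refine CompP.pick (Γ := Ext (Ext Γ)) (P := fun n p => P n p.1.1) (f := fun n p => f n p.1.1)
    (x := fun n p => x n p.1.1) (fun n p S => φ n S p.1.2 p.2) (hS.wk.wk.wk.app VertC.snd) ?_ hx
  exact (hf.comp (((CtxHom.fst.comp (CtxHom.fst.comp CtxHom.fst))).pair VertC.snd)).app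
    VertC.snd.wk.wk VertC.snd.wk

theorem GraphC.pick {P : ∀ n, Γ n → Fin n → Prop} (hP : CompP fun n (p : Ext Γ n) => P n p.1 p.2)
    {f : ∀ n, Γ n → Fin n → VGraph (Fin n)} {x : ∀ n, Γ n → VGraph (Fin n)}
    (hf : GraphC fun n (p : Ext Γ n) => f n p.1 p.2) (hx : GraphC x) :
    GraphC fun n γ => pick (P n γ) (f n γ) (x n γ) := by
  refine ⟨?_, RelC.pick (fun n (H : VGraph (Fin n)) => H.Adj) hP hf.adj hx.adj⟩
  have hS : SetC fun n γ => {v | P n γ v} := hP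
  refine CompP.pick (Γ := Ext Γ) (P := fun n p => P n p.1) (f := fun n p => f n p.1)
    (x := fun n p => x n p.1) (fun n p (H : VGraph (Fin n)) => p.2 ∈ H.verts) (hS.wk.wk.app VertC.snd) ?_ hx.verts
  exact (hf.verts.comp ((CtxHom.fst.comp CtxHom.fst).pair VertC.snd)).app VertC.snd.wk

theorem InstC.pick {P : ∀ n, Γ n → Fin n → Prop} (hP : CompP fun n (p : Ext Γ n) => P n p.1 p.2)
    {f : ∀ n, Γ n → Fin n → CMCInstance (Fin n)} {x : ∀ n, Γ n → CMCInstance (Fin n)}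
    (hf : InstC fun n (p : Ext Γ n) => f n p.1 p.2) (hx : InstC x) :
    InstC fun n γ => pick (P n γ) (f n γ) (x n γ) := by
  refine ⟨⟨?_, RelC.pick (fun n (H : CMCInstance (Fin n)) => H.graph.Adj) hP hf.graph.adj
    hx.graph.adj⟩, RelC.pick (fun n (H : CMCInstance (Fin n)) u v => H.weight s(u, v) = 1) hP
    hf.weight hx.weight⟩
  have hS : SetC fun n γ => {v | P n γ v} := hP
  refine CompP.pick (Γ := Ext Γ) (P := fun n p => P n p.1) (f := fun n p => f n p.1)
    (x := fun n p => x n p.1) (fun n p (H : CMCInstance (Fin n)) => p.2 ∈ H.graph.verts) (hS.wk.wk.app VertC.snd) ?_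
    hx.graph.verts
  exact (hf.graph.verts.comp ((CtxHom.fst.comp CtxHom.fst).pair VertC.snd)).app VertC.snd.wk

/-- Computable relations between four vertices. -/
def Rel4C (P : ∀ n, Γ n → Fin n → Fin n → Fin n → Fin n → Prop) : Prop :=
  CompP fun n (p : Ext (Ext (Ext (Ext Γ))) n) => P n p.1.1.1.1 p.1.1.1.2 p.1.1.2 p.1.2 p.2

theorem Rel4C.ex1 {P : ∀ n, Γ n → Fin n → Fin n → Fin n → Fin n → Prop} (hP : Rel4C P) :
    CompP fun n (p : Ext (Ext (Ext Γ)) n) => ∃ d, P n p.1.1.1 p.1.1.2 p.1.2 p.2 d :=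
  CompP.ex (P := fun n (p : Ext (Ext (Ext Γ)) n) d => P n p.1.1.1 p.1.1.2 p.1.2 p.2 d) hP

theorem Rel4C.ex2 {P : ∀ n, Γ n → Fin n → Fin n → Fin n → Fin n → Prop} (hP : Rel4C P) :
    CompP fun n (p : Ext (Ext Γ) n) => ∃ c d, P n p.1.1 p.1.2 p.2 c d :=
  CompP.ex (P := fun n (p : Ext (Ext Γ) n) c => ∃ d, P n p.1.1 p.1.2 p.2 c d) hP.ex1

theorem Rel4C.ex3 {P : ∀ n, Γ n → Fin n → Fin n → Fin n → Fin n → Prop} (hP : Rel4C P) :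
    CompP fun n (p : Ext Γ n) => ∃ b c d, P n p.1 p.2 b c d :=
  CompP.ex (P := fun n (p : Ext Γ n) b => ∃ c d, P n p.1 p.2 b c d) hP.ex2

theorem GraphC.pick4 {P : ∀ n, Γ n → Fin n → Fin n → Fin n → Fin n → Prop} (hP : Rel4C P)
    {f : ∀ n, Γ n → Fin n → Fin n → Fin n → Fin n → VGraph (Fin n)} {x : ∀ n, Γ n → VGraph (Fin n)}
    (hf : GraphC fun n (p : Ext (Ext (Ext (Ext Γ))) n) =>
      f n p.1.1.1.1 p.1.1.1.2 p.1.1.2 p.1.2 p.2) (hx : GraphC x) :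
    GraphC fun n γ => pick4 (P n γ) (f n γ) (x n γ) := by
  unfold ConnCut.pick4
  refine .pick hP.ex3 (.pick hP.ex2 (.pick hP.ex1 ?_ hx.wk.wk) hx.wk) hx
  exact .pick (P := fun n (p : Ext (Ext (Ext Γ)) n) => P n p.1.1.1 p.1.1.2 p.1.2 p.2)
    (f := fun n (p : Ext (Ext (Ext Γ)) n) => f n p.1.1.1 p.1.1.2 p.1.2 p.2) hP hf hx.wk.wk.wk

theorem SetC.pick4 {P : ∀ n, Γ n → Fin n → Fin n → Fin n → Fin n → Prop} (hP : Rel4C P)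
    {f : ∀ n, Γ n → Fin n → Fin n → Fin n → Fin n → Set (Fin n)} {x : ∀ n, Γ n → Set (Fin n)}
    (hf : SetC fun n (p : Ext (Ext (Ext (Ext Γ))) n) =>
      f n p.1.1.1.1 p.1.1.1.2 p.1.1.2 p.1.2 p.2) (hx : SetC x) :
    SetC fun n γ => pick4 (P n γ) (f n γ) (x n γ) := by
  unfold ConnCut.pick4
  refine .pick hP.ex3 (.pick hP.ex2 (.pick hP.ex1 ?_ hx.wk.wk) hx.wk) hx
  exact .pick (P := fun n (p : Ext (Ext (Ext Γ)) n) => P n p.1.1.1 p.1.1.2 p.1.2 p.2)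
    (f := fun n (p : Ext (Ext (Ext Γ)) n) => f n p.1.1.1 p.1.1.2 p.1.2 p.2) hP hf hx.wk.wk.wk

theorem InstC.pick4 {P : ∀ n, Γ n → Fin n → Fin n → Fin n → Fin n → Prop} (hP : Rel4C P)
    {f : ∀ n, Γ n → Fin n → Fin n → Fin n → Fin n → CMCInstance (Fin n)}
    {x : ∀ n, Γ n → CMCInstance (Fin n)}
    (hf : InstC fun n (p : Ext (Ext (Ext (Ext Γ))) n) =>
      f n p.1.1.1.1 p.1.1.1.2 p.1.1.2 p.1.2 p.2) (hx : InstC x) :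
    InstC fun n γ => pick4 (P n γ) (f n γ) (x n γ) := by
  unfold ConnCut.pick4
  refine .pick hP.ex3 (.pick hP.ex2 (.pick hP.ex1 ?_ hx.wk.wk) hx.wk) hx
  exact .pick (P := fun n (p : Ext (Ext (Ext Γ)) n) => P n p.1.1.1 p.1.1.2 p.1.2 p.2)
    (f := fun n (p : Ext (Ext (Ext Γ)) n) => f n p.1.1.1 p.1.1.2 p.1.2 p.2) hP hf hx.wk.wk.wk

theorem GraphC.isThinPath4 {H : ∀ n, Γ n → VGraph (Fin n)} (hH : GraphC H) :
    Rel4C fun n γ => VGraph.IsThinPath (H n γ) :=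
  hH.wk.wk.wk.wk.isThinPath VertC.snd.wk.wk.wk VertC.snd.wk.wk VertC.snd.wk VertC.snd

end PickC

/-! ### Iteration of improvement steps -/

/-- `μ` decreases until `R` holds, and afterwards nothing changes. So any number of steps not below
the initial potential will do, and no test for termination is needed. -/
theorem iterate_reaches {α : Type*} {J R : α → Prop} {f : α → α} (μ : α → ℕ)
    (hJ : ∀ x, J x → J (f x)) (hfix : ∀ x, R x → f x = x)
    (hdec : ∀ x, J x → ¬ R x → μ (f x) < μ x) :
    ∀ k x, J x → μ x ≤ k → R (f^[k] x) ∧ J (f^[k] x) := by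
  intro k
  induction k with
  | zero =>
    intro x hx hμ
    refine ⟨?_, hx⟩
    by_contra hR
    have := hdec x hx hR
    omega
  | succ k ih =>
    intro x hx hμ
    by_cases hR : R x
    · rw [Function.iterate_fixed (hfix x hR)]
      exact ⟨hR, hx⟩
    · rw [Function.iterate_succ_apply]
      exact ih _ (hJ x hx) (by have := hdec x hx hR; omega)

/-! ### Local search for leafy trees ends after polynomially many steps -/

section Search

variable {n : ℕ} {H T : VGraph (Fin n)}

theorem arcs_univ (R : Fin n → Fin n → Prop) :
    arcs R Set.univ Set.univ = {p : Fin n × Fin n | R p.1 p.2}.ncard := by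
  rw [← card_filter_mem, Finset.card_filter, Fintype.sum_prod_type]
  simp [arcs]

theorem arcs_univ_le (R : Fin n → Fin n → Prop) (A B : Set (Fin n)) : arcs R A B ≤ n * n := by
  refine (arcs_mono (R' := R) (A' := Set.univ) (B' := Set.univ)
    fun u v _ _ h => ⟨trivial, trivial, h⟩).trans ?_
  rw [arcs_univ]
  refine (Set.ncard_le_ncard (Set.subset_univ _) (Set.toFinite _)).trans ?_
  rw [Set.ncard_univ, Nat.card_eq_fintype_card, Fintype.card_prod, Fintype.card_fin]

theorem ncard_le_size (A : Set (Fin n)) : A.ncard ≤ n := by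
  refine (Set.ncard_le_ncard (Set.subset_univ _) (Set.toFinite _)).trans ?_
  rw [Set.ncard_univ, Nat.card_eq_fintype_card, Fintype.card_fin]

noncomputable def improveStep (H T : VGraph (Fin n)) : VGraph (Fin n) :=
  pick4 (Improves H T) (exch T) T

/-- The largest possible value of the potential in `localSearch_localOpt`: at most n² arcs with
weight n + 1, plus n for missing leaves. -/
def searchSteps (n : ℕ) : ℕ := n * n * (n + 1) + n

/-- A spanning subgraph with many leaves, found by local search. -/
noncomputable def localSearch (H : VGraph (Fin n)) : VGraph (Fin n) :=
  (improveStep H)^[searchSteps n] H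

theorem arcs_exch_lt {u v x y : Fin n} (huv : T.Adj u v) (hxy : T.Adj x y) :
    arcs (exch T u v x y).Adj Set.univ Set.univ < arcs T.Adj Set.univ Set.univ := by
  rw [arcs_univ, arcs_univ]
  refine Set.ncard_lt_ncard ⟨?_, fun h => ?_⟩ (Set.toFinite _)
  · rintro ⟨a, b⟩ ⟨-, -, -, h | h⟩
    · exact h
    · rcases Sym2.eq_iff.1 h with ⟨h1, h2⟩ | ⟨h1, h2⟩
      · simp only at h1 h2; subst h1 h2; exact huv
      · simp only at h1 h2; subst h1 h2; exact huv.symm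
  · exact (h (show (x, y) ∈ {p : Fin n × Fin n | T.Adj p.1 p.2} from hxy)).2.2.1 rfl

theorem arcs_exch_le {u v x y : Fin n} (hxy : T.Adj x y) :
    arcs (exch T u v x y).Adj Set.univ Set.univ ≤ arcs T.Adj Set.univ Set.univ := by
  rw [arcs_univ, arcs_univ]
  set E := {p : Fin n × Fin n | T.Adj p.1 p.2} with hE
  have hne : (x, y) ≠ (y, x) := fun h => hxy.ne (Prod.ext_iff.1 h).1
  have hsub : ({(x, y), (y, x)} : Set (Fin n × Fin n)) ⊆ E := by
    rintro p (rfl | rfl)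
    · exact hxy
    · exact hxy.symm
  have h1 : {p : Fin n × Fin n | (exch T u v x y).Adj p.1 p.2} ⊆
      (E \ {(x, y), (y, x)}) ∪ {(u, v), (v, u)} := by
    rintro ⟨a, b⟩ ⟨-, -, hne, h | h⟩
    · refine .inl ⟨h, ?_⟩
      rintro (h' | h')
      · exact hne (by rw [(Prod.ext_iff.1 h').1, (Prod.ext_iff.1 h').2])
      · exact hne (by rw [(Prod.ext_iff.1 h').1, (Prod.ext_iff.1 h').2, Sym2.eq_swap])
    · refine .inr ?_
      rcases Sym2.eq_iff.1 h with ⟨h1, h2⟩ | ⟨h1, h2⟩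
      · exact .inl (Prod.ext h1 h2)
      · exact .inr (Prod.ext h1 h2)
  have h2 := Set.ncard_le_ncard h1 (Set.toFinite _)
  have h3 := Set.ncard_union_le (E \ {(x, y), (y, x)}) {(u, v), (v, u)}
  have h4 := Set.ncard_sdiff_add_ncard_of_subset hsub (Set.toFinite _)
  rw [Set.ncard_pair hne] at h4
  have h5 : ({(u, v), (v, u)} : Set (Fin n × Fin n)).ncard ≤ 2 := Set.ncard_insert_le _ _ |>.trans
    (by simp)
  omega

/-- The potential is lexicographic: one arc less outweighs any loss of leaves because of the factor
n + 1, and a proper exchange gains a leaf without increasing the number of arcs. The search starts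
with `H` itself. -/
theorem localSearch_localOpt (hH : ConnOn H.Adj H.verts) : LocalOpt H (localSearch H) := by
  have key := iterate_reaches (α := VGraph (Fin n)) (f := improveStep H)
    (J := fun T => T ≤ H ∧ T.verts = H.verts ∧ ConnOn T.Adj T.verts)
    (R := fun T => ∀ u v x y, ¬ Improves H T u v x y)
    (fun T => arcs T.Adj Set.univ Set.univ * (n + 1) + (n - (VGraph.leaves T).ncard)) ?_ ?_ ?_
    (searchSteps n) H ⟨le_rfl, rfl, hH⟩ ?_
  · exact ⟨key.2.1, key.2.2.1, key.2.2.2, key.1⟩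
  · rintro T ⟨h1, h2, h3⟩
    by_cases hi : ∃ u v x y, Improves H T u v x y
    · obtain ⟨u, v, x, y, hi, he⟩ := exists_pick4 hi
      rw [improveStep, he]
      refine ⟨⟨h1.1, fun a b hab => ?_⟩, h2, hi.2.2.1⟩
      rcases hab.2.2.2 with h | h
      · exact h1.2 h
      · rcases Sym2.eq_iff.1 h with ⟨rfl, rfl⟩ | ⟨rfl, rfl⟩
        · exact hi.1
        · exact hi.1.symm
    · push Not at hi
      rw [improveStep, pick4_eq_of_not hi]
      exact ⟨h1, h2, h3⟩
  · intro T hT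
    exact pick4_eq_of_not hT _ _
  · rintro T - hR
    push Not at hR
    obtain ⟨u, v, x, y, hi, he⟩ := exists_pick4 hR
    rw [improveStep, he]
    have hl := ncard_le_size (VGraph.leaves (exch T u v x y))
    by_cases huv : T.Adj u v
    · have := arcs_exch_lt huv hi.2.1
      have h2 := Nat.mul_le_mul_right (n + 1) (Nat.succ_le_of_lt this)
      rw [Nat.succ_mul] at h2
      omega
    · have h1 := Nat.mul_le_mul_right (n + 1) (arcs_exch_le (u := u) (v := v) hi.2.1)
      have h2 := hi.2.2.2.resolve_left huv
      omega
  · have h1 := Nat.mul_le_mul_right (n + 1) (arcs_univ_le H.Adj Set.univ Set.univ)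
    unfold searchSteps
    omega

end Search

/-! ### Splitting the leaves -/

section Split

variable {n : ℕ}

def toggle (A : Set (Fin n)) (v : Fin n) : Set (Fin n) := (A \ {v}) ∪ ({v} \ A)

/-- Moving one vertex to the other side if this increases the number of edges between the sides. -/
noncomputable def splitStep (R : Fin n → Fin n → Prop) (L A : Set (Fin n)) : Set (Fin n) :=
  pick (fun v => v ∈ L ∧ arcs R A (L \ A) < arcs R (toggle A v) (L \ toggle A v)) (toggle A) A

noncomputable def splitSet (R : Fin n → Fin n → Prop) (L : Set (Fin n)) : Set (Fin n) :=
  (splitStep R L)^[n * n] ∅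

/-- Moving `v` from `X` to `Y` gains its edges into `X` and loses its edges into `Y`. -/
theorem arcs_singleton_le_of_move {R : Fin n → Fin n → Prop} (hs : ∀ a b, R a b → R b a)
    (hi : ∀ a, ¬ R a a) {X Y : Set (Fin n)} (hXY : Disjoint X Y) {v : Fin n} (hv : v ∈ X)
    (h : arcs R (X \ {v}) (Y ∪ {v}) ≤ arcs R X Y) : arcs R {v} X ≤ arcs R {v} Y := by
  have hX : X = (X \ {v}) ∪ {v} := by
    ext a
    by_cases ha : a = v <;> simp [ha, hv]
  have hd : Disjoint (X \ {v}) {v} := by simp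
  have hvY : Disjoint Y {v} := by
    rw [Set.disjoint_singleton_right]
    exact fun h' => hXY.le_bot ⟨hv, h'⟩
  have h1 : arcs R X Y = arcs R (X \ {v}) Y + arcs R {v} Y := by
    conv_lhs => rw [hX]
    exact arcs_union_left hd
  have h2 : arcs R {v} X = arcs R {v} (X \ {v}) + arcs R {v} {v} := by
    conv_lhs => rw [hX]
    exact arcs_union_right hd
  have h3 : arcs R {v} {v} = 0 := by
    unfold arcs
    refine Finset.sum_eq_zero fun a _ => Finset.sum_eq_zero fun b _ => if_neg ?_
    rintro ⟨rfl, rfl, h⟩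
    exact hi _ h
  rw [h1, arcs_union_right hvY, arcs_comm hs (X \ {v}) {v}] at h
  omega

theorem arcs_le_of_singleton {R : Fin n → Fin n → Prop} {X Y : Set (Fin n)}
    (h : ∀ v ∈ X, arcs R {v} X ≤ arcs R {v} Y) : arcs R X X ≤ arcs R X Y := by
  rw [← sum_arcs_singleton R X X (Finset.univ.filter (· ∈ X)) (by simp),
    ← sum_arcs_singleton R X Y (Finset.univ.filter (· ∈ X)) (by simp)]
  exact Finset.sum_le_sum fun v hv => h v (by simpa using hv)

/-- At a local optimum every vertex has at least as many neighbours across as on its own side.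
Summation bounds the arcs inside either part by those across, so all arcs together are at most four
times the number of edges across. -/
theorem splitSet_spec {R : Fin n → Fin n → Prop} (hs : ∀ a b, R a b → R b a)
    (hi : ∀ a, ¬ R a a) (L : Set (Fin n)) :
    splitSet R L ⊆ L ∧ arcs R L L ≤ 4 * arcs R (splitSet R L) (L \ splitSet R L) := by
  have key := iterate_reaches (α := Set (Fin n)) (f := splitStep R L) (J := fun A => A ⊆ L)
    (R := fun A => ∀ v, ¬ (v ∈ L ∧ arcs R A (L \ A) < arcs R (toggle A v) (L \ toggle A v)))
    (fun A => n * n - arcs R A (L \ A)) ?_ ?_ ?_ (n * n) ∅ (Set.empty_subset _) (Nat.sub_le _ _)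
  · change _ ∧ splitSet R L ⊆ L at key
    refine ⟨key.2, ?_⟩
    replace key : (∀ v, ¬ (v ∈ L ∧ arcs R (splitSet R L) (L \ splitSet R L) <
      arcs R (toggle (splitSet R L) v) (L \ toggle (splitSet R L) v))) ∧ splitSet R L ⊆ L := key
    generalize splitSet R L = A at key ⊢
    obtain ⟨h1, h2⟩ := key
    have hd : Disjoint A (L \ A) := Set.disjoint_sdiff_right
    have hA : arcs R A A ≤ arcs R A (L \ A) := by
      refine arcs_le_of_singleton fun v hv => arcs_singleton_le_of_move hs hi hd hv ?_
      have h3 := h1 v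
      push Not at h3
      have e1 : A \ {v} = toggle A v := by
        ext a
        by_cases ha : a = v <;> simp [toggle, ha, hv]
      have e2 : L \ A ∪ {v} = L \ toggle A v := by
        ext a
        by_cases ha : a = v <;> simp [toggle, ha, hv, h2 hv]
      rw [e1, e2]
      exact h3 (h2 hv)
    have hB : arcs R (L \ A) (L \ A) ≤ arcs R (L \ A) A := by
      refine arcs_le_of_singleton fun v hv => arcs_singleton_le_of_move hs hi hd.symm hv ?_
      have h3 := h1 v
      push Not at h3
      rw [arcs_comm hs, arcs_comm hs (L \ A) A]
      have e1 : A ∪ {v} = toggle A v := by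
        ext a
        by_cases ha : a = v <;> simp [toggle, ha, hv.2]
      have e2 : (L \ A) \ {v} = L \ toggle A v := by
        ext a
        by_cases ha : a = v <;> simp [toggle, ha, hv.2, hv.1]
      rw [e1, e2]
      exact h3 hv.1
    have hL : L = A ∪ (L \ A) := (Set.union_sdiff_cancel h2).symm
    have h3 : arcs R L L = arcs R A A + arcs R A (L \ A) + (arcs R (L \ A) A +
        arcs R (L \ A) (L \ A)) := by
      conv_lhs => rw [hL]
      rw [arcs_union_left hd, arcs_union_right hd, arcs_union_right hd]
    have h4 := arcs_comm hs A (L \ A)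
    omega
  · intro A hA
    by_cases h : ∃ v, v ∈ L ∧ arcs R A (L \ A) < arcs R (toggle A v) (L \ toggle A v)
    · obtain ⟨v, hv⟩ := exists_last h
      rw [splitStep, pick_eq_of_last hv]
      rintro a (ha | ha)
      · exact hA ha.1
      · rw [ha.1]; exact hv.1.1
    · rw [splitStep, pick_eq_of_not (not_exists.1 h)]
      exact hA
  · intro A hA
    exact pick_eq_of_not hA _ _
  · intro A _ hA
    push Not at hA
    obtain ⟨v, hv⟩ := exists_last hA
    rw [splitStep, pick_eq_of_last hv]
    have h1 := hv.1.2
    have h2 := arcs_univ_le R (toggle A v) (L \ toggle A v)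
    omega

/-- The better of two sets. -/
noncomputable def better (I : CMCInstance (Fin n)) (X Y : Set (Fin n)) : Set (Fin n) :=
  if I.cutW X ≤ I.cutW Y then Y else X

theorem better_spec (I : CMCInstance (Fin n)) (X Y : Set (Fin n)) :
    (better I X Y = X ∨ better I X Y = Y) ∧ I.cutW X ≤ I.cutW (better I X Y) ∧
      I.cutW Y ≤ I.cutW (better I X Y) := by
  unfold better
  split_ifs with h
  · exact ⟨.inr rfl, h, le_rfl⟩
  · exact ⟨.inl rfl, le_rfl, by omega⟩

/-- The solution obtained from the tree `T` and the part `A` of its leaves. -/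
noncomputable def treeSet (I : CMCInstance (Fin n)) (T : VGraph (Fin n)) (A : Set (Fin n)) :
    Set (Fin n) :=
  better I (T.verts \ A) (T.verts \ (VGraph.leaves T \ A))

theorem fromTree_treeSet (I : CMCInstance (Fin n)) (T : VGraph (Fin n)) :
    I.FromTree T (treeSet I T (splitSet (One I) (VGraph.leaves T))) := by
  obtain ⟨h1, h2⟩ := splitSet_spec (R := One I) (fun a b h => ⟨h.1.symm, by
    rw [Sym2.eq_swap]; exact h.2⟩) (fun a h => h.1.ne rfl) (VGraph.leaves T)
  obtain ⟨h3, h4, h5⟩ := better_spec I (T.verts \ splitSet (One I) (VGraph.leaves T))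
    (T.verts \ (VGraph.leaves T \ splitSet (One I) (VGraph.leaves T)))
  refine ⟨_, _, Set.disjoint_sdiff_right, Set.union_sdiff_cancel h1, ?_, h3, h4, h5⟩
  rw [between_eq Set.disjoint_sdiff_right]
  have := two_mul_inside (I := I) (VGraph.leaves T)
  omega

end Split

/-! ### The reductions and the way back -/

section Reductions

variable {n : ℕ} {I : CMCInstance (Fin n)}

/-- The vertex `v` has no incident edge of weight one. -/
def NoOne (I : CMCInstance (Fin n)) (v : Fin n) : Prop :=
  v ∈ I.graph.verts ∧ ∀ u, I.graph.Adj v u → I.weight s(v, u) = 0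

theorem everyVertexHasOne_iff : I.EveryVertexHasOne ↔ ∀ v, ¬ NoOne I v := by
  constructor
  · rintro h v ⟨hv, h'⟩
    obtain ⟨u, hu, hw⟩ := h v hv
    rw [h' u hu] at hw
    exact absurd hw (by decide)
  · intro h v hv
    by_contra h'
    push Not at h'
    exact h v ⟨hv, fun u hu => (fin2_cases _).resolve_right (h' u hu)⟩

/-- One vertex disappears in each step that changes anything; thin paths are considered only when
every vertex has a 1-edge, as the algorithm demands. -/
noncomputable def reduceStep (I : CMCInstance (Fin n)) : CMCInstance (Fin n) :=
  pick (NoOne I) I.dropVertex (if ∃ v, NoOne I v then I else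
    pick4 (VGraph.IsThinPath I.graph) I.contract I)

noncomputable def best3 (I : CMCInstance (Fin n)) (X Y Z : Set (Fin n)) : Set (Fin n) :=
  better I X (better I Y Z)

theorem best3_spec (I : CMCInstance (Fin n)) (X Y Z : Set (Fin n)) :
    best3 I X Y Z ∈ ({X, Y, Z} : Set (Set (Fin n))) ∧
      ∀ W ∈ ({X, Y, Z} : Set (Set (Fin n))), I.cutW W ≤ I.cutW (best3 I X Y Z) := by
  obtain ⟨h1, h2, h3⟩ := better_spec I Y Z
  obtain ⟨h4, h5, h6⟩ := better_spec I X (better I Y Z)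
  constructor
  · rcases h4 with h | h
    · exact .inl h
    · rcases h1 with h' | h'
      · exact .inr (.inl (h.trans h'))
      · exact .inr (.inr (h.trans h'))
  · rintro W (rfl | rfl | rfl)
    · exact h5
    · exact h2.trans h6
    · exact h3.trans h6

/-- A best set among the candidates for carrying `S` back over the shortening of `abcd`. -/
noncomputable def bestCandidate (I : CMCInstance (Fin n)) (S : Set (Fin n)) (a b c d : Fin n) :
    Set (Fin n) :=
  if a ∈ S ∧ d ∈ S then
    if b ∈ S then S ∪ {c} else best3 I S (S ∪ {b}) (S ∪ {c})
  else if a ∈ S then best3 I (S \ {b}) (S \ {b} ∪ {b}) (S \ {b} ∪ {b, c})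
  else if d ∈ S then best3 I (S \ {b}) (S \ {b} ∪ {c}) (S \ {b} ∪ {b, c})
  else if b ∈ S then best3 I {b} {c} {b, c} else S

theorem bestCandidate_spec (I : CMCInstance (Fin n)) (S : Set (Fin n)) (a b c d : Fin n) :
    bestCandidate I S a b c d ∈ expandCandidates a b c d S ∧
      ∀ X ∈ expandCandidates a b c d S, I.cutW X ≤ I.cutW (bestCandidate I S a b c d) := by
  unfold bestCandidate expandCandidates
  split_ifs
  · exact ⟨rfl, by rintro X rfl; exact le_rfl⟩
  · exact best3_spec I _ _ _
  · exact best3_spec I _ _ _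
  · exact best3_spec I _ _ _
  · exact best3_spec I _ _ _
  · exact ⟨rfl, by rintro X rfl; exact le_rfl⟩

/-- The way back over `reduceStep`. -/
noncomputable def carry (I : CMCInstance (Fin n)) (S : Set (Fin n)) : Set (Fin n) :=
  pick (NoOne I) (fun v => if ConnOn I.graph.Adj S then S else S ∪ {v}) (if ∃ v, NoOne I v then S
    else pick4 (VGraph.IsThinPath I.graph) (bestCandidate I S) S)

/-- In each case, `reduceStep` is one of the reductions, and `carry` is the way back. -/
theorem reduceStep_cases (I : CMCInstance (Fin n)) :
    (∃ v, NoOne I v ∧ reduceStep I = I.dropVertex v ∧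
      ∀ S, carry I S = if ConnOn I.graph.Adj S then S else S ∪ {v}) ∨
    (I.EveryVertexHasOne ∧ ∃ a b c d, VGraph.IsThinPath I.graph a b c d ∧
      reduceStep I = I.contract a b c d ∧ ∀ S, carry I S = bestCandidate I S a b c d) ∨
    (I.EveryVertexHasOne ∧ VGraph.NoThinPath I.graph ∧ reduceStep I = I ∧ ∀ S, carry I S = S) := by
  by_cases h : ∃ v, NoOne I v
  · obtain ⟨v, hv⟩ := exists_last h
    refine .inl ⟨v, hv.1, ?_, fun S => ?_⟩
    · rw [reduceStep, pick_eq_of_last hv]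
    · rw [carry, pick_eq_of_last hv]
  · right
    have h1 : I.EveryVertexHasOne := everyVertexHasOne_iff.2 (not_exists.1 h)
    by_cases ht : ∃ a b c d, VGraph.IsThinPath I.graph a b c d
    · obtain ⟨a, b, c, d, ht', he⟩ := exists_pick4 ht
      refine .inl ⟨h1, a, b, c, d, ht', ?_, fun S => ?_⟩
      · rw [reduceStep, pick_eq_of_not (not_exists.1 h), if_neg h, he]
      · rw [carry, pick_eq_of_not (not_exists.1 h), if_neg h, he]
    · push Not at ht
      refine .inr ⟨h1, ht, ?_, fun S => ?_⟩
      · rw [reduceStep, pick_eq_of_not (not_exists.1 h), if_neg h, pick4_eq_of_not ht]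
      · rw [carry, pick_eq_of_not (not_exists.1 h), if_neg h, pick4_eq_of_not ht]

theorem output_carry {c : ℕ} {S : Set (Fin n)} (h : CMCInstance.Output c (reduceStep I) S) :
    CMCInstance.Output c I (carry I S) := by
  rcases reduceStep_cases I with ⟨v, hv, h1, h2⟩ | ⟨h1, a, b, c', d, ht, h2, h3⟩ | ⟨-, -, h1, h2⟩
  · rw [h1] at h
    have := CMCInstance.Output.drop I v S hv.1 hv.2 h
    rw [h2]
    convert this using 2
    exact (induce_connected_iff I.graph S).symm
  · rw [h2] at h
    rw [h3]
    obtain ⟨h4, h5⟩ := bestCandidate_spec I S a b c' d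
    exact .shorten I a b c' d S _ h1 ht h h4 h5
  · rw [h1] at h
    rwa [h2]

/-- The instance is connected and has an edge of weight one. -/
def Good (I : CMCInstance (Fin n)) : Prop :=
  ConnOn I.graph.Adj I.graph.verts ∧ ∃ u v, One I u v

theorem Good.reduceStep (h : Good I) : Good (reduceStep I) := by
  rcases reduceStep_cases I with ⟨v, hv, h1, -⟩ | ⟨h1, a, b, c, d, ht, h2, -⟩ | ⟨-, -, h1, -⟩
  · rw [h1]
    obtain ⟨hc, x, y, hxy⟩ := h
    have hone := (one_dropVertex hv.2 x y).2 hxy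
    exact ⟨connOn_dropVertex hc ⟨x, hone.1.fst_mem⟩, x, y, hone⟩
  · rw [h2]
    refine ⟨IsThinPath.connOn_contract_verts ht h.1, b, d, ?_, ?_⟩
    · exact (IsThinPath.contract_iff ht).2 (.inr rfl)
    -- A 1-edge survives: one of the two edges at `b` has weight one, so k ≥ 1 and the new edge `bd`
    -- gets weight one.
    · obtain ⟨u, hu, hw⟩ := h1 b ht.adj₀₁.snd_mem
      have hk : 1 ≤ (I.weight s(a, b) : ℕ) + (I.weight s(b, c) : ℕ) + (I.weight s(c, d) : ℕ) := by
        rcases (adj_iff_of_deg_two ht.deg₁ ht.adj₀₁.symm ht.adj₁₂ ht.ne₀₂ u).1 hu with rfl | rfl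
        · rw [Sym2.eq_swap] at hw
          simp [hw]
          omega
        · simp [hw]
          omega
      simp only [CMCInstance.contract]
      rw [if_neg, if_pos trivial, if_pos hk]
      rw [Sym2.eq_iff]
      rintro (⟨h3, -⟩ | ⟨-, h3⟩)
      · exact ht.adj₀₁.ne h3.symm
      · exact ht.ne₀₃ h3.symm
  · rwa [h1]

theorem reduceStep_reduced (h : Good I) {k : ℕ} (hk : n ≤ k) :
    Good (reduceStep^[k] I) ∧ (reduceStep^[k] I).EveryVertexHasOne ∧
      VGraph.NoThinPath (reduceStep^[k] I).graph := by
  have key := iterate_reaches (α := CMCInstance (Fin n)) (f := reduceStep) (J := Good)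
    (R := fun I => I.EveryVertexHasOne ∧ VGraph.NoThinPath I.graph) (fun I => I.graph.verts.ncard)
    (fun I h => h.reduceStep) ?_ ?_ k I h ((ncard_le_size _).trans hk)
  · exact ⟨key.2, key.1⟩
  · rintro I ⟨h1, h2⟩
    rcases reduceStep_cases I with ⟨v, hv, -⟩ | ⟨-, a, b, c, d, ht, -⟩ | ⟨-, -, h3, -⟩
    · exact absurd hv (everyVertexHasOne_iff.1 h1 v)
    · exact absurd ht (h2 a b c d)
    · exact h3
  · intro I _ hR
    rcases reduceStep_cases I with ⟨v, hv, h1, -⟩ | ⟨-, a, b, c, d, ht, h2, -⟩ | ⟨h1, h2, -⟩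
    · rw [h1]
      exact Set.ncard_sdiff_singleton_lt_of_mem hv.1 (Set.toFinite _)
    · rw [h2]
      exact Set.ncard_sdiff_singleton_lt_of_mem ht.adj₁₂.snd_mem (Set.toFinite _)
    · exact absurd ⟨h1, h2⟩ hR

end Reductions

/-! ### Computability of the steps -/

section StepsC

variable {Γ : ℕ → Type} [Ctx Γ]

theorem GraphC.improveStep {H T : ∀ n, Γ n → VGraph (Fin n)} (hH : GraphC H) (hT : GraphC T) :
    GraphC fun n γ => improveStep (H n γ) (T n γ) :=
  GraphC.pick4 (P := fun n γ => Improves (H n γ) (T n γ)) (f := fun n γ => ConnCut.exch (T n γ))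
    (hH.wk.wk.wk.wk.improves hT.wk.wk.wk.wk VertC.snd.wk.wk.wk VertC.snd.wk.wk VertC.snd.wk
      VertC.snd)
    (hT.wk.wk.wk.wk.exch VertC.snd.wk.wk.wk VertC.snd.wk.wk VertC.snd.wk VertC.snd) hT

theorem SetC.toggle {A : ∀ n, Γ n → Set (Fin n)} (hA : SetC A) {v : ∀ n, Γ n → Fin n}
    (hv : VertC v) : SetC fun n γ => toggle (A n γ) (v n γ) :=
  (hA.diff (.singleton hv)).union ((SetC.singleton hv).diff hA)

theorem SetC.splitStep {R : ∀ n, Γ n → Fin n → Fin n → Prop} (hR : RelC R)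
    {L A : ∀ n, Γ n → Set (Fin n)} (hL : SetC L) (hA : SetC A) :
    SetC fun n γ => splitStep (R n γ) (L n γ) (A n γ) := by
  have ht := hA.wk.toggle (v := fun n (p : Ext Γ n) => p.2) VertC.snd
  exact SetC.pick (P := fun n γ v => v ∈ L n γ ∧ ConnCut.arcs (R n γ) (A n γ) (L n γ \ A n γ) <
      ConnCut.arcs (R n γ) (ConnCut.toggle (A n γ) v) (L n γ \ ConnCut.toggle (A n γ) v))
    (f := fun n γ v => ConnCut.toggle (A n γ) v)
    (CompP.and hL ((hR.arcs hA (hL.diff hA)).wk.lt (hR.wk.arcs ht (hL.wk.diff ht)))) ht hA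

theorem SetC.better {I : ∀ n, Γ n → CMCInstance (Fin n)} (hI : InstC I)
    {X Y : ∀ n, Γ n → Set (Fin n)} (hX : SetC X) (hY : SetC Y) :
    SetC fun n γ => better (I n γ) (X n γ) (Y n γ) :=
  SetC.ite ((hI.cutW hX).le (hI.cutW hY)) hY hX

theorem SetC.best3 {I : ∀ n, Γ n → CMCInstance (Fin n)} (hI : InstC I)
    {X Y Z : ∀ n, Γ n → Set (Fin n)} (hX : SetC X) (hY : SetC Y) (hZ : SetC Z) :
    SetC fun n γ => best3 (I n γ) (X n γ) (Y n γ) (Z n γ) :=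
  SetC.better hI hX (SetC.better hI hY hZ)

theorem SetC.treeSet {I : ∀ n, Γ n → CMCInstance (Fin n)} (hI : InstC I)
    {T : ∀ n, Γ n → VGraph (Fin n)} (hT : GraphC T) {A : ∀ n, Γ n → Set (Fin n)} (hA : SetC A) :
    SetC fun n γ => treeSet (I n γ) (T n γ) (A n γ) :=
  SetC.better hI (hT.verts.diff hA) (hT.verts.diff (hT.leaves.diff hA))

theorem InstC.noOne {I : ∀ n, Γ n → CMCInstance (Fin n)} (hI : InstC I) :
    CompP fun n (p : Ext Γ n) => NoOne (I n p.1) p.2 :=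
  CompP.and hI.graph.verts (CompP.all (P := fun n (p : Ext Γ n) u =>
    (I n p.1).graph.Adj p.2 u → (I n p.1).weight s(p.2, u) = 0)
    (CompP.imp hI.graph.adj ((CompP.not hI.weight).congr fun n p => by
      rcases fin2_cases ((I n p.1.1).weight s(p.1.2, p.2)) with h | h <;> simp [h])))

theorem InstC.ite {P : ∀ n, Γ n → Prop} (hP : CompP P) {I J : ∀ n, Γ n → CMCInstance (Fin n)}
    (hI : InstC I) (hJ : InstC J) [∀ n γ, Decidable (P n γ)] :
    InstC fun n γ => if P n γ then I n γ else J n γ := by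
  refine ⟨⟨?_, ?_⟩, ?_⟩
  · refine (SetC.ite hP hI.graph.verts hJ.graph.verts).congr fun n γ => ?_
    by_cases h : P n γ.1 <;> simp [h]
  · refine ((hP.wk.wk.and hI.graph.adj).or (hP.wk.wk.not.and hJ.graph.adj)).congr fun n γ => ?_
    by_cases h : P n γ.1.1 <;> simp [h]
  · refine ((hP.wk.wk.and hI.weight).or (hP.wk.wk.not.and hJ.weight)).congr fun n γ => ?_
    by_cases h : P n γ.1.1 <;> simp [h]

theorem InstC.reduceStep {I : ∀ n, Γ n → CMCInstance (Fin n)} (hI : InstC I) :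
    InstC fun n γ => reduceStep (I n γ) :=
  InstC.pick (P := fun n γ => NoOne (I n γ)) (f := fun n γ => (I n γ).dropVertex) hI.noOne
    (hI.wk.dropVertex VertC.snd) (InstC.ite (CompP.ex hI.noOne) hI
    (InstC.pick4 (P := fun n γ => VGraph.IsThinPath (I n γ).graph) (f := fun n γ => (I n γ).contract)
      hI.graph.isThinPath4 (hI.wk.wk.wk.wk.contract VertC.snd.wk.wk.wk VertC.snd.wk.wk VertC.snd.wk
        VertC.snd) hI))

theorem SetC.bestCandidate {I : ∀ n, Γ n → CMCInstance (Fin n)} (hI : InstC I)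
    {S : ∀ n, Γ n → Set (Fin n)} (hS : SetC S) {a b c d : ∀ n, Γ n → Fin n} (ha : VertC a)
    (hb : VertC b) (hc : VertC c) (hd : VertC d) :
    SetC fun n γ => bestCandidate (I n γ) (S n γ) (a n γ) (b n γ) (c n γ) (d n γ) := by
  have hSb := hS.diff (.singleton hb)
  exact SetC.ite ((hS.app ha).and (hS.app hd)) (SetC.ite (hS.app hb) (hS.union (.singleton hc))
    (.best3 hI hS (hS.union (.singleton hb)) (hS.union (.singleton hc))))
    (SetC.ite (hS.app ha) (.best3 hI hSb (hSb.union (.singleton hb)) (hSb.union (.pair hb hc)))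
    (SetC.ite (hS.app hd) (.best3 hI hSb (hSb.union (.singleton hc)) (hSb.union (.pair hb hc)))
    (SetC.ite (hS.app hb) (.best3 hI (.singleton hb) (.singleton hc) (.pair hb hc)) hS)))

theorem SetC.carry {I : ∀ n, Γ n → CMCInstance (Fin n)} (hI : InstC I)
    {S : ∀ n, Γ n → Set (Fin n)} (hS : SetC S) : SetC fun n γ => carry (I n γ) (S n γ) :=
  SetC.pick (P := fun n γ => NoOne (I n γ)) (f := fun n γ v =>
    if ConnOn (I n γ).graph.Adj (S n γ) then S n γ else S n γ ∪ {v}) hI.noOne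
    (SetC.ite (hI.graph.adj.connOn hS).wk hS.wk (hS.wk.union (.singleton VertC.snd)))
    (SetC.ite (CompP.ex hI.noOne) hS (SetC.pick4 (P := fun n γ => VGraph.IsThinPath (I n γ).graph)
      (f := fun n γ => ConnCut.bestCandidate (I n γ) (S n γ)) hI.graph.isThinPath4
      (.bestCandidate hI.wk.wk.wk.wk hS.wk.wk.wk.wk VertC.snd.wk.wk.wk VertC.snd.wk.wk VertC.snd.wk
        VertC.snd) hS))

end StepsC

/-! ### The shortening log -/

section Log

variable {n : ℕ}

/-- Three arrays that hold, row by row, the vertices `v₁, v₂, v₃` of shortened paths. -/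
abbrev Log (n : ℕ) := (Fin n → Fin n → ℕ) × (Fin n → Fin n → ℕ) × (Fin n → Fin n → ℕ)

/-- Undoing the shortening that is recorded in the row `t`, if there is one. -/
noncomputable def rowExpand (L : Log n) (t : ℕ) (X : VGraph (Fin n)) : VGraph (Fin n) :=
  pick4 (fun i b c d => (i : ℕ) = t ∧ L.1 i b ≠ 0 ∧ L.2.1 i c ≠ 0 ∧ L.2.2 i d ≠ 0)
    (fun _ b c d => VGraph.expand b c d X) X

/-- Undoing the shortenings that are recorded in the rows below `k`, one after the other. -/
noncomputable def expandLog (L : Log n) : ℕ → VGraph (Fin n) → VGraph (Fin n)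
  | 0, X => X
  | k + 1, X => rowExpand L k (expandLog L k X)

theorem rowExpand_of_empty {L : Log n} {t : ℕ} (h : ∀ i : Fin n, (i : ℕ) = t → ∀ c, L.2.1 i c = 0)
    (X : VGraph (Fin n)) : rowExpand L t X = X :=
  pick4_eq_of_not (fun i _ c _ h' => h'.2.2.1 (h i h'.1 c)) _ _

theorem rowExpand_congr {L L' : Log n} {t : ℕ} (h : ∀ i : Fin n, (i : ℕ) = t → ∀ c,
    L.1 i c = L'.1 i c ∧ L.2.1 i c = L'.2.1 i c ∧ L.2.2 i c = L'.2.2 i c) (X : VGraph (Fin n)) :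
    rowExpand L t X = rowExpand L' t X := by
  unfold rowExpand
  congr 1
  ext i b c d
  refine and_congr_right fun hi => ?_
  rw [(h i hi b).1, (h i hi c).2.1, (h i hi d).2.2]

theorem rowExpand_of_row {L : Log n} {t : Fin n} {b c d : Fin n}
    (h1 : ∀ j, L.1 t j ≠ 0 ↔ j = b) (h2 : ∀ j, L.2.1 t j ≠ 0 ↔ j = c)
    (h3 : ∀ j, L.2.2 t j ≠ 0 ↔ j = d) (X : VGraph (Fin n)) :
    rowExpand L t X = VGraph.expand b c d X := by
  obtain ⟨i, b', c', d', ⟨hi, h1', h2', h3'⟩, he⟩ := exists_pick4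
    (P := fun i b c d => (i : ℕ) = t ∧ L.1 i b ≠ 0 ∧ L.2.1 i c ≠ 0 ∧ L.2.2 i d ≠ 0)
    ⟨t, b, c, d, rfl, (h1 b).2 rfl, (h2 c).2 rfl, (h3 d).2 rfl⟩
  obtain rfl : i = t := Fin.ext hi
  rw [rowExpand, he, (h1 b').1 h1', (h2 c').1 h2', (h3 d').1 h3']

theorem expandLog_of_empty {L : Log n} {m : ℕ}
    (h : ∀ i : Fin n, (i : ℕ) < m → ∀ c, L.2.1 i c = 0) {k : ℕ} (hk : k ≤ m) (X : VGraph (Fin n)) :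
    expandLog L k X = X := by
  induction k with
  | zero => rfl
  | succ k ih =>
    rw [expandLog, ih (by omega)]
    exact rowExpand_of_empty (fun i hi => h i (by omega)) X

/-- A graph together with a log. -/
structure Logged (n : ℕ) where
  graph : VGraph (Fin n)
  log : Log n

/-- Entering the set `A` into row `t`. -/
noncomputable def enter (t : ℕ) (A : Set (Fin n)) (L : Fin n → Fin n → ℕ) : Fin n → Fin n → ℕ :=
  fun i j => if (i : ℕ) + 1 = t ∧ j ∈ A then 1 else L i j

noncomputable def thinStep (H : VGraph (Fin n)) : VGraph (Fin n) :=
  pick4 (VGraph.IsThinPath H) (fun _ b c d => VGraph.contract H b c d) H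

noncomputable def thinEntry (H : VGraph (Fin n)) : Set (Fin n) × Set (Fin n) × Set (Fin n) :=
  pick4 (VGraph.IsThinPath H) (fun _ b c d => ({b}, {c}, {d})) (∅, ∅, ∅)

/-- Shortening a thin path, with an entry into the log. -/
noncomputable def logStep (x : Logged n) : Logged n where
  graph := thinStep x.graph
  log := (enter x.graph.verts.ncard (thinEntry x.graph).1 x.log.1,
    enter x.graph.verts.ncard (thinEntry x.graph).2.1 x.log.2.1,
    enter x.graph.verts.ncard (thinEntry x.graph).2.2 x.log.2.2)

/-- Only rows that come from larger graphs are in use. -/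
def Fresh (x : Logged n) : Prop := ∀ i : Fin n, (i : ℕ) < x.graph.verts.ncard → ∀ c,
  x.log.1 i c = 0 ∧ x.log.2.1 i c = 0 ∧ x.log.2.2 i c = 0

/-- A shortening of a graph with m vertices is entered into row m - 1. Graphs shrink, so rows are
never reused and later shortenings have smaller rows; running through the rows upwards undoes the
latest shortening first. -/
theorem logStep_of_thin {x : Logged n} (hx : Fresh x)
    (h : ∃ a b c d, VGraph.IsThinPath x.graph a b c d) :
    ∃ a b c d, VGraph.IsThinPath x.graph a b c d ∧
      (logStep x).graph = VGraph.contract x.graph b c d ∧ Fresh (logStep x) ∧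
      (logStep x).graph.verts.ncard < x.graph.verts.ncard ∧
      ∀ X, expandLog (logStep x).log n X = expandLog x.log n (VGraph.expand b c d X) := by
  obtain ⟨a, b, c, d, ht, he⟩ := exists_pick4 h
  have hg : (logStep x).graph = VGraph.contract x.graph b c d :=
    he _ (fun _ b c d => VGraph.contract x.graph b c d) _
  have hent : thinEntry x.graph = ({b}, {c}, {d}) :=
    he (Set (Fin n) × Set (Fin n) × Set (Fin n)) (fun _ b c d => ({b}, {c}, {d})) _
  have hlog : (logStep x).log = (enter x.graph.verts.ncard {b} x.log.1,
    enter x.graph.verts.ncard {c} x.log.2.1, enter x.graph.verts.ncard {d} x.log.2.2) := by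
    rw [logStep, hent]
  have hlt : (logStep x).graph.verts.ncard < x.graph.verts.ncard := by
    rw [hg]
    exact Set.ncard_sdiff_singleton_lt_of_mem ht.adj₁₂.snd_mem (Set.toFinite _)
  have hn := ncard_le_size x.graph.verts
  have hold : ∀ i : Fin n, (i : ℕ) + 1 ≠ x.graph.verts.ncard → ∀ j,
      (logStep x).log.1 i j = x.log.1 i j ∧ (logStep x).log.2.1 i j = x.log.2.1 i j ∧
        (logStep x).log.2.2 i j = x.log.2.2 i j := by
    intro i hi j
    rw [hlog]
    simp [enter, hi]
  have hfresh : Fresh (logStep x) := by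
    intro i hi j
    obtain ⟨h1, h2, h3⟩ := hold i (by omega) j
    rw [h1, h2, h3]
    exact hx i (by omega) j
  refine ⟨a, b, c, d, ht, hg, hfresh, hlt, fun X => ?_⟩
  obtain ⟨m, hm⟩ : ∃ m, x.graph.verts.ncard = m + 1 := ⟨x.graph.verts.ncard - 1, by omega⟩
  have hrow : ∀ Y, rowExpand (logStep x).log m Y = VGraph.expand b c d Y := by
    intro Y
    have hz : ∀ j, x.log.1 ⟨m, by omega⟩ j = 0 ∧ x.log.2.1 ⟨m, by omega⟩ j = 0 ∧
        x.log.2.2 ⟨m, by omega⟩ j = 0 := hx ⟨m, by omega⟩ (by simp only; omega)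
    refine rowExpand_of_row (t := ⟨m, by omega⟩) ?_ ?_ ?_ Y <;> intro j <;> rw [hlog] <;>
      simp [enter, hm, hz j]
  -- In both logs the rows below `m` are empty, row `m` is the new entry, and the rows above agree.
  suffices H : ∀ k, m + 1 ≤ k → expandLog (logStep x).log k X =
      expandLog x.log k (VGraph.expand b c d X) from H n (by omega)
  intro k hk
  induction k, hk using Nat.le_induction with
  | base =>
    rw [expandLog_of_empty (m := m + 1) (fun i hi j => (hx i (by omega) j).2.1) le_rfl, expandLog,
      expandLog_of_empty (m := m) (fun i hi j => ?_) le_rfl, hrow]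
    rw [(hold i (by omega) j).2.1]
    exact (hx i (by omega) j).2.1
  | succ k hk ih =>
    rw [expandLog, expandLog, ih]
    exact rowExpand_congr (fun i hi j => hold i (by omega) j) _

theorem logStep_of_noThin {x : Logged n} (h : VGraph.NoThinPath x.graph) : logStep x = x := by
  have h1 : thinStep x.graph = x.graph := pick4_eq_of_not h _ _
  have h2 : thinEntry x.graph = (∅, ∅, ∅) := pick4_eq_of_not h _ _
  have h3 : ∀ L : Fin n → Fin n → ℕ, enter x.graph.verts.ncard ∅ L = L := fun L => by
    ext i j
    simp [enter]
  rw [logStep, h1, h2, h3, h3, h3]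

/-- Shortening all thin paths. -/
theorem logStep_iterate {x : Logged n} (hx : Fresh x)
    (hc : x.graph.verts = ∅ ∨ ConnOn x.graph.Adj x.graph.verts) :
    ∃ f, ShrinksTo x.graph (logStep^[n] x).graph f ∧ Fresh (logStep^[n] x) ∧
      VGraph.NoThinPath (logStep^[n] x).graph ∧
      ((logStep^[n] x).graph.verts = ∅ ∨
        ConnOn (logStep^[n] x).graph.Adj (logStep^[n] x).graph.verts) ∧
      (logStep^[n] x).graph.verts.ncard ≤ x.graph.verts.ncard ∧
      ∀ X, expandLog (logStep^[n] x).log n X = expandLog x.log n (f X) := by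
  -- `ShrinksTo` is built from its first step, whereas the iteration appends steps at the end. The
  -- invariant therefore says how every continuation from the current graph extends to the initial
  -- one.
  have key := iterate_reaches (f := logStep)
    (J := fun y : Logged n => Fresh y ∧
      (y.graph.verts = ∅ ∨ ConnOn y.graph.Adj y.graph.verts) ∧
      y.graph.verts.ncard ≤ x.graph.verts.ncard ∧
      ∀ H g, ShrinksTo y.graph H g → ∃ f, ShrinksTo x.graph H f ∧
        ∀ X, expandLog y.log n (g X) = expandLog x.log n (f X))
    (R := fun y => VGraph.NoThinPath y.graph) (fun y => y.graph.verts.ncard) ?_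
    (fun y hy => logStep_of_noThin hy) ?_ n x
    ⟨hx, hc, le_rfl, fun H g hg => ⟨g, hg, fun _ => rfl⟩⟩ (ncard_le_size _)
  · obtain ⟨h1, h2, h3, h4, h5⟩ := key
    obtain ⟨f, hf, hf'⟩ := h5 _ _ (.done _ h1)
    exact ⟨f, hf, h2, h1, h3, h4, hf'⟩
  · rintro y ⟨h1, h2, h3, h4⟩
    by_cases ht : ∃ a b c d, VGraph.IsThinPath y.graph a b c d
    · obtain ⟨a, b, c, d, ht', hg, hfresh, hlt, hX⟩ := logStep_of_thin h1 ht
      refine ⟨hfresh, .inr ?_, by omega, fun H g hg' => ?_⟩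
      · rw [hg]
        refine IsThinPath.connOn_contract_verts ht' (h2.resolve_left fun h0 => ?_)
        exact Set.notMem_empty b (h0 ▸ ht'.adj₁₂.fst_mem)
      · rw [hg] at hg'
        obtain ⟨f, hf, hf'⟩ := h4 H _ (.step y.graph H g a b c d ht' hg')
        exact ⟨f, hf, fun X => (hX _).trans (hf' X)⟩
    · push Not at ht
      rw [logStep_of_noThin ht]
      exact ⟨h1, h2, h3, h4⟩
  · rintro y ⟨h1, -⟩ hR
    have ht : ∃ a b c d, VGraph.IsThinPath y.graph a b c d := by
      unfold VGraph.NoThinPath at hR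
      push Not at hR
      exact hR
    obtain ⟨a, b, c, d, -, -, -, hlt, -⟩ := logStep_of_thin h1 ht
    exact hlt

/-! ### Peeling -/

structure PeelState (n : ℕ) extends Logged n where
  best : VGraph (Fin n)

/-- One round of the main loop. -/
noncomputable def peelStep (I : CMCInstance (Fin n)) (x : PeelState n) : PeelState n :=
  if x.graph.verts.Nonempty then
    { toLogged := logStep^[n] ⟨x.graph.deleteVerts (VGraph.leaves (localSearch x.graph)), x.log⟩
      best := if I.leafWeight x.best ≤ I.leafWeight (expandLog x.log n (localSearch x.graph)) then
        expandLog x.log n (localSearch x.graph) else x.best }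
  else x

theorem deleteVerts_leaves_conn {H T : VGraph (Fin n)} (hT : LocalOpt H T) :
    (H.deleteVerts (VGraph.leaves T)).verts = ∅ ∨
      ConnOn (H.deleteVerts (VGraph.leaves T)).Adj (H.deleteVerts (VGraph.leaves T)).verts := by
  rcases Set.eq_empty_or_nonempty (H.verts \ VGraph.leaves T) with h | h
  · exact .inl h
  · right
    have hv : (H.deleteVerts (VGraph.leaves T)).verts = T.verts \ VGraph.leaves T := by
      rw [hT.verts_eq]; rfl
    rw [hv]
    refine (connOn_congr fun a ha b hb => ?_).1
      ((connOn_diff_leaves hT.conn subset_rfl (hT.verts_eq ▸ h)).mono fun a b hab => hT.le.2 hab)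
    rw [SimpleGraph.Subgraph.deleteVerts_adj]
    exact ⟨fun h => ⟨h.fst_mem, ha.2, h.snd_mem, hb.2, h⟩, fun h => h.2.2.2.2⟩

/-- The empty graph has leaf weight zero, so the first tree found always replaces it. -/
def initialPeel (H : VGraph (Fin n)) : PeelState n :=
  ⟨⟨H, fun _ _ => 0, fun _ _ => 0, fun _ _ => 0⟩, ⊥⟩

theorem peelStep_iterate (I : CMCInstance (Fin n)) (hc : ConnOn I.graph.Adj I.graph.verts)
    (ht : VGraph.NoThinPath I.graph) :
    ∃ ts, Peel I.graph ts ∧ ((peelStep I)^[n] (initialPeel I.graph)).best ∈ ts ∧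
      ∀ T' ∈ ts, I.leafWeight T' ≤
        I.leafWeight ((peelStep I)^[n] (initialPeel I.graph)).best := by
  -- As for `ShrinksTo`, the invariant describes a started run by its completions: the trees `ts`
  -- found so far, viewed in the initial graph, are followed by the expanded trees of any run on the
  -- current graph.
  have key := iterate_reaches (f := peelStep I)
    (J := fun y : PeelState n => Fresh y.toLogged ∧ VGraph.NoThinPath y.graph ∧
      (y.graph.verts = ∅ ∨ ConnOn y.graph.Adj y.graph.verts) ∧
      ∃ ts, (∀ ts', Peel y.graph ts' → Peel I.graph (ts ++ ts'.map (expandLog y.log n))) ∧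
        ((ts = [] ∧ I.leafWeight y.best = 0) ∨
          (y.best ∈ ts ∧ ∀ T' ∈ ts, I.leafWeight T' ≤ I.leafWeight y.best)))
    (R := fun y => y.graph.verts = ∅) (fun y => y.graph.verts.ncard) ?_ ?_ ?_ n
    (initialPeel I.graph) ?_ (ncard_le_size _)
  · obtain ⟨h1, -, -, -, ts, h2, h3⟩ := key
    have hp := h2 [] (.nil _ h1)
    rw [List.map_nil, List.append_nil] at hp
    rcases h3 with ⟨rfl, -⟩ | ⟨h4, h5⟩
    · cases hp with
      | nil _ h => exact absurd hc.1 (Set.not_nonempty_iff_eq_empty.2 h)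
    · exact ⟨ts, hp, h4, h5⟩
  · rintro y ⟨h1, h2, h3, ts, h4, h5⟩
    by_cases hne : y.graph.verts.Nonempty
    · rw [peelStep, if_pos hne]
      have hopt := localSearch_localOpt (h3.resolve_left hne.ne_empty)
      set T := localSearch y.graph with hT
      have hfresh : Fresh (⟨y.graph.deleteVerts (VGraph.leaves T), y.log⟩ : Logged n) := by
        intro i hi j
        refine h1 i (lt_of_lt_of_le hi ?_) j
        exact Set.ncard_le_ncard Set.sdiff_subset (Set.toFinite _)
      obtain ⟨f, hf, g1, g2, g3, -, g4⟩ := logStep_iterate hfresh (deleteVerts_leaves_conn hopt)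
      refine ⟨g1, g2, g3, ts ++ [expandLog y.log n T], fun ts' hts' => ?_, .inr ?_⟩
      · have := h4 _ (.cons y.graph T _ f ts' hne (hopt.leafy h2) hf hts')
        rw [List.append_assoc]
        simp only [List.map_cons, List.map_map, List.singleton_append] at this ⊢
        convert this using 4
        ext1 X
        exact g4 X
      · constructor
        · simp only
          split_ifs with hle
          · simp
          · rcases h5 with ⟨-, h0⟩ | ⟨h6, -⟩
            · omega
            · exact List.mem_append_left _ h6
        · intro T' hT'
          simp only
          rw [List.mem_append, List.mem_singleton] at hT'
          split_ifs with hle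
          · rcases hT' with hT' | rfl
            · rcases h5 with ⟨rfl, -⟩ | ⟨-, h6⟩
              · exact absurd hT' List.not_mem_nil
              · exact (h6 T' hT').trans hle
            · exact le_rfl
          · rcases hT' with hT' | rfl
            · rcases h5 with ⟨rfl, -⟩ | ⟨-, h6⟩
              · exact absurd hT' List.not_mem_nil
              · exact h6 T' hT'
            · omega
    · rw [peelStep, if_neg hne]
      exact ⟨h1, h2, h3, ts, h4, h5⟩
  · intro y hy
    rw [peelStep, if_neg (Set.not_nonempty_iff_eq_empty.2 hy)]
  · rintro y ⟨h1, h2, h3, -⟩ hR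
    have hne := Set.nonempty_iff_ne_empty.2 hR
    have hopt := localSearch_localOpt (h3.resolve_left hR)
    have hfresh : Fresh (⟨y.graph.deleteVerts (VGraph.leaves (localSearch y.graph)), y.log⟩ :
        Logged n) := by
      intro i hi j
      refine h1 i (lt_of_lt_of_le hi ?_) j
      exact Set.ncard_le_ncard Set.sdiff_subset (Set.toFinite _)
    obtain ⟨f, -, -, -, -, g, -⟩ := logStep_iterate hfresh (deleteVerts_leaves_conn hopt)
    rw [peelStep, if_pos hne]
    refine lt_of_le_of_lt g (Set.ncard_lt_ncard ⟨Set.sdiff_subset, fun hsub => ?_⟩ (Set.toFinite _))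
    obtain ⟨-, -, -, h14⟩ := hopt.leafy h2
    have hpos : 0 < y.graph.verts.ncard := (Set.ncard_pos (Set.toFinite _)).2 hne
    obtain ⟨v, hv⟩ := (Set.ncard_pos (Set.toFinite _)).1
      (show 0 < (VGraph.leaves (localSearch y.graph)).ncard by omega)
    exact (hsub (hopt.verts_eq ▸ hv.1)).2 hv
  · refine ⟨fun i _ c => ⟨rfl, rfl, rfl⟩, ht, .inr hc, [], fun ts' hts' => ?_, .inl ⟨rfl, ?_⟩⟩
    · rw [List.nil_append]
      have hid : expandLog (initialPeel I.graph).log n = id := funext fun X =>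
        expandLog_of_empty (m := n) (fun i _ c => rfl) le_rfl X
      rw [hid, List.map_id]
      exact hts'
    · rw [leafWeight_eq]
      unfold arcs
      refine Finset.sum_eq_zero fun a _ => Finset.sum_eq_zero fun b _ => if_neg ?_
      rintro ⟨h, -⟩
      exact h.1

end Log

/-! ### Procedures: search, split, expansion -/

section Procedures

open Function

theorem CompS.congr {F G : ∀ n, St n → St n} (hF : CompS F) (h : ∀ n σ, F n σ = G n σ) :
    CompS G := by
  obtain rfl : F = G := funext fun n => funext fun σ => h n σ
  exact hF

theorem CompS.iterSize {F : ∀ n, St n → St n} (hF : CompS F) : CompS fun n σ => (F n)^[n] σ :=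
  hF.iter Comp.size Polynomial.X fun n _ => by simp

/-- A procedure that acts on the encoded content of a single array can be iterated on the level of
the encoded objects. -/
theorem iterate_update {n : ℕ} {β : Type*} {enc : β → Fin n → Fin n → ℕ} {F : St n → St n}
    {σ : St n} {a : ℕ} {φ : β → β}
    (hF : ∀ x, F (update σ a (enc x)) = update σ a (enc (φ x))) (x : β) (k : ℕ) :
    F^[k] (update σ a (enc x)) = update σ a (enc (φ^[k] x)) := by
  induction k generalizing x with
  | zero => rfl
  | succ k ih => rw [iterate_succ_apply, iterate_succ_apply, hF, ih]

theorem Comp.square {Γ : ℕ → Type} [Ctx Γ] : Comp fun n (_ : Γ n) => n * n :=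
  (Comp.sum (f := fun n (_ : Γ n) _ => n) Comp.size).congr fun n _ => by simp

theorem Comp.searchSteps {Γ : ℕ → Type} [Ctx Γ] : Comp fun n (_ : Γ n) => searchSteps n :=
  (Comp.add (Comp.sum (f := fun n (_ : Γ n) _ => n * n) Comp.square) (Comp.square.add
    Comp.size)).congr fun n _ => by simp [ConnCut.searchSteps]; ring

theorem CompS.search {a t : ℕ} (hat : a ≠ t) :
    CompS fun _ σ => update σ t (encG (localSearch (decG (σ a)))) := by
  have h1 : CompS fun n (σ : St n) => update σ t (encG (decG (σ a))) :=
    CompS.setG t (GraphC.state a)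
  have h2 : CompS fun n (σ : St n) => update σ t (encG (improveStep (decG (σ a)) (decG (σ t)))) :=
    CompS.setG t ((GraphC.state a).improveStep (GraphC.state t))
  refine ((h2.iter Comp.searchSteps (.X * .X * (.X + 1) + .X) fun n _ => by
    simp [searchSteps]).comp h1).congr fun _ σ => ?_
  exact iterate_update (φ := improveStep (decG (σ a))) (fun x => by simp [update_of_ne hat]) _ _

theorem CompS.split {a t s : ℕ} (has : a ≠ s) (hts : t ≠ s) :
    CompS fun _ σ => update σ s (encS (splitSet (One (decI (σ a))) (VGraph.leaves (decG (σ t))))) := by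
  have h1 : CompS fun n (σ : St n) => update σ s (encS ∅) :=
    CompS.setS s (SetC.univ.compl.congr fun n γ => by simp)
  have h2 : CompS fun n (σ : St n) => update σ s (encS (splitStep (One (decI (σ a)))
      (VGraph.leaves (decG (σ t))) (decS (σ s)))) :=
    CompS.setS s (SetC.splitStep (InstC.state a).one (GraphC.state t).leaves (SetC.state s))
  refine ((h2.iter Comp.square (.X * .X) fun n _ => by simp).comp h1).congr fun _ σ => ?_
  exact iterate_update (φ := splitStep (One (decI (σ a))) (VGraph.leaves (decG (σ t))))
    (fun x => by simp [update_of_ne has, update_of_ne hts]) _ _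

noncomputable def inc (a : ℕ) {n : ℕ} (σ : St n) : St n := update σ a (encN (decN (σ a) + 1))

theorem CompS.inc (a : ℕ) : CompS fun n σ => inc (n := n) a σ :=
  CompS.setN a ((Comp.state a).add (.lit 1))

/-- The log that is kept in the arrays 12, 13, 14. -/
def logAt {n : ℕ} (σ : St n) : Log n := (σ 12, σ 13, σ 14)

noncomputable def expandRow {n : ℕ} (σ : St n) : St n :=
  update σ 15 (encG (rowExpand (logAt σ) (decN (σ 16)) (decG (σ 15))))

theorem CompS.expandRow : CompS fun n σ => expandRow (n := n) σ := by
  have hom : CtxHom fun n (p : Ext (Ext (Ext (Ext St))) n) => p.1.1.1.1 :=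
    CtxHom.fst.comp (CtxHom.fst.comp (CtxHom.fst.comp CtxHom.fst))
  have hi : VertC fun n (p : Ext (Ext (Ext (Ext St))) n) => p.1.1.1.2 := VertC.snd.wk.wk.wk
  exact CompS.setG 15 (GraphC.pick4
    (P := fun n (σ : St n) i b c d => (i : ℕ) = decN (σ 16) ∧ σ 12 i b ≠ 0 ∧ σ 13 i c ≠ 0 ∧
      σ 14 i d ≠ 0)
    (f := fun n (σ : St n) _ b c d => VGraph.expand b c d (decG (σ 15)))
    ((Comp.eq hi (Comp.state 16).wk.wk.wk.wk).and
      ((Comp.arrApp 12 hom hi VertC.snd.wk.wk).ne_zero.and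
        ((Comp.arrApp 13 hom hi VertC.snd.wk).ne_zero.and
          (Comp.arrApp 14 hom hi VertC.snd).ne_zero)))
    ((GraphC.state 15).wk.wk.wk.wk.expand VertC.snd.wk.wk VertC.snd.wk VertC.snd) (GraphC.state 15))

/-- The tree in array 11, expanded by the log, is put into array 15. -/
noncomputable def expandProc {n : ℕ} (σ : St n) : St n :=
  (fun σ => inc 16 (expandRow σ))^[n] (update (update σ 15 (encG (decG (σ 11)))) 16 (encN 0))

theorem CompS.expandProc : CompS fun n σ => expandProc (n := n) σ :=
  ((CompS.inc 16).comp CompS.expandRow).iterSize.comp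
    ((CompS.setN 16 (Comp.lit 0)).comp (CompS.setG 15 (GraphC.state 11)))

theorem expandProc_eq {n : ℕ} [NeZero n] (σ : St n) :
    expandProc σ = update (update σ 15 (encG (expandLog (logAt σ) n (decG (σ 11))))) 16 (encN n) := by
  suffices H : ∀ k, (fun σ => inc 16 (expandRow σ))^[k]
      (update (update σ 15 (encG (decG (σ 11)))) 16 (encN 0)) =
      update (update σ 15 (encG (expandLog (logAt σ) k (decG (σ 11))))) 16 (encN k) from H n
  intro k
  induction k with
  | zero => rfl
  | succ k ih =>
    rw [iterate_succ_apply', ih]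
    simp only [inc, expandRow, logAt, expandLog]
    ext b i j
    by_cases h16 : b = 16
    · subst h16; simp
    · by_cases h15 : b = 15
      · subst h15; simp
      · simp [h16, h15]

/-- Array 10 holds the current graph. -/
noncomputable def loggedAt {n : ℕ} (σ : St n) : Logged n := ⟨decG (σ 10), logAt σ⟩

/-- The graph in array 10 is replaced last, because all three log entries are computed from the old
graph. -/
noncomputable def logProc {n : ℕ} (σ : St n) : St n :=
  (fun σ => update σ 10 (encG (thinStep (decG (σ 10)))))
    ((fun σ => update σ 14 (enter (decG (σ 10)).verts.ncard (thinEntry (decG (σ 10))).2.2 (σ 14)))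
      ((fun σ => update σ 13 (enter (decG (σ 10)).verts.ncard (thinEntry (decG (σ 10))).2.1 (σ 13)))
        (update σ 12 (enter (decG (σ 10)).verts.ncard (thinEntry (decG (σ 10))).1 (σ 12)))))

theorem CompS.enter (a : ℕ) {A : ∀ n, St n → Set (Fin n)} (hA : SetC A) :
    CompS fun n σ => update σ a (enter (decG (σ 10)).verts.ncard (A n σ) (σ a)) :=
  CompS.set a (f := fun n σ => ConnCut.enter (decG (σ 10)).verts.ncard (A n σ) (σ a))
    (CompP.ite ((Comp.eq (Comp.add VertC.snd.wk (.lit 1)) (GraphC.state 10).verts.ncard.wk.wk).and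
      (hA.wk.wk.app VertC.snd)) (.lit 1) (Comp.arr a))

theorem SetC.thinEntry {Γ : ℕ → Type} [Ctx Γ] {H : ∀ n, Γ n → VGraph (Fin n)} (hH : GraphC H) :
    SetC (fun n γ => (thinEntry (H n γ)).1) ∧ SetC (fun n γ => (thinEntry (H n γ)).2.1) ∧
      SetC (fun n γ => (thinEntry (H n γ)).2.2) := by
  have hf : ∀ n (H : VGraph (Fin n)) {β β' : Type} (g : β → β') (f : Fin n → Fin n → Fin n → Fin n → β)
      (x : β), g (ConnCut.pick4 (VGraph.IsThinPath H) f x) =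
        ConnCut.pick4 (VGraph.IsThinPath H) (fun a b c d => g (f a b c d)) (g x) := by
    intro n H β β' g f x
    by_cases h : ∃ a b c d, VGraph.IsThinPath H a b c d
    · obtain ⟨a, b, c, d, -, he⟩ := exists_pick4 h
      rw [he, he]
    · push Not at h
      rw [pick4_eq_of_not h, pick4_eq_of_not h]
  have hempty : SetC fun n (_ : Γ n) => ∅ := SetC.univ.compl.congr fun n γ => by simp
  refine ⟨?_, ?_, ?_⟩
  · refine (SetC.pick4 (P := fun n γ => VGraph.IsThinPath (H n γ)) (f := fun n _ _ b _ _ => {b})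
      hH.isThinPath4 (SetC.singleton VertC.snd.wk.wk) hempty).congr fun n p => ?_
    exact Iff.of_eq (congrArg (p.2 ∈ ·) (hf n (H n p.1)
      (fun x : Set (Fin n) × Set (Fin n) × Set (Fin n) => x.1)
      (fun _ b c d => ({b}, {c}, {d})) (∅, ∅, ∅)).symm)
  · refine (SetC.pick4 (P := fun n γ => VGraph.IsThinPath (H n γ)) (f := fun n _ _ _ c _ => {c})
      hH.isThinPath4 (SetC.singleton VertC.snd.wk) hempty).congr fun n p => ?_
    exact Iff.of_eq (congrArg (p.2 ∈ ·) (hf n (H n p.1)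
      (fun x : Set (Fin n) × Set (Fin n) × Set (Fin n) => x.2.1)
      (fun _ b c d => ({b}, {c}, {d})) (∅, ∅, ∅)).symm)
  · refine (SetC.pick4 (P := fun n γ => VGraph.IsThinPath (H n γ)) (f := fun n _ _ _ _ d => {d})
      hH.isThinPath4 (SetC.singleton VertC.snd) hempty).congr fun n p => ?_
    exact Iff.of_eq (congrArg (p.2 ∈ ·) (hf n (H n p.1)
      (fun x : Set (Fin n) × Set (Fin n) × Set (Fin n) => x.2.2)
      (fun _ b c d => ({b}, {c}, {d})) (∅, ∅, ∅)).symm)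

theorem CompS.logProc : CompS fun n σ => logProc (n := n) σ := by
  have hH := GraphC.state 10
  have h1 : CompS fun n (σ : St n) => update σ 10 (encG (thinStep (decG (σ 10)))) :=
    CompS.setG 10 (GraphC.pick4 (P := fun n (σ : St n) => VGraph.IsThinPath (decG (σ 10)))
      (f := fun n (σ : St n) _ b c d => VGraph.contract (decG (σ 10)) b c d) hH.isThinPath4
      (hH.wk.wk.wk.wk.contract VertC.snd.wk.wk VertC.snd.wk VertC.snd) hH)
  obtain ⟨e1, e2, e3⟩ := SetC.thinEntry hH
  exact h1.comp ((CompS.enter 14 e3).comp ((CompS.enter 13 e2).comp (CompS.enter 12 e1)))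

theorem loggedAt_logProc {n : ℕ} (σ : St n) : loggedAt (logProc σ) = logStep (loggedAt σ) := by
  simp [logProc, loggedAt, logAt, logStep]

theorem logProc_of_ne {n : ℕ} (σ : St n) {b : ℕ} (h10 : b ≠ 10) (h12 : b ≠ 12) (h13 : b ≠ 13)
    (h14 : b ≠ 14) : logProc σ b = σ b := by
  simp [logProc, h10, h12, h13, h14]

theorem logProc_iterate {n : ℕ} (σ : St n) (k : ℕ) :
    loggedAt (logProc^[k] σ) = logStep^[k] (loggedAt σ) ∧
      ∀ b, b ≠ 10 → b ≠ 12 → b ≠ 13 → b ≠ 14 → logProc^[k] σ b = σ b := by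
  induction k generalizing σ with
  | zero => exact ⟨rfl, fun _ _ _ _ _ => rfl⟩
  | succ k ih =>
    rw [iterate_succ_apply, iterate_succ_apply, ← loggedAt_logProc]
    refine ⟨(ih _).1, fun b h10 h12 h13 h14 => ?_⟩
    rw [(ih _).2 b h10 h12 h13 h14, logProc_of_ne σ h10 h12 h13 h14]

/-- Array 17 holds the best tree. -/
noncomputable def peelAt {n : ℕ} (σ : St n) : PeelState n := ⟨loggedAt σ, decG (σ 17)⟩

noncomputable def keepBest {n : ℕ} (σ : St n) : St n :=
  if (decI (σ 7)).leafWeight (decG (σ 17)) ≤ (decI (σ 7)).leafWeight (decG (σ 15))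
    then update σ 17 (encG (decG (σ 15))) else σ

noncomputable def dropLeaves {n : ℕ} (σ : St n) : St n :=
  update σ 10 (encG ((decG (σ 10)).deleteVerts (VGraph.leaves (decG (σ 11)))))

noncomputable def peelProc {n : ℕ} (σ : St n) : St n :=
  if ∃ v, v ∈ (decG (σ 10)).verts then
    logProc^[n] (dropLeaves (keepBest (expandProc
      (update σ 11 (encG (localSearch (decG (σ 10))))))))
  else σ

theorem CompS.peelProc : CompS fun n σ => peelProc (n := n) σ := by
  have h1 : CompS fun n (σ : St n) => dropLeaves σ :=
    CompS.setG 10 ((GraphC.state 10).deleteVerts (GraphC.state 11).leaves)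
  have h2 : CompS fun n (σ : St n) => keepBest σ :=
    CompS.ite (((InstC.state 7).leafWeight (GraphC.state 17)).le
      ((InstC.state 7).leafWeight (GraphC.state 15))) (CompS.setG 17 (GraphC.state 15)) CompS.skip
  exact CompS.ite (CompP.ex (P := fun n (σ : St n) v => v ∈ (decG (σ 10)).verts)
    (GraphC.state 10).verts) (CompS.logProc.iterSize.comp (h1.comp (h2.comp
      (CompS.expandProc.comp (CompS.search (a := 10) (t := 11) (by decide)))))) CompS.skip

/-- The arrays below 10 belong to the surrounding procedures; those from 10 on are work space. The
second claim is what allows the procedures to be nested. -/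
theorem peelProc_spec {n : ℕ} [NeZero n] (σ : St n) :
    peelAt (peelProc σ) = peelStep (decI (σ 7)) (peelAt σ) ∧ ∀ b < 10, peelProc σ b = σ b := by
  unfold peelProc
  by_cases hne : ∃ v, v ∈ (decG (σ 10)).verts
  · rw [if_pos hne, expandProc_eq]
    set T := localSearch (decG (σ 10)) with hT
    set σ2 : St n := update (update (update σ 11 (encG T)) 15 (encG (expandLog
      (logAt (update σ 11 (encG T))) n (decG (update σ 11 (encG T) 11))))) 16 (encN n) with hσ2
    set σ3 : St n := keepBest σ2 with hσ3
    have h2 : ∀ b, b ≠ 11 → b ≠ 15 → b ≠ 16 → σ2 b = σ b := by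
      intro b h1 h2 h3
      simp [hσ2, h1, h2, h3]
    have h2' : decG (σ2 15) = expandLog (logAt σ) n T := by
      simp [hσ2, logAt]
    have h3 : ∀ b, b ≠ 17 → σ3 b = σ2 b := by
      intro b hb
      rw [hσ3, keepBest]
      split_ifs
      · exact update_of_ne hb _ _
      · rfl
    have h11 : decG (σ3 11) = T := by
      rw [h3 11 (by decide), hσ2]
      simp
    have h17 : decG (σ3 17) = if (decI (σ 7)).leafWeight (decG (σ 17)) ≤
        (decI (σ 7)).leafWeight (expandLog (logAt σ) n T) then expandLog (logAt σ) n T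
        else decG (σ 17) := by
      rw [hσ3, keepBest, h2', h2 7 (by decide) (by decide) (by decide), h2 17 (by decide) (by decide) (by decide)]
      split_ifs
      · simp
      · rw [h2 17 (by decide) (by decide) (by decide)]
    set σ4 : St n := dropLeaves σ3 with hσ4
    have h4 : loggedAt σ4 = ⟨(decG (σ 10)).deleteVerts (VGraph.leaves T), logAt σ⟩ := by
      have e : ∀ b, b = 10 ∨ b = 12 ∨ b = 13 ∨ b = 14 → σ3 b = σ b := fun b hb => by
        rw [h3 b (by omega), h2 b (by omega) (by omega) (by omega)]
      rw [hσ4, loggedAt, dropLeaves]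
      simp only [update_self, decG_encG, logAt]
      rw [h11, e 10 (by omega), update_of_ne (by decide), update_of_ne (by decide),
        update_of_ne (by decide), e 12 (by omega), e 13 (by omega), e 14 (by omega)]
    obtain ⟨h5, h6⟩ := logProc_iterate σ4 n
    refine ⟨?_, fun b hb => ?_⟩
    · rw [peelStep, if_pos (by exact hne), peelAt, h5, h4,
        h6 17 (by decide) (by decide) (by decide) (by decide), hσ4, dropLeaves,
        update_of_ne (by decide), h17]
      rfl
    · rw [h6 b (by omega) (by omega) (by omega) (by omega), hσ4, dropLeaves,
        update_of_ne (by omega), h3 b (by omega), h2 b (by omega) (by omega) (by omega)]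
  · rw [if_neg hne, peelStep, if_neg (by exact hne)]
    exact ⟨rfl, fun b _ => rfl⟩

theorem peelProc_iterate {n : ℕ} [NeZero n] (σ : St n) (k : ℕ) :
    peelAt (peelProc^[k] σ) = (peelStep (decI (σ 7)))^[k] (peelAt σ) ∧
      ∀ b < 10, peelProc^[k] σ b = σ b := by
  induction k generalizing σ with
  | zero => exact ⟨rfl, fun _ _ => rfl⟩
  | succ k ih =>
    obtain ⟨h1, h2⟩ := peelProc_spec σ
    rw [iterate_succ_apply, iterate_succ_apply, ← h1, ← h2 7 (by decide)]
    exact ⟨(ih _).1, fun b hb => ((ih _).2 b hb).trans (h2 b hb)⟩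

end Procedures

/-! ### The algorithm on a reduced instance as a procedure -/

section CoreProcedure

open Function

/-- Array 7 holds the instance, array 18 a power of two, array 19 its exponent. -/
noncomputable def clogStep {n : ℕ} (σ : St n) : St n :=
  if decN (σ 18) < (decI (σ 7)).graph.verts.ncard then
    inc 19 (update σ 18 (encN (decN (σ 18) + decN (σ 18)))) else σ

noncomputable def clogProc {n : ℕ} (σ : St n) : St n :=
  clogStep^[n] (update (update σ 18 (encN 1)) 19 (encN 0))

theorem CompS.clogProc : CompS fun n σ => clogProc (n := n) σ :=
  (CompS.ite ((Comp.state 18).lt (InstC.state 7).graph.verts.ncard)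
    ((CompS.inc 19).comp (CompS.setN 18 ((Comp.state 18).add (Comp.state 18))))
    CompS.skip).iterSize.comp ((CompS.setN 19 (.lit 0)).comp (CompS.setN 18 (.lit 1)))

/-- After `k` steps the exponent is `min k c`: doubling stops as soon as the power reaches the
number of vertices. At most `n` steps are needed, as n < 2^n. -/
theorem clogProc_eq {n : ℕ} [NeZero n] (σ : St n) :
    decN (clogProc σ 19) = Nat.clog 2 (decI (σ 7)).graph.verts.ncard ∧
      ∀ b, b ≠ 18 → b ≠ 19 → clogProc σ b = σ b := by
  set c := Nat.clog 2 (decI (σ 7)).graph.verts.ncard with hc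
  have H : ∀ k, clogStep^[k] (update (update σ 18 (encN 1)) 19 (encN 0)) =
      update (update σ 18 (encN (2 ^ min k c))) 19 (encN (min k c)) := by
    intro k
    induction k with
    | zero => simp
    | succ k ih =>
      rw [iterate_succ_apply', ih, clogStep]
      have e7 : update (update σ 18 (encN (2 ^ min k c))) 19 (encN (min k c)) 7 = σ 7 := by simp
      have e18 : decN (update (update σ 18 (encN (2 ^ min k c))) 19 (encN (min k c)) 18) =
          2 ^ min k c := by simp
      rw [e7, e18]
      by_cases hk : k < c
      · have h1 : 2 ^ k < (decI (σ 7)).graph.verts.ncard :=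
          (Nat.lt_clog_iff_pow_lt one_lt_two).1 hk
        rw [min_eq_left hk.le, min_eq_left (Nat.succ_le_of_lt hk), if_pos h1]
        ext b i j
        by_cases h19 : b = 19
        · subst h19; simp [inc]
        · by_cases h18 : b = 18
          · subst h18; simp [inc, pow_succ, mul_two]
          · simp [inc, h18, h19]
      · rw [min_eq_right (not_lt.1 hk), min_eq_right (by omega), if_neg]
        exact not_lt.2 (Nat.le_pow_clog one_lt_two _)
  have hcn : c ≤ n := by
    refine Nat.clog_le_of_le_pow ((ncard_le_size _).trans ?_)
    exact Nat.lt_two_pow_self.le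
  unfold clogProc
  rw [H, min_eq_right hcn]
  refine ⟨by simp, fun b h18 h19 => by simp [h18, h19]⟩

theorem Comp.ncard_mul {Γ : ℕ → Type} [Ctx Γ] {A : ∀ n, Γ n → Set (Fin n)} (hA : SetC A)
    {f : ∀ n, Γ n → ℕ} (hf : Comp f) : Comp fun n γ => (A n γ).ncard * f n γ :=
  (Comp.sum (f := fun n γ v => if v ∈ A n γ then f n γ else 0) (CompP.ite hA hf.wk (.lit 0))).congr
    fun n γ => by
      rw [← Finset.sum_filter, Finset.sum_const, card_filter_mem, smul_eq_mul]

theorem GraphC.bot {Γ : ℕ → Type} [Ctx Γ] : GraphC fun n (_ : Γ n) => (⊥ : VGraph (Fin n)) :=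
  ⟨SetC.univ.compl.congr fun n γ => by simp, SetC.univ.compl.congr fun n γ => by simp⟩

noncomputable def startPeel {n : ℕ} (σ : St n) : St n :=
  update (update (update (update σ 12 (encN 0)) 13 (encN 0)) 14 (encN 0)) 17 (encG ⊥)

theorem CompS.startPeel : CompS fun n σ => startPeel (n := n) σ :=
  (CompS.setG 17 GraphC.bot).comp ((CompS.setN 14 (.lit 0)).comp ((CompS.setN 13 (.lit 0)).comp
    (CompS.setN 12 (.lit 0))))

/-- A tree for the instance in array 7 is put into array 17. -/
noncomputable def treeProc {n : ℕ} (σ : St n) : St n :=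
  -- Arcs count every 1-edge twice, so the factor 8 corresponds to the threshold constant 4.
  if arcs (One (decI (σ 7))) Set.univ Set.univ ≤
      8 * ((decI (σ 7)).graph.verts.ncard * decN (σ 19)) then
    update σ 17 (encG (localSearch (decG (σ 10))))
  else peelProc^[n] (startPeel σ)

theorem CompS.treeProc : CompS fun n σ => treeProc (n := n) σ := by
  have h := Comp.ncard_mul (InstC.state 7).graph.verts (Comp.state 19)
  have h2 := h.add h
  have h4 := h2.add h2
  exact CompS.ite (((InstC.state 7).one.arcs SetC.univ SetC.univ).le ((h4.add h4).congr fun n σ => by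
    ring)) (CompS.search (a := 10) (t := 17) (by decide))
    (CompS.peelProc.iterSize.comp CompS.startPeel)

/-- The leaves of the tree in array 17 are split, and the resulting solution is put into
array 5. -/
noncomputable def splitProc {n : ℕ} (σ : St n) : St n :=
  (fun σ => update σ 5 (encS (treeSet (decI (σ 7)) (decG (σ 17)) (decS (σ 20)))))
    (update σ 20 (encS (splitSet (One (decI (σ 7))) (VGraph.leaves (decG (σ 17))))))

theorem CompS.splitProc : CompS fun n σ => splitProc (n := n) σ :=
  (CompS.setS 5 (SetC.treeSet (InstC.state 7) (GraphC.state 17) (SetC.state 20))).comp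
    (CompS.split (by decide) (by decide))

theorem splitProc_spec {n : ℕ} (σ : St n) :
    (decI (σ 7)).FromTree (decG (σ 17)) (decS (splitProc σ 5)) ∧
      ∀ b < 10, b ≠ 5 → splitProc σ b = σ b := by
  refine ⟨?_, fun b hb h5 => ?_⟩
  · simpa [splitProc] using fromTree_treeSet (decI (σ 7)) (decG (σ 17))
  · have : b ≠ 20 := by omega
    simp [splitProc, h5, this]

noncomputable def coreProc {n : ℕ} (σ : St n) : St n :=
  splitProc (treeProc ((fun σ => update σ 10 (encG (decI (σ 7)).graph)) (clogProc σ)))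

theorem CompS.coreProc : CompS fun n σ => coreProc (n := n) σ :=
  CompS.splitProc.comp (CompS.treeProc.comp ((CompS.setG 10 (InstC.state 7).graph).comp
    CompS.clogProc))

theorem treeProc_spec {n : ℕ} [NeZero n] {σ : St n} {I : CMCInstance (Fin n)}
    (hI : decI (σ 7) = I) (hH : decG (σ 10) = I.graph)
    (h19 : decN (σ 19) = Nat.clog 2 I.graph.verts.ncard)
    (hc : ConnOn I.graph.Adj I.graph.verts) (ht : VGraph.NoThinPath I.graph) :
    (∀ S, I.FromTree (decG (treeProc σ 17)) S → I.CoreOutput 4 S) ∧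
      ∀ b < 10, treeProc σ b = σ b := by
  have hone := two_mul_numOnes (I := I)
  unfold treeProc
  rw [hI, hH, h19]
  split_ifs with h
  · refine ⟨fun S hS => .inl ⟨?_, localSearch I.graph, ?_, ?_⟩, fun b hb => update_of_ne (by omega) _ _⟩
    · rw [mul_assoc]; omega
    · exact (localSearch_localOpt hc).leafy ht
    · simpa using hS
  · have h7 : startPeel σ 7 = σ 7 := by simp [startPeel]
    have hp : peelAt (startPeel σ) = initialPeel I.graph := by
      rw [← hH]
      simp [peelAt, startPeel, loggedAt, logAt, initialPeel]
      rfl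
    obtain ⟨h1, h2⟩ := peelProc_iterate (startPeel σ) n
    rw [hp, h7, hI] at h1
    obtain ⟨ts, h3, h4, h5⟩ := peelStep_iterate I hc ht
    rw [← h1] at h4 h5
    refine ⟨fun S hS => .inr ⟨?_, ts, h3, _, h4, h5, hS⟩, fun b hb => ?_⟩
    · rw [mul_assoc]; omega
    · have h12 : b ≠ 12 := by omega
      have h13 : b ≠ 13 := by omega
      have h14 : b ≠ 14 := by omega
      have h17 : b ≠ 17 := by omega
      rw [h2 b hb]
      simp [startPeel, h12, h13, h14, h17]

theorem coreProc_spec {n : ℕ} [NeZero n] (σ : St n)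
    (hc : ConnOn (decI (σ 7)).graph.Adj (decI (σ 7)).graph.verts)
    (ht : VGraph.NoThinPath (decI (σ 7)).graph) :
    (decI (σ 7)).CoreOutput 4 (decS (coreProc σ 5)) ∧ ∀ b < 10, b ≠ 5 → coreProc σ b = σ b := by
  obtain ⟨h1, h2⟩ := clogProc_eq σ
  have h7 := h2 7 (by decide) (by decide)
  set σ1 := clogProc σ with hσ1
  set σ2 : St n := update σ1 10 (encG (decI (σ1 7)).graph) with hσ2
  have e7 : σ2 7 = σ 7 := by rw [hσ2, update_of_ne (by decide), h7]
  obtain ⟨h3, h4⟩ := treeProc_spec (σ := σ2) (I := decI (σ 7)) (by rw [e7])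
    (by rw [hσ2, update_self, decG_encG, h7]) (by rw [hσ2, update_of_ne (by decide), h1]) hc ht
  obtain ⟨h5, h6⟩ := splitProc_spec (treeProc σ2)
  rw [h4 7 (by decide), e7] at h5
  refine ⟨h3 _ h5, fun b hb hb5 => ?_⟩
  change splitProc (treeProc σ2) b = σ b
  rw [h6 b hb hb5, h4 b hb, hσ2, update_of_ne (by omega), h2 b (by omega) (by omega)]

/-- Array 7 receives the instance in array 4 after `k` reductions. -/
noncomputable def reduceProc {n : ℕ} (k : ℕ) (σ : St n) : St n :=
  (fun σ => update σ 7 (encI (reduceStep (decI (σ 7)))))^[k] (update σ 7 (encI (decI (σ 4))))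

theorem reduceProc_eq {n : ℕ} (k : ℕ) (σ : St n) :
    reduceProc k σ = update σ 7 (encI (reduceStep^[k] (decI (σ 4)))) :=
  iterate_update (φ := reduceStep) (fun x => by simp) _ _

theorem CompS.reduceProc {f : ∀ n, St n → ℕ} (hf : Comp f)
    (hfix : ∀ n (σ : St n) x, f n (update σ 7 x) = f n σ) (b : Polynomial ℕ)
    (hb : ∀ n σ, f n σ ≤ b.eval n) : CompS fun n σ => reduceProc (f n σ) σ :=
  (((CompS.setI 7 (InstC.state 7).reduceStep).iter hf b hb).comp (CompS.setI 7 (InstC.state 4))).congr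
    fun n σ => by rw [hfix]; rfl

/-- The solution in array 5 is carried back over the last reduction but those in array 6. -/
noncomputable def carryProc {n : ℕ} (σ : St n) : St n :=
  (fun σ => update σ 5 (encS (carry (decI (σ 7)) (decS (σ 5)))))
    -- No history of instances is kept: the instance before the last reduction is recomputed from
    -- array 4. The nested subtraction is the minimum of the counter and `n`, which bounds the
    -- number of rounds in every state.
    ((fun σ => reduceProc (decN (σ 6) - (decN (σ 6) - n)) σ) (update σ 6 (encN (decN (σ 6) - 1))))

theorem CompS.carryProc : CompS fun n σ => carryProc (n := n) σ :=
  (CompS.setS 5 (SetC.carry (InstC.state 7) (SetC.state 5))).comp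
    ((CompS.reduceProc ((Comp.state 6).sub ((Comp.state 6).sub Comp.size)) (fun n σ x => by
      rw [update_of_ne (by decide)]) .X (fun n σ => by simp; omega)).comp
      (CompS.setN 6 ((Comp.state 6).sub (.lit 1))))

/-- The instance in array 4 is solved; the solution is put into array 5. -/
noncomputable def solveProc {n : ℕ} (σ : St n) : St n :=
  carryProc^[n] ((fun σ => update σ 6 (encN n)) (coreProc (reduceProc n σ)))

theorem CompS.solveProc : CompS fun n σ => solveProc (n := n) σ :=
  CompS.carryProc.iterSize.comp ((CompS.setN 6 Comp.size).comp (CompS.coreProc.comp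
    (CompS.reduceProc Comp.size (fun _ _ _ => rfl) .X fun n _ => by simp)))

theorem solveProc_spec {n : ℕ} [NeZero n] (σ : St n) (hI : Good (decI (σ 4))) :
    (decI (σ 4)).Output 4 (decS (solveProc σ 5)) ∧ ∀ b < 5, solveProc σ b = σ b := by
  set I := decI (σ 4) with hI'
  obtain ⟨hg, h1, ht⟩ := reduceStep_reduced hI le_rfl
  set σ1 := reduceProc n σ with hσ1
  rw [reduceProc_eq, ← hI'] at hσ1
  have e7 : decI (σ1 7) = reduceStep^[n] I := by rw [hσ1, update_self, decI_encI]
  obtain ⟨h2, h3⟩ := coreProc_spec σ1 (by rw [e7]; exact hg.1) (by rw [e7]; exact ht)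
  rw [e7] at h2
  have h4 := CMCInstance.Output.core _ _ h1 ht h2
  set σ2 : St n := update (coreProc σ1) 6 (encN n) with hσ2
  -- After `j` steps back, array 5 holds a solution of the instance after `n - j` reductions.
  suffices H : ∀ j ≤ n, decN (carryProc^[j] σ2 6) = n - j ∧
      (reduceStep^[n - j] I).Output 4 (decS (carryProc^[j] σ2 5)) ∧
      ∀ b < 5, carryProc^[j] σ2 b = σ b by
    obtain ⟨-, h5, h6⟩ := H n le_rfl
    rw [Nat.sub_self] at h5
    exact ⟨h5, h6⟩
  intro j
  induction j with
  | zero =>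
    intro _
    refine ⟨by simp [hσ2], ?_, fun b hb => ?_⟩
    · rw [iterate_zero, id, hσ2, update_of_ne (by decide)]
      exact h4
    · rw [iterate_zero, id, hσ2, update_of_ne (by omega), h3 b (by omega) (by omega), hσ1,
        update_of_ne (by omega)]
  | succ j ih =>
    intro hj
    obtain ⟨i1, i2, i3⟩ := ih (by omega)
    rw [iterate_succ_apply']
    set τ := carryProc^[j] σ2
    have e6 : n - j - 1 - (n - j - 1 - n) = n - (j + 1) := by omega
    have h4τ : decI (τ 4) = I := by rw [i3 4 (by decide)]
    have key : carryProc τ = update (update (update τ 6 (encN (n - (j + 1)))) 7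
        (encI (reduceStep^[n - (j + 1)] I))) 5
        (encS (carry (reduceStep^[n - (j + 1)] I) (decS (τ 5)))) := by
      unfold carryProc
      simp only [reduceProc_eq, i1, update_self, decN_encN, e6]
      simp [h4τ, Nat.sub_sub]
    rw [key]
    refine ⟨by simp, ?_, fun b hb => ?_⟩
    · rw [update_self, decS_encS]
      refine output_carry ?_
      rw [← iterate_succ_apply' reduceStep, show (n - (j + 1)).succ = n - j by omega]
      exact i2
    · rw [update_of_ne (by omega), update_of_ne (by omega), update_of_ne (by omega), i3 b hb]

end CoreProcedure

/-! ### Only the weights of edges matter -/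

section Same

variable {V : Type*} [Fintype V] {I J : CMCInstance V}

/-- The input matrix does not show the values of `w` outside the edges, so the instance rebuilt by
the program may differ from `ofComponent w C` there. The output relation is shown to be insensitive
to this. -/
def Same (I J : CMCInstance V) : Prop :=
  I.graph = J.graph ∧ ∀ u v, I.graph.Adj u v → I.weight s(u, v) = J.weight s(u, v)

theorem Same.one (h : Same I J) : One I = One J := by
  ext u v
  unfold One
  rw [← h.1]
  exact and_congr_right fun hadj => by rw [h.2 u v hadj]

theorem Same.cutW (h : Same I J) (S : Set V) : I.cutW S = J.cutW S := by
  rw [cutW_eq, cutW_eq, h.one]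

theorem Same.numOnes (h : Same I J) : I.numOnes = J.numOnes := by
  have h1 := two_mul_numOnes (I := I)
  have h2 := two_mul_numOnes (I := J)
  rw [h.one] at h1
  omega

theorem Same.leafWeight (h : Same I J) (T : VGraph V) : I.leafWeight T = J.leafWeight T := by
  rw [leafWeight_eq, leafWeight_eq, h.one]

theorem Same.fromTree (h : Same I J) {T : VGraph V} {S : Set V} (hS : I.FromTree T S) :
    J.FromTree T S := by
  obtain ⟨L₁, L₂, hd, hu, hw, hS, h1, h2⟩ := hS
  refine ⟨L₁, L₂, hd, hu, ?_, hS, by rwa [← h.cutW, ← h.cutW], by rwa [← h.cutW, ← h.cutW]⟩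
  have h3 := two_mul_inside (I := I) (VGraph.leaves T)
  have h4 := two_mul_inside (I := J) (VGraph.leaves T)
  rw [h.one] at h3
  rw [between_eq hd, h.one] at hw
  rw [between_eq hd]
  omega

theorem Same.coreOutput (h : Same I J) {c : ℕ} {S : Set V} (hS : I.CoreOutput c S) :
    J.CoreOutput c S := by
  unfold CMCInstance.CoreOutput at *
  simp only [h.numOnes, h.leafWeight, h.1] at hS
  rcases hS with ⟨h1, T, h2, h3⟩ | ⟨h1, ts, h2, T, h3, h4, h5⟩
  · exact .inl ⟨h1, T, h2, h.fromTree h3⟩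
  · exact .inr ⟨h1, ts, h2, T, h3, h4, h.fromTree h5⟩

theorem Same.everyVertexHasOne (h : Same I J) (hI : I.EveryVertexHasOne) : J.EveryVertexHasOne := by
  intro v hv
  obtain ⟨u, hu, hw⟩ := hI v (h.1 ▸ hv)
  exact ⟨u, h.1 ▸ hu, by rw [← h.2 v u hu, hw]⟩

/-- The results are even equal, since all weights off the old edges are reset to zero. -/
theorem Same.dropVertex (h : Same I J) (v : V) : I.dropVertex v = J.dropVertex v := by
  unfold CMCInstance.dropVertex
  rw [← h.1]
  congr 1
  ext e
  induction e using Sym2.ind with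
  | _ a b =>
    by_cases hab : I.graph.Adj a b
    · simp [hab, h.2 a b hab]
    · simp [hab]

theorem Same.contract (h : Same I J) {a b c d : V} (ht : VGraph.IsThinPath I.graph a b c d) :
    Same (I.contract a b c d) (J.contract a b c d) := by
  refine ⟨by simp only [CMCInstance.contract, h.1], fun u v huv => ?_⟩
  simp only [CMCInstance.contract]
  rw [h.2 _ _ ht.adj₀₁, h.2 _ _ ht.adj₁₂, h.2 _ _ ht.adj₂₃]
  split_ifs with h1 h2 h3 h4
  any_goals rfl
  exact h.2 u v (huv.2.2.resolve_right h3)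

theorem Same.output {c : ℕ} {S : Set V} (hS : I.Output c S) (h : Same I J) : J.Output c S := by
  induction hS generalizing J with
  | drop I v S' hv hz ho ih =>
    rw [h.1]
    refine .drop J v S' (h.1 ▸ hv) (fun u hu => ?_) (h.dropVertex v ▸ ho)
    rw [← h.1] at hu
    rw [← h.2 v u hu, hz u hu]
  | shorten I a b c' d S' S h1 ht ho hS hbest ih =>
    refine .shorten J a b c' d S' S (h.everyVertexHasOne h1) (h.1 ▸ ht) (ih (h.contract ht)) hS ?_
    intro X hX
    rw [← h.cutW, ← h.cutW]
    exact hbest X hX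
  | core I S h1 ht ho => exact .core J S (h.everyVertexHasOne h1) (h.1 ▸ ht) (h.coreOutput ho)

end Same

/-! ### The program -/

section Main

open Function

variable {n : ℕ}

/-- The component of the vertex number `r` in the graph with adjacency matrix `A`. -/
noncomputable def compI (A : Fin n → Fin n → ℕ) (r : ℕ) : CMCInstance (Fin n) where
  graph :=
    { verts := {v | ∃ x : Fin n, (x : ℕ) = r ∧ ReflTransGen (fun a b => A a b ≠ 0) x v}
      Adj := fun u v => ((∃ x : Fin n, (x : ℕ) = r ∧ ReflTransGen (fun a b => A a b ≠ 0) x u) ∧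
        ∃ x : Fin n, (x : ℕ) = r ∧ ReflTransGen (fun a b => A a b ≠ 0) x v) ∧
        u ≠ v ∧ A u v ≠ 0 ∧ A v u ≠ 0
      adj_sub := fun h => h.2.1
      edge_vert := fun h => h.1.1
      symm := ⟨fun _ _ h => ⟨h.1.symm, h.2.1.symm, h.2.2.symm⟩⟩ }
  weight := decW fun i j => A i j - 1

theorem InstC.compI : InstC fun n (σ : St n) => compI (σ 0) (decN (σ 3)) := by
  have hR : RelC fun n (σ : St n) u v => σ 0 u v ≠ 0 := (Comp.arr 0).ne_zero
  have hreach : RelC fun n (σ : St n) u v => ReflTransGen (fun a b => σ 0 a b ≠ 0) u v :=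
    CompP.reach (R := fun n (σ : St n) u v => σ 0 u v ≠ 0) hR
  have hv : SetC fun n (σ : St n) => {v | ∃ x : Fin n, (x : ℕ) = decN (σ 3) ∧
      ReflTransGen (fun a b => σ 0 a b ≠ 0) x v} :=
    CompP.ex (P := fun n (p : Ext St n) x => (x : ℕ) = decN (p.1 3) ∧
      ReflTransGen (fun a b => p.1 0 a b ≠ 0) x p.2)
      ((Comp.eq VertC.snd (Comp.state 3).wk.wk).and (hreach.wk.wk.app VertC.snd VertC.snd.wk))
  have v0 : VertC fun n (p : Ext (Ext St) n) => p.2 := VertC.snd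
  have v1 : VertC fun n (p : Ext (Ext St) n) => p.1.2 := VertC.snd.wk
  refine ⟨⟨hv, ((hv.wk.wk.app v1).and (hv.wk.wk.app v0)).and ((v1.eq v0).not.and
    ((hR.wk.wk.app v1 v0).and (hR.wk.wk.app v0 v1)))⟩, ?_⟩
  have hR' : RelC fun n (σ : St n) u v => σ 0 u v - 1 ≠ 0 := ((Comp.arr 0).sub (.lit 1)).ne_zero
  exact (CompP.or hR' (hR'.wk.wk.app v0 v1)).congr fun n γ =>
    (decW_eq (fun i j => γ.1.1 0 i j - 1) γ.1.2 γ.2).symm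

/-- The adjacency matrix that is the input. -/
noncomputable def inputMatrix (G : SimpleGraph (Fin n)) (w : Sym2 (Fin n) → Fin 2) :
    Fin n → Fin n → ℕ :=
  fun u v => if G.Adj u v then 1 + (w s(u, v) : ℕ) else 0

theorem inputMatrix_ne_zero {G : SimpleGraph (Fin n)} {w : Sym2 (Fin n) → Fin 2} {u v : Fin n} :
    inputMatrix G w u v ≠ 0 ↔ G.Adj u v := by
  unfold inputMatrix
  split_ifs with h <;> simp [h]

theorem compI_same (G : SimpleGraph (Fin n)) (w : Sym2 (Fin n) → Fin 2) (r : Fin n) :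
    Same (compI (inputMatrix G w) r) (CMCInstance.ofComponent w (G.connectedComponentMk r)) := by
  have hv : ∀ v, (∃ x : Fin n, (x : ℕ) = r ∧
      ReflTransGen (fun a b => inputMatrix G w a b ≠ 0) x v) ↔
      v ∈ (G.connectedComponentMk r).supp := by
    intro v
    simp only [inputMatrix_ne_zero]
    rw [SimpleGraph.ConnectedComponent.mem_supp_iff, SimpleGraph.ConnectedComponent.eq,
      SimpleGraph.reachable_comm, SimpleGraph.reachable_iff_reflTransGen]
    constructor
    · rintro ⟨x, hx, h⟩
      rwa [← Fin.ext hx]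
    · exact fun h => ⟨r, rfl, h⟩
  refine ⟨SimpleGraph.Subgraph.ext (Set.ext hv) ?_, fun u v huv => ?_⟩
  · ext u v
    refine and_congr (and_congr (hv u) (hv v)) ?_
    rw [inputMatrix_ne_zero, inputMatrix_ne_zero]
    exact ⟨fun h => h.2.1, fun h => ⟨h.ne, h, h.symm⟩⟩
  · have hadj : G.Adj u v := inputMatrix_ne_zero.1 huv.2.2.1
    have h := decW_eq (fun i j => inputMatrix G w i j - 1) u v
    simp only [inputMatrix, hadj, hadj.symm, if_true, Sym2.eq_swap (a := v) (b := u), or_self] at h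
    change decW (fun i j => inputMatrix G w i j - 1) s(u, v) = w s(u, v)
    rcases fin2_cases (w s(u, v)) with h1 | h1
    · refine h1 ▸ (fin2_cases _).resolve_right fun h2 => ?_
      exact absurd (h.1 h2) (by simp [h1])
    · rw [h1]
      exact h.2 (by simp [h1])

noncomputable def answerProc (σ : St n) : St n :=
  if arcs (One (decI (σ 4))) Set.univ Set.univ = 0 then
    update σ 5 (encS {v | (v : ℕ) = decN (σ 3)})
  else solveProc σ

theorem CompS.answerProc : CompS fun n σ => answerProc (n := n) σ :=
  CompS.ite (((InstC.state 4).one.arcs SetC.univ SetC.univ).eq (.lit 0))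
    (CompS.setS 5 (S := fun n (σ : St n) => {v | (v : ℕ) = decN (σ 3)})
      (Comp.eq VertC.snd (Comp.state 3).wk)) CompS.solveProc

/-- The best solution so far is in array 1, its cut weight in array 2. -/
noncomputable def recordProc (σ : St n) : St n :=
  -- The comparison is not strict, so that the first set is recorded even if its cut weight is zero,
  -- like the initial content of array 2.
  if decN (σ 2) ≤ (decI (σ 4)).cutW (decS (σ 5)) then
    (fun σ => update σ 1 (encS (decS (σ 5))))
      (update σ 2 (encN ((decI (σ 4)).cutW (decS (σ 5)))))
  else σ

theorem CompS.recordProc : CompS fun n σ => recordProc (n := n) σ := by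
  have h := (InstC.state 4).cutW (SetC.state 5)
  exact CompS.ite ((Comp.state 2).le h) ((CompS.setS 1 (SetC.state 5)).comp (CompS.setN 2 h))
    CompS.skip

/-- The component of the vertex with the number in array 3 is treated. -/
noncomputable def roundProc (σ : St n) : St n :=
  inc 3 (recordProc (answerProc (update σ 4 (encI (compI (σ 0) (decN (σ 3)))))))

theorem CompS.roundProc : CompS fun n σ => roundProc (n := n) σ :=
  (CompS.inc 3).comp (CompS.recordProc.comp (CompS.answerProc.comp (CompS.setI 4 InstC.compI)))

theorem answerProc_spec [NeZero n] {G : SimpleGraph (Fin n)} {w : Sym2 (Fin n) → Fin 2} {σ : St n}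
    {r : Fin n} (h4 : decI (σ 4) = compI (inputMatrix G w) r) (h3 : decN (σ 3) = r) :
    CMCInstance.ComponentOutput 4 (CMCInstance.ofComponent w (G.connectedComponentMk r))
      (decS (answerProc σ 5)) ∧ ∀ b < 5, answerProc σ b = σ b := by
  have hs := compI_same G w r
  have hone := two_mul_numOnes (I := compI (inputMatrix G w) r)
  unfold answerProc
  rw [h4]
  split_ifs with h
  · refine ⟨.inl ⟨by rw [← hs.numOnes]; omega, r, rfl, ?_⟩, fun b hb => update_of_ne (by omega) _ _⟩
    rw [update_self, decS_encS, h3]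
    ext v
    simp [Fin.ext_iff]
  · have hg : Good (decI (σ 4)) := by
      rw [h4]
      refine ⟨?_, ?_⟩
      · rw [hs.1]
        exact (ofComponent_connOn_iff _ subset_rfl).2 ((graph_induce_connected_iff _ _).1
          (G.connectedComponentMk r).connected_toSimpleGraph)
      · by_contra hno
        push Not at hno
        exact h (by simp [arcs, hno])
    obtain ⟨h1, h2⟩ := solveProc_spec σ hg
    rw [h4] at h1
    exact ⟨.inr ⟨by rw [← hs.numOnes]; omega, Same.output h1 hs⟩, h2⟩

theorem roundProc_spec [NeZero n] {G : SimpleGraph (Fin n)} {w : Sym2 (Fin n) → Fin 2} {σ : St n}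
    {r : Fin n} (h0 : σ 0 = inputMatrix G w) (h3 : decN (σ 3) = r) :
    roundProc σ 0 = σ 0 ∧ decN (roundProc σ 3) = r + 1 ∧
      ∃ S, CMCInstance.ComponentOutput 4 (CMCInstance.ofComponent w (G.connectedComponentMk r)) S ∧
        ((decN (σ 2) ≤ cutWeight G.edgeSet w S ∧ roundProc σ 1 = encS S ∧
            decN (roundProc σ 2) = cutWeight G.edgeSet w S) ∨
          (cutWeight G.edgeSet w S < decN (σ 2) ∧ roundProc σ 1 = σ 1 ∧
            decN (roundProc σ 2) = decN (σ 2))) := by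
  set σ1 : St n := update σ 4 (encI (compI (σ 0) (decN (σ 3)))) with hσ1
  have e4 : decI (σ1 4) = compI (inputMatrix G w) r := by
    rw [hσ1, update_self, decI_encI, h0, h3]
  have hne : ∀ b, b ≠ 4 → σ1 b = σ b := fun b hb => by rw [hσ1, update_of_ne hb]
  obtain ⟨h1, h2⟩ := answerProc_spec e4 (by rw [hne 3 (by decide), h3])
  set σ2 := answerProc σ1 with hσ2
  set S := decS (σ2 5) with hS
  have hsub := (componentOutput_guarantee le_rfl h1).1
  have hcut : (decI (σ2 4)).cutW S = cutWeight G.edgeSet w S := by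
    rw [h2 4 (by decide), e4, (compI_same G w r).cutW, ofComponent_cutW _ hsub]
  have e : ∀ b < 4, σ2 b = σ b := fun b hb => by rw [h2 b (by omega), hne b (by omega)]
  have hr : roundProc σ = inc 3 (recordProc σ2) := rfl
  have hrec : recordProc σ2 = if decN (σ 2) ≤ cutWeight G.edgeSet w S then
      update (update σ2 2 (encN (cutWeight G.edgeSet w S))) 1 (encS S) else σ2 := by
    unfold recordProc
    rw [← hS, hcut, e 2 (by decide)]
    simp [hS]
  rw [hr, hrec]
  by_cases h : decN (σ 2) ≤ cutWeight G.edgeSet w S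
  · rw [if_pos h]
    refine ⟨?_, ?_, S, h1, .inl ⟨h, ?_, ?_⟩⟩
    · simp [inc, e]
    · simp [inc, e, h3]
    · simp [inc]
    · simp [inc]
  · rw [if_neg h]
    refine ⟨?_, ?_, S, h1, .inr ⟨not_le.1 h, ?_, ?_⟩⟩
    · simp [inc, e]
    · simp [inc, e, h3]
    · simp [inc, e]
    · simp [inc, e]

theorem roundProc_iterate [NeZero n] {G : SimpleGraph (Fin n)} {w : Sym2 (Fin n) → Fin 2} {σ : St n}
    (h0 : σ 0 = inputMatrix G w) (h2 : decN (σ 2) = 0) (h3 : decN (σ 3) = 0) :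
    ∃ S, AlgorithmOutput 4 G w S ∧ roundProc^[n] σ 1 = encS S := by
  suffices H : ∀ k ≤ n, roundProc^[k] σ 0 = inputMatrix G w ∧ decN (roundProc^[k] σ 3) = k ∧
      ∃ f : Fin n → Set (Fin n), (∀ r : Fin n, (r : ℕ) < k →
        CMCInstance.ComponentOutput 4 (CMCInstance.ofComponent w (G.connectedComponentMk r)) (f r) ∧
        cutWeight G.edgeSet w (f r) ≤ decN (roundProc^[k] σ 2)) ∧
      ((k = 0 ∧ decN (roundProc^[k] σ 2) = 0) ∨ ∃ r : Fin n, (r : ℕ) < k ∧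
        roundProc^[k] σ 1 = encS (f r) ∧
        decN (roundProc^[k] σ 2) = cutWeight G.edgeSet w (f r)) by
    obtain ⟨-, -, f, hf, h | ⟨r, -, hr1, hr2⟩⟩ := H n le_rfl
    · exact absurd h.1 (NeZero.ne n)
    · have hrep : ∀ C : G.ConnectedComponent, ∃ v, G.connectedComponentMk v = C := fun C =>
        C.ind fun v => ⟨v, rfl⟩
      choose out hout using hrep
      -- A component is treated once for each of its vertices. The component of the winning round
      -- `r` is represented by `r`, every other one by an arbitrary vertex.
      refine ⟨f r, ⟨fun C => if C = G.connectedComponentMk r then f r else f (out C), fun C => ?_,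
        G.connectedComponentMk r, by simp, fun C => ?_⟩, hr1⟩
      · beta_reduce
        split_ifs with hC
        · rw [hC]
          exact (hf r r.2).1
        · have := (hf (out C) (Fin.is_lt _)).1
          rwa [hout C] at this
      · beta_reduce
        rw [if_pos rfl, ← hr2]
        split_ifs
        · exact (hf r r.2).2
        · exact (hf _ (Fin.is_lt _)).2
  intro k
  induction k with
  | zero => exact fun _ => ⟨h0, h3, fun _ => ∅, fun r hr => absurd hr (Nat.not_lt_zero _), .inl ⟨rfl, h2⟩⟩
  | succ k ih =>
    intro hk
    obtain ⟨i0, i3, f, hf, hbest⟩ := ih (by omega)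
    rw [iterate_succ_apply']
    set τ := roundProc^[k] σ
    obtain ⟨j0, j3, S, hS, hcase⟩ := roundProc_spec (r := ⟨k, hk⟩) i0 i3
    have hlt : ∀ r : Fin n, (r : ℕ) < k + 1 → r ≠ ⟨k, hk⟩ → (r : ℕ) < k := fun r hr hne => by
      have : (r : ℕ) ≠ k := fun h => hne (Fin.ext h)
      omega
    refine ⟨j0.trans i0, j3, update f ⟨k, hk⟩ S, fun r hr => ?_, .inr ?_⟩
    · have hle : decN (τ 2) ≤ decN (roundProc τ 2) ∧
          cutWeight G.edgeSet w S ≤ decN (roundProc τ 2) := by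
        rcases hcase with ⟨h1, -, h2⟩ | ⟨h1, -, h2⟩ <;> omega
      by_cases hrk : r = ⟨k, hk⟩
      · subst hrk
        rw [update_self]
        exact ⟨hS, hle.2⟩
      · rw [update_of_ne hrk]
        exact ⟨(hf r (hlt r hr hrk)).1, (hf r (hlt r hr hrk)).2.trans hle.1⟩
    · rcases hcase with ⟨-, h4, h5⟩ | ⟨h1, h4, h5⟩
      · exact ⟨⟨k, hk⟩, by simp, by simpa using h4, by simpa using h5⟩
      · rcases hbest with ⟨-, h⟩ | ⟨r, hr, h6, h7⟩
        · omega
        · have hrk : r ≠ ⟨k, hk⟩ := fun h => by simp [h] at hr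
          exact ⟨r, by omega, by rw [h4, h6, update_of_ne hrk], by rw [h5, h7, update_of_ne hrk]⟩

theorem exists_program : ∃ (P : RAM.Program) (p : Polynomial ℕ), ∀ (n : ℕ), 1 ≤ n →
    ∀ (G : SimpleGraph (Fin n)) (w : Sym2 (Fin n) → Fin 2),
      ∃ (t : ℕ) (m : RAM.Mem), RAM.Exec P (RAM.encode G w) t m ∧ t ≤ p.eval n ∧
        AlgorithmOutput 4 G w (RAM.decode n m) := by
  obtain ⟨P, p, hP⟩ := CompS.roundProc.iterSize 0
  refine ⟨P, p, fun n hn G w => ?_⟩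
  have : NeZero n := ⟨by omega⟩
  set σ : St n := fun a i j => RAM.encode G w (place a) i j with hσ
  have hrep : Rep id σ (RAM.encode G w) :=
    ⟨by simp [RAM.encode], fun _ _ _ => rfl, fun k hk => absurd hk (Nat.not_lt_zero _)⟩
  obtain ⟨t, m, hexec, ht, hrep', -⟩ := hP n σ _ hrep
  -- The record in array 2 and the counter in array 3 need no initialization, since the input leaves
  -- them zero.
  have hzero : ∀ a, a ≠ 0 → decN (σ a) = 0 := fun a ha => by
    have h1 : place a ≠ 1 := fun h => ha (place_inj.1 (h.trans rfl))
    simp [decN, hσ, RAM.encode, place_ne_zero, h1]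
  obtain ⟨S, hS, h1⟩ := roundProc_iterate (G := G) (w := w) (σ := σ) (by
    ext i j
    simp [hσ, place, RAM.encode, inputMatrix]) (hzero 2 (by decide)) (hzero 3 (by decide))
  refine ⟨t, m, hexec, ht, ?_⟩
  convert hS using 1
  ext v
  have h2 : m 2 v 0 = encS S v 0 := by
    have := hrep'.arr 1 v 0
    rw [show Ctx.st ((fun σ => roundProc σ)^[n] σ) 1 v 0 = encS S v 0 from
      congrFun (congrFun h1 v) 0] at this
    simpa [place] using this
  simp [RAM.decode, h2, encS]

end Main

end ConnCut

end

/-! ### The main theorem -/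

theorem mainTheorem1 :
    ∃ (c : ℕ) (κ : ℝ), 0 < c ∧ 0 < κ ∧
      -- every output is connected, and its cut weight is at least `κ / log n` times the optimum
      (∀ (n : ℕ), 2 ≤ n → ∀ (G : SimpleGraph (Fin n)) (w : Sym2 (Fin n) → Fin 2)
        (S : Set (Fin n)), AlgorithmOutput c G w S →
          (G.induce S).Connected ∧
          ∀ S' : Set (Fin n), (G.induce S').Connected →
            κ / Real.log n * (cutWeight G.edgeSet w S' : ℝ) ≤ (cutWeight G.edgeSet w S : ℝ)) ∧
      -- one program carries out the algorithm on all inputs, in polynomial time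
      (∃ (P : RAM.Program) (p : Polynomial ℕ), ∀ (n : ℕ), 1 ≤ n →
        ∀ (G : SimpleGraph (Fin n)) (w : Sym2 (Fin n) → Fin 2),
          ∃ (t : ℕ) (m : RAM.Mem), RAM.Exec P (RAM.encode G w) t m ∧ t ≤ p.eval n ∧
            AlgorithmOutput c G w (RAM.decode n m)) ∧
      -- on a reduced instance, the solution comes from a `κ / log n`-thick tree
      (∀ (N : ℕ) (I : CMCInstance (Fin N)) (S : Set (Fin N)),
        I.EveryVertexHasOne → VGraph.NoThinPath I.graph → I.CoreOutput c S →
          ∃ T, I.IsThickTree (κ / Real.log I.graph.verts.ncard) T ∧ I.FromTree T S) ∧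
      -- an `α`-thick tree is converted into a connected cut of weight at least `(α / 4) η`
      (∀ (N : ℕ) (I : CMCInstance (Fin N)) (α : ℝ) (T : VGraph (Fin N)) (S : Set (Fin N)),
        0 < α → 0 < I.numOnes → I.IsThickTree α T → I.FromTree T S →
          S ⊆ I.graph.verts ∧ (I.graph.induce S).Connected ∧
          α / 4 * (I.numOnes : ℝ) ≤ (I.cutW S : ℝ)) := by
  -- The threshold is 4 because shortening loses at most 4n arcs, and 896 = 4 · 224 combines the
  -- conversion into a cut with the thickness.
  refine ⟨4, 1 / 896, by norm_num, by norm_num, ?_, ?_, ?_, ?_⟩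
  · intro n _ G w S h
    exact ConnCut.algorithm_guarantee (by simp) h
  · exact ConnCut.exists_program
  · intro N I S h1 _ h
    obtain ⟨T, h2, hT, hS⟩ := ConnCut.thick_of_coreOutput h1 h
    refine ⟨T, ⟨hT.1, hT.2.1, le_trans ?_ hT.2.2⟩, hS⟩
    have hlog : 0 < Real.log I.graph.verts.ncard := Real.log_pos (by exact_mod_cast h2)
    gcongr
    norm_num
  · intro N I α T S hα hpos hT hS
    exact ConnCut.fromTree_of_thick hα hpos hT hS
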